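/- Let $0\le s\le n$ be integers and use coordinates $(w,z,\zeta)\in\mathbb C\oplus\mathbb C^s\oplus\mathbb C^{n-s}$ on $\mathbb C^{n+1}$, with weights $\mathrm{wt}(w)=2$, $\mathrm{wt}(z_j)=1$, $\mathrm{wt}(\zeta_\alpha)=0$ (conjugate variables have the same weights, and $\mathrm{Im}\,w$ has weight $2$). For a real hypersurface $M$ with CR structure $\mathcal H\subset\mathbb C TM$ (the $(1,0)$-tangent vectors), let $\mathcal K_2\subset\mathcal H$ be the left kernel of the Levi form $(X_p,Y_p)\mapsto\frac1{2i}[X,\overline Y]_p \bmod \mathcal H\oplus\overline{\mathcal H}$. The Levi form has rank $s$ at $p$ if $(\mathcal K_2)_p$ has codimension $s$ in $\mathcal H_p$. When this rank is constant, let $\mathcal K_3\subset\mathcal K_2$ be the left kernel of $(X_p,Y_p,Y'_p)\mapsto\frac1{2i}[[X,\overline Y],\overline{Y'}]_p\bmod\mathcal H\oplus\overline{\mathcal H}$, with $X$ a section of $\mathcal K_2$ and $Y,Y'$ sections of $\mathcal H$; $M$ is $2$-nondegenerate at $p$ if $(\mathcal K_2)_p\ne0$ and $(\mathcal K_3)_p=0$.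 An equation in *adapted form* is $$\mathrm{Re}(w)=P(z,\zeta,\bar z,\bar\zeta)+Q(z,\zeta,\bar z,\bar\zeta,\mathrm{Im}\,w),\qquad P=z^TH(\zeta,\bar\zeta)\bar z+\mathrm{Re}\big(\bar z^TS(\zeta,\bar\zeta)\bar z\big),$$ where $H$ and $S$ are real analytic near $0$ with values in the Hermitian, respectively symmetric, $s\times s$ matrices, $H(0,0)$ is nondegenerate, and $Q$ is real valued, real analytic near $0$, and all terms of its power series have weighted degree greater than $2$. Its *model* is the germ at $0$ of $M_0=\{\mathrm{Re}(w)=P\}$. A *$2$-nondegenerate model* is a germ of this form $\mathrm{Re}(w)=P$ which near $0$ has Levi form of constant rank $s$ and is everywhere $2$-nondegenerate. **Theorem 1.1.** 1. Let $M\subset\mathbb C^{n+1}$ be a real analytic real hypersurface with Levi form of constant rank $s$. Near each of its points $p$ there are local holomorphic coordinates $(w,z,\zeta)$ centred at $p$ in which $M$ is given by an equation in adapted form. For every such choice of coordinates and equation, the model $M_0$ is near $0$ a hypersurface with Levi form of constant rank $s$; if moreover $M$ is everywhere $2$-nondegenerate, then $M_0$ is a $2$-nondegenerate model. 2. Let $M$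 and $M'$ be germs at $0$ of hypersurfaces with Levi form of constant rank $s$ given by equations in adapted form, with models $M_0$ and $M_0'$. Let $\phi=(h,g,f)$ be a local biholomorphism of $\mathbb C^{n+1}$ at $0$ with $\phi(0)=0$ and $\phi(M)=M'$ as germs at $0$. Let $\phi_0=(h_2,g_1,f_0)$ be its weighted degree preserving component, formed by the terms of weight $2$, $1$, $0$ of $h$, $g$, $f$ respectively. Then $\phi_0$ is a local biholomorphism at $0$ fixing $0$, and $\phi_0(M_0)=M_0'$ as germs at $0$. 3. Let $M$ be a germ at $0$ of a hypersurface with Levi form of constant rank $s$ given by an equation in adapted form, with model $M_0$. Then $\dim\mathfrak{hol}(M,0)\le\dim\mathfrak{hol}(M_0,0)$, where $\mathfrak{hol}(\cdot,0)$ is the real Lie algebra of germs at $0$ of holomorphic vector fields whose real part is tangent to the hypersurface, and dimensions are over $\mathbb R$ with values in $\{0,1,2,\dots,\infty\}$. -/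

import Mathlib

open Filter Topology
open scoped ContDiff

noncomputable section

namespace CRModel

section Geometry

variable {E : Type*} [NormedAddCommGroup E] [NormedSpace ℂ E]

/-- `ρ` is a real analytic local defining function at `p` of the set `M`. -/
def IsDefiningFunctionAt (M : Set E) (p : E) (ρ : E → ℝ) : Prop :=
  AnalyticAt ℝ ρ p ∧ fderiv ℝ ρ p ≠ 0 ∧ ∀ᶠ q in 𝓝 p, (q ∈ M ↔ ρ q = 0)

/-- Near `p`, the set `M` is a real analytic real hypersurface. -/
def IsHypersurfaceAt (M : Set E) (p : E) : Prop :=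
  ∃ ρ : E → ℝ, IsDefiningFunctionAt M p ρ

/-- `M` is an (embedded) real analytic real hypersurface. -/
def IsRealAnalyticHypersurface (M : Set E) : Prop :=
  ∀ p ∈ M, IsHypersurfaceAt M p

/-- The real tangent space `T_p M`, the common kernel of the differentials at `p` of the local
defining functions of `M` (these differentials are all proportional). -/
def realTangent (M : Set E) (p : E) : Submodule ℝ E where
  carrier := {v | ∀ ρ : E → ℝ, IsDefiningFunctionAt M p ρ → fderiv ℝ ρ p v = 0}
  zero_mem' := fun _ _ => map_zero _
  add_mem' := fun {a b} ha hb ρ hρ => by rw [map_add, ha ρ hρ, hb ρ hρ, add_zero]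
  smul_mem' := fun c a ha ρ hρ => by rw [map_smul, ha ρ hρ, smul_zero]

lemma complex_smul_eq (c : ℂ) (v : E) : c • v = c.re • v + c.im • (Complex.I • v) := by
  rw [← Complex.coe_smul c.re v, ← Complex.coe_smul c.im, smul_smul, ← add_smul,
    Complex.re_add_im]

/-- The complex tangent space `T_p M ∩ i T_p M`. The fibre `𝓗_p` of the CR structure consists of
the vectors `v^{1,0} = (v - i J v) / 2` with `v` in this space, and its conjugate consists
of the vectors `v^{0,1} = (v + i J v) / 2`; here `J` is multiplication by the imaginary unit
in `E` and `i` the imaginary unit of the complexified tangent space. -/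
def complexTangent (M : Set E) (p : E) : Submodule ℂ E where
  carrier := {v | v ∈ realTangent M p ∧ Complex.I • v ∈ realTangent M p}
  zero_mem' := ⟨zero_mem _, by rw [smul_zero]; exact zero_mem _⟩
  add_mem' := fun ha hb => ⟨add_mem ha.1 hb.1, by rw [smul_add]; exact add_mem ha.2 hb.2⟩
  smul_mem' := fun c v hv => by
    refine ⟨?_, ?_⟩
    · rw [complex_smul_eq]
      exact add_mem (Submodule.smul_mem _ _ hv.1) (Submodule.smul_mem _ _ hv.2)
    · have h : Complex.I • c • v = (Complex.I * c) • v := smul_smul _ _ _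
      rw [h, complex_smul_eq]
      exact add_mem (Submodule.smul_mem _ _ hv.1) (Submodule.smul_mem _ _ hv.2)

/-- Complex vector fields on `E`, that is, sections of the complexified tangent bundle: the pair
`(U, V)` stands for `U + i V`. -/
abbrev ComplexField (E : Type*) := E → E × E

/-- The Lie bracket `[U + i V, U' + i V']` of complex vector fields, the complex bilinear
extension of the Lie bracket of real vector fields. -/
def cBracket (X Y : ComplexField E) : ComplexField E := fun q =>
  (VectorField.lieBracket ℝ (fun a => (X a).1) (fun a => (Y a).1) q
      - VectorField.lieBracket ℝ (fun a => (X a).2) (fun a => (Y a).2) q,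
    VectorField.lieBracket ℝ (fun a => (X a).1) (fun a => (Y a).2) q
      + VectorField.lieBracket ℝ (fun a => (X a).2) (fun a => (Y a).1) q)

/-- The field `x^{1,0} = (x - i J x) / 2` of type `(1,0)`; in coordinates, `∑ x_j ∂/∂Z_j`. -/
def fieldOneZero (x : E → E) : ComplexField E := fun q =>
  ((1 / 2 : ℝ) • x q, -((1 / 2 : ℝ) • (Complex.I • x q)))

/-- The field `x^{0,1} = (x + i J x) / 2`, the conjugate of `x^{1,0}`. -/
def fieldZeroOne (x : E → E) : ComplexField E := fun q =>
  ((1 / 2 : ℝ) • x q, (1 / 2 : ℝ) • (Complex.I • x q))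

/-- The complex tangent vector `u = (u.1 + i u.2)` at `p` lies in `𝓗_p ⊕ conj 𝓗_p`, the
complexification of the complex tangent space. -/
def InHorizontal (M : Set E) (p : E) (u : E × E) : Prop :=
  u.1 ∈ complexTangent M p ∧ u.2 ∈ complexTangent M p

/-- `x` is (an ambient extension of) a smooth section near `p`, over `M`, of the family of
subspaces `D q` of the complex tangent spaces. -/
def IsSectionNear (M : Set E) (D : E → Submodule ℂ E) (p : E) (x : E → E) : Prop :=
  ∀ᶠ q in 𝓝 p, ContDiffAt ℝ ∞ x q ∧ (q ∈ M → x q ∈ D q)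

lemma IsSectionNear.differentiableAt {M : Set E} {D : E → Submodule ℂ E} {p : E} {x : E → E}
    (h : IsSectionNear M D p x) : DifferentiableAt ℝ x p :=
  (h.self_of_nhds).1.differentiableAt (by simp)

lemma fderiv_I_smul {x : E → E} {p : E} (h : DifferentiableAt ℝ x p) :
    fderiv ℝ (fun a => Complex.I • x a) p = Complex.I • fderiv ℝ x p := by
  exact fderiv_fun_const_smul h Complex.I

/-- Brackets `[x^{1,0}, y^{0,1}]` in terms of derivatives. -/
lemma cBracket_apply {x y : E → E} {p : E} (hx : DifferentiableAt ℝ x p)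
    (hy : DifferentiableAt ℝ y p) :
    cBracket (fieldOneZero x) (fieldZeroOne y) p =
      ((1 / 4 : ℝ) • (fderiv ℝ y p (x p) - fderiv ℝ x p (y p)
          + (Complex.I • fderiv ℝ y p (Complex.I • x p)
            - Complex.I • fderiv ℝ x p (Complex.I • y p))),
        (1 / 4 : ℝ) • (Complex.I • fderiv ℝ y p (x p) - fderiv ℝ x p (Complex.I • y p)
          - (fderiv ℝ y p (Complex.I • x p) - Complex.I • fderiv ℝ x p (y p)))) := by
  have hx' : DifferentiableAt ℝ (fun a => Complex.I • x a) p := hx.const_smul Complex.I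
  have hy' : DifferentiableAt ℝ (fun a => Complex.I • y a) p := hy.const_smul Complex.I
  simp only [cBracket, fieldOneZero, fieldZeroOne, VectorField.lieBracket, fderiv_fun_neg]
  rw [fderiv_fun_const_smul hx, fderiv_fun_const_smul hy, fderiv_fun_const_smul hx',
    fderiv_fun_const_smul hy', fderiv_I_smul hx, fderiv_I_smul hy]
  simp only [smul_apply, neg_apply, map_smul, map_neg]
  refine Prod.ext ?_ ?_ <;> simp only <;> module

lemma InHorizontal.add {M : Set E} {p : E} {u v : E × E} (hu : InHorizontal M p u)
    (hv : InHorizontal M p v) : InHorizontal M p (u + v) :=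
  ⟨add_mem hu.1 hv.1, add_mem hu.2 hv.2⟩

lemma cBracket_add {x x' y : E → E} {p : E} (hx : DifferentiableAt ℝ x p)
    (hx' : DifferentiableAt ℝ x' p) (hy : DifferentiableAt ℝ y p) :
    cBracket (fieldOneZero (x + x')) (fieldZeroOne y) p =
      cBracket (fieldOneZero x) (fieldZeroOne y) p
        + cBracket (fieldOneZero x') (fieldZeroOne y) p := by
  rw [cBracket_apply (hx.add hx') hy, cBracket_apply hx hy, cBracket_apply hx' hy,
    fderiv_add hx hx']
  simp only [Pi.add_apply, add_apply, smul_add, map_add]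
  refine Prod.ext ?_ ?_ <;> simp only [Prod.fst_add, Prod.snd_add] <;> module

lemma InHorizontal.const_smul_field {M : Set E} {x y : E → E} {p : E} (c : ℂ)
    (hx : DifferentiableAt ℝ x p) (hy : DifferentiableAt ℝ y p)
    (h : InHorizontal M p (cBracket (fieldOneZero x) (fieldZeroOne y) p)) :
    InHorizontal M p (cBracket (fieldOneZero (c • x)) (fieldZeroOne y) p) := by
  have key : cBracket (fieldOneZero (c • x)) (fieldZeroOne y) p =
      (c.re • (cBracket (fieldOneZero x) (fieldZeroOne y) p).1
          - c.im • (cBracket (fieldOneZero x) (fieldZeroOne y) p).2,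
        c.re • (cBracket (fieldOneZero x) (fieldZeroOne y) p).2
          + c.im • (cBracket (fieldOneZero x) (fieldZeroOne y) p).1) := by
    rw [cBracket_apply (hx.const_smul c) hy, cBracket_apply hx hy, fderiv_const_smul hx c]
    simp only [Pi.smul_apply, smul_apply]
    have hI : ∀ v : E, Complex.I • Complex.I • v = -v := fun v => by
      rw [smul_smul, Complex.I_mul_I, neg_one_smul]
    have hc : ∀ v : E, Complex.I • c • v = c.re • (Complex.I • v) - c.im • v := fun v => by
      rw [complex_smul_eq c v, smul_add, smul_comm Complex.I c.re, smul_comm Complex.I c.im, hI,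
        smul_neg, sub_eq_add_neg]
    simp only [hc]
    simp only [complex_smul_eq c, map_add, map_sub, map_smul, smul_add, smul_sub,
      smul_comm Complex.I c.re, smul_comm Complex.I c.im]
    refine Prod.ext ?_ ?_ <;> simp only <;> module
  have hr : ∀ (t : ℝ) {v : E}, v ∈ complexTangent M p → t • v ∈ complexTangent M p :=
    fun t v hv => by
      rw [← Complex.coe_smul]
      exact Submodule.smul_mem _ _ hv
  rw [key]
  exact ⟨sub_mem (hr _ h.1) (hr _ h.2), add_mem (hr _ h.2) (hr _ h.1)⟩

/-- The Levi kernel `𝓚_2` of `M` at `p`: the left kernel in `𝓗_p` of the Levi form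
`(X_p, Y_p) ↦ (1 / 2i) [X, conj Y]_p mod 𝓗 ⊕ conj 𝓗`, for sections `X`, `Y` of `𝓗`. The value does
not depend on the sections extending `X_p`, `Y_p`. The `(1,0)`-vector `v^{1,0}` is
represented by `v`. -/
def leviKernel (M : Set E) (p : E) : Submodule ℂ E where
  carrier := {v | v ∈ complexTangent M p ∧
    ∃ x : E → E, IsSectionNear M (complexTangent M) p x ∧ x p = v ∧
      ∀ y : E → E, IsSectionNear M (complexTangent M) p y →
        InHorizontal M p (cBracket (fieldOneZero x) (fieldZeroOne y) p)}
  zero_mem' := by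
    refine ⟨zero_mem _, fun _ => 0, ?_, rfl, fun y hy => ?_⟩
    · exact Eventually.of_forall fun q => ⟨contDiffAt_const, fun _ => zero_mem _⟩
    · rw [cBracket_apply (differentiableAt_const _) hy.differentiableAt]
      simp [InHorizontal]
  add_mem' := by
    rintro a b ⟨ha, x, hx, rfl, hxy⟩ ⟨hb, x', hx', rfl, hxy'⟩
    refine ⟨add_mem ha hb, x + x', ?_, rfl, fun y hy => ?_⟩
    · filter_upwards [hx, hx'] with q h h'
      exact ⟨h.1.add h'.1, fun hq => add_mem (h.2 hq) (h'.2 hq)⟩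
    · rw [cBracket_add hx.differentiableAt hx'.differentiableAt hy.differentiableAt]
      exact (hxy y hy).add (hxy' y hy)
  smul_mem' := by
    rintro c a ⟨ha, x, hx, rfl, hxy⟩
    refine ⟨Submodule.smul_mem _ _ ha, c • x, ?_, rfl, fun y hy => ?_⟩
    · filter_upwards [hx] with q h
      exact ⟨h.1.const_smul c, fun hq => Submodule.smul_mem _ _ (h.2 hq)⟩
    · exact (hxy y hy).const_smul_field c hx.differentiableAt hy.differentiableAt

/-- The Levi form of `M` has rank `s` at `p`: its kernel has codimension `s` in `𝓗_p`. -/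
def HasLeviRankAt (M : Set E) (p : E) (s : ℕ) : Prop :=
  Module.finrank ℂ (leviKernel M p) + s = Module.finrank ℂ (complexTangent M p)

/-- The third term `𝓚_3` of the Freeman filtration at `p`: the vectors of `𝓚_2` annihilated by
the generalized Levi form
`(X_p, Y_p, Y'_p) ↦ (1 / 2i) [[X, conj Y], conj Y']_p mod 𝓗 ⊕ conj 𝓗`,
for a section `X` of `𝓚_2` and sections `Y`, `Y'` of `𝓗`. Where `𝓚_2` has locally
constant rank, the value does not depend on the sections extending `X_p`, `Y_p`, `Y'_p`. -/
def freemanThree (M : Set E) (p : E) : Set E :=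
  {v | v ∈ leviKernel M p ∧
    ∃ x : E → E, IsSectionNear M (leviKernel M) p x ∧ x p = v ∧
      ∀ y y' : E → E, IsSectionNear M (complexTangent M) p y →
        IsSectionNear M (complexTangent M) p y' →
        InHorizontal M p
          (cBracket (cBracket (fieldOneZero x) (fieldZeroOne y)) (fieldZeroOne y') p)}

/-- `M` (of locally constant Levi rank) is `2`-nondegenerate at `p`: `𝓚_2 ≠ 0` and `𝓚_3 = 0`. -/
def IsTwoNondegenerateAt (M : Set E) (p : E) : Prop :=
  leviKernel M p ≠ ⊥ ∧ freemanThree M p = {0}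

/-- `φ` is a local biholomorphism at `p` that maps the germ of `M` at `p` onto the germ of `M'`
at `φ p`. -/
def IsLocalEquivalence {E' : Type*} [NormedAddCommGroup E'] [NormedSpace ℂ E']
    (φ : E → E') (p : E) (M : Set E) (M' : Set E') : Prop :=
  AnalyticAt ℂ φ p ∧ (∃ e : E ≃L[ℂ] E', HasFDerivAt φ (e : E →L[ℂ] E') p) ∧
    ∀ᶠ q in 𝓝 p, (φ q ∈ M' ↔ q ∈ M)

/-- (The real vector space underlying) the Lie algebra `𝔥𝔬𝔩(M, p)` of germs at `p` of holomorphic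
infinitesimal symmetries of `M`: germs of holomorphic vector fields `∑ X_j ∂/∂Z_j` whose
real part, which as a real vector field is `X / 2`, is tangent to `M`. -/
def hol (M : Set E) (p : E) : Submodule ℝ (Germ (𝓝 p) E) where
  carrier := {ξ | ∃ X : E → E, ξ = (X : Germ (𝓝 p) E) ∧ AnalyticAt ℂ X p ∧
    ∀ᶠ q in 𝓝 p, q ∈ M → X q ∈ realTangent M q}
  zero_mem' := ⟨0, rfl, analyticAt_const,
    Eventually.of_forall fun _ _ => zero_mem _⟩
  add_mem' := by
    rintro a b ⟨X, rfl, hX, h⟩ ⟨X', rfl, hX', h'⟩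
    refine ⟨X + X', rfl, hX.add hX', ?_⟩
    filter_upwards [h, h'] with q h h' hq using add_mem (h hq) (h' hq)
  smul_mem' := by
    rintro c a ⟨X, rfl, hX, h⟩
    refine ⟨c • X, rfl, ?_, ?_⟩
    · have : AnalyticAt ℂ ((c : ℂ) • X) p := hX.const_smul
      refine this.congr (Eventually.of_forall fun q => ?_)
      exact Complex.coe_smul c (X q)
    · filter_upwards [h] with q h hq using Submodule.smul_mem _ c (h hq)

/-- The dimension of a real vector space, in `{0, 1, 2, …, ∞}`. -/
def realDim (V : Type*) [AddCommGroup V] [Module ℝ V] : ℕ∞ :=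
  Cardinal.toENat (Module.rank ℝ V)

end Geometry

section Weights

/-- The space `ℂ ⊕ ℂˢ ⊕ ℂʳ` of the coordinates `(w, z, ζ)`. -/
abbrev Coord (s r : ℕ) := ℂ × (Fin s → ℂ) × (Fin r → ℂ)

/-- The space of the variables `(z, ζ, v)`, where `v` stands for `Im w`. -/
abbrev GraphVar (s r : ℕ) := (Fin s → ℂ) × (Fin r → ℂ) × ℝ

/-- The coefficient of `t ^ k` in the Taylor series at `0` of `f`. -/
def taylorCoeff {V : Type*} [NormedAddCommGroup V] [NormedSpace ℝ V] (k : ℕ) (f : ℝ → V) : V :=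
  ((k.factorial : ℝ)⁻¹) • iteratedDeriv k f 0

variable {s r : ℕ}

/-- The sum of the terms of weighted degree `k` in the power series of `f(w, z, ζ)`, with
respect to `wt w = 2`, `wt z_j = 1`, `wt ζ_α = 0`. It is the coefficient of `t ^ k` in the
expansion of `f(t² w, t z, ζ)`. -/
def weightPart {V : Type*} [NormedAddCommGroup V] [NormedSpace ℝ V] (k : ℕ)
    (f : Coord s r → V) : Coord s r → V := fun q =>
  taylorCoeff k fun t : ℝ => f ((t : ℂ) ^ 2 * q.1, (t : ℂ) • q.2.1, q.2.2)

/-- The sum of the terms of weighted degree `k` in the power series in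
`z, ζ, conj z, conj ζ, v` of `Q(z, ζ, v)`, with respect to the weights `1, 0, 1, 0, 2`. -/
def graphWeightPart (k : ℕ) (Q : GraphVar s r → ℝ) : GraphVar s r → ℝ := fun x =>
  taylorCoeff k fun t : ℝ => Q ((t : ℂ) • x.1, x.2.1, t ^ 2 * x.2.2)

/-- The weighted degree preserving component of the map `φ = (h, g, f)` in the coordinates
`(w, z, ζ)`: the components of weight `2`, `1`, `0` of `h`, `g`, `f` respectively. -/
def degreePreservingPart (φ : Coord s r → Coord s r) : Coord s r → Coord s r := fun q =>
  (weightPart 2 (fun x => (φ x).1) q, weightPart 1 (fun x => (φ x).2.1) q,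
    weightPart 0 (fun x => (φ x).2.2) q)

end Weights

open Matrix in
/-- A defining equation `Re w = P + Q` with
`P = zᵀ H(ζ, conj ζ) (conj z) + Re ((conj z)ᵀ S(ζ, conj ζ) (conj z))`, where `H` and `S` are real
analytic near `0`, respectively Hermitian and symmetric matrix valued, `H(0, 0)` is
nondegenerate, and `Q` is a real analytic function of `(z, ζ, Im w)` near `0` all
whose terms have weighted degree greater than `2`. -/
structure DefiningEquation (s r : ℕ) where
  H : (Fin r → ℂ) → Matrix (Fin s) (Fin s) ℂ
  S : (Fin r → ℂ) → Matrix (Fin s) (Fin s) ℂ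
  Q : GraphVar s r → ℝ
  analytic_H : ∀ i j, AnalyticAt ℝ (fun ζ => H ζ i j) 0
  analytic_S : ∀ i j, AnalyticAt ℝ (fun ζ => S ζ i j) 0
  hermitian_H : ∀ᶠ ζ in 𝓝 0, (H ζ).IsHermitian
  symmetric_S : ∀ᶠ ζ in 𝓝 0, (S ζ).IsSymm
  nondegenerate_H : (H 0).det ≠ 0
  analytic_Q : AnalyticAt ℝ Q 0
  weight_Q : ∀ᶠ ζ in 𝓝 (0 : Fin r → ℂ), ∀ (z : Fin s → ℂ) (v : ℝ), ∀ k ≤ 2,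
    graphWeightPart k Q (z, ζ, v) = 0

namespace DefiningEquation

variable {s r : ℕ} (F : DefiningEquation s r)

open Matrix in
/-- The function `P`. -/
def P (z : Fin s → ℂ) (ζ : Fin r → ℂ) : ℝ :=
  (z ⬝ᵥ (F.H ζ *ᵥ star z)).re + (star z ⬝ᵥ (F.S ζ *ᵥ star z)).re

/-- The hypersurface `M = {Re w = P + Q}`; only its germ at `0` is meaningful. -/
def hypersurface : Set (Coord s r) :=
  {q | q.1.re = F.P q.2.1 q.2.2 + F.Q (q.2.1, q.2.2, q.1.im)}

/-- The model `M_0 = {Re w = P}`; only its germ at `0` is meaningful. -/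
def model : Set (Coord s r) :=
  {q | q.1.re = F.P q.2.1 q.2.2}

end DefiningEquation

/-- In a neighbourhood of `p`, the set `M` is a real analytic hypersurface with Levi form of
constant rank `s`. -/
def HasConstantLeviRankNear {E : Type*} [NormedAddCommGroup E] [NormedSpace ℂ E]
    (M : Set E) (p : E) (s : ℕ) : Prop :=
  ∀ᶠ q in 𝓝 p, q ∈ M → IsHypersurfaceAt M q ∧ HasLeviRankAt M q s

/-- In a neighbourhood of `p`, the set `M` is everywhere `2`-nondegenerate. -/
def IsTwoNondegenerateNear {E : Type*} [NormedAddCommGroup E] [NormedSpace ℂ E]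
    (M : Set E) (p : E) : Prop :=
  ∀ᶠ q in 𝓝 p, q ∈ M → IsTwoNondegenerateAt M q

end CRModel

end

/-! The organising device is the family of dilations `dil t` : (w, z, ζ) ↦ (t²w, tz, ζ). If ρ = Re w
− P − Q, then t⁻² ρ ∘ `dil t` = ρ₀ − t⁻² Q ∘ `dil t`, where ρ₀ = Re w − P. Since Q has only terms of
weight at least 3, the last term tends to 0 together with its derivatives as t → 0. The model is
thus a limit of biholomorphic images of M, and most of the theorem is a passage to this limit
(`VanishesToOrder.tendsto`).

Levi geometry first becomes linear algebra of 2-jets (`IsDefiningFunctionAt.leviKernel_eq`). An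
equation in graph form is equivariant under real translations in w, so a rank condition on M spreads
to a whole neighbourhood. Nondegeneracy of H(0,0) bounds the Levi kernel by the dimension r of the
ζ-space; having dimension exactly r is then a closed condition and passes to the model
(`finrank_jetKernel_rho0`). The kernel is a graph over the ζ-space with a smooth frame, and
2-nondegeneracy means that no nonzero ζ-vector is killed by all ∂̄-derivatives of this frame in
complex tangential directions. At 0 these derivatives involve only second and third derivatives to
which Q does not contribute, so M and its model agree there (`fderiv_frame_eq`), and the condition
is open (`injective_near`).

Adapted coordinates come from the Levi foliation. The Levi kernels are involutive
(`bracket_mem_jetKernel`), so the Frobenius theorem yields a leaf through the point, which is a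
complex submanifold. Suitably normalized, the conormal ∂ρ is holomorphic along the leaf, because the
leaf is tangent to the Levi kernel (`analyticAt_conormal_apply`). Straightening leaf and conormal
leaves an equation whose terms of weight at most 2 are quadratic in z (`exists_flat`,
`exists_definingEquation_of_flat`).

An equivalence φ maps Levi leaves to Levi leaves and complex tangent spaces to complex tangent
spaces. Hence h has no terms of weight below 2 and g none of weight 0, so `dil t⁻¹` ∘ φ ∘ `dil t`
converges to φ₀. Limits of points, and of the inverse map, give the second part.

For the third part, an infinitesimal symmetry is split into weighted components. Its lowest
component is a symmetry of the model (`tau_mem_realTangent`), and comparing the filtrations by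
weight gives the inequality of dimensions (`realDim_le_of_leading_terms`). -/

namespace CRModel

/-! ### Complex linear parts of real linear maps -/

section ComplexPart

variable {E F : Type*} [NormedAddCommGroup E] [NormedSpace ℂ E] [NormedAddCommGroup F]
  [NormedSpace ℂ F]

/-- Twice the complex linear part of a real linear map, `v ↦ T v - i T (i v)`. -/
noncomputable def cpart (T : E →L[ℝ] F) : E →L[ℂ] F :=
  LinearMap.mkContinuous
    { toFun := fun v => T v - Complex.I • T (Complex.I • v)
      map_add' := fun v w => by simp only [smul_add, map_add]; abel
      map_smul' := fun c v => by
        have h : Complex.I • c • v = c.re • (Complex.I • v) - c.im • v := by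
          rw [complex_smul_eq c v, smul_add, smul_comm Complex.I c.re, smul_comm Complex.I c.im,
            smul_smul Complex.I Complex.I, Complex.I_mul_I, neg_one_smul, smul_neg, sub_eq_add_neg]
        have h2 (a b : F) : Complex.I • (c.re • a - c.im • b)
            = c.re • Complex.I • a - c.im • Complex.I • b := by
          rw [smul_sub, smul_comm Complex.I c.re, smul_comm Complex.I c.im]
        rw [RingHom.id_apply, h, map_sub, T.map_smul, T.map_smul, h2, complex_smul_eq c v, map_add,
          T.map_smul, T.map_smul, complex_smul_eq c (_ - _), smul_sub Complex.I, smul_smul Complex.I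
          Complex.I, Complex.I_mul_I]
        module }
    (2 * ‖T‖) fun v => by
      have h1 := T.le_opNorm v
      have h2 := T.le_opNorm (Complex.I • v)
      have h3 := norm_sub_le (T v) (Complex.I • T (Complex.I • v))
      rw [norm_smul, Complex.norm_I, one_mul] at h2 h3
      simp only [LinearMap.coe_mk, AddHom.coe_mk]
      linarith

@[simp] lemma cpart_apply (T : E →L[ℝ] F) (v : E) :
    cpart T v = T v - Complex.I • T (Complex.I • v) := rfl

lemma norm_cpart_le (T : E →L[ℝ] F) : ‖cpart T‖ ≤ 2 * ‖T‖ :=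
  LinearMap.mkContinuous_norm_le _ (by positivity) _

/-- `cpart` as a continuous linear map. -/
noncomputable def cpartL (E F : Type*) [NormedAddCommGroup E] [NormedSpace ℂ E]
    [NormedAddCommGroup F] [NormedSpace ℂ F] : (E →L[ℝ] F) →L[ℝ] (E →L[ℂ] F) :=
  LinearMap.mkContinuous
    { toFun := cpart
      map_add' := fun T S => by
        ext v; simp only [cpart_apply, add_apply, smul_add]; abel
      map_smul' := fun c T => by
        ext v
        simp only [cpart_apply, smul_apply, RingHom.id_apply, smul_sub,
          smul_comm Complex.I c] }
    2 fun T => norm_cpart_le T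

@[simp] lemma cpartL_apply (T : E →L[ℝ] F) : cpartL E F T = cpart T := rfl

lemma cpart_restrictScalars (T : E →L[ℂ] F) :
    cpart (T.restrictScalars ℝ) = (2 : ℂ) • T := by
  ext v
  rw [cpart_apply, ContinuousLinearMap.coe_restrictScalars', map_smul, smul_smul,
    Complex.I_mul_I, smul_apply, two_smul, neg_one_smul, sub_neg_eq_add]

lemma restrictScalars_half_cpart {T : E →L[ℝ] F}
    (hT : ∀ v, T (Complex.I • v) = Complex.I • T v) :
    ((1 / 2 : ℂ) • cpart T).restrictScalars ℝ = T := by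
  ext v
  rw [ContinuousLinearMap.coe_restrictScalars', smul_apply, cpart_apply, hT,
    smul_smul Complex.I, Complex.I_mul_I, neg_one_smul, sub_neg_eq_add, ← two_smul ℂ, smul_smul]
  norm_num

lemma differentiableAt_complex_of_real {f : E → F} {x : E} (h : DifferentiableAt ℝ f x)
    (hI : ∀ v, fderiv ℝ f x (Complex.I • v) = Complex.I • fderiv ℝ f x v) :
    DifferentiableAt ℂ f x :=
  (hasFDerivAt_of_restrictScalars ℝ h.hasFDerivAt
    (restrictScalars_half_cpart hI)).differentiableAt

lemma fderiv_real_eq {f : E → F} {x : E} (h : DifferentiableAt ℂ f x) :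
    fderiv ℝ f x = (fderiv ℂ f x).restrictScalars ℝ :=
  (h.hasFDerivAt.restrictScalars ℝ).fderiv

end ComplexPart

/-! ### Complex analyticity of smooth complex differentiable maps in several variables -/

section Osgood

lemma minSmoothness_two_le : minSmoothness ℝ 2 ≤ (∞ : WithTop ℕ∞) := by
  rw [minSmoothness_of_isRCLikeNormedField]
  exact WithTop.coe_le_coe.2 (le_top : (2 : ℕ∞) ≤ ⊤)

universe u

/-- The complex derivative is half of `cpart` of the real one, hence smooth in the real sense. It is
itself complex differentiable because the real second derivative is symmetric and complex linear in
one slot, hence in both. So the induction on `n` applies to the derivative; both spaces lie in one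
universe because the target changes to a space of linear maps. -/
lemma contDiffOn_complex_of_real {E : Type u} [NormedAddCommGroup E] [NormedSpace ℂ E]
    {s : Set E} (hs : IsOpen s) (n : ℕ) :
    ∀ {F : Type u} [NormedAddCommGroup F] [NormedSpace ℂ F] {f : E → F},
      ContDiffOn ℝ ∞ f s → DifferentiableOn ℂ f s → ContDiffOn ℂ n f s := by
  induction n with
  | zero =>
    intro F _ _ f hf hd
    exact contDiffOn_zero.2 hd.continuousOn
  | succ n ih =>
    intro F _ _ f hf hd
    have hda : ∀ x ∈ s, DifferentiableAt ℂ f x := fun x hx => hd.differentiableAt (hs.mem_nhds hx)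
    have hre : ∀ x ∈ s, fderiv ℂ f x = (1 / 2 : ℂ) • cpartL E F (fderiv ℝ f x) := fun x hx => by
      rw [fderiv_real_eq (hda x hx), cpartL_apply, cpart_restrictScalars, smul_smul]
      norm_num
    have hf' : ContDiffOn ℝ ∞ (fderiv ℝ f) s := hf.fderiv_of_isOpen hs (by simp)
    have hsm : ContDiffOn ℝ ∞ (fderiv ℂ f) s := by
      refine ContDiffOn.congr ?_ hre
      exact ((cpartL E F).contDiff.comp_contDiffOn hf').const_smul (1 / 2 : ℂ)
    push_cast
    rw [contDiffOn_succ_iff_fderiv_of_isOpen hs]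
    refine ⟨hd, by simp, ih hsm fun x hx => ?_⟩
    refine (differentiableAt_complex_of_real
      ((hsm.contDiffAt (hs.mem_nhds hx)).differentiableAt (by simp)) fun v =>
          ?_).differentiableWithinAt
    have hsym : IsSymmSndFDerivAt ℝ f x :=
      (hf.contDiffAt (hs.mem_nhds hx)).isSymmSndFDerivAt minSmoothness_two_le
    have hD : DifferentiableAt ℝ (fderiv ℂ f) x :=
      (hsm.contDiffAt (hs.mem_nhds hx)).differentiableAt (by simp)
    have key : ∀ a b : E, fderiv ℝ (fderiv ℂ f) x a b = fderiv ℝ (fderiv ℝ f) x a b := by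
      intro a b
      have h1 : fderiv ℝ f =ᶠ[𝓝 x]
          fun y => ContinuousLinearMap.restrictScalarsL ℂ E F ℝ ℝ (fderiv ℂ f y) := by
        filter_upwards [hs.mem_nhds hx] with y hy
        rw [fderiv_real_eq (hda y hy)]
        rfl
      rw [h1.fderiv_eq]
      have h2 := ((ContinuousLinearMap.restrictScalarsL ℂ E F ℝ ℝ).hasFDerivAt.comp x
        hD.hasFDerivAt).fderiv
      change _ = (fderiv ℝ ((ContinuousLinearMap.restrictScalarsL ℂ E F ℝ ℝ) ∘ fderiv ℂ f) x a) b
      rw [h2]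
      rfl
    ext u
    rw [key, hsym.eq, ← key, map_smul, key, hsym.eq, ← key]
    rfl

variable {E F : Type*} [NormedAddCommGroup E] [NormedSpace ℂ E] [NormedAddCommGroup F]
  [NormedSpace ℂ F]

/-- The one-variable Cauchy estimate on each complex line through `x`. -/
lemma norm_fderiv_le_div {f : E → F} {s : Set E} (hf : DifferentiableOn ℂ f s) (hs : IsOpen s)
    {x : E} {ρ M : ℝ} (hρ : 0 < ρ) (hx : Metric.closedBall x ρ ⊆ s)
    (hM : ∀ y ∈ Metric.closedBall x ρ, ‖f y‖ ≤ M) : ‖fderiv ℂ f x‖ ≤ M / ρ := by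
  have hM0 : 0 ≤ M := (norm_nonneg _).trans (hM x (Metric.mem_closedBall_self hρ.le))
  refine ContinuousLinearMap.opNorm_le_bound _ (by positivity) fun v => ?_
  rcases eq_or_ne v 0 with rfl | hv
  · simp
  have hv' : 0 < ‖v‖ := norm_pos_iff.2 hv
  have hmaps : ∀ c : ℂ, ‖c‖ ≤ ρ / ‖v‖ → x + c • v ∈ Metric.closedBall x ρ := fun c hc => by
    rw [mem_closedBall_iff_norm, add_sub_cancel_left, norm_smul]
    rwa [le_div_iff₀ hv'] at hc
  have hline : ∀ c : ℂ, HasDerivAt (fun c : ℂ => x + c • v) v c := fun c => by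
    simpa using ((hasDerivAt_id c).smul_const v).const_add x
  have hd : ∀ c : ℂ, ‖c‖ ≤ ρ / ‖v‖ →
      HasDerivAt (fun c : ℂ => f (x + c • v)) (fderiv ℂ f (x + c • v) v) c := fun c hc =>
    ((hf.differentiableAt (hs.mem_nhds (hx (hmaps c hc)))).hasFDerivAt).comp_hasDerivAt c (hline c)
  have h := Complex.norm_deriv_le_of_forall_mem_sphere_norm_le (c := 0) (R := ρ / ‖v‖) (C := M)
    (f := fun c : ℂ => f (x + c • v)) (by positivity) ?_ fun c hc =>
      hM _ (hmaps c (by simpa using (mem_sphere_zero_iff_norm.1 hc).le))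
  · rw [(hd 0 (by simpa using by positivity)).deriv] at h
    simp only [zero_smul, add_zero] at h
    calc _ ≤ M / (ρ / ‖v‖) := h
      _ = M / ρ * ‖v‖ := by field_simp
  · refine DifferentiableOn.diffContOnCl fun c hc => ?_
    rw [closure_ball _ (by positivity), mem_closedBall_zero_iff] at hc
    exact (hd c hc).differentiableAt.differentiableWithinAt

/-- The Cauchy estimate is applied `k` times, each time giving up `ρ / k` of the radius. -/
lemma norm_iteratedFDeriv_zero_le {f : E → F} {r ρ M : ℝ} (hρ : 0 < ρ) (hr : ρ < r)
    (hf : ContDiffOn ℂ ∞ f (Metric.ball 0 r)) (hM : ∀ y ∈ Metric.ball (0 : E) r, ‖f y‖ ≤ M)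
    (k : ℕ) (hk : 0 < k) : ‖iteratedFDeriv ℂ k f 0‖ ≤ M * (k / ρ) ^ k := by
  have hk' : (0 : ℝ) < k := by exact_mod_cast hk
  have main : ∀ j ≤ k, ∀ x : E, ‖x‖ + j * (ρ / k) ≤ ρ →
      ‖iteratedFDeriv ℂ j f x‖ ≤ M * (k / ρ) ^ j := by
    intro j
    induction j with
    | zero =>
      intro _ x hx
      simp only [Nat.cast_zero, zero_mul, add_zero] at hx
      simpa using hM x (by simpa using hx.trans_lt hr)
    | succ j ih =>
      intro hj x hx
      push_cast at hx
      rw [← norm_fderiv_iteratedFDeriv, pow_succ]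
      have hd : DifferentiableOn ℂ (iteratedFDeriv ℂ j f) (Metric.ball 0 r) := by
        have := (hf.differentiableOn_iteratedFDerivWithin (m := j)
          (by exact_mod_cast ENat.natCast_lt_top j)
          Metric.isOpen_ball.uniqueDiffOn)
        exact this.congr fun y hy => (iteratedFDerivWithin_of_isOpen j Metric.isOpen_ball hy).symm
      have hpos : 0 < ρ / k := by positivity
      have hb : ∀ y ∈ Metric.closedBall x (ρ / k), ‖y‖ + j * (ρ / k) ≤ ρ := fun y hy => by
        have h1 : ‖y‖ ≤ ‖x‖ + ρ / k := by
          have := norm_sub_norm_le y x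
          rw [mem_closedBall_iff_norm] at hy
          linarith
        linarith
      have := norm_fderiv_le_div hd Metric.isOpen_ball (x := x) hpos (fun y hy => ?_)
        fun y hy => ih (by omega) y (hb y hy)
      · calc _ ≤ _ := this
          _ = _ := by field_simp
      · have := hb y hy
        rw [mem_ball_zero_iff]
        have : (0 : ℝ) ≤ j * (ρ / k) := by positivity
        linarith
  exact main k le_rfl 0 (by rw [norm_zero, zero_add]; field_simp; rfl)

/-- A function that is smooth in the real sense and complex differentiable near a point is
complex analytic there. -/
theorem analyticAt_complex_of_smooth {E F : Type u} [NormedAddCommGroup E] [NormedSpace ℂ E]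
    [NormedAddCommGroup F] [NormedSpace ℂ F] [CompleteSpace F] {f : E → F} {x : E}
    (hf : ∀ᶠ y in 𝓝 x, ContDiffAt ℝ ∞ f y)
    (hd : ∀ᶠ y in 𝓝 x, DifferentiableAt ℂ f y) :
    AnalyticAt ℂ f x := by
  wlog hx : x = 0 generalizing f x
  · have hc : Tendsto (fun y : E => x + y) (𝓝 0) (𝓝 x) :=
      Continuous.tendsto' (by fun_prop) _ _ (by simp)
    have h0 : AnalyticAt ℂ (fun y => f (x + y)) 0 := by
      refine this ?_ ?_ rfl
      · filter_upwards [hc.eventually hf] with y hy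
        exact ContDiffAt.comp y (g := f) hy (by fun_prop)
      · filter_upwards [hc.eventually hd] with y hy
        exact DifferentiableAt.comp y (g := f) hy (by fun_prop)
    have h1 : AnalyticAt ℂ (fun y : E => y - x) x := by fun_prop
    have := AnalyticAt.fun_comp (g := fun y => f (x + y)) (f := fun y => y - x) (x := x)
      (by simpa using h0) h1
    simpa using this
  subst hx
  obtain ⟨r, hr, hsm, hdf, hM⟩ : ∃ r > 0, ContDiffOn ℝ ∞ f (Metric.ball 0 r) ∧
      DifferentiableOn ℂ f (Metric.ball 0 r) ∧
      ∀ y ∈ Metric.ball (0 : E) r, ‖f y‖ ≤ ‖f 0‖ + 1 := by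
    have h2 : ∀ᶠ y in 𝓝 (0 : E), ‖f y‖ < ‖f 0‖ + 1 :=
      hf.self_of_nhds.continuousAt.norm.eventually_lt continuousAt_const (by simp)
    obtain ⟨r, hr, h⟩ := Metric.eventually_nhds_iff_ball.1 (hf.and (hd.and h2))
    exact ⟨r, hr, fun y hy => (h y hy).1.contDiffWithinAt,
      fun y hy => (h y hy).2.1.differentiableWithinAt, fun y hy => (h y hy).2.2.le⟩
  have hcd : ContDiffOn ℂ ∞ f (Metric.ball 0 r) :=
    contDiffOn_infty.2 fun n => contDiffOn_complex_of_real Metric.isOpen_ball n hsm hdf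
  set M := ‖f 0‖ + 1 with hMdef
  set p : FormalMultilinearSeries ℂ E F := fun k => ((k.factorial : ℂ)⁻¹) • iteratedFDeriv ℂ k f 0
    with hp
  obtain ⟨ρ, hρ0, hρr, hρ2⟩ : ∃ ρ : ℝ, 0 < ρ ∧ ρ < r ∧ 2 * ρ = r :=
    ⟨r / 2, by linarith, by linarith, by ring⟩
  -- Dividing by e absorbs the factor k^k / k! ≤ e^k produced by the iterated Cauchy estimate.
  obtain ⟨R, hR⟩ : ∃ R : NNReal, (R : ℝ) = ρ / Real.exp 1 := ⟨⟨_, by positivity⟩, rfl⟩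
  have hbound : ∀ k, ‖p k‖ * (R : ℝ) ^ k ≤ M := by
    intro k
    rw [hR]
    have hM1 : 0 ≤ M := by positivity
    rcases Nat.eq_zero_or_pos k with rfl | hk
    · simp [hp, hMdef]
    have h1 := norm_iteratedFDeriv_zero_le hρ0 hρr hcd hM k hk
    have h2 := Real.pow_div_factorial_le_exp (k : ℝ) (by positivity) k
    have h3 : ‖p k‖ = ‖iteratedFDeriv ℂ k f 0‖ / k.factorial := by
      simp only [hp]
      rw [norm_smul, norm_inv, Complex.norm_natCast, inv_mul_eq_div]
    rw [h3]
    calc ‖iteratedFDeriv ℂ k f 0‖ / k.factorial * (ρ / Real.exp 1) ^ k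
        ≤ M * (k / ρ) ^ k / k.factorial * (ρ / Real.exp 1) ^ k := by gcongr
      _ = M * ((k : ℝ) ^ k / k.factorial / Real.exp k) := by
          have : Real.exp (k : ℝ) = Real.exp 1 ^ k := by rw [← Real.exp_nat_mul, mul_one]
          rw [this, div_pow, div_pow]
          field_simp
      _ ≤ M * 1 := by
          gcongr
          rw [div_le_one (Real.exp_pos _)]
          exact h2
      _ = M := mul_one _
  refine ⟨p, R,
    p.le_radius_of_bound M hbound, ?_, ?_⟩
  · have : 0 < (R : ℝ) := by rw [hR]; positivity
    exact_mod_cast this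
  · intro y hy
    have hy1 : ‖y‖ < ρ := by
      rw [Metric.eball_coe, mem_ball_zero_iff, hR] at hy
      refine hy.trans_le (div_le_self hρ0.le ?_)
      exact Real.one_le_exp zero_le_one
    have hmem : ∀ c ∈ Metric.ball (0 : ℂ) 2, c • y ∈ Metric.ball (0 : E) r := fun c hc => by
      rw [mem_ball_zero_iff] at hc ⊢
      rw [norm_smul]
      nlinarith [norm_nonneg y, norm_nonneg c]
    -- The sum is identified on the complex line through `y`: c ↦ f(c • y) is holomorphic on the
    -- disc of radius 2, as ‖y‖ < ρ = r / 2, and its Taylor series is evaluated at c = 1.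
    set L : ℂ →L[ℂ] E := (ContinuousLinearMap.id ℂ ℂ).smulRight y with hL
    have hLa : ∀ c, L c = c • y := fun c => by simp [hL]
    have hdl : DifferentiableOn ℂ (f ∘ L) (Metric.ball 0 2) := by
      refine hdf.comp L.differentiable.differentiableOn fun c hc => ?_
      rw [hLa]
      exact hmem c hc
    have hsum := Complex.hasSum_taylorSeries_on_ball (c := 0) (r := 2)
      (f := f ∘ L) hdl (z := 1) (by simp)
    have hit : ∀ k, iteratedDeriv k (f ∘ L) 0 = iteratedFDeriv ℂ k f 0 fun _ => y := by
      intro k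
      have hopen : IsOpen (L ⁻¹' Metric.ball 0 r) := Metric.isOpen_ball.preimage L.continuous
      have h0 : (0 : ℂ) ∈ L ⁻¹' Metric.ball 0 r := by simp [hr]
      have := L.iteratedFDerivWithin_comp_right hcd Metric.isOpen_ball.uniqueDiffOn
        hopen.uniqueDiffOn (x := 0) (by simpa using hr) (i := k) (by exact_mod_cast le_top)
      rw [iteratedFDerivWithin_of_isOpen k hopen h0,
        iteratedFDerivWithin_of_isOpen k Metric.isOpen_ball (by simpa using hr)] at this
      rw [iteratedDeriv_eq_iteratedFDeriv, this]
      simp [hLa]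
    rw [zero_add]
    have hfy : (f ∘ L) 1 = f y := by simp [hLa]
    rw [hfy] at hsum
    convert! hsum using 2 with k
    rw [hit]
    simp [hp]

end Osgood


/-! ### The Frobenius theorem for total differential equations -/

section Frobenius

open Metric Set

variable {U V : Type*} [NormedAddCommGroup U] [NormedSpace ℝ U] [NormedAddCommGroup V]
  [NormedSpace ℝ V]

lemma exists_ball_bounds {E F : Type*} [NormedAddCommGroup E] [NormedSpace ℝ E]
    [NormedAddCommGroup F] [NormedSpace ℝ F] {a : E → F} {q₀ : E}
    (ha : ∀ᶠ q in 𝓝 q₀, ContDiffAt ℝ ∞ a q) {p : E → Prop} (hp : ∀ᶠ q in 𝓝 q₀, p q) :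
    ∃ R > 0, ∃ A B C : ℝ, 1 ≤ A ∧ 0 ≤ B ∧ 0 ≤ C ∧ ∀ q ∈ ball q₀ R,
      p q ∧ DifferentiableAt ℝ a q ∧ ‖a q‖ ≤ A ∧ ‖fderiv ℝ a q‖ ≤ B ∧
        ∀ q' ∈ ball q₀ R, ‖fderiv ℝ a q' - fderiv ℝ a q‖ ≤ C * ‖q' - q‖ := by
  have hc : ContDiffAt ℝ ∞ a q₀ := ha.self_of_nhds
  have hd : ContDiffAt ℝ 1 (fderiv ℝ a) q₀ := hc.fderiv_right (m := 1) (by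
    exact WithTop.coe_le_coe.2 (le_top : (1 + 1 : ℕ∞) ≤ ⊤))
  obtain ⟨K, t, ht, hK⟩ := hd.exists_lipschitzOnWith
  have h1 : ∀ᶠ q in 𝓝 q₀, ‖a q‖ < ‖a q₀‖ + 1 :=
    hc.continuousAt.norm.eventually_lt continuousAt_const (by simp)
  have h2 : ∀ᶠ q in 𝓝 q₀, ‖fderiv ℝ a q‖ < ‖fderiv ℝ a q₀‖ + 1 :=
    hd.continuousAt.norm.eventually_lt continuousAt_const (by simp)
  obtain ⟨R, hR, h⟩ := eventually_nhds_iff_ball.1 (((ha.and hp).and (h1.and h2)).and ht)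
  refine ⟨R, hR, ‖a q₀‖ + 1, ‖fderiv ℝ a q₀‖ + 1, K, by linarith [norm_nonneg (a q₀)],
    by positivity, K.2, fun q hq => ⟨(h q hq).1.1.2, (h q hq).1.1.1.differentiableAt (by simp),
      (h q hq).1.2.1.le, (h q hq).1.2.2.le, fun q' hq' => ?_⟩⟩
  simpa [dist_eq_norm] using hK.dist_le_mul q' (h q' hq').2 q (h q hq).2

lemma norm_taylor_one_le {E F : Type*} [NormedAddCommGroup E] [NormedSpace ℝ E]
    [NormedAddCommGroup F] [NormedSpace ℝ F] {a : E → F} {q₀ q h : E} {R C : ℝ} (hC : 0 ≤ C)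
    (hd : ∀ q ∈ ball q₀ R, DifferentiableAt ℝ a q)
    (hL : ∀ q ∈ ball q₀ R, ∀ q' ∈ ball q₀ R,
      ‖fderiv ℝ a q' - fderiv ℝ a q‖ ≤ C * ‖q' - q‖)
    (hq : q ∈ ball q₀ R) (hqh : q + h ∈ ball q₀ R) :
    ‖a (q + h) - a q - fderiv ℝ a q h‖ ≤ C * ‖h‖ * ‖h‖ := by
  have := Convex.norm_image_sub_le_of_norm_hasFDerivWithin_le' (f := a) (f' := fderiv ℝ a)
    (φ := fderiv ℝ a q) (C := C * ‖h‖) (s := ball q₀ R ∩ closedBall q ‖h‖) (x := q) (y := q + h)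
    (fun x hx => (hd x hx.1).hasFDerivAt.hasFDerivWithinAt) (fun x hx => ?_)
    ((convex_ball _ _).inter (convex_closedBall _ _))
    ⟨hq, mem_closedBall_self (norm_nonneg _)⟩ ⟨hqh, by simp⟩
  · simpa using this
  · refine (hL q hq x hx.1).trans ?_
    have := mem_closedBall_iff_norm.1 hx.2
    gcongr

/-- The solutions of `Dg = a(g, ·)` along rays from the origin. -/
lemma exists_ray_solution [CompleteSpace U] {a : U × V → (V →L[ℝ] U)} {u₀ : U} {R A B δ : ℝ}
    (hA : 1 ≤ A) (hB : 0 ≤ B) (hδ : 0 < δ) (hδR : 8 * A * δ ≤ R)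
    (hd : ∀ q ∈ ball (u₀, (0 : V)) R, DifferentiableAt ℝ a q)
    (hbA : ∀ q ∈ ball (u₀, (0 : V)) R, ‖a q‖ ≤ A)
    (hbB : ∀ q ∈ ball (u₀, (0 : V)) R, ‖fderiv ℝ a q‖ ≤ B) {ζ : V} (hζ : ‖ζ‖ ≤ δ) :
    ∃ u : ℝ → U, u 0 = u₀ ∧
      ∀ t ∈ Icc (0 : ℝ) 1, HasDerivWithinAt u (a (u t, t • ζ) ζ) (Icc 0 1) t ∧
        ‖u t - u₀‖ ≤ 2 * A * δ := by
  have hR : 0 < R := by nlinarith [mul_pos (lt_of_lt_of_le one_pos hA) hδ]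
  have hAδ : δ ≤ A * δ := by nlinarith
  have hmem : ∀ t ∈ Icc (0 : ℝ) 1, ∀ u ∈ closedBall u₀ (2 * A * δ),
      (u, t • ζ) ∈ ball (u₀, (0 : V)) R := by
    intro t ht u hu
    rw [mem_ball, Prod.dist_eq, max_lt_iff]
    rw [mem_closedBall] at hu
    refine ⟨by dsimp only; nlinarith, ?_⟩
    simp only [dist_zero_right, norm_smul, Real.norm_eq_abs, abs_of_nonneg ht.1]
    nlinarith [ht.2, ht.1, norm_nonneg ζ]
  have hLip : ∀ t ∈ Icc (0 : ℝ) 1, LipschitzOnWith (Real.toNNReal (B * δ))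
      (fun u => a (u, t • ζ) ζ) (closedBall u₀ (2 * A * δ)) := by
    intro t ht
    refine LipschitzOnWith.of_dist_le_mul fun u hu u' hu' => ?_
    rw [dist_eq_norm, dist_eq_norm, Real.coe_toNNReal _ (by positivity), ← sub_apply]
    have := (convex_ball (u₀, (0 : V)) R).norm_image_sub_le_of_norm_fderiv_le hd hbB
      (hmem t ht u' hu') (hmem t ht u hu)
    refine ((a (u, t • ζ) - a (u', t • ζ)).le_opNorm ζ).trans ?_
    have h2 : ‖(u, t • ζ) - (u', t • ζ)‖ = ‖u - u'‖ := by
      rw [Prod.mk_sub_mk, sub_self, Prod.norm_mk, norm_zero, max_eq_left (norm_nonneg _)]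
    rw [h2] at this
    calc _ ≤ (B * ‖u - u'‖) * δ := by gcongr
      _ = _ := by ring
  have hPL : IsPicardLindelof (fun t u => a (u, t • ζ) ζ) (⟨0, by simp⟩ : Icc (0 : ℝ) 1) u₀
      (Real.toNNReal (2 * A * δ)) 0 (Real.toNNReal (A * δ)) (Real.toNNReal (B * δ)) := by
    refine ⟨fun t ht => ?_, fun u hu => ?_, fun t ht u hu => ?_, ?_⟩
    · rw [Real.coe_toNNReal _ (by positivity)]
      exact hLip t ht
    · rw [Real.coe_toNNReal _ (by positivity)] at hu
      intro t ht
      have h1 : ContinuousAt a (u, t • ζ) := (hd _ (hmem t ht u hu)).continuousAt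
      have h2 : ContinuousAt (fun t : ℝ => a (u, t • ζ)) t :=
        ContinuousAt.comp (f := fun t : ℝ => (u, t • ζ)) (g := a) h1 (by fun_prop)
      exact (h2.clm_apply continuousAt_const).continuousWithinAt
    · rw [Real.coe_toNNReal _ (by positivity)] at hu ⊢
      refine ((a (u, t • ζ)).le_opNorm ζ).trans ?_
      have := hbA _ (hmem t ht u hu)
      gcongr
    · rw [Real.coe_toNNReal _ (by positivity), Real.coe_toNNReal _ (by positivity)]
      simp
      nlinarith
  obtain ⟨u, hu0, hu⟩ := hPL.exists_eq_forall_mem_Icc_hasDerivWithinAt₀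
  -- A fencing argument: the speed is at most `A * δ`, strictly below the slope `2 * A * δ` of the
  -- barrier.
  have hb : ∀ t ∈ Icc (0 : ℝ) 1, ‖u t - u₀‖ ≤ 2 * A * δ * t := by
    refine image_norm_le_of_norm_deriv_right_lt_deriv_boundary (f := fun t => u t - u₀)
      (f' := fun t => a (u t, t • ζ) ζ) (B' := fun _ => 2 * A * δ)
      (fun t ht => ((hu t ht).continuousWithinAt).sub continuousWithinAt_const)
      (fun t ht => ?_) (by simp [hu0]) (fun t => by simpa using (hasDerivAt_id t).const_mul (2 * A *
          δ))
      fun t ht hn => ?_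
    · exact ((hu t ⟨ht.1, ht.2.le⟩).mono_of_mem_nhdsWithin
        (Icc_mem_nhdsGE_of_mem ht)).sub_const u₀
    · have hmem' : u t ∈ closedBall u₀ (2 * A * δ) := by
        rw [mem_closedBall_iff_norm, hn]
        have : 0 < A * δ := by positivity
        nlinarith [ht.2]
      have h1 := (a (u t, t • ζ)).le_opNorm ζ
      have h2 := hbA _ (hmem t ⟨ht.1, ht.2.le⟩ _ hmem')
      have h3 : ‖a (u t, t • ζ)‖ * ‖ζ‖ ≤ A * δ := by gcongr
      have : 0 < A * δ := by positivity
      linarith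
  refine ⟨u, hu0, fun t ht => ⟨hu t ht, (hb t ht).trans ?_⟩⟩
  have : 0 < A * δ := by positivity
  nlinarith [ht.2]

/-- **Frobenius theorem**: the total differential equation `Dg(ζ) = a(g(ζ), ζ)` is solvable if
its integrability condition holds. -/
theorem exists_hasFDerivAt_eq [CompleteSpace U] {a : U × V → (V →L[ℝ] U)} {u₀ : U}
    (ha : ∀ᶠ q in 𝓝 (u₀, (0 : V)), ContDiffAt ℝ ∞ a q)
    (hint : ∀ᶠ q in 𝓝 (u₀, (0 : V)), ∀ η ξ : V,
      fderiv ℝ a q (a q η, η) ξ = fderiv ℝ a q (a q ξ, ξ) η) :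
    ∃ g : V → U, g 0 = u₀ ∧ ∀ᶠ ζ in 𝓝 (0 : V), HasFDerivAt g (a (g ζ, ζ)) ζ := by
  obtain ⟨R, hR, A, B, C, hA, hB, hC, hq⟩ := exists_ball_bounds ha hint
  have hd := fun q hq' => (hq q hq').2.1
  have hbA := fun q hq' => (hq q hq').2.2.1
  have hbB := fun q hq' => (hq q hq').2.2.2.1
  have hL := fun q hq' => (hq q hq').2.2.2.2
  set δ := R / (8 * A) with hδdef
  have hδ : 0 < δ := by positivity
  have hδR : 8 * A * δ = R := by rw [hδdef]; field_simp
  have hAδ : δ ≤ A * δ := by nlinarith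
  choose! u hu0 hu using fun (ζ : V) (hζ : ‖ζ‖ ≤ δ) =>
    exists_ray_solution hA hB hδ hδR.le hd hbA hbB hζ
  have hmem : ∀ t ∈ Icc (0 : ℝ) 1, ∀ ζ : V, ‖ζ‖ ≤ δ → ∀ v ∈ closedBall u₀ (4 * A * δ),
      (v, t • ζ) ∈ ball (u₀, (0 : V)) R := by
    intro t ht ζ hζ v hv
    rw [mem_ball, Prod.dist_eq, max_lt_iff]
    rw [mem_closedBall] at hv
    refine ⟨by dsimp only; nlinarith, ?_⟩
    simp only [dist_zero_right, norm_smul, Real.norm_eq_abs, abs_of_nonneg ht.1]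
    nlinarith [ht.2, ht.1, norm_nonneg ζ]
  have hu4 : ∀ ζ : V, ‖ζ‖ ≤ δ → ∀ t ∈ Icc (0 : ℝ) 1, u ζ t ∈ closedBall u₀ (4 * A * δ) :=
    fun ζ hζ t ht => by
      rw [mem_closedBall_iff_norm]
      have := (hu ζ hζ t ht).2
      nlinarith
  -- A solution must satisfy the ordinary differential equation along each ray, so its value at ζ
  -- can only be the ray solution at time 1. It remains to see that this function has the prescribed
  -- derivative.
  refine ⟨fun ζ => u ζ 1, ?_, ?_⟩
  · have h0 : ‖(0 : V)‖ ≤ δ := by simpa using hδ.le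
    have := norm_image_sub_le_of_norm_deriv_le_segment' (f := u 0) (C := 0) (a := 0) (b := 1)
      (fun t ht => (hu 0 h0 t ht).1) (fun t _ => by simp) 1 (by simp)
    rw [zero_mul, norm_le_zero_iff, sub_eq_zero, hu0 0 h0] at this
    exact this
  · filter_upwards [ball_mem_nhds (0 : V) hδ] with ζ hζ
    rw [mem_ball_zero_iff] at hζ
    set K₀ := C * A ^ 2 * δ + B * A with hK₀
    have hK₀' : 0 ≤ K₀ := by positivity
    set L := B * δ + 1 with hLdef
    have hLpos : 0 < L := by positivity
    have main : ∀ η : V, ‖ζ + η‖ < δ →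
        ‖u (ζ + η) 1 - u ζ 1 - a (u ζ 1, ζ) η‖ ≤ K₀ / L * (Real.exp L - 1) * ‖η‖ ^ 2 := by
      intro η hη
      have hη2 : ‖η‖ ≤ 2 * δ := by
        have := norm_sub_le (ζ + η) ζ
        rw [add_sub_cancel_left] at this
        linarith
      set q : ℝ → U × V := fun t => (u ζ t, t • ζ) with hqdef
      -- The expected first-order perturbation of the ray solution when ζ is replaced by ζ + η. It
      -- solves the perturbed equation up to O(‖η‖²), and Grönwall's inequality compares it with the
      -- true solution.
      set v : ℝ → U := fun t => u ζ t + t • a (q t) η with hv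
      have hqmem : ∀ t ∈ Icc (0 : ℝ) 1, q t ∈ ball (u₀, (0 : V)) R := fun t ht =>
        hmem t ht ζ hζ.le _ (hu4 ζ hζ.le t ht)
      have hq' : ∀ t ∈ Icc (0 : ℝ) 1, HasDerivWithinAt q (a (q t) ζ, ζ) (Icc 0 1) t :=
        fun t ht => (hu ζ hζ.le t ht).1.prodMk
          (by simpa using ((hasDerivAt_id t).smul_const ζ).hasDerivWithinAt)
      have hv' : ∀ t ∈ Icc (0 : ℝ) 1, HasDerivWithinAt v
          (a (q t) ζ + (a (q t) η + t • fderiv ℝ a (q t) (a (q t) ζ, ζ) η)) (Icc 0 1) t := by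
        intro t ht
        have h1 : HasDerivWithinAt (fun t => a (q t)) (fderiv ℝ a (q t) (a (q t) ζ, ζ))
            (Icc 0 1) t :=
          (hd _ (hqmem t ht)).hasFDerivAt.comp_hasDerivWithinAt t (hq' t ht)
        have h2 : HasDerivWithinAt (fun t => a (q t) η) (fderiv ℝ a (q t) (a (q t) ζ, ζ) η)
            (Icc 0 1) t := by
          simpa using h1.clm_apply (hasDerivWithinAt_const t (Icc 0 1) η)
        have h3 := (hasDerivAt_id t).hasDerivWithinAt (s := Icc 0 1) |>.smul h2
        refine ((hu ζ hζ.le t ht).1.add h3).congr_deriv ?_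
        simp only [id, one_smul, hqdef]
        abel
      have haq : ∀ t ∈ Icc (0 : ℝ) 1, ∀ x : V, ‖a (q t) x‖ ≤ A * ‖x‖ := fun t ht x =>
        ((a (q t)).le_opNorm x).trans (by have := hbA _ (hqmem t ht); gcongr)
      have hv4 : ∀ t ∈ Icc (0 : ℝ) 1, v t ∈ closedBall u₀ (4 * A * δ) := by
        intro t ht
        rw [mem_closedBall_iff_norm]
        have h1 := (hu ζ hζ.le t ht).2
        have h2 := haq t ht η
        have h3 : v t - u₀ = (u ζ t - u₀) + t • a (q t) η := by simp only [hv]; abel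
        rw [h3]
        refine (norm_add_le _ _).trans ?_
        rw [norm_smul, Real.norm_eq_abs, abs_of_nonneg ht.1]
        have h4 : A * ‖η‖ ≤ A * (2 * δ) := by gcongr
        have h5 : t * ‖a (q t) η‖ ≤ 1 * ‖a (q t) η‖ :=
          mul_le_mul_of_nonneg_right ht.2 (norm_nonneg _)
        linarith
      have hgr := dist_le_of_approx_trajectories_ODE_of_mem (K := Real.toNNReal L)
        (v := fun t x => a (x, t • (ζ + η)) (ζ + η)) (s := fun _ => closedBall u₀ (4 * A * δ))
        (a := 0) (b := 1) (f := u (ζ + η)) (g := v) (εf := 0) (εg := K₀ * ‖η‖ ^ 2) (δ := 0)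
        (fun t ht => ?_) (fun t ht => (hu _ hη.le t ht).1.continuousWithinAt)
        (fun t ht => (hu _ hη.le t ⟨ht.1, ht.2.le⟩).1.mono_of_mem_nhdsWithin
          (Icc_mem_nhdsGE_of_mem ht)) (fun t ht => by simp)
        (fun t ht => hu4 _ hη.le t ⟨ht.1, ht.2.le⟩)
        (fun t ht => (hv' t ht).continuousWithinAt)
        (fun t ht => (hv' t ⟨ht.1, ht.2.le⟩).mono_of_mem_nhdsWithin
          (Icc_mem_nhdsGE_of_mem ht)) (fun t ht => ?_)
        (fun t ht => hv4 t ⟨ht.1, ht.2.le⟩) (by simp [hu0 _ hη.le, hu0 _ hζ.le, hv]) 1 (by simp)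
      · rw [Real.coe_toNNReal _ hLpos.le, gronwallBound_of_K_ne_0 hLpos.ne', dist_eq_norm] at hgr
        have h1 : u (ζ + η) 1 - u ζ 1 - a (u ζ 1, ζ) η = u (ζ + η) 1 - v 1 := by
          simp only [hv, hqdef, one_smul]; abel
        rw [h1]
        refine hgr.trans (le_of_eq ?_)
        simp only [sub_zero, mul_one, zero_mul, zero_add]
        ring
      · have ht' : t ∈ Icc (0 : ℝ) 1 := ⟨ht.1, ht.2.le⟩
        refine LipschitzOnWith.of_dist_le_mul fun x hx y hy => ?_
        rw [dist_eq_norm, dist_eq_norm, Real.coe_toNNReal _ hLpos.le, ← sub_apply]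
        have := (convex_ball (u₀, (0 : V)) R).norm_image_sub_le_of_norm_fderiv_le hd hbB
          (hmem t ht' _ hη.le y hy) (hmem t ht' _ hη.le x hx)
        refine (ContinuousLinearMap.le_opNorm _ (ζ + η)).trans ?_
        rw [Prod.mk_sub_mk, sub_self, Prod.norm_mk, norm_zero, max_eq_left (norm_nonneg _)] at this
        calc _ ≤ (B * ‖x - y‖) * δ := by gcongr
          _ ≤ _ := by rw [hLdef]; nlinarith [norm_nonneg (x - y)]
      · have ht' : t ∈ Icc (0 : ℝ) 1 := ⟨ht.1, ht.2.le⟩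
        set h : U × V := t • (a (q t) η, η) with hh
        have hqh : (v t, t • (ζ + η)) = q t + h := by
          simp only [hv, hqdef, hh, Prod.smul_mk, Prod.mk_add_mk, smul_add]
        have hhn : ‖h‖ ≤ A * ‖η‖ := by
          rw [hh, norm_smul, Real.norm_eq_abs, abs_of_nonneg ht.1, Prod.norm_mk]
          have h1 : max ‖a (q t) η‖ ‖η‖ ≤ A * ‖η‖ :=
            max_le (haq t ht' η) (by nlinarith [norm_nonneg η])
          have h0 : 0 ≤ max ‖a (q t) η‖ ‖η‖ := le_max_of_le_right (norm_nonneg _)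
          nlinarith [ht.1, ht.2]
        have hTay := norm_taylor_one_le hC hd hL (hqmem t ht')
          (by rw [← hqh]; exact hmem t ht' _ hη.le _ (hv4 t ht'))
        rw [dist_eq_norm, ← norm_neg, hqh]
        -- Here integrability enters: exchanging ζ and η in the derivative term turns it into part
        -- of the first-order Taylor expansion of `a` at `q t`, and only quadratic errors remain.
        have hsplit : -(a (q t) ζ + (a (q t) η + t • fderiv ℝ a (q t) (a (q t) ζ, ζ) η)
            - a (q t + h) (ζ + η)) = (a (q t + h) - a (q t) - fderiv ℝ a (q t) h) (ζ + η)
              + t • fderiv ℝ a (q t) (a (q t) η, η) η := by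
          have hs := (hq _ (hqmem t ht')).1 ζ η
          rw [hs, hh, map_smul]
          simp only [sub_apply, map_add, smul_apply]
          abel
        rw [hsplit]
        refine (norm_add_le _ _).trans ?_
        have h1 : ‖(a (q t + h) - a (q t) - fderiv ℝ a (q t) h) (ζ + η)‖
            ≤ (C * (A * ‖η‖) * (A * ‖η‖)) * δ := by
          refine (ContinuousLinearMap.le_opNorm _ _).trans ?_
          refine mul_le_mul (hTay.trans ?_) hη.le (norm_nonneg _) (by positivity)
          gcongr
        have h2 : ‖t • fderiv ℝ a (q t) (a (q t) η, η) η‖ ≤ B * (A * ‖η‖) * ‖η‖ := by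
          have h3 : t • fderiv ℝ a (q t) (a (q t) η, η) η = fderiv ℝ a (q t) h η := by
            rw [hh, map_smul, smul_apply]
          rw [h3]
          refine (ContinuousLinearMap.le_opNorm _ _).trans ?_
          gcongr
          refine (ContinuousLinearMap.le_opNorm _ _).trans ?_
          have := hbB _ (hqmem t ht')
          gcongr
        calc _ ≤ _ := add_le_add h1 h2
          _ = _ := by rw [hK₀]; ring
    have hev : ∀ᶠ η in 𝓝 (0 : V), ‖ζ + η‖ < δ := by
      have : ContinuousAt (fun η : V => ‖ζ + η‖) 0 := by fun_prop
      exact this.eventually_lt continuousAt_const (by simpa using hζ)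
    have hO : (fun η => u (ζ + η) 1 - u ζ 1 - a (u ζ 1, ζ) η) =O[𝓝 0]
        fun η : V => ‖η‖ ^ 2 :=
      Asymptotics.IsBigO.of_bound (K₀ / L * (Real.exp L - 1)) (by
        filter_upwards [hev] with η hη
        simpa using main η hη)
    rw [hasFDerivAt_iff_isLittleO_nhds_zero]
    exact hO.trans_isLittleO ((Asymptotics.isLittleO_pow_id one_lt_two).comp_tendsto
      (tendsto_norm_zero)|>.trans_isBigO (Asymptotics.isBigO_refl _ _).norm_left)

/-- Solutions of a smooth total differential equation are smooth. -/
lemma contDiffAt_of_hasFDerivAt_eq {a : U × V → (V →L[ℝ] U)} {g : V → U} {ζ₀ : V}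
    (ha : ∀ᶠ q in 𝓝 (g ζ₀, ζ₀), ContDiffAt ℝ ∞ a q)
    (hg : ∀ᶠ ζ in 𝓝 ζ₀, HasFDerivAt g (a (g ζ, ζ)) ζ) :
    ∀ᶠ ζ in 𝓝 ζ₀, ContDiffAt ℝ ∞ g ζ := by
  have hcont : ContinuousAt (fun ζ => (g ζ, ζ)) ζ₀ :=
    hg.self_of_nhds.continuousAt.prodMk continuousAt_id
  obtain ⟨r, hr, h⟩ := eventually_nhds_iff_ball.1 (hg.and (hcont.eventually ha))
  have main : ∀ n : ℕ, ContDiffOn ℝ n g (ball ζ₀ r) := by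
    intro n
    induction n with
    | zero =>
      exact contDiffOn_zero.2 fun ζ hζ => (h ζ hζ).1.continuousAt.continuousWithinAt
    | succ n ih =>
      push_cast
      rw [contDiffOn_succ_iff_fderiv_of_isOpen isOpen_ball]
      refine ⟨fun ζ hζ => (h ζ hζ).1.differentiableAt.differentiableWithinAt, by simp, ?_⟩
      have : ContDiffOn ℝ n (fun ζ => a (g ζ, ζ)) (ball ζ₀ r) := fun ζ hζ =>
        ContDiffAt.comp_contDiffWithinAt (g := a) (f := fun ζ => (g ζ, ζ)) ζ
          (contDiffAt_infty.1 (h ζ hζ).2 n)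
          ((ih ζ hζ).prodMk contDiffWithinAt_id)
      exact this.congr fun ζ hζ => (h ζ hζ).1.fderiv
  filter_upwards [ball_mem_nhds ζ₀ hr] with ζ hζ
  exact contDiffAt_infty.2 fun n => (main n).contDiffAt (isOpen_ball.mem_nhds hζ)

end Frobenius


/-! ### The Levi form and Levi kernel of a 2-jet -/

section Jets

variable {E : Type*} [NormedAddCommGroup E] [NormedSpace ℂ E]

/-- The complex linear form `2 ∂ρ` attached to a real differential `ℓ = dρ`. -/
noncomputable def dC (ℓ : E →L[ℝ] ℝ) : E →L[ℂ] ℂ := cpart (Complex.ofRealCLM.comp ℓ)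

lemma dC_apply (ℓ : E →L[ℝ] ℝ) (v : E) :
    dC ℓ v = (ℓ v : ℂ) - Complex.I * (ℓ (Complex.I • v) : ℂ) := by
  simp [dC]

lemma dC_re (ℓ : E →L[ℝ] ℝ) (v : E) : (dC ℓ v).re = ℓ v := by simp [dC_apply]

lemma dC_eq_zero_iff {ℓ : E →L[ℝ] ℝ} {v : E} :
    dC ℓ v = 0 ↔ ℓ v = 0 ∧ ℓ (Complex.I • v) = 0 := by
  rw [dC_apply, Complex.ext_iff]
  simp

/-- `dC` as a continuous linear map. -/
noncomputable def dCL (E : Type*) [NormedAddCommGroup E] [NormedSpace ℂ E] :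
    (E →L[ℝ] ℝ) →L[ℝ] (E →L[ℂ] ℂ) :=
  (cpartL E ℂ).comp (ContinuousLinearMap.compL ℝ E ℝ ℂ Complex.ofRealCLM)

@[simp] lemma dCL_apply (ℓ : E →L[ℝ] ℝ) : dCL E ℓ = dC ℓ := rfl

/-- The Levi form attached to a real Hessian `B`. -/
noncomputable def lev (B : E →L[ℝ] E →L[ℝ] ℝ) (x y : E) : ℝ := B x y + B (Complex.I • x) (Complex.I
    • y)

lemma I_smul_I_smul (v : E) : Complex.I • Complex.I • v = -v := by
  rw [smul_smul, Complex.I_mul_I, neg_one_smul]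

/-- `lev` is the real part of a sesquilinear form. This is why vanishing of the real form on a
complex subspace already defines a complex subspace. -/
lemma lev_I_left (B : E →L[ℝ] E →L[ℝ] ℝ) (x y : E) :
    lev B (Complex.I • x) y = -lev B x (Complex.I • y) := by
  simp only [lev, I_smul_I_smul, map_neg, neg_apply]
  ring

lemma lev_add_left (B : E →L[ℝ] E →L[ℝ] ℝ) (x x' y : E) :
    lev B (x + x') y = lev B x y + lev B x' y := by
  simp only [lev, smul_add, map_add, add_apply]; ring

lemma lev_add_right (B : E →L[ℝ] E →L[ℝ] ℝ) (x y y' : E) :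
    lev B x (y + y') = lev B x y + lev B x y' := by
  simp only [lev, smul_add, map_add]; ring

lemma lev_smul_left (B : E →L[ℝ] E →L[ℝ] ℝ) (c : ℝ) (x y : E) :
    lev B (c • x) y = c * lev B x y := by
  simp only [lev, smul_comm Complex.I c, map_smul, smul_apply, smul_eq_mul]; ring

lemma lev_smul_right (B : E →L[ℝ] E →L[ℝ] ℝ) (c : ℝ) (x y : E) :
    lev B x (c • y) = c * lev B x y := by
  simp only [lev, smul_comm Complex.I c, map_smul, smul_eq_mul]; ring

/-- The abstract Levi kernel of a pair of a differential and a Hessian. -/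
def jetKernel (ℓ : E →L[ℝ] ℝ) (B : E →L[ℝ] E →L[ℝ] ℝ) : Submodule ℂ E where
  carrier := {v | dC ℓ v = 0 ∧ ∀ y, dC ℓ y = 0 → lev B v y = 0}
  zero_mem' := ⟨map_zero _, fun y _ => by simp [lev]⟩
  add_mem' := fun {a b} ha hb => ⟨by rw [map_add, ha.1, hb.1, add_zero], fun y hy => by
    rw [lev_add_left, ha.2 y hy, hb.2 y hy, add_zero]⟩
  smul_mem' := fun c v hv => ⟨by rw [map_smul, hv.1, smul_zero], fun y hy => by
    have hy' : dC ℓ (Complex.I • y) = 0 := by rw [map_smul, hy, smul_zero]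
    rw [complex_smul_eq, lev_add_left, lev_smul_left, lev_smul_left, lev_I_left, hv.2 y hy,
      hv.2 _ hy']
    simp⟩

lemma mem_jetKernel {ℓ : E →L[ℝ] ℝ} {B : E →L[ℝ] E →L[ℝ] ℝ} {v : E} :
    v ∈ jetKernel ℓ B ↔ dC ℓ v = 0 ∧ ∀ y, dC ℓ y = 0 → lev B v y = 0 := Iff.rfl

/-- The real Hessian. -/
noncomputable abbrev hess (ρ : E → ℝ) (p : E) : E →L[ℝ] E →L[ℝ] ℝ := fderiv ℝ (fderiv ℝ ρ) p

/-- `2 ∂̄_y x`, the derivative of a field `x` in the direction `y^{0,1}`. -/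
noncomputable def dbar (x : E → E) (p y : E) : E :=
  fderiv ℝ x p y + Complex.I • fderiv ℝ x p (Complex.I • y)

lemma fderiv_dC {ρ : E → ℝ} {p : E} (h : AnalyticAt ℝ ρ p) :
    HasFDerivAt (fun q => dC (fderiv ℝ ρ q)) ((dCL E).comp (hess ρ p)) p :=
  (dCL E).hasFDerivAt.comp p h.fderiv.differentiableAt.hasFDerivAt

lemma hess_symm {ρ : E → ℝ} {p : E} (h : AnalyticAt ℝ ρ p) (x y : E) :
    hess ρ p x y = hess ρ p y x :=
  (h.contDiffAt (n := ω)).isSymmSndFDerivAt (by simp) x y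

end Jets

/-! ### Tangent spaces and Levi kernels through a defining function -/

section Tangent

variable {E : Type*} [NormedAddCommGroup E] [NormedSpace ℂ E] {M : Set E} {p : E} {ρ : E → ℝ}

lemma IsDefiningFunctionAt.eventually (h : IsDefiningFunctionAt M p ρ) :
    ∀ᶠ q in 𝓝 p, IsDefiningFunctionAt M q ρ := by
  have h2 : ∀ᶠ q in 𝓝 p, fderiv ℝ ρ q ≠ 0 := h.1.fderiv.continuousAt.eventually_ne h.2.1
  filter_upwards [h.1.eventually_analyticAt, h2, h.2.2.eventually_nhds] with q h1 h2 h3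
    using ⟨h1, h2, h3⟩

/-- A function vanishing on a hypersurface has vanishing derivative in tangential directions. -/
lemma IsDefiningFunctionAt.fderiv_eq_zero {F : Type*} [NormedAddCommGroup F] [NormedSpace ℝ F]
    (h : IsDefiningFunctionAt M p ρ) (hp : p ∈ M) {f : E → F} (hf : DifferentiableAt ℝ f p)
    (hM : ∀ᶠ q in 𝓝 p, q ∈ M → f q = 0) {v : E} (hv : fderiv ℝ ρ p v = 0) :
    fderiv ℝ f p v = 0 := by
  obtain ⟨e₀, he₀⟩ : ∃ e, fderiv ℝ ρ p e ≠ 0 := by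
    by_contra! hcon
    exact h.2.1 (by ext e; simpa using hcon e)
  set e : E := (fderiv ℝ ρ p e₀)⁻¹ • e₀ with he
  have he1 : fderiv ℝ ρ p e = 1 := by
    rw [he, map_smul, smul_eq_mul, inv_mul_cancel₀ he₀]
  set N : ℝ := ‖v‖ + ‖e‖ + 1 with hN
  have hNpos : 0 < N := by positivity
  have hρp : ρ p = 0 := h.2.2.self_of_nhds.1 hp
  have hfp : f p = 0 := hM.self_of_nhds hp
  suffices H : ∀ ε > 0, ε < 1 → ‖fderiv ℝ f p v‖ ≤ ε * (‖fderiv ℝ f p e‖ + N) by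
    rw [← norm_le_zero_iff]
    refine le_of_forall_pos_le_add fun δ hδ => ?_
    have hc : 0 < ‖fderiv ℝ f p e‖ + N := by positivity
    refine (H (min (1 / 2) (δ / (‖fderiv ℝ f p e‖ + N))) (by positivity)
      (lt_of_le_of_lt (min_le_left _ _) (by norm_num))).trans ?_
    rw [zero_add]
    calc _ ≤ δ / (‖fderiv ℝ f p e‖ + N) * (‖fderiv ℝ f p e‖ + N) := by
          gcongr; exact min_le_right _ _
      _ = δ := by field_simp
  intro ε hε hε1
  have h1 := (hasFDerivAt_iff_isLittleO_nhds_zero.1 h.1.differentiableAt.hasFDerivAt).def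
    (show 0 < ε / (2 * N) by positivity)
  have h2 := (hasFDerivAt_iff_isLittleO_nhds_zero.1 hf.hasFDerivAt).def hε
  have h3 : ∀ᶠ d in 𝓝 (0 : E), ContinuousAt ρ (p + d) ∧ (p + d ∈ M ↔ ρ (p + d) = 0) ∧
      (p + d ∈ M → f (p + d) = 0) := by
    have hc : Tendsto (fun d : E => p + d) (𝓝 0) (𝓝 p) :=
      Continuous.tendsto' (by fun_prop) _ _ (by simp)
    filter_upwards [hc.eventually h.1.eventually_analyticAt, hc.eventually h.2.2,
      hc.eventually hM] with d a b c using ⟨a.continuousAt, b, c⟩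
  obtain ⟨r, hr, hball⟩ := Metric.eventually_nhds_iff_ball.1 ((h1.and h2).and h3)
  set σ : ℝ := r / (2 * N) with hσ
  have hσpos : 0 < σ := by positivity
  -- A point of M near p + σv is sought by a small correction along the transversal vector `e`, of
  -- size at most εσ.
  set d : ℝ → E := fun t => σ • v + t • e with hd
  have hdn : ∀ t ∈ Set.Icc (-(ε * σ)) (ε * σ), ‖d t‖ ≤ σ * N := by
    intro t ht
    have : |t| ≤ ε * σ := abs_le.2 ht
    calc ‖d t‖ ≤ ‖σ • v‖ + ‖t • e‖ := norm_add_le _ _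
      _ = σ * ‖v‖ + |t| * ‖e‖ := by rw [norm_smul, norm_smul, Real.norm_of_nonneg hσpos.le,
          Real.norm_eq_abs]
      _ ≤ σ * ‖v‖ + σ * ‖e‖ := by gcongr; nlinarith
      _ ≤ σ * N := by rw [hN]; nlinarith
  have hdball : ∀ t ∈ Set.Icc (-(ε * σ)) (ε * σ), d t ∈ Metric.ball (0 : E) r := by
    intro t ht
    rw [mem_ball_zero_iff]
    refine (hdn t ht).trans_lt ?_
    rw [hσ]; field_simp; linarith
  have hεσ : 0 < ε * σ := by positivity
  have hval : ∀ t ∈ Set.Icc (-(ε * σ)) (ε * σ), |ρ (p + d t) - t| ≤ ε * σ / 2 := by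
    intro t ht
    have := (hball _ (hdball t ht)).1.1
    rw [hρp, sub_zero] at this
    have h4 : fderiv ℝ ρ p (d t) = t := by simp [hd, hv, he1]
    rw [h4, Real.norm_eq_abs] at this
    refine this.trans ?_
    calc ε / (2 * N) * ‖d t‖ ≤ ε / (2 * N) * (σ * N) := by gcongr; exact hdn t ht
      _ = ε * σ / 2 := by field_simp
  have hcont : ContinuousOn (fun t => ρ (p + d t)) (Set.Icc (-(ε * σ)) (ε * σ)) := by
    intro t ht
    have h5 : ContinuousAt ρ (p + d t) := (hball _ (hdball t ht)).2.1
    exact (ContinuousAt.comp (f := fun t => p + d t) (g := ρ) h5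
      (by simp only [hd]; fun_prop)).continuousWithinAt
  -- At the two ends t = ∓εσ the value of ρ differs from t by at most εσ / 2, so ρ changes sign.
  obtain ⟨t, ht, hzero⟩ : ∃ t ∈ Set.Icc (-(ε * σ)) (ε * σ), ρ (p + d t) = 0 := by
    have hl := abs_le.1 (hval (-(ε * σ)) ⟨le_rfl, by linarith⟩)
    have hu := abs_le.1 (hval (ε * σ) ⟨by linarith, le_rfl⟩)
    exact intermediate_value_Icc (by linarith) hcont ⟨by linarith [hl.2], by linarith [hu.1]⟩
  have hb := hball _ (hdball t ht)
  have hf0 : f (p + d t) = 0 := hb.2.2.2 (hb.2.2.1.2 hzero)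
  have h6 := hb.1.2
  rw [hf0, hfp, sub_zero, zero_sub, norm_neg] at h6
  have h7 : fderiv ℝ f p (d t) = σ • fderiv ℝ f p v + t • fderiv ℝ f p e := by simp [hd]
  have h8 : σ * ‖fderiv ℝ f p v‖ ≤ ε * (σ * N) + ε * σ * ‖fderiv ℝ f p e‖ := by
    have h9 : σ • fderiv ℝ f p v = fderiv ℝ f p (d t) - t • fderiv ℝ f p e := by rw [h7]; abel
    have h10 : ‖σ • fderiv ℝ f p v‖ = σ * ‖fderiv ℝ f p v‖ := by
      rw [norm_smul, Real.norm_of_nonneg hσpos.le]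
    rw [← h10, h9]
    refine (norm_sub_le _ _).trans (add_le_add (h6.trans ?_) ?_)
    · have := hdn t ht
      gcongr
    · rw [norm_smul, Real.norm_eq_abs]
      have : |t| ≤ ε * σ := abs_le.2 ht
      gcongr
  have : σ * ‖fderiv ℝ f p v‖ ≤ σ * (ε * (‖fderiv ℝ f p e‖ + N)) := by linarith
  exact le_of_mul_le_mul_left this hσpos

lemma IsDefiningFunctionAt.mem_realTangent (h : IsDefiningFunctionAt M p ρ) (hp : p ∈ M) {v : E} :
    v ∈ realTangent M p ↔ fderiv ℝ ρ p v = 0 :=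
  ⟨fun hv => hv ρ h, fun hv _ h' => h.fderiv_eq_zero hp h'.1.differentiableAt
    (by filter_upwards [h'.2.2] with q hq using hq.1) hv⟩

lemma IsDefiningFunctionAt.mem_complexTangent (h : IsDefiningFunctionAt M p ρ) (hp : p ∈ M)
    {v : E} : v ∈ complexTangent M p ↔ dC (fderiv ℝ ρ p) v = 0 := by
  rw [dC_eq_zero_iff]
  exact and_congr (h.mem_realTangent hp) (h.mem_realTangent hp)

/-- The projection to `ker ∂ρ` along `e`. -/
noncomputable def hproj (ρ : E → ℝ) (e y : E) : E → E := fun q =>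
  y - (dC (fderiv ℝ ρ q) y / dC (fderiv ℝ ρ q) e) • e

lemma dC_hproj {q e : E} (he : dC (fderiv ℝ ρ q) e ≠ 0) (y : E) :
    dC (fderiv ℝ ρ q) (hproj ρ e y q) = 0 := by
  rw [hproj, map_sub, map_smul, smul_eq_mul, div_mul_cancel₀ _ he, sub_self]

lemma contDiffAt_hproj {q e : E} (hρ : AnalyticAt ℝ ρ q) (he : dC (fderiv ℝ ρ q) e ≠ 0) (y : E) :
    ContDiffAt ℝ ∞ (hproj ρ e y) q := by
  have h1 : ∀ x : E, ContDiffAt ℝ ∞ (fun q => dC (fderiv ℝ ρ q) x) q := fun x => by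
    have h2 : ContDiffAt ℝ ∞ (fun q => dCL E (fderiv ℝ ρ q)) q :=
      (dCL E).contDiff.contDiffAt.comp q hρ.fderiv.contDiffAt
    exact ((ContinuousLinearMap.apply ℝ ℂ x).comp
      (ContinuousLinearMap.restrictScalarsL ℂ E ℂ ℝ ℝ)).contDiff.contDiffAt.comp q h2
  have h3 : ContDiffAt ℝ ∞ (fun q => dC (fderiv ℝ ρ q) y / dC (fderiv ℝ ρ q) e) q := by
    simp only [div_eq_mul_inv]
    exact (h1 y).mul ((h1 e).inv he)
  exact contDiffAt_const.sub (h3.smul contDiffAt_const)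

lemma IsDefiningFunctionAt.exists_transversal (h : IsDefiningFunctionAt M p ρ) :
    ∃ e, dC (fderiv ℝ ρ p) e ≠ 0 := by
  by_contra! hcon
  exact h.2.1 (by ext e; simpa [dC_re] using congrArg Complex.re (hcon e))

lemma eventually_dC_ne (h : AnalyticAt ℝ ρ p) {e : E} (he : dC (fderiv ℝ ρ p) e ≠ 0) :
    ∀ᶠ q in 𝓝 p, dC (fderiv ℝ ρ q) e ≠ 0 := by
  have h1 := (fderiv_dC h).continuousAt
  have h2 : ContinuousAt (fun q => dC (fderiv ℝ ρ q) e) p := h1.clm_apply continuousAt_const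
  exact h2.eventually_ne he

lemma IsDefiningFunctionAt.exists_section (h : IsDefiningFunctionAt M p ρ) (hp : p ∈ M) {y : E}
    (hy : y ∈ complexTangent M p) :
    ∃ Y : E → E, IsSectionNear M (complexTangent M) p Y ∧ Y p = y := by
  obtain ⟨e, he⟩ := h.exists_transversal
  refine ⟨hproj ρ e y, ?_, ?_⟩
  · filter_upwards [h.eventually, eventually_dC_ne h.1 he] with q hq hqe
    exact ⟨contDiffAt_hproj hq.1 hqe y, fun hqM =>
      (hq.mem_complexTangent hqM).2 (dC_hproj hqe y)⟩
  · rw [hproj, (h.mem_complexTangent hp).1 hy]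
    simp

lemma IsSectionNear.eventually {D : E → Submodule ℂ E} {x : E → E} (h : IsSectionNear M D p x) :
    ∀ᶠ q in 𝓝 p, IsSectionNear M D q x := h.eventually_nhds

lemma IsSectionNear.tangential_derivative {x : E → E}
    (hx : IsSectionNear M (complexTangent M) p x) (h : IsDefiningFunctionAt M p ρ) (hp : p ∈ M)
    {v : E} (hv : fderiv ℝ ρ p v = 0) :
    dC (hess ρ p v) (x p) + dC (fderiv ℝ ρ p) (fderiv ℝ x p v) = 0 := by
  have h1 := (fderiv_dC h.1)
  have h1' : HasFDerivAt (fun q => (dC (fderiv ℝ ρ q)).restrictScalars ℝ)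
      ((ContinuousLinearMap.restrictScalarsL ℂ E ℂ ℝ ℝ).comp ((dCL E).comp (hess ρ p))) p :=
    (ContinuousLinearMap.restrictScalarsL ℂ E ℂ ℝ ℝ).hasFDerivAt.comp p h1
  have h2 := h1'.clm_apply hx.differentiableAt.hasFDerivAt
  have h3 := h.fderiv_eq_zero hp (f := fun q => (dC (fderiv ℝ ρ q)).restrictScalars ℝ (x q))
    h2.differentiableAt (by
      filter_upwards [hx, h.eventually] with q hq hq' hqM
      exact (hq'.mem_complexTangent hqM).1 (hq.2 hqM)) hv
  rw [h2.fderiv] at h3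
  simpa [add_comm] using h3

/-- Differentiating ∂ρ(x) = 0 along M trades the derivative of `x` for the Hessian of ρ, and the
∂̄-combination of the two tangential derivatives leaves exactly the sesquilinear Levi form. This is
the link between brackets and Hessians. -/
lemma IsSectionNear.dC_dbar {x : E → E} (hx : IsSectionNear M (complexTangent M) p x)
    (h : IsDefiningFunctionAt M p ρ) (hp : p ∈ M) {y : E} (hy : y ∈ complexTangent M p) :
    dC (fderiv ℝ ρ p) (dbar x p y)
      = -((lev (hess ρ p) (x p) y : ℂ) + Complex.I * (lev (hess ρ p) (x p) (Complex.I • y) : ℂ)) := by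
  obtain ⟨h1, h2⟩ := dC_eq_zero_iff.1 ((h.mem_complexTangent hp).1 hy)
  have h3 := hx.tangential_derivative h hp h1
  have h4 := hx.tangential_derivative h hp h2
  rw [dbar, map_add, map_smul, eq_neg_of_add_eq_zero_right h3, eq_neg_of_add_eq_zero_right h4]
  simp only [dC_apply, lev, I_smul_I_smul, map_neg, smul_eq_mul, hess_symm h.1 _ (x p),
    hess_symm h.1 _ (Complex.I • x p)]
  push_cast
  linear_combination (hess ρ p (Complex.I • x p) (Complex.I • y) : ℂ) * Complex.I_sq

lemma IsSectionNear.dbar_mem_iff {x : E → E} (hx : IsSectionNear M (complexTangent M) p x)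
    (h : IsDefiningFunctionAt M p ρ) (hp : p ∈ M) {y : E} (hy : y ∈ complexTangent M p) :
    dbar x p y ∈ complexTangent M p ↔
      lev (hess ρ p) (x p) y = 0 ∧ lev (hess ρ p) (x p) (Complex.I • y) = 0 := by
  rw [h.mem_complexTangent hp, hx.dC_dbar h hp hy, neg_eq_zero, Complex.ext_iff]
  simp

/-- The vector on the left is a combination of the (0,1)-vector of `a` and the (1,0)-vector of `b`,
and the two types can be separated. -/
lemma inHorizontal_iff {c : ℝ} (hc : c ≠ 0) {a b : E} :
    InHorizontal M p (c • (a - b), c • Complex.I • (a + b)) ↔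
      a ∈ complexTangent M p ∧ b ∈ complexTangent M p := by
  have hr : ∀ (t : ℝ) (w : E), w ∈ complexTangent M p → t • w ∈ complexTangent M p :=
    fun t w hw => by
      rw [← Complex.coe_smul]
      exact Submodule.smul_mem _ _ hw
  constructor
  · rintro ⟨h1, h2⟩
    have h3 : a - b ∈ complexTangent M p := by
      simpa [smul_smul, inv_mul_cancel₀ hc] using hr c⁻¹ _ h1
    have h4 : a + b ∈ complexTangent M p := by
      have := hr c⁻¹ _ h2
      simp only [smul_smul c⁻¹ c, inv_mul_cancel₀ hc, one_smul] at this
      have := Submodule.smul_mem _ (-Complex.I) this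
      rwa [smul_smul, neg_mul, Complex.I_mul_I, neg_neg, one_smul] at this
    constructor
    · have : a = (1 / 2 : ℝ) • ((a - b) + (a + b)) := by module
      rw [this]
      exact hr _ _ (add_mem h3 h4)
    · have : b = (1 / 2 : ℝ) • ((a + b) - (a - b)) := by module
      rw [this]
      exact hr _ _ (sub_mem h4 h3)
  · rintro ⟨ha, hb⟩
    exact ⟨hr _ _ (sub_mem ha hb), hr _ _ (Submodule.smul_mem _ _ (add_mem ha hb))⟩

/-- A (1,0)-field differentiates only the coefficients of a (0,1)-field and conversely, so the
bracket is half the (0,1)-vector of `dbar y p (x p)` minus half the (1,0)-vector of `dbar x p (y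
p)`. -/
lemma cBracket_eq_dbar {x y : E → E} (hx : DifferentiableAt ℝ x p) (hy : DifferentiableAt ℝ y p) :
    cBracket (fieldOneZero x) (fieldZeroOne y) p =
      ((1 / 4 : ℝ) • (dbar y p (x p) - dbar x p (y p)),
        (1 / 4 : ℝ) • Complex.I • (dbar y p (x p) + dbar x p (y p))) := by
  rw [cBracket_apply hx hy]
  simp only [dbar, smul_add, I_smul_I_smul]
  refine Prod.ext ?_ ?_ <;> simp only <;> module

/-- Both type components of the bracket lead to the same condition, since the Levi form is
Hermitian. -/
lemma inHorizontal_cBracket_iff {x y : E → E} (h : IsDefiningFunctionAt M p ρ) (hp : p ∈ M)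
    (hx : IsSectionNear M (complexTangent M) p x) (hy : IsSectionNear M (complexTangent M) p y) :
    InHorizontal M p (cBracket (fieldOneZero x) (fieldZeroOne y) p) ↔
      lev (hess ρ p) (x p) (y p) = 0 ∧ lev (hess ρ p) (x p) (Complex.I • y p) = 0 := by
  have hxp := hx.self_of_nhds.2 hp
  have hyp := hy.self_of_nhds.2 hp
  have hsymm : ∀ a b, lev (hess ρ p) a b = lev (hess ρ p) b a := fun a b => by
    simp only [lev, hess_symm h.1 b, hess_symm h.1 (Complex.I • b)]
  rw [cBracket_eq_dbar hx.differentiableAt hy.differentiableAt, inHorizontal_iff (by norm_num),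
    hx.dbar_mem_iff h hp hyp, hy.dbar_mem_iff h hp hxp, hsymm (y p), hsymm (y p), lev_I_left,
    neg_eq_zero, and_self]

/-- Every complex tangent vector extends to a section by `hproj`, and the bracket condition depends
only on the values at `p`. From here on the Levi kernel is linear algebra. -/
lemma IsDefiningFunctionAt.leviKernel_eq (h : IsDefiningFunctionAt M p ρ) (hp : p ∈ M) :
    leviKernel M p = jetKernel (fderiv ℝ ρ p) (hess ρ p) := by
  ext v
  rw [mem_jetKernel, ← h.mem_complexTangent hp]
  constructor
  · rintro ⟨hv, x, hx, rfl, hxy⟩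
    refine ⟨hv, fun y hy => ?_⟩
    obtain ⟨Y, hY, rfl⟩ := h.exists_section hp ((h.mem_complexTangent hp).2 hy)
    exact ((inHorizontal_cBracket_iff h hp hx hY).1 (hxy Y hY)).1
  · rintro ⟨hv, hvy⟩
    obtain ⟨X, hX, rfl⟩ := h.exists_section hp hv
    refine ⟨hv, X, hX, rfl, fun y hy => (inHorizontal_cBracket_iff h hp hX hy).2 ⟨?_, ?_⟩⟩
    · exact hvy _ ((h.mem_complexTangent hp).1 (hy.self_of_nhds.2 hp))
    · exact hvy _ ((h.mem_complexTangent hp).1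
        (Submodule.smul_mem _ Complex.I (hy.self_of_nhds.2 hp)))

lemma leviKernel_le_complexTangent : leviKernel M p ≤ complexTangent M p := fun _ hv => hv.1

lemma IsSectionNear.complexTangent {x : E → E} (hx : IsSectionNear M (leviKernel M) p x) :
    IsSectionNear M (complexTangent M) p x := by
  filter_upwards [hx] with q hq using ⟨hq.1, fun hqM => leviKernel_le_complexTangent (hq.2 hqM)⟩

end Tangent


/-! ### The third term of the Freeman filtration -/

section Freeman

variable {E : Type*} [NormedAddCommGroup E] [NormedSpace ℂ E] {M : Set E} {p : E} {ρ : E → ℝ}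

lemma contDiffAt_dbar {x y : E → E} (hx : ∀ᶠ q in 𝓝 p, ContDiffAt ℝ ∞ x q)
    (hy : ∀ᶠ q in 𝓝 p, ContDiffAt ℝ ∞ y q) :
    ∀ᶠ q in 𝓝 p, ContDiffAt ℝ ∞ (fun q => dbar x q (y q)) q := by
  filter_upwards [hx, hy] with q hxq hyq
  have h1 : ContDiffAt ℝ ∞ (fderiv ℝ x) q := hxq.fderiv_right (by simp)
  exact (h1.clm_apply hyq).add ((h1.clm_apply (hyq.const_smul Complex.I)).const_smul Complex.I)

lemma IsSectionNear.smooth {D : E → Submodule ℂ E} {x : E → E} (h : IsSectionNear M D p x) :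
    ∀ᶠ q in 𝓝 p, ContDiffAt ℝ ∞ x q := by
  filter_upwards [h] with q hq using hq.1

/-- A double bracket in terms of the derivatives of the fields. -/
lemma cBracket_cBracket {x y y' : E → E} (hx : ∀ᶠ q in 𝓝 p, ContDiffAt ℝ ∞ x q)
    (hy : ∀ᶠ q in 𝓝 p, ContDiffAt ℝ ∞ y q) (hy' : DifferentiableAt ℝ y' p) :
    let A := fun q => dbar y q (x q)
    let B := fun q => dbar x q (y q)
    cBracket (cBracket (fieldOneZero x) (fieldZeroOne y)) (fieldZeroOne y') p =
      ((1 / 8 : ℝ) • ((fderiv ℝ y' p (A p) - Complex.I • fderiv ℝ y' p (Complex.I • A p)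
            - (fderiv ℝ A p (y' p) - Complex.I • fderiv ℝ A p (Complex.I • y' p))
            - dbar y' p (B p)) - (-dbar B p (y' p))),
        (1 / 8 : ℝ) • Complex.I • ((fderiv ℝ y' p (A p)
            - Complex.I • fderiv ℝ y' p (Complex.I • A p)
            - (fderiv ℝ A p (y' p) - Complex.I • fderiv ℝ A p (Complex.I • y' p))
            - dbar y' p (B p)) + (-dbar B p (y' p)))) := by
  intro A B
  have hA : DifferentiableAt ℝ A p := (contDiffAt_dbar hy hx).self_of_nhds.differentiableAt (by
      simp)
  have hB : DifferentiableAt ℝ B p := (contDiffAt_dbar hx hy).self_of_nhds.differentiableAt (by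
      simp)
  have hev : ∀ᶠ q in 𝓝 p, cBracket (fieldOneZero x) (fieldZeroOne y) q =
      ((1 / 4 : ℝ) • (A q - B q), (1 / 4 : ℝ) • Complex.I • (A q + B q)) := by
    filter_upwards [hx, hy] with q hxq hyq
    exact cBracket_eq_dbar (hxq.differentiableAt (by simp)) (hyq.differentiableAt (by simp))
  have h1 : (fun q => (cBracket (fieldOneZero x) (fieldZeroOne y) q).1) =ᶠ[𝓝 p]
      fun q => (1 / 4 : ℝ) • (A q - B q) := by filter_upwards [hev] with q hq; rw [hq]
  have h2 : (fun q => (cBracket (fieldOneZero x) (fieldZeroOne y) q).2) =ᶠ[𝓝 p]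
      fun q => (1 / 4 : ℝ) • Complex.I • (A q + B q) := by filter_upwards [hev] with q hq; rw [hq]
  have d1 := ((hA.hasFDerivAt.fun_sub hB.hasFDerivAt).fun_const_smul (1 / 4 :
      ℝ)).congr_of_eventuallyEq h1
  have d2 := (((hA.hasFDerivAt.fun_add hB.hasFDerivAt).fun_const_smul Complex.I).fun_const_smul
    (1 / 4 : ℝ)).congr_of_eventuallyEq h2
  have e1 := hy'.hasFDerivAt.fun_const_smul (1 / 2 : ℝ)
  have e2 := (hy'.hasFDerivAt.fun_const_smul Complex.I).fun_const_smul (1 / 2 : ℝ)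
  have hZ := hev.self_of_nhds
  rw [cBracket]
  simp only [VectorField.lieBracket, fieldZeroOne] at d1 d2 e1 e2 hZ ⊢
  rw [d1.fderiv, d2.fderiv, e1.fderiv, e2.fderiv, hZ]
  simp only [dbar, smul_apply, sub_apply, add_apply, map_smul, map_add, map_sub, smul_add, smul_sub,
    I_smul_I_smul, smul_neg]
  refine Prod.ext ?_ ?_ <;> simp only <;> module

/-- For `x` in the Levi kernel both components `A`, `B` of the inner bracket are complex tangential
along M. Bracketing with `y'` again, the contribution of `A` is of the form [(0,1), (0,1)] and stays
tangential, so the condition is that `B` and `y'` are orthogonal for the Levi form. -/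
lemma IsDefiningFunctionAt.inHorizontal_double_iff (h : IsDefiningFunctionAt M p ρ) (hp : p ∈ M)
    {x y y' : E → E} (hx : IsSectionNear M (leviKernel M) p x)
    (hy : IsSectionNear M (complexTangent M) p y)
    (hy' : IsSectionNear M (complexTangent M) p y') :
    InHorizontal M p (cBracket (cBracket (fieldOneZero x) (fieldZeroOne y)) (fieldZeroOne y') p) ↔
      lev (hess ρ p) (dbar x p (y p)) (y' p) = 0 ∧
        lev (hess ρ p) (dbar x p (y p)) (Complex.I • y' p) = 0 := by
  set A := fun q => dbar y q (x q) with hAdef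
  set B := fun q => dbar x q (y q) with hBdef
  have hAB : ∀ᶠ q in 𝓝 p, q ∈ M → A q ∈ CRModel.complexTangent M q ∧
      B q ∈ CRModel.complexTangent M q := by
    filter_upwards [h.eventually, hx.eventually, hy.eventually] with q hq hxq hyq hqM
    have hk : x q ∈ jetKernel (fderiv ℝ ρ q) (hess ρ q) := by
      rw [← hq.leviKernel_eq hqM]
      exact hxq.self_of_nhds.2 hqM
    have hyq' := (hq.mem_complexTangent hqM).1 (hyq.self_of_nhds.2 hqM)
    have h2 : dC (fderiv ℝ ρ q) (Complex.I • y q) = 0 := by rw [map_smul, hyq', smul_zero]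
    have := (inHorizontal_cBracket_iff hq hqM hxq.complexTangent hyq).2
      ⟨hk.2 _ hyq', hk.2 _ h2⟩
    rwa [cBracket_eq_dbar hxq.differentiableAt hyq.differentiableAt,
      inHorizontal_iff (by norm_num)] at this
  have hA : IsSectionNear M (CRModel.complexTangent M) p A := by
    filter_upwards [hAB, contDiffAt_dbar hy.smooth hx.smooth] with q h1 h2
      using ⟨h2, fun hq => (h1 hq).1⟩
  have hB : IsSectionNear M (CRModel.complexTangent M) p B := by
    filter_upwards [hAB, contDiffAt_dbar hx.smooth hy.smooth] with q h1 h2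
      using ⟨h2, fun hq => (h1 hq).2⟩
  have hy'p := hy'.self_of_nhds.2 hp
  have hBp := hB.self_of_nhds.2 hp
  -- Integrability of the CR structure: the Hessian terms of the tangential derivatives of `y'` and
  -- `A` cancel by symmetry.
  have hC : fderiv ℝ y' p (A p) - Complex.I • fderiv ℝ y' p (Complex.I • A p)
      - (fderiv ℝ A p (y' p) - Complex.I • fderiv ℝ A p (Complex.I • y' p))
      ∈ CRModel.complexTangent M p := by
    obtain ⟨a1, a2⟩ := dC_eq_zero_iff.1 ((h.mem_complexTangent hp).1 (hA.self_of_nhds.2 hp))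
    obtain ⟨b1, b2⟩ := dC_eq_zero_iff.1 ((h.mem_complexTangent hp).1 hy'p)
    have c1 := eq_neg_of_add_eq_zero_right (hy'.tangential_derivative h hp a1)
    have c2 := eq_neg_of_add_eq_zero_right (hy'.tangential_derivative h hp a2)
    have c3 := eq_neg_of_add_eq_zero_right (hA.tangential_derivative h hp b1)
    have c4 := eq_neg_of_add_eq_zero_right (hA.tangential_derivative h hp b2)
    rw [h.mem_complexTangent hp, map_sub, map_sub, map_sub,
      (dC (fderiv ℝ ρ p)).map_smul, (dC (fderiv ℝ ρ p)).map_smul, c1, c2, c3, c4]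
    simp only [dC_apply, smul_eq_mul, hess_symm h.1 (y' p), hess_symm h.1 (Complex.I • y' p)]
    linear_combination ((hess ρ p (Complex.I • A p) (Complex.I • y' p) : ℂ) -
      (hess ρ p (Complex.I • A p) (Complex.I • y' p) : ℂ)) * Complex.I_sq
  have hsymm : ∀ a b, lev (hess ρ p) a b = lev (hess ρ p) b a := fun a b => by
    simp only [lev, hess_symm h.1 b, hess_symm h.1 (Complex.I • b)]
  rw [cBracket_cBracket hx.smooth hy.smooth hy'.differentiableAt,
    inHorizontal_iff (by norm_num)]
  have e1 : -dbar B p (y' p) ∈ CRModel.complexTangent M p ↔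
      lev (hess ρ p) (B p) (y' p) = 0 ∧ lev (hess ρ p) (B p) (Complex.I • y' p) = 0 := by
    rw [neg_mem_iff, hB.dbar_mem_iff h hp hy'p]
  have e2 := hy'.dbar_mem_iff h hp hBp
  rw [hsymm (y' p), hsymm (y' p), lev_I_left, neg_eq_zero] at e2
  have e3 := (Submodule.add_mem_iff_right _ hC (y := -dbar y' p (B p))).trans
    (neg_mem_iff.trans e2)
  rw [← sub_eq_add_neg] at e3
  exact (and_congr e3 e1).trans (and_self_iff)

/-- Orthogonality of `dbar x p y` to all complex tangent vectors means that it lies in the Levi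
kernel; thus 𝓚₃ measures the failure of sections of 𝓚₂ to be stable under ∂̄. -/
lemma IsDefiningFunctionAt.mem_freemanThree (h : IsDefiningFunctionAt M p ρ) (hp : p ∈ M) {v : E} :
    v ∈ freemanThree M p ↔ ∃ x : E → E, IsSectionNear M (leviKernel M) p x ∧ x p = v ∧
      ∀ y ∈ complexTangent M p, dbar x p y ∈ leviKernel M p := by
  constructor
  · rintro ⟨hv, x, hx, rfl, hxy⟩
    refine ⟨x, hx, rfl, fun y hy => ?_⟩
    obtain ⟨Y, hY, rfl⟩ := h.exists_section hp hy
    rw [h.leviKernel_eq hp]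
    have hk : x p ∈ jetKernel (fderiv ℝ ρ p) (hess ρ p) := by rwa [← h.leviKernel_eq hp]
    refine ⟨?_, fun y' hy' => ?_⟩
    · rw [← h.mem_complexTangent hp, hx.complexTangent.dbar_mem_iff h hp hy]
      have h1 := (h.mem_complexTangent hp).1 hy
      exact ⟨hk.2 _ h1, hk.2 _ (by rw [map_smul, h1, smul_zero])⟩
    · obtain ⟨Y', hY', rfl⟩ := h.exists_section hp ((h.mem_complexTangent hp).2 hy')
      exact ((h.inHorizontal_double_iff hp hx hY hY').1 (hxy Y Y' hY hY')).1
  · rintro ⟨x, hx, rfl, hxy⟩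
    refine ⟨hx.self_of_nhds.2 hp, x, hx, rfl, fun y y' hy hy' => ?_⟩
    rw [h.inHorizontal_double_iff hp hx hy hy']
    have := hxy _ (hy.self_of_nhds.2 hp)
    rw [h.leviKernel_eq hp] at this
    have h1 := (h.mem_complexTangent hp).1 (hy'.self_of_nhds.2 hp)
    exact ⟨this.2 _ h1, this.2 _ (by rw [map_smul, h1, smul_zero])⟩

end Freeman


/-! ### Biholomorphic invariance -/

section Transport

/-- The inverse function theorem for analytic maps. -/
lemma exists_analytic_inverse {𝕜 E E' : Type*} [RCLike 𝕜] [NormedAddCommGroup E]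
    [NormedSpace 𝕜 E] [NormedAddCommGroup E'] [NormedSpace 𝕜 E'] [CompleteSpace E]
    [CompleteSpace E'] {f : E → E'} {p : E}
    (hf : AnalyticAt 𝕜 f p) (e : E ≃L[𝕜] E') (he : HasFDerivAt f (e : E →L[𝕜] E') p) :
    ∃ g : E' → E, g (f p) = p ∧ AnalyticAt 𝕜 g (f p) ∧
      HasFDerivAt g (e.symm : E' →L[𝕜] E) (f p) ∧ (∀ᶠ q in 𝓝 p, g (f q) = q) ∧
      ∀ᶠ q in 𝓝 (f p), f (g q) = q := by
  have hs : HasStrictFDerivAt f (e : E →L[𝕜] E') p := by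
    have := hf.hasStrictFDerivAt
    rwa [he.fderiv] at this
  refine ⟨hs.localInverse f e p, hs.localInverse_apply_image, ?_,
    hs.to_localInverse.hasFDerivAt, hs.eventually_left_inverse, hs.eventually_right_inverse⟩
  exact (hs.toOpenPartialHomeomorph f).analyticAt_symm' hs.mem_toOpenPartialHomeomorph_source hf
    he.fderiv

variable {E E' : Type*} [NormedAddCommGroup E] [NormedSpace ℂ E] [NormedAddCommGroup E']
  [NormedSpace ℂ E'] {M : Set E} {M' : Set E'} {p : E} {φ : E → E'} {ρ' : E' → ℝ}

lemma hasFDerivAt_real_of_complex (h : AnalyticAt ℂ φ p) :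
    HasFDerivAt φ ((fderiv ℂ φ p).restrictScalars ℝ) p :=
  h.differentiableAt.hasFDerivAt.restrictScalars ℝ

lemma dC_fderiv_comp {p : E} (h : AnalyticAt ℂ φ p) (h' : AnalyticAt ℝ ρ' (φ p)) (v : E) :
    dC (fderiv ℝ (ρ' ∘ φ) p) v = dC (fderiv ℝ ρ' (φ p)) (fderiv ℂ φ p v) := by
  rw [(h'.differentiableAt.hasFDerivAt.comp p (hasFDerivAt_real_of_complex h)).fderiv]
  simp [dC_apply]

lemma hasFDerivAt_fderiv_complex [CompleteSpace E'] (h : AnalyticAt ℂ φ p) :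
    HasFDerivAt (fun q => (fderiv ℂ φ q).restrictScalars ℝ)
      ((ContinuousLinearMap.restrictScalarsL ℂ E E' ℝ ℝ).comp
        ((fderiv ℂ (fderiv ℂ φ) p).restrictScalars ℝ)) p :=
  (ContinuousLinearMap.restrictScalarsL ℂ E E' ℝ ℝ).hasFDerivAt.comp p
    (h.fderiv.differentiableAt.hasFDerivAt.restrictScalars ℝ)

/-- The second derivative of φ is complex bilinear, so its values at (x, y) and (ix, iy) cancel in
the Levi form. -/
lemma lev_hess_comp [CompleteSpace E'] (h : AnalyticAt ℂ φ p) (h' : AnalyticAt ℝ ρ' (φ p))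
    (x y : E) : lev (hess (ρ' ∘ φ) p) x y
      = lev (hess ρ' (φ p)) (fderiv ℂ φ p x) (fderiv ℂ φ p y) := by
  have h1 : fderiv ℝ (ρ' ∘ φ) =ᶠ[𝓝 p]
      fun q => (fderiv ℝ ρ' (φ q)).comp ((fderiv ℂ φ q).restrictScalars ℝ) := by
    filter_upwards [h.eventually_analyticAt,
      h.continuousAt.eventually h'.eventually_analyticAt] with q h1 h2
    exact (h2.differentiableAt.hasFDerivAt.comp q (hasFDerivAt_real_of_complex h1)).fderiv
  have h2 : HasFDerivAt (fun q => fderiv ℝ ρ' (φ q))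
      ((hess ρ' (φ p)).comp ((fderiv ℂ φ p).restrictScalars ℝ)) p :=
    h'.fderiv.differentiableAt.hasFDerivAt.comp p (hasFDerivAt_real_of_complex h)
  have h3 := (h2.clm_comp (hasFDerivAt_fderiv_complex h)).congr_of_eventuallyEq h1
  have h4 : ∀ a b, hess (ρ' ∘ φ) p a b = fderiv ℝ ρ' (φ p) (fderiv ℂ (fderiv ℂ φ) p a b)
      + hess ρ' (φ p) (fderiv ℂ φ p a) (fderiv ℂ φ p b) := by
    intro a b
    rw [hess, h3.fderiv]
    simp
  simp only [lev, h4, map_smul, smul_apply, I_smul_I_smul, map_neg]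
  ring

lemma IsLocalEquivalence.pullback (h : IsLocalEquivalence φ p M M')
    (h' : IsDefiningFunctionAt M' (φ p) ρ') : IsDefiningFunctionAt M p (ρ' ∘ φ) := by
  obtain ⟨ha, ⟨e, he⟩, hM⟩ := h
  refine ⟨h'.1.comp ha.restrictScalars, fun h0 => ?_, ?_⟩
  · rw [(h'.1.differentiableAt.hasFDerivAt.comp p (hasFDerivAt_real_of_complex ha)).fderiv,
      he.fderiv] at h0
    refine h'.2.1 ?_
    ext v
    have := DFunLike.congr_fun h0 (e.symm v)
    simpa using this
  · filter_upwards [hM, ha.continuousAt.eventually h'.2.2] with q h1 h2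
    rw [← h1, h2]; rfl

variable [CompleteSpace E] [CompleteSpace E']

lemma IsLocalEquivalence.eventually (h : IsLocalEquivalence φ p M M') :
    ∀ᶠ q in 𝓝 p, IsLocalEquivalence φ q M M' := by
  obtain ⟨ha, ⟨e, he⟩, hM⟩ := h
  have hopen : ∀ᶠ q in 𝓝 p, ∃ e : E ≃L[ℂ] E', (e : E →L[ℂ] E') = fderiv ℂ φ q := by
    have := (ContinuousLinearEquiv.isOpen (𝕜 := ℂ) (E := E) (F := E')).mem_nhds ⟨e, he.fderiv.symm⟩
    exact ha.fderiv.continuousAt.eventually this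
  filter_upwards [ha.eventually_analyticAt, hopen, hM.eventually_nhds] with q h1 h2 h3
  obtain ⟨e', he'⟩ := h2
  exact ⟨h1, ⟨e', by rw [he']; exact h1.differentiableAt.hasFDerivAt⟩, h3⟩

lemma IsLocalEquivalence.exists_symm (h : IsLocalEquivalence φ p M M') :
    ∃ ψ : E' → E, ψ (φ p) = p ∧ IsLocalEquivalence ψ (φ p) M' M ∧
      (∀ᶠ q in 𝓝 p, ψ (φ q) = q) ∧ ∀ᶠ q in 𝓝 (φ p), φ (ψ q) = q := by
  obtain ⟨ha, ⟨e, he⟩, hM⟩ := h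
  obtain ⟨ψ, h0, h1, h2, h3, h4⟩ := exists_analytic_inverse ha e he
  refine ⟨ψ, h0, ⟨h1, ⟨e.symm, h2⟩, ?_⟩, h3, h4⟩
  have : Tendsto ψ (𝓝 (φ p)) (𝓝 p) := by
    have := h1.continuousAt.tendsto
    rwa [h0] at this
  filter_upwards [this.eventually hM, h4] with q hq hq'
  rw [← hq, hq']

lemma IsLocalEquivalence.mem_complexTangent_iff (h : IsLocalEquivalence φ p M M')
    (hM' : IsHypersurfaceAt M' (φ p)) (hp : p ∈ M) {v : E} :
    v ∈ complexTangent M p ↔ fderiv ℂ φ p v ∈ complexTangent M' (φ p) := by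
  obtain ⟨ρ', hρ'⟩ := hM'
  rw [(h.pullback hρ').mem_complexTangent hp, hρ'.mem_complexTangent (h.2.2.self_of_nhds.2 hp),
    dC_fderiv_comp h.1 hρ'.1]

lemma IsLocalEquivalence.mem_leviKernel_iff (h : IsLocalEquivalence φ p M M')
    (hM' : IsHypersurfaceAt M' (φ p)) (hp : p ∈ M) {v : E} :
    v ∈ leviKernel M p ↔ fderiv ℂ φ p v ∈ leviKernel M' (φ p) := by
  obtain ⟨ρ', hρ'⟩ := hM'
  obtain ⟨e, he⟩ := h.2.1
  rw [(h.pullback hρ').leviKernel_eq hp, hρ'.leviKernel_eq (h.2.2.self_of_nhds.2 hp),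
    mem_jetKernel, mem_jetKernel, dC_fderiv_comp h.1 hρ'.1]
  refine and_congr_right fun _ => ⟨fun H y hy => ?_, fun H y hy => ?_⟩
  · have hy' : fderiv ℂ φ p (e.symm y) = y := by rw [he.fderiv]; simp
    have := H (e.symm y) (by rw [dC_fderiv_comp h.1 hρ'.1, hy', hy])
    rwa [lev_hess_comp h.1 hρ'.1, hy'] at this
  · rw [lev_hess_comp h.1 hρ'.1]
    exact H _ (by rwa [dC_fderiv_comp h.1 hρ'.1] at hy)

lemma finrank_eq_of_mem_iff {D : Submodule ℂ E} {D' : Submodule ℂ E'} (e : E ≃L[ℂ] E')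
    (h : ∀ v, v ∈ D ↔ e v ∈ D') : Module.finrank ℂ D = Module.finrank ℂ D' := by
  have : D' = D.map (e : E ≃ₗ[ℂ] E').toLinearMap := by
    ext w
    rw [Submodule.mem_map]
    refine ⟨fun hw => ⟨e.symm w, (h _).2 (by simpa using hw), by simp⟩, ?_⟩
    rintro ⟨v, hv, rfl⟩
    exact (h v).1 hv
  rw [this]
  exact (LinearEquiv.finrank_map_eq (e : E ≃ₗ[ℂ] E') D).symm

lemma IsLocalEquivalence.hasLeviRankAt_iff (h : IsLocalEquivalence φ p M M')
    (hM' : IsHypersurfaceAt M' (φ p)) (hp : p ∈ M) {s : ℕ} :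
    HasLeviRankAt M p s ↔ HasLeviRankAt M' (φ p) s := by
  obtain ⟨e, he⟩ := h.2.1
  have h1 : ∀ v, fderiv ℂ φ p v = e v := fun v => by rw [he.fderiv]; rfl
  rw [HasLeviRankAt, HasLeviRankAt,
    finrank_eq_of_mem_iff e fun v => by rw [h.mem_leviKernel_iff hM' hp, h1],
    finrank_eq_of_mem_iff e fun v => by rw [h.mem_complexTangent_iff hM' hp, h1]]

/-- The Levi rank near a point transfers to an equivalent hypersurface. -/
lemma IsLocalEquivalence.hasConstantLeviRankNear (h : IsLocalEquivalence φ p M M') {s : ℕ}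
    (hM : HasConstantLeviRankNear M p s) : HasConstantLeviRankNear M' (φ p) s := by
  obtain ⟨ψ, hψ0, hψ, -, hφψ⟩ := h.exists_symm
  have hc : Tendsto ψ (𝓝 (φ p)) (𝓝 p) := by
    have := hψ.1.continuousAt.tendsto
    rwa [hψ0] at this
  filter_upwards [hψ.eventually, hc.eventually hM] with q h1 h2 hq
  have hq' : ψ q ∈ M := h1.2.2.self_of_nhds.2 hq
  obtain ⟨ρ, hρ⟩ := (h2 hq').1
  exact ⟨⟨_, h1.pullback hρ⟩, (h1.hasLeviRankAt_iff ⟨ρ, hρ⟩ hq).2 (h2 hq').2⟩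

/-- A section on the target is pulled back by the derivative of the inverse, and the derivative of φ
commutes with `dbar`. -/
lemma IsLocalEquivalence.freemanThree_eq_zero (h : IsLocalEquivalence φ p M M')
    (hM' : ∀ᶠ q in 𝓝 (φ p), q ∈ M' → IsHypersurfaceAt M' q) (hp : p ∈ M)
    (h0 : freemanThree M p = {0}) : freemanThree M' (φ p) = {0} := by
  obtain ⟨ψ, hψ0, hψ, hψφ, hφψ⟩ := h.exists_symm
  have hp' : φ p ∈ M' := h.2.2.self_of_nhds.2 hp
  obtain ⟨ρ', hρ'⟩ := hM'.self_of_nhds hp'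
  refine Set.eq_singleton_iff_unique_mem.2 ⟨?_, fun v' hv' => ?_⟩
  · refine (hρ'.mem_freemanThree hp').2 ⟨fun _ => 0, ?_, rfl, fun y _ => ?_⟩
    · exact Eventually.of_forall fun q => ⟨contDiffAt_const, fun _ => zero_mem _⟩
    · simp [dbar]
  obtain ⟨x', hx', rfl, hxy⟩ := (hρ'.mem_freemanThree hp').1 hv'
  have hcφ : Tendsto φ (𝓝 p) (𝓝 (φ p)) := h.1.continuousAt
  set x : E → E := fun q => fderiv ℂ ψ (φ q) (x' (φ q)) with hx
  have hinv : ∀ᶠ q in 𝓝 p, ∀ v, fderiv ℂ φ q (fderiv ℂ ψ (φ q) v) = v := by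
    filter_upwards [h.eventually, hcφ.eventually hψ.eventually, hcφ.eventually hφψ.eventually_nhds,
      hψφ] with q h1 h2 h3 h4 v
    have h5 : HasFDerivAt (φ ∘ ψ) ((fderiv ℂ φ q).comp (fderiv ℂ ψ (φ q))) (φ q) := by
      refine HasFDerivAt.comp (φ q) ?_ h2.1.differentiableAt.hasFDerivAt
      rw [h4]
      exact h1.1.differentiableAt.hasFDerivAt
    have h6 : HasFDerivAt (φ ∘ ψ) (ContinuousLinearMap.id ℂ E') (φ q) :=
      (hasFDerivAt_id _).congr_of_eventuallyEq h3
    exact DFunLike.congr_fun (h5.unique h6) v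
  have hxx' : ∀ᶠ q in 𝓝 p, fderiv ℂ φ q (x q) = x' (φ q) := by
    filter_upwards [hinv] with q hq using hq _
  have hsec : IsSectionNear M (leviKernel M) p x := by
    filter_upwards [h.eventually, hcφ.eventually hψ.eventually, hcφ.eventually hx',
      hcφ.eventually hM', hxx'] with q h1 h2 h3 h4 h5
    refine ⟨?_, fun hq => ?_⟩
    · have a1 : ContDiffAt ℝ ∞ φ q := h1.1.restrictScalars.contDiffAt
      have a2 : ContDiffAt ℝ ∞ (fun q => (fderiv ℂ ψ q).restrictScalars ℝ) (φ q) := by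
        have : ContDiffAt ℝ ∞ (fderiv ℂ ψ) (φ q) := h2.1.fderiv.restrictScalars.contDiffAt
        exact (ContinuousLinearMap.restrictScalarsL ℂ E' E ℝ ℝ).contDiff.contDiffAt.comp _ this
      exact (a2.comp q a1).clm_apply (h3.1.comp q a1)
    · have hq' : φ q ∈ M' := h1.2.2.self_of_nhds.2 hq
      rw [h1.mem_leviKernel_iff (h4 hq') hq, h5]
      exact h3.2 hq'
  have hx0 : x p = 0 := by
    have : x p ∈ freemanThree M p := by
      refine ((h.pullback hρ').mem_freemanThree hp).2 ⟨x, hsec, rfl, fun y hy => ?_⟩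
      rw [h.mem_leviKernel_iff ⟨ρ', hρ'⟩ hp]
      have hkey : ∀ v, fderiv ℂ (fderiv ℂ φ) p v (x p) + fderiv ℂ φ p (fderiv ℝ x p v)
          = fderiv ℝ x' (φ p) (fderiv ℂ φ p v) := by
        intro v
        have d1 := (hasFDerivAt_fderiv_complex h.1).clm_apply hsec.differentiableAt.hasFDerivAt
        have d2 := (hx'.differentiableAt.hasFDerivAt.comp p
          (hasFDerivAt_real_of_complex h.1)).congr_of_eventuallyEq hxx'
        have := DFunLike.congr_fun (d1.unique d2) v
        simpa [add_comm] using this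
      -- The second derivative of φ is complex linear in its first argument, so its two
      -- contributions to the ∂̄-combination cancel.
      have e1 : fderiv ℂ φ p (dbar x p y) = dbar x' (φ p) (fderiv ℂ φ p y) := by
        have k1 := hkey y
        have k2 := hkey (Complex.I • y)
        rw [(fderiv ℂ (fderiv ℂ φ) p).map_smul, smul_apply,
          (fderiv ℂ φ p).map_smul Complex.I y] at k2
        rw [dbar, dbar, map_add, (fderiv ℂ φ p).map_smul, ← k1, ← k2, smul_add, I_smul_I_smul]
        abel
      rw [e1]
      exact hxy _ ((h.mem_complexTangent_iff ⟨ρ', hρ'⟩ hp).1 hy)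
    rwa [h0] at this
  rw [← hxx'.self_of_nhds, hx0, map_zero]

end Transport


/-! ### Uniform Taylor expansion in one parameter -/

section Order

variable {X F : Type*} [NormedAddCommGroup X] [NormedSpace ℝ X] [NormedAddCommGroup F]
  [NormedSpace ℝ F]

/-- The derivative in the first variable. -/
noncomputable def dT (G : ℝ × X → F) (p : ℝ × X) : F := fderiv ℝ G p (1, 0)

/-- The derivative in the second variable. -/
noncomputable def dX (G : ℝ × X → F) (p : ℝ × X) : X →L[ℝ] F :=
  (fderiv ℝ G p).comp (ContinuousLinearMap.inr ℝ ℝ X)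

/-- `G(t, x)` is smooth near `(0, x₀)` and vanishes to order `m` at `t = 0`. -/
def VanishesToOrder (m : ℕ) (G : ℝ × X → F) (x₀ : X) : Prop :=
  (∀ᶠ p in 𝓝 ((0 : ℝ), x₀), ContDiffAt ℝ ∞ G p) ∧
    ∀ j < m, ∀ᶠ x in 𝓝 x₀, iteratedDeriv j (fun t => G (t, x)) 0 = 0

lemma eventually_slice {x₀ : X} {p : ℝ × X → Prop} (h : ∀ᶠ q in 𝓝 ((0 : ℝ), x₀), p q) :
    ∀ᶠ x in 𝓝 x₀, ∀ᶠ t in 𝓝 (0 : ℝ), p (t, x) := by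
  rw [nhds_prod_eq] at h
  exact (Filter.eventually_swap_iff.1 h).curry

lemma hasDerivAt_slice {G : ℝ × X → F} {t : ℝ} {x : X} (h : DifferentiableAt ℝ G (t, x)) :
    HasDerivAt (fun t => G (t, x)) (dT G (t, x)) t :=
  HasFDerivAt.comp_hasDerivAt (f := fun t => (t, x)) t h.hasFDerivAt
    ((hasDerivAt_id t).prodMk (hasDerivAt_const t x))

lemma hasFDerivAt_slice {G : ℝ × X → F} {t : ℝ} {x : X} (h : DifferentiableAt ℝ G (t, x)) :
    HasFDerivAt (fun x => G (t, x)) (dX G (t, x)) x :=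
  h.hasFDerivAt.comp x (hasFDerivAt_prodMk_right t x)

lemma iteratedDeriv_slice_succ {G : ℝ × X → F} {x₀ : X}
    (hG : ∀ᶠ p in 𝓝 ((0 : ℝ), x₀), ContDiffAt ℝ ∞ G p) (j : ℕ) :
    ∀ᶠ x in 𝓝 x₀, iteratedDeriv (j + 1) (fun t => G (t, x)) 0
      = iteratedDeriv j (fun t => dT G (t, x)) 0 := by
  filter_upwards [eventually_slice hG] with x hx
  rw [iteratedDeriv_succ']
  refine Filter.EventuallyEq.iteratedDeriv_eq j ?_
  filter_upwards [hx] with t ht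
  exact (hasDerivAt_slice (ht.differentiableAt (by simp))).deriv

lemma smooth_dT {G : ℝ × X → F} {x₀ : X} (hG : ∀ᶠ p in 𝓝 ((0 : ℝ), x₀), ContDiffAt ℝ ∞ G p) :
    ∀ᶠ p in 𝓝 ((0 : ℝ), x₀), ContDiffAt ℝ ∞ (dT G) p := by
  filter_upwards [hG] with p hp
  exact (hp.fderiv_right (m := ∞) (by simp)).clm_apply contDiffAt_const

lemma smooth_dX {G : ℝ × X → F} {x₀ : X} (hG : ∀ᶠ p in 𝓝 ((0 : ℝ), x₀), ContDiffAt ℝ ∞ G p) :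
    ∀ᶠ p in 𝓝 ((0 : ℝ), x₀), ContDiffAt ℝ ∞ (dX G) p := by
  filter_upwards [hG] with p hp
  exact (hp.fderiv_right (m := ∞) (by simp)).clm_comp contDiffAt_const

lemma dT_dX_comm {G : ℝ × X → F} {p : ℝ × X} (hG : ContDiffAt ℝ ∞ G p) :
    dT (dX G) p = dX (dT G) p := by
  have hd : DifferentiableAt ℝ (fderiv ℝ G) p :=
    (hG.fderiv_right (m := ∞) (by simp)).differentiableAt (by simp)
  have h1 : HasFDerivAt (dT G) ((fderiv ℝ (fderiv ℝ G) p).flip (1, 0)) p := by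
    have := hd.hasFDerivAt.clm_apply (hasFDerivAt_const ((1 : ℝ), (0 : X)) p)
    refine this.congr_fderiv ?_
    ext <;> simp
  have h2 := hd.hasFDerivAt.clm_comp (hasFDerivAt_const (ContinuousLinearMap.inr ℝ ℝ X) p)
  have h3 : fderiv ℝ (dX G) p = _ := h2.fderiv
  have hs : IsSymmSndFDerivAt ℝ G p := hG.isSymmSndFDerivAt minSmoothness_two_le
  ext e
  rw [dT, h3, dX, h1.fderiv]
  simpa using hs.eq (1, 0) (0, e)

/-- Differentiation in the parameters preserves the order of vanishing. -/
lemma VanishesToOrder.dX {m : ℕ} {G : ℝ × X → F} {x₀ : X} (h : VanishesToOrder m G x₀) :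
    VanishesToOrder m (dX G) x₀ := by
  refine ⟨smooth_dX h.1, fun j hj => ?_⟩
  -- The statement is for all `G` because the induction step passes from `G` to its t-derivative.
  have key : ∀ j, ∀ G : ℝ × X → F, (∀ᶠ p in 𝓝 ((0 : ℝ), x₀), ContDiffAt ℝ ∞ G p) →
      (∀ᶠ x in 𝓝 x₀, iteratedDeriv j (fun t => G (t, x)) 0 = 0) →
      ∀ᶠ x in 𝓝 x₀, iteratedDeriv j (fun t => CRModel.dX G (t, x)) 0 = 0 := by
    intro j
    induction j with
    | zero =>
      intro G hG h0
      filter_upwards [eventually_slice hG, h0.eventually_nhds] with x hx h0x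
      simp only [iteratedDeriv_zero] at h0x ⊢
      rw [← (hasFDerivAt_slice (hx.self_of_nhds.differentiableAt (by simp))).fderiv,
        Filter.EventuallyEq.fderiv_eq (f := fun _ => (0 : F)) h0x]
      simp
    | succ j ih =>
      intro G hG h0
      have h1 : ∀ᶠ x in 𝓝 x₀, iteratedDeriv j (fun t => dT G (t, x)) 0 = 0 := by
        filter_upwards [h0, iteratedDeriv_slice_succ hG j] with x a b
        rw [← b, a]
      filter_upwards [ih _ (smooth_dT hG) h1, iteratedDeriv_slice_succ (smooth_dX hG) j,
        eventually_slice hG] with x a b c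
      rw [b, ← a]
      refine Filter.EventuallyEq.iteratedDeriv_eq j ?_
      filter_upwards [c] with t ht using dT_dX_comm ht
  exact key j G h.1 (h.2 j hj)

/-- The remainder is uniform for x near x₀: by induction the estimate holds for the t-derivative,
and it is integrated from 0 to t, where G vanishes. -/
lemma VanishesToOrder.norm_sub_le {m : ℕ} {x₀ : X} :
    ∀ {G : ℝ × X → F}, VanishesToOrder m G x₀ → ∀ ε > 0, ∀ᶠ p in 𝓝 ((0 : ℝ), x₀),
      ‖G p - p.1 ^ m • taylorCoeff m (fun t => G (t, x₀))‖ ≤ ε * |p.1| ^ m := by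
  induction m with
  | zero =>
    intro G h ε hε
    have hc : ContinuousAt G (0, x₀) := h.1.self_of_nhds.continuousAt
    have : ∀ᶠ p in 𝓝 ((0 : ℝ), x₀), ‖G p - G (0, x₀)‖ < ε := by
      have h1 : ContinuousAt (fun p => ‖G p - G (0, x₀)‖) (0, x₀) := (hc.sub
          continuousAt_const).norm
      exact h1.eventually_lt continuousAt_const (by simpa using hε)
    filter_upwards [this] with p hp
    simpa [taylorCoeff] using hp.le
  | succ m ih =>
    intro G h ε hε
    have hT : VanishesToOrder m (dT G) x₀ := by
      refine ⟨smooth_dT h.1, fun j hj => ?_⟩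
      filter_upwards [h.2 (j + 1) (by omega), iteratedDeriv_slice_succ h.1 j] with x a b
      rw [← b, a]
    have h0 : ∀ᶠ x in 𝓝 x₀, G (0, x) = 0 := by simpa using h.2 0 (by omega)
    have hIH := ih hT ε hε
    have hcoef := (iteratedDeriv_slice_succ h.1 m).self_of_nhds
    set c := iteratedDeriv m (fun t => dT G (t, x₀)) 0 with hc
    rw [nhds_prod_eq] at hIH
    have hall := hIH.and (by rw [← nhds_prod_eq]; exact h.1)
    obtain ⟨pa, hpa, pb, hpb, hab⟩ := Filter.eventually_prod_iff.1 hall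
    obtain ⟨δ, hδ, hball⟩ := Metric.eventually_nhds_iff_ball.1 hpa
    rw [nhds_prod_eq]
    refine Filter.eventually_prod_iff.2 ⟨_, Metric.ball_mem_nhds (0 : ℝ) hδ, _, hpb.and h0,
      fun {t} ht {x} hx => ?_⟩
    have hseg : ∀ τ ∈ Set.uIcc 0 t, |τ| ≤ |t| := fun τ hτ => by
      have := Set.abs_sub_left_of_mem_uIcc hτ
      simpa using this
    have hmem : ∀ τ ∈ Set.uIcc 0 t, pa τ := fun τ hτ => by
      refine hball τ ?_
      rw [mem_ball_zero_iff, Real.norm_eq_abs]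
      have ht' : |t| < δ := by simpa using ht
      exact (hseg τ hτ).trans_lt ht'
    have hder : ∀ τ ∈ Set.uIcc 0 t, HasDerivWithinAt
        (fun τ => G (τ, x) - τ ^ (m + 1) • (((m + 1).factorial : ℝ)⁻¹ • c))
        (dT G (τ, x) - τ ^ m • ((m.factorial : ℝ)⁻¹ • c)) (Set.uIcc 0 t) τ := by
      intro τ hτ
      have h1 := hasDerivAt_slice ((hab (hmem τ hτ) hx.1).2.differentiableAt (by simp))
      have h2 := (hasDerivAt_pow (m + 1) τ).smul_const (((m + 1).factorial : ℝ)⁻¹ • c)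
      have h3 : ((m + 1 : ℕ) : ℝ) * τ ^ (m + 1 - 1) * ((m + 1).factorial : ℝ)⁻¹
          = τ ^ m * (m.factorial : ℝ)⁻¹ := by
        rw [Nat.factorial_succ]
        have : (m.factorial : ℝ) ≠ 0 := by positivity
        push_cast
        field_simp
      refine ((h1.fun_sub h2).congr_deriv ?_).hasDerivWithinAt
      rw [smul_smul, smul_smul, h3]
    have hbd := (convex_uIcc (0 : ℝ) t).norm_image_sub_le_of_norm_hasDerivWithin_le hder
      (C := ε * |t| ^ m) (fun τ hτ => ?_) Set.left_mem_uIcc Set.right_mem_uIcc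
    · simp only [hx.2, zero_pow (Nat.succ_ne_zero m), zero_smul, sub_zero, Real.norm_eq_abs] at hbd
      rw [taylorCoeff, hcoef, pow_succ |t|, ← mul_assoc]
      exact hbd
    · refine ((hab (hmem τ hτ) hx.1).1).trans ?_
      have := hseg τ hτ
      gcongr

/-- The base point may move with the parameter. This is needed later, where the points on the
rescaled hypersurfaces depend on t. -/
lemma VanishesToOrder.tendsto {m : ℕ} {G : ℝ × X → F} {x₀ : X} (h : VanishesToOrder m G x₀)
    {ι : Type*} {l : Filter ι} {t : ι → ℝ} {x : ι → X} (ht : Tendsto t l (𝓝 0))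
    (hne : ∀ᶠ i in l, t i ≠ 0) (hx : Tendsto x l (𝓝 x₀)) :
    Tendsto (fun i => (t i ^ m)⁻¹ • G (t i, x i)) l (𝓝 (taylorCoeff m fun t => G (t, x₀))) := by
  rw [Metric.tendsto_nhds]
  intro ε hε
  have hp : Tendsto (fun i => (t i, x i)) l (𝓝 ((0 : ℝ), x₀)) := ht.prodMk_nhds hx
  filter_upwards [hp.eventually (h.norm_sub_le (ε / 2) (by positivity)), hne] with i hi hi0
  have hpos : 0 < |t i| ^ m := by positivity
  have hid : (t i ^ m)⁻¹ • G (t i, x i) - taylorCoeff m (fun t => G (t, x₀))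
      = (t i ^ m)⁻¹ • (G (t i, x i) - t i ^ m • taylorCoeff m (fun t => G (t, x₀))) := by
    rw [smul_sub, smul_smul, inv_mul_cancel₀ (pow_ne_zero _ hi0), one_smul]
  rw [dist_eq_norm, hid, norm_smul, norm_inv, norm_pow, Real.norm_eq_abs]
  calc (|t i| ^ m)⁻¹ * _ ≤ (|t i| ^ m)⁻¹ * (ε / 2 * |t i| ^ m) := by gcongr
    _ = ε / 2 := by field_simp
    _ < ε := by linarith

/-- A function vanishing to order `m + 1` is `o(t ^ m)`. -/
lemma VanishesToOrder.tendsto_zero {m : ℕ} {G : ℝ × X → F} {x₀ : X}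
    (h : VanishesToOrder (m + 1) G x₀)
    {ι : Type*} {l : Filter ι} {t : ι → ℝ} {x : ι → X} (ht : Tendsto t l (𝓝 0))
    (hne : ∀ᶠ i in l, t i ≠ 0) (hx : Tendsto x l (𝓝 x₀)) :
    Tendsto (fun i => (t i ^ m)⁻¹ • G (t i, x i)) l (𝓝 0) := by
  have h1 : VanishesToOrder m G x₀ := ⟨h.1, fun j hj => h.2 j (by omega)⟩
  have h2 : taylorCoeff m (fun t => G (t, x₀)) = 0 := by
    rw [taylorCoeff, (h.2 m (by omega)).self_of_nhds, smul_zero]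
  have := h1.tendsto ht hne hx
  rwa [h2] at this

end Order

/-! ### Weighted dilations -/

section Dilations

variable {s r : ℕ}

/-- The dilation `(w, z, ζ) ↦ (t² w, t z, ζ)`. -/
noncomputable def dil (t : ℝ) : Coord s r →L[ℂ] Coord s r :=
  (((t : ℂ) ^ 2) • ContinuousLinearMap.fst ℂ ℂ ((Fin s → ℂ) × (Fin r → ℂ))).prod
    (((t : ℂ) • (ContinuousLinearMap.fst ℂ (Fin s → ℂ) (Fin r → ℂ)).comp
      (ContinuousLinearMap.snd ℂ ℂ ((Fin s → ℂ) × (Fin r → ℂ)))).prod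
      ((ContinuousLinearMap.snd ℂ (Fin s → ℂ) (Fin r → ℂ)).comp
        (ContinuousLinearMap.snd ℂ ℂ ((Fin s → ℂ) × (Fin r → ℂ)))))

lemma dil_apply (t : ℝ) (q : Coord s r) :
    dil t q = ((t : ℂ) ^ 2 * q.1, (t : ℂ) • q.2.1, q.2.2) := by
  simp [dil]

lemma analyticAt_dil (p : ℝ × Coord s r) : AnalyticAt ℝ (fun p : ℝ × Coord s r => dil p.1 p.2) p := by
  simp only [dil_apply]
  have h1 : AnalyticAt ℝ (fun p : ℝ × Coord s r => (p.1 : ℂ)) p :=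
    (Complex.ofRealCLM.comp (ContinuousLinearMap.fst ℝ ℝ (Coord s r))).analyticAt p
  have hw : AnalyticAt ℝ (fun p : ℝ × Coord s r => p.2.1) p :=
    analyticAt_fst.comp analyticAt_snd
  have hz : AnalyticAt ℝ (fun p : ℝ × Coord s r => p.2.2.1) p :=
    analyticAt_fst.comp (analyticAt_snd.comp analyticAt_snd)
  have hζ : AnalyticAt ℝ (fun p : ℝ × Coord s r => p.2.2.2) p :=
    analyticAt_snd.comp (analyticAt_snd.comp analyticAt_snd)
  exact ((h1.pow 2).mul hw).prod ((h1.smul hz).prod hζ)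

lemma contDiff_dil : ContDiff ℝ ∞ (fun p : ℝ × Coord s r => dil p.1 p.2) :=
  contDiff_iff_contDiffAt.2 fun p => (analyticAt_dil p).contDiffAt

end Dilations


/-! ### The Levi kernel as a graph over the ζ-space -/

section Frame

variable {s r : ℕ}

/-- The space of the coordinates `(w, z)`. -/
abbrev CoordU (s : ℕ) := ℂ × (Fin s → ℂ)

/-- The inclusion of the `(w, z)`-space. -/
noncomputable def inU (s r : ℕ) : CoordU s →L[ℂ] Coord s r :=
  (ContinuousLinearMap.fst ℂ ℂ (Fin s → ℂ)).prod
    ((ContinuousLinearMap.snd ℂ ℂ (Fin s → ℂ)).prod 0)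

/-- The inclusion of the `ζ`-space. -/
noncomputable def inV (s r : ℕ) : (Fin r → ℂ) →L[ℂ] Coord s r :=
  (0 : (Fin r → ℂ) →L[ℂ] ℂ).prod ((0 : (Fin r → ℂ) →L[ℂ] (Fin s → ℂ)).prod (.id ℂ _))

/-- The projection to the `(w, z)`-space. -/
noncomputable def prU (s r : ℕ) : Coord s r →L[ℂ] CoordU s :=
  (ContinuousLinearMap.fst ℂ _ _).prod
    ((ContinuousLinearMap.fst ℂ _ _).comp (ContinuousLinearMap.snd ℂ _ _))

/-- The projection to the `ζ`-space. -/
noncomputable def prV (s r : ℕ) : Coord s r →L[ℂ] (Fin r → ℂ) :=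
  (ContinuousLinearMap.snd ℂ _ _).comp (ContinuousLinearMap.snd ℂ _ _)

@[simp] lemma inU_apply (u : CoordU s) : inU s r u = (u.1, u.2, 0) := rfl
@[simp] lemma inV_apply (η : Fin r → ℂ) : inV s r η = (0, 0, η) := rfl
@[simp] lemma prU_apply (q : Coord s r) : prU s r q = (q.1, q.2.1) := rfl
@[simp] lemma prV_apply (q : Coord s r) : prV s r q = q.2.2 := rfl

lemma inU_add_inV (q : Coord s r) : inU s r (prU s r q) + inV s r (prV s r q) = q := by
  simp

/-- The coordinate vector of `w`. -/
noncomputable def eW (s r : ℕ) : Coord s r := (1, 0, 0)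

/-- The coordinate vectors of `z`. -/
noncomputable def eZ (s r : ℕ) (j : Fin s) : Coord s r := (0, Pi.single j 1, 0)

variable {E : Type*} [NormedAddCommGroup E] [NormedSpace ℂ E]

/-- `x ↦ lev B x y` as a linear map. -/
noncomputable def levL (y : E) : (E →L[ℝ] E →L[ℝ] ℝ) →L[ℝ] (E →L[ℝ] ℝ) :=
  let J : E →L[ℝ] E := (Complex.I • ContinuousLinearMap.id ℂ E).restrictScalars ℝ
  let flipL := (ContinuousLinearMap.flipₗᵢ ℝ E E ℝ : _ →L[ℝ] (E →L[ℝ] E →L[ℝ] ℝ))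
  (ContinuousLinearMap.apply ℝ (E →L[ℝ] ℝ) y).comp flipL +
    ((ContinuousLinearMap.compL ℝ E E ℝ).flip J).comp
      ((ContinuousLinearMap.apply ℝ (E →L[ℝ] ℝ) (Complex.I • y)).comp flipL)

lemma levL_apply (y : E) (B : E →L[ℝ] E →L[ℝ] ℝ) (x : E) : levL y B x = lev B x y := by
  simp [levL, lev]

lemma contDiff_levL (y : E) : ContDiff ℝ ∞ fun B : E →L[ℝ] E →L[ℝ] ℝ => levL y B :=
  ContinuousLinearMap.contDiff (𝕜 := ℝ) (E := E →L[ℝ] E →L[ℝ] ℝ) (F := E →L[ℝ] ℝ) (levL y)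

/-- The sesquilinear Levi form. -/
noncomputable def levC (B : E →L[ℝ] E →L[ℝ] ℝ) (y : E) : E →L[ℂ] ℂ := dC (levL y B)

lemma levC_apply (B : E →L[ℝ] E →L[ℝ] ℝ) (x y : E) :
    levC B y x = (lev B x y : ℂ) + Complex.I * (lev B x (Complex.I • y) : ℂ) := by
  rw [levC, dC_apply, levL_apply, levL_apply, lev_I_left]
  push_cast
  ring

lemma levC_smul (B : E →L[ℝ] E →L[ℝ] ℝ) (c : ℂ) (x y : E) :
    levC B (c • y) x = starRingEnd ℂ c * levC B y x := by
  simp only [levC_apply]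
  have h1 : c • y = c.re • y + c.im • (Complex.I • y) := complex_smul_eq c y
  have h2 : Complex.I • c • y = c.re • (Complex.I • y) + (-c.im) • y := by
    rw [h1, smul_add, smul_comm Complex.I c.re, smul_comm Complex.I c.im, I_smul_I_smul]
    module
  have hc : starRingEnd ℂ c = (c.re : ℂ) - c.im * Complex.I := by
    apply Complex.ext <;> simp
  rw [h2, h1, lev_add_right, lev_add_right, lev_smul_right, lev_smul_right, lev_smul_right,
    lev_smul_right, hc]
  push_cast
  linear_combination (c.im : ℂ) * (lev B x (Complex.I • y)) * Complex.I_sq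

lemma levC_add (B : E →L[ℝ] E →L[ℝ] ℝ) (x y y' : E) :
    levC B (y + y') x = levC B y x + levC B y' x := by
  simp only [levC_apply, smul_add, lev_add_right]
  push_cast
  ring

lemma levC_re (B : E →L[ℝ] E →L[ℝ] ℝ) (x y : E) : (levC B y x).re = lev B x y := by
  simp [levC_apply]

/-- The complex linear map whose kernel contains the Levi kernel. -/
noncomputable def jetMap (ℓ : Coord s r →L[ℝ] ℝ) (B : Coord s r →L[ℝ] Coord s r →L[ℝ] ℝ) :
    Coord s r →L[ℂ] CoordU s :=
  (ContinuousLinearMap.smulRightL ℂ (Coord s r) (CoordU s)).flip (1, 0) (dC ℓ) +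
    ∑ j, (ContinuousLinearMap.smulRightL ℂ (Coord s r) (CoordU s)).flip (0, Pi.single j 1)
      (starRingEnd ℂ (dC ℓ (eW s r)) • levC B (eZ s r j)
        - starRingEnd ℂ (dC ℓ (eZ s r j)) • levC B (eW s r))

lemma jetMap_fst (ℓ : Coord s r →L[ℝ] ℝ) (B : Coord s r →L[ℝ] Coord s r →L[ℝ] ℝ) (x : Coord s r) :
    (jetMap ℓ B x).1 = dC ℓ x := by
  simp [jetMap, Prod.fst_sum]

lemma jetMap_snd (ℓ : Coord s r →L[ℝ] ℝ) (B : Coord s r →L[ℝ] Coord s r →L[ℝ] ℝ) (x : Coord s r)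
    (j : Fin s) : (jetMap ℓ B x).2 j = starRingEnd ℂ (dC ℓ (eW s r)) * levC B (eZ s r j) x
        - starRingEnd ℂ (dC ℓ (eZ s r j)) * levC B (eW s r) x := by
  simp [jetMap, Prod.snd_sum, Pi.single_apply]

lemma contDiff_jetMap : ContDiff ℝ ∞
    fun J : (Coord s r →L[ℝ] ℝ) × (Coord s r →L[ℝ] Coord s r →L[ℝ] ℝ) => jetMap J.1 J.2 := by
  have h1 : ContDiff ℝ ∞ fun J : (Coord s r →L[ℝ] ℝ) ×
      (Coord s r →L[ℝ] Coord s r →L[ℝ] ℝ) => dC J.1 :=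
    (dCL (Coord s r)).contDiff.comp contDiff_fst
  have h2 : ∀ y, ContDiff ℝ ∞ fun J : (Coord s r →L[ℝ] ℝ) ×
      (Coord s r →L[ℝ] Coord s r →L[ℝ] ℝ) => levC J.2 y := fun y => by
    have h := (contDiff_levL (E := Coord s r) y).comp (contDiff_snd (𝕜 := ℝ) (n := ∞)
      (E := Coord s r →L[ℝ] ℝ) (F := Coord s r →L[ℝ] Coord s r →L[ℝ] ℝ))
    exact (dCL (Coord s r)).contDiff.comp h
  have h3 : ∀ y, ContDiff ℝ ∞ fun J : (Coord s r →L[ℝ] ℝ) ×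
      (Coord s r →L[ℝ] Coord s r →L[ℝ] ℝ) => starRingEnd ℂ (dC J.1 y) := fun y => by
    have : ContDiff ℝ ∞ fun J : (Coord s r →L[ℝ] ℝ) ×
      (Coord s r →L[ℝ] Coord s r →L[ℝ] ℝ) => dC J.1 y :=
      (((ContinuousLinearMap.apply ℂ ℂ y).restrictScalars ℝ).contDiff).comp h1
    exact Complex.conjCLE.contDiff.comp this
  have h4 : ∀ u : CoordU s, ContDiff ℝ ∞ fun T : Coord s r →L[ℂ] ℂ =>
      (ContinuousLinearMap.smulRightL ℂ (Coord s r) (CoordU s)).flip u T := fun u =>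
    (((ContinuousLinearMap.smulRightL ℂ (Coord s r) (CoordU s)).flip u).restrictScalars ℝ).contDiff
  refine ((h4 _).comp h1).add (ContDiff.sum fun j _ => (h4 _).comp ?_)
  exact ((h3 _).smul (h2 _)).sub ((h3 _).smul (h2 _))

/-- With c and d the values of ∂ρ on the w- and z_j-directions, the j-th equation is the Levi
pairing with c e_j − d e_w, a vector annihilated by ∂ρ. Thus `jetMap` collects 1 + s equations that
every Levi kernel vector satisfies. -/
lemma jetMap_eq_zero_of_mem_jetKernel {ℓ : Coord s r →L[ℝ] ℝ}
    {B : Coord s r →L[ℝ] Coord s r →L[ℝ] ℝ} {x : Coord s r} (hx : x ∈ jetKernel ℓ B) :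
    jetMap ℓ B x = 0 := by
  refine Prod.ext ((jetMap_fst ℓ B x).trans hx.1) (funext fun j => ?_)
  rw [jetMap_snd, ← levC_smul, ← levC_smul]
  set c := dC ℓ (eW s r)
  set d := dC ℓ (eZ s r j)
  have h1 : levC B (c • eZ s r j) x - levC B (d • eW s r) x
      = levC B (c • eZ s r j + (-1 : ℂ) • d • eW s r) x := by
    rw [levC_add, levC_smul B (-1 : ℂ)]; simp [sub_eq_add_neg]
  have h2 : dC ℓ (c • eZ s r j + (-1 : ℂ) • d • eW s r) = 0 := by
    simp only [map_add, map_smul, smul_eq_mul]; ring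
  rw [h1, levC_apply, hx.2 _ h2, hx.2 _ (by rw [map_smul, h2, smul_zero])]
  simp

/-- The frame of the kernel of `T` as a graph over the `ζ`-space. -/
noncomputable def frameMap (T : Coord s r →L[ℂ] CoordU s) : (Fin r → ℂ) →L[ℂ] CoordU s :=
  -(T.comp (inU s r)).inverse.comp (T.comp (inV s r))

lemma frameMap_spec {T : Coord s r →L[ℂ] CoordU s} (hT : (T.comp (inU s r)).IsInvertible)
    {x : Coord s r} : T x = 0 ↔ prU s r x = frameMap T (prV s r x) := by
  obtain ⟨e, he⟩ := hT
  have h1 : T x = e (prU s r x) + T (inV s r (prV s r x)) := by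
    conv_lhs => rw [← inU_add_inV x, map_add]
    congr 1
    exact (DFunLike.congr_fun he (prU s r x)).symm
  rw [h1, frameMap, ← he, ContinuousLinearMap.inverse_equiv, neg_apply,
    ContinuousLinearMap.comp_apply, ContinuousLinearMap.comp_apply, add_eq_zero_iff_eq_neg]
  constructor
  · intro h
    rw [← e.symm_apply_apply (prU s r x), h, map_neg]; rfl
  · intro h
    rw [h, map_neg]
    congr 1
    exact e.apply_symm_apply _

lemma contDiffAt_frameMap {T₀ : Coord s r →L[ℂ] CoordU s}
    (hT : (T₀.comp (inU s r)).IsInvertible) : ContDiffAt ℝ ∞ (frameMap (s := s) (r := r)) T₀ := by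
  obtain ⟨e, he⟩ := hT
  have h1 : ContDiffAt ℝ ∞ (fun T : Coord s r →L[ℂ] CoordU s => T.comp (inU s r)) T₀ :=
    (((ContinuousLinearMap.compL ℂ (CoordU s) (Coord s r) (CoordU s)).flip
      (inU s r)).restrictScalars ℝ).contDiff.contDiffAt
  have h2 : ContDiffAt ℝ ∞ (fun T : Coord s r →L[ℂ] CoordU s => T.comp (inV s r)) T₀ :=
    (((ContinuousLinearMap.compL ℂ (Fin r → ℂ) (Coord s r) (CoordU s)).flip
      (inV s r)).restrictScalars ℝ).contDiff.contDiffAt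
  have h3 : ContDiffAt ℝ ∞ (ContinuousLinearMap.inverse : (CoordU s →L[ℂ] CoordU s) → _)
      (T₀.comp (inU s r)) := by
    rw [← he]
    exact (contDiffAt_map_inverse (𝕜 := ℂ) e).restrict_scalars ℝ
  have h4 : ContDiff ℝ ∞ (fun p : (CoordU s →L[ℂ] CoordU s) × ((Fin r → ℂ) →L[ℂ] CoordU s) =>
      p.1.comp p.2) :=
    (ContDiff.restrict_scalars ℝ (𝕜' := ℂ) (by
      exact contDiff_fst.clm_comp contDiff_snd))
  exact (h4.contDiffAt.comp T₀ ((h3.comp T₀ h1).prodMk h2)).neg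

lemma eventually_isInvertible {T₀ : Coord s r →L[ℂ] CoordU s}
    (hT : (T₀.comp (inU s r)).IsInvertible) : ∀ᶠ T in 𝓝 T₀, (T.comp (inU s r)).IsInvertible := by
  obtain ⟨e, he⟩ := hT
  have h1 : ContinuousAt (fun T : Coord s r →L[ℂ] CoordU s => T.comp (inU s r)) T₀ :=
    ((ContinuousLinearMap.compL ℂ (CoordU s) (Coord s r) (CoordU s)).flip
      (inU s r)).continuous.continuousAt
  refine h1.eventually ?_
  change ∀ᶠ T in 𝓝 (T₀.comp (inU s r)), T.IsInvertible
  rw [← he]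
  exact ContinuousLinearEquiv.nhds e

/-- The graph of a linear map from the `ζ`-space to the `(w, z)`-space. -/
noncomputable def graphMap (a : (Fin r → ℂ) →L[ℂ] CoordU s) : (Fin r → ℂ) →L[ℂ] Coord s r :=
  (inU s r).comp a + inV s r

lemma graphMap_apply (a : (Fin r → ℂ) →L[ℂ] CoordU s) (η : Fin r → ℂ) :
    graphMap a η = ((a η).1, (a η).2, η) := by
  simp [graphMap]

lemma finrank_range_graphMap (a : (Fin r → ℂ) →L[ℂ] CoordU s) :
    Module.finrank ℂ (LinearMap.range (graphMap a : (Fin r → ℂ) →ₗ[ℂ] Coord s r)) = r := by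
  rw [LinearMap.finrank_range_of_inj]
  · simp
  · intro η ξ h
    simpa [graphMap_apply] using congrArg (fun q : Coord s r => q.2.2) h

lemma jetMap_eq_zero_iff {T : Coord s r →L[ℂ] CoordU s} (hT : (T.comp (inU s r)).IsInvertible)
    {x : Coord s r} : T x = 0 ↔
      x ∈ LinearMap.range (graphMap (frameMap T) : (Fin r → ℂ) →ₗ[ℂ] Coord s r) := by
  rw [frameMap_spec hT]
  constructor
  · intro h
    refine ⟨prV s r x, ?_⟩
    rw [ContinuousLinearMap.coe_coe, graphMap_apply, ← h]
    rfl
  · rintro ⟨η, rfl⟩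
    simp [graphMap_apply]

/-- Invertibility in the (w, z)-directions gives `jetMap` an r-dimensional kernel, which contains
the Levi kernel; equality of dimensions makes them equal. -/
lemma jetKernel_eq_range {ℓ : Coord s r →L[ℝ] ℝ} {B : Coord s r →L[ℝ] Coord s r →L[ℝ] ℝ}
    (hT : ((jetMap ℓ B).comp (inU s r)).IsInvertible)
    (hr : Module.finrank ℂ (jetKernel ℓ B) = r) :
    jetKernel ℓ B
      = LinearMap.range (graphMap (frameMap (jetMap ℓ B)) : (Fin r → ℂ) →ₗ[ℂ] Coord s r) := by
  refine Submodule.eq_of_le_of_finrank_eq (fun x hx => ?_) ?_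
  · exact (jetMap_eq_zero_iff hT).1 (jetMap_eq_zero_of_mem_jetKernel hx)
  · rw [hr, finrank_range_graphMap]

lemma tendsto_jetMap {ι : Type*} {f : Filter ι}
    {ℓ : ι → Coord s r →L[ℝ] ℝ} {B : ι → Coord s r →L[ℝ] Coord s r →L[ℝ] ℝ}
    {ℓ₀ : Coord s r →L[ℝ] ℝ} {B₀ : Coord s r →L[ℝ] Coord s r →L[ℝ] ℝ}
    (hℓ : Tendsto ℓ f (𝓝 ℓ₀)) (hB : Tendsto B f (𝓝 B₀)) :
    Tendsto (fun i => jetMap (ℓ i) (B i)) f (𝓝 (jetMap ℓ₀ B₀)) := by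
  have h1 : Tendsto (fun i => (ℓ i, B i)) f (𝓝 (ℓ₀, B₀)) := hℓ.prodMk_nhds hB
  have h2 := (contDiff_jetMap (s := s) (r := r)).continuous.continuousAt (x := (ℓ₀, B₀))
  rw [ContinuousAt] at h2
  have h3 := h2.comp h1
  simp only [Function.comp_def] at h3
  exact h3

lemma tendsto_clm_apply {𝕜 G H ι : Type*} [NontriviallyNormedField 𝕜] [NormedAddCommGroup G]
    [NormedSpace 𝕜 G] [NormedAddCommGroup H] [NormedSpace 𝕜 H] {f : Filter ι}
    {A : ι → G →L[𝕜] H} {A₀ : G →L[𝕜] H} {x : ι → G} {x₀ : G} (hA : Tendsto A f (𝓝 A₀))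
    (hx : Tendsto x f (𝓝 x₀)) : Tendsto (fun i => A i (x i)) f (𝓝 (A₀ x₀)) :=
  (isBoundedBilinearMap_apply.continuous.tendsto (A₀, x₀)).comp (hA.prodMk_nhds hx)

/-- The condition that the Levi kernel has the maximal possible dimension is closed. -/
lemma finrank_jetKernel_of_tendsto {ι : Type*} {f : Filter ι} [f.NeBot]
    {ℓ : ι → Coord s r →L[ℝ] ℝ} {B : ι → Coord s r →L[ℝ] Coord s r →L[ℝ] ℝ}
    {ℓ₀ : Coord s r →L[ℝ] ℝ} {B₀ : Coord s r →L[ℝ] Coord s r →L[ℝ] ℝ}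
    (hℓ : Tendsto ℓ f (𝓝 ℓ₀)) (hB : Tendsto B f (𝓝 B₀)) (hw : dC ℓ₀ (eW s r) ≠ 0)
    (hT : ((jetMap ℓ₀ B₀).comp (inU s r)).IsInvertible)
    (hr : ∀ᶠ i in f, Module.finrank ℂ (jetKernel (ℓ i) (B i)) = r) :
    Module.finrank ℂ (jetKernel ℓ₀ B₀) = r := by
  have hTt := tendsto_jetMap hℓ hB
  have hA : Tendsto (fun i => frameMap (jetMap (ℓ i) (B i))) f
      (𝓝 (frameMap (jetMap ℓ₀ B₀))) :=
    (contDiffAt_frameMap hT).continuousAt.tendsto.comp hTt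
  have hdC : Tendsto (fun i => dC (ℓ i)) f (𝓝 (dC ℓ₀)) := ((dCL _).continuous.tendsto ℓ₀).comp hℓ
  have heq : jetKernel ℓ₀ B₀ = LinearMap.range
      (graphMap (frameMap (jetMap ℓ₀ B₀)) : (Fin r → ℂ) →ₗ[ℂ] Coord s r) := by
    refine le_antisymm (fun x hx =>
      (jetMap_eq_zero_iff hT).1 (jetMap_eq_zero_of_mem_jetKernel hx)) ?_
    rintro x ⟨η, rfl⟩
    have hx0 := (jetMap_eq_zero_iff hT).2 (LinearMap.mem_range_self
      (graphMap (frameMap (jetMap ℓ₀ B₀)) : (Fin r → ℂ) →ₗ[ℂ] Coord s r) η)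
    refine ⟨by rw [← jetMap_fst, hx0]; rfl, fun y hy => ?_⟩
    -- A candidate kernel vector of the limit is approached by genuine kernel vectors, through
    -- continuity of the frame.
    set x : ι → Coord s r := fun i => graphMap (frameMap (jetMap (ℓ i) (B i))) η with hx
    -- The test vector is corrected along e_w so as to be annihilated by the i-th form; the
    -- correction tends to 0.
    set y' : ι → Coord s r := fun i => y - (dC (ℓ i) y / dC (ℓ i) (eW s r)) • eW s r with hy'
    have hxt : Tendsto x f (𝓝 (graphMap (frameMap (jetMap ℓ₀ B₀)) η)) := by
      have h1 := tendsto_clm_apply hA (tendsto_const_nhds (x := η))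
      simp only [hx, graphMap, add_apply, ContinuousLinearMap.comp_apply]
      exact (((inU s r).continuous.tendsto _).comp h1).add_const _
    have hyt : Tendsto y' f (𝓝 y) := by
      have h1 := tendsto_clm_apply hdC (tendsto_const_nhds (x := y))
      have h2 := tendsto_clm_apply hdC (tendsto_const_nhds (x := eW s r))
      have h3 := ((h1.div h2 hw).smul_const (eW s r)).const_sub y
      rwa [hy, zero_div, zero_smul, sub_zero] at h3
    have hlev : Tendsto (fun i => lev (B i) (x i) (y' i)) f
        (𝓝 (lev B₀ (graphMap (frameMap (jetMap ℓ₀ B₀)) η) y)) := by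
      exact (tendsto_clm_apply (tendsto_clm_apply hB hxt) hyt).add (tendsto_clm_apply
        (tendsto_clm_apply hB (hxt.const_smul Complex.I)) (hyt.const_smul Complex.I))
    refine tendsto_nhds_unique hlev (Tendsto.congr' ?_ tendsto_const_nhds)
    filter_upwards [hr, hTt.eventually (eventually_isInvertible hT),
      (tendsto_clm_apply hdC (tendsto_const_nhds (x := eW s r))).eventually_ne hw] with i h1 h2 h3
    have hk : x i ∈ jetKernel (ℓ i) (B i) := by
      rw [jetKernel_eq_range h2 h1]
      exact LinearMap.mem_range_self _ η
    refine (hk.2 _ ?_).symm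
    rw [hy', map_sub, map_smul, smul_eq_mul, div_mul_cancel₀ _ h3, sub_self]
  rw [heq, finrank_range_graphMap]

lemma finrank_ker_dC {ℓ : Coord s r →L[ℝ] ℝ} (hw : dC ℓ (eW s r) ≠ 0) :
    Module.finrank ℂ (LinearMap.ker (dC ℓ : Coord s r →ₗ[ℂ] ℂ)) = s + r := by
  have h1 := LinearMap.finrank_range_add_finrank_ker (dC ℓ : Coord s r →ₗ[ℂ] ℂ)
  have h2 : LinearMap.range (dC ℓ : Coord s r →ₗ[ℂ] ℂ) = ⊤ := by
    rw [LinearMap.range_eq_top]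
    intro c
    refine ⟨(c / dC ℓ (eW s r)) • eW s r, ?_⟩
    rw [ContinuousLinearMap.coe_coe, map_smul, smul_eq_mul, div_mul_cancel₀ _ hw]
  rw [h2, finrank_top] at h1
  simp only [Module.finrank_self, Module.finrank_prod, Module.finrank_fintype_fun_eq_card,
    Fintype.card_fin] at h1
  omega

end Frame


/-! ### Equations in graph form and translations in Re w -/

section Translation

variable {s r : ℕ}

/-- `ρ (w + c, z, ζ) = ρ (w, z, ζ) + c` for real `c`, as for `ρ = Re w - F (z, ζ, Im w)`. -/
def IsGraphFunction (ρ : Coord s r → ℝ) : Prop :=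
  ∀ (q : Coord s r) (c : ℝ), ρ (q + c • eW s r) = ρ q + c

variable {ρ : Coord s r → ℝ} {M : Set (Coord s r)}

lemma IsGraphFunction.fderiv_add (h : IsGraphFunction ρ) (q : Coord s r) (c : ℝ) :
    fderiv ℝ ρ (q + c • eW s r) = fderiv ℝ ρ q := by
  rw [← fderiv_comp_add_right]
  have : (fun x => ρ (x + c • eW s r)) = fun x => ρ x + c := funext fun x => h x c
  rw [this, fderiv_add_const]

lemma IsGraphFunction.hess_add (h : IsGraphFunction ρ) (q : Coord s r) (c : ℝ) :
    hess ρ (q + c • eW s r) = hess ρ q := by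
  rw [hess, ← fderiv_comp_add_right]
  have : (fun x => fderiv ℝ ρ (x + c • eW s r)) = fderiv ℝ ρ := funext fun x => h.fderiv_add x c
  rw [this]

lemma IsGraphFunction.fderiv_eW (h : IsGraphFunction ρ) {q : Coord s r}
    (hd : DifferentiableAt ℝ ρ q) : fderiv ℝ ρ q (eW s r) = 1 := by
  have h1 : HasDerivAt (fun c : ℝ => ρ (q + c • eW s r)) (fderiv ℝ ρ q (eW s r)) 0 := by
    have h2 : HasDerivAt (fun c : ℝ => q + c • eW s r) (eW s r) 0 := by
      simpa using ((hasDerivAt_id (0 : ℝ)).smul_const (eW s r)).const_add q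
    refine HasFDerivAt.comp_hasDerivAt (f := fun c : ℝ => q + c • eW s r) 0 ?_ h2
    simpa using hd.hasFDerivAt
  have h3 : HasDerivAt (fun c : ℝ => ρ (q + c • eW s r)) 1 0 := by
    rw [funext fun c => h q c]
    exact (hasDerivAt_id (0 : ℝ)).const_add _
  exact h1.unique h3

lemma IsGraphFunction.dC_eW (h : IsGraphFunction ρ) {q : Coord s r}
    (hd : DifferentiableAt ℝ ρ q) : dC (fderiv ℝ ρ q) (eW s r) ≠ 0 := fun h0 => by
  have := dC_re (fderiv ℝ ρ q) (eW s r)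
  rw [h0, h.fderiv_eW hd] at this
  simp at this

lemma IsDefiningFunctionAt.hasLeviRankAt_iff {p : Coord s r}
    (h : IsDefiningFunctionAt M p ρ) (hp : p ∈ M) (hw : dC (fderiv ℝ ρ p) (eW s r) ≠ 0) :
    HasLeviRankAt M p s ↔ Module.finrank ℂ (jetKernel (fderiv ℝ ρ p) (hess ρ p)) = r := by
  have h1 : complexTangent M p = LinearMap.ker (dC (fderiv ℝ ρ p) : Coord s r →ₗ[ℂ] ℂ) := by
    ext v
    rw [h.mem_complexTangent hp, LinearMap.mem_ker, ContinuousLinearMap.coe_coe]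
  rw [HasLeviRankAt, h.leviKernel_eq hp, h1, finrank_ker_dC hw]
  omega

lemma IsGraphFunction.tendsto_project (hρ : ContinuousAt ρ 0) (h0 : ρ 0 = 0) :
    Tendsto (fun q => q + (-ρ q) • eW s r) (𝓝 0) (𝓝 0) := by
  have h1 : ContinuousAt (fun q => q + (-ρ q) • eW s r) 0 :=
    continuousAt_id.add (hρ.neg.smul continuousAt_const)
  simpa [ContinuousAt, h0] using h1

/-- Translating q by −ρ(q) in the direction e_w puts it on M and changes neither the first nor the
second derivatives. Hence the rank condition on M holds on a full neighbourhood, that is, on all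
nearby level sets of ρ. -/
lemma IsGraphFunction.finrank_jetKernel (h : IsGraphFunction ρ) (hM : IsDefiningFunctionAt M 0 ρ)
    (h0 : ρ 0 = 0) (hr : HasConstantLeviRankNear M 0 s) :
    ∀ᶠ q in 𝓝 0, Module.finrank ℂ (jetKernel (fderiv ℝ ρ q) (hess ρ q)) = r := by
  filter_upwards [(IsGraphFunction.tendsto_project hM.1.continuousAt h0).eventually
    (hr.and hM.eventually)] with q hq
  set q' := q + (-ρ q) • eW s r with hq'
  have hρ0 : ρ q' = 0 := by rw [hq', h]; ring
  have hmem : q' ∈ M := hq.2.2.2.self_of_nhds.2 hρ0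
  have h3 := (hq.2.hasLeviRankAt_iff hmem (h.dC_eW hq.2.1.differentiableAt)).1
    (hq.1 hmem).2
  rwa [hq', h.fderiv_add, h.hess_add] at h3

lemma IsGraphFunction.hasConstantLeviRankNear (h : IsGraphFunction ρ)
    (hM : IsDefiningFunctionAt M 0 ρ)
    (hr : ∀ᶠ q in 𝓝 0, Module.finrank ℂ (jetKernel (fderiv ℝ ρ q) (hess ρ q)) = r) :
    HasConstantLeviRankNear M 0 s := by
  filter_upwards [hr, hM.eventually] with q h1 h2 hq
  exact ⟨⟨ρ, h2⟩, (h2.hasLeviRankAt_iff hq (h.dC_eW h2.1.differentiableAt)).2 h1⟩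

end Translation

/-! ### Levi kernels and real scaling -/

section JetKernel

variable {E : Type*} [NormedAddCommGroup E] [NormedSpace ℂ E]

lemma lev_smul_form (c : ℝ) (B : E →L[ℝ] E →L[ℝ] ℝ) (x y : E) :
    lev (c • B) x y = c * lev B x y := by
  simp [lev, mul_add]

lemma jetKernel_smul {c : ℝ} (hc : c ≠ 0) (ℓ : E →L[ℝ] ℝ) (B : E →L[ℝ] E →L[ℝ] ℝ) :
    jetKernel (c • ℓ) (c • B) = jetKernel ℓ B := by
  have h1 : ∀ v, dC (c • ℓ) v = 0 ↔ dC ℓ v = 0 := fun v => by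
    simp [dC_eq_zero_iff, hc]
  ext v
  simp only [mem_jetKernel, h1, lev_smul_form, mul_eq_zero, hc, false_or]

end JetKernel

/-! ### Defining functions of M and of the model -/

section Equations

variable {s r : ℕ}

/-- Dilations as equivalences. -/
noncomputable def dilEquiv (s r : ℕ) {t : ℝ} (ht : t ≠ 0) : Coord s r ≃L[ℂ] Coord s r :=
  ContinuousLinearEquiv.equivOfInverse (dil t) (dil t⁻¹)
    (fun q => by
      have : (t : ℂ) ≠ 0 := by exact_mod_cast ht
      simp only [dil_apply]
      refine Prod.ext ?_ (Prod.ext ?_ rfl)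
      · rw [Complex.ofReal_inv]
        field_simp
      · simp only [smul_smul, ← Complex.ofReal_mul]
        simp [ht])
    (fun q => by
      have : (t : ℂ) ≠ 0 := by exact_mod_cast ht
      simp only [dil_apply]
      refine Prod.ext ?_ (Prod.ext ?_ rfl)
      · rw [Complex.ofReal_inv]
        field_simp
      · simp only [smul_smul, ← Complex.ofReal_mul]
        simp [ht])

lemma finrank_jetKernel_comp_dil {ρ : Coord s r → ℝ} {t : ℝ} (ht : t ≠ 0) {q : Coord s r}
    (h : AnalyticAt ℝ ρ (dil t q)) :
    Module.finrank ℂ (jetKernel (fderiv ℝ (ρ ∘ dil t) q) (hess (ρ ∘ dil t) q))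
      = Module.finrank ℂ (jetKernel (fderiv ℝ ρ (dil t q)) (hess ρ (dil t q))) := by
  have ha : AnalyticAt ℂ (dil (s := s) (r := r) t) q := (dil t).analyticAt q
  have hf : fderiv ℂ (dil (s := s) (r := r) t) q = dil t := (dil t).fderiv
  refine finrank_eq_of_mem_iff (dilEquiv s r ht) fun v => ?_
  have he : ∀ v, dilEquiv s r ht v = dil t v := fun v => rfl
  rw [mem_jetKernel, mem_jetKernel, dC_fderiv_comp ha h, hf, he]
  refine and_congr_right fun _ => ⟨fun hy y hy0 => ?_, fun hy y hy0 => ?_⟩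
  · have h1 : dil t ((dilEquiv s r ht).symm y) = y := (dilEquiv s r ht).apply_symm_apply y
    have := hy ((dilEquiv s r ht).symm y) (by rw [dC_fderiv_comp ha h, hf, h1, hy0])
    rwa [lev_hess_comp ha h, hf, h1] at this
  · rw [dC_fderiv_comp ha h, hf] at hy0
    rw [lev_hess_comp ha h, hf]
    exact hy _ hy0

namespace DefiningEquation

variable (F : DefiningEquation s r)

/-- `P` as a function on the ambient space. -/
noncomputable def Pc (q : Coord s r) : ℝ := F.P q.2.1 q.2.2

/-- `Q` as a function on the ambient space. -/
noncomputable def Qc (q : Coord s r) : ℝ := F.Q (q.2.1, q.2.2, q.1.im)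

/-- The defining function of the model. -/
noncomputable def rho0 (q : Coord s r) : ℝ := q.1.re - F.Pc q

/-- The defining function of the hypersurface. -/
noncomputable def rho (q : Coord s r) : ℝ := F.rho0 q - F.Qc q

/-- `Q` composed with the dilations. -/
noncomputable def Qt (p : ℝ × Coord s r) : ℝ := F.Qc (dil p.1 p.2)

lemma mem_hypersurface_iff {q : Coord s r} : q ∈ F.hypersurface ↔ F.rho q = 0 := by
  rw [hypersurface, Set.mem_ofPred_eq, rho, rho0, Pc, Qc]
  constructor <;> intro h <;> linarith

lemma mem_model_iff {q : Coord s r} : q ∈ F.model ↔ F.rho0 q = 0 := by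
  rw [model, Set.mem_ofPred_eq, rho0, Pc]
  constructor <;> intro h <;> linarith

lemma P_smul (t : ℝ) (z : Fin s → ℂ) (ζ : Fin r → ℂ) :
    F.P ((t : ℂ) • z) ζ = t ^ 2 * F.P z ζ := by
  have h1 : star ((t : ℂ) • z) = (t : ℂ) • star z := by
    ext i; simp
  simp only [P, h1, Matrix.mulVec_smul, dotProduct_smul, smul_dotProduct, smul_eq_mul]
  simp only [Complex.re_ofReal_mul]
  ring

lemma Pc_dil (t : ℝ) (q : Coord s r) : F.Pc (dil t q) = t ^ 2 * F.Pc q := by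
  simp only [Pc, dil_apply, P_smul]

lemma rho0_dil (t : ℝ) (q : Coord s r) : F.rho0 (dil t q) = t ^ 2 * F.rho0 q := by
  rw [rho0, Pc_dil, dil_apply, ← Complex.ofReal_pow, Complex.re_ofReal_mul, rho0]
  ring

lemma analyticAt_Pc : ∀ᶠ q in 𝓝 (0 : Coord s r), AnalyticAt ℝ F.Pc q := by
  have hH : ∀ᶠ ζ in 𝓝 (0 : Fin r → ℂ), ∀ i j, AnalyticAt ℝ (fun ζ => F.H ζ i j) ζ :=
    eventually_all.2 fun i => eventually_all.2 fun j => (F.analytic_H i j).eventually_analyticAt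
  have hS : ∀ᶠ ζ in 𝓝 (0 : Fin r → ℂ), ∀ i j, AnalyticAt ℝ (fun ζ => F.S ζ i j) ζ :=
    eventually_all.2 fun i => eventually_all.2 fun j => (F.analytic_S i j).eventually_analyticAt
  have ht : Tendsto (fun q : Coord s r => q.2.2) (𝓝 0) (𝓝 0) :=
    (continuous_snd.comp continuous_snd).tendsto (0 : Coord s r)
  filter_upwards [ht.eventually hH, ht.eventually hS] with q h1 h2
  have hζ : AnalyticAt ℝ (fun q : Coord s r => q.2.2) q := analyticAt_snd.comp analyticAt_snd
  have hz : ∀ i, AnalyticAt ℝ (fun q : Coord s r => q.2.1 i) q := fun i =>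
    ((ContinuousLinearMap.proj (R := ℝ) (φ := fun _ : Fin s => ℂ) i).analyticAt _).comp
      (analyticAt_fst.comp analyticAt_snd : AnalyticAt ℝ (fun q : Coord s r => q.2.1) q)
  have hzc : ∀ i, AnalyticAt ℝ (fun q : Coord s r => star (q.2.1 i)) q := fun i =>
    (Complex.conjCLE.toContinuousLinearMap.analyticAt _).comp (hz i)
  have hre : ∀ f : Coord s r → ℂ, AnalyticAt ℝ f q → AnalyticAt ℝ (fun q => (f q).re) q :=
    fun f hf => (Complex.reCLM.analyticAt _).comp hf
  change AnalyticAt ℝ (fun q : Coord s r => (∑ i, q.2.1 i * ∑ j, F.H q.2.2 i j * star (q.2.1 j)).re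
    + (∑ i, star (q.2.1 i) * ∑ j, F.S q.2.2 i j * star (q.2.1 j)).re) q
  refine (hre _ ?_).add (hre _ ?_)
  · refine Finset.analyticAt_fun_sum _ fun i _ => (hz i).mul ?_
    refine Finset.analyticAt_fun_sum _ fun j _ => AnalyticAt.mul ?_ (hzc j)
    exact AnalyticAt.comp (g := fun ζ => F.H ζ i j) (f := fun q : Coord s r => q.2.2) (h1 i j) hζ
  · refine Finset.analyticAt_fun_sum _ fun i _ => (hzc i).mul ?_
    refine Finset.analyticAt_fun_sum _ fun j _ => AnalyticAt.mul ?_ (hzc j)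
    exact AnalyticAt.comp (g := fun ζ => F.S ζ i j) (f := fun q : Coord s r => q.2.2) (h2 i j) hζ

lemma analyticAt_graphVar (q : Coord s r) :
    AnalyticAt ℝ (fun q : Coord s r => ((q.2.1, q.2.2, q.1.im) : GraphVar s r)) q :=
  (analyticAt_fst.comp analyticAt_snd).prod ((analyticAt_snd.comp analyticAt_snd).prod
    ((Complex.imCLM.analyticAt _).comp analyticAt_fst))

lemma analyticAt_Qc : ∀ᶠ q in 𝓝 (0 : Coord s r), AnalyticAt ℝ F.Qc q := by
  have h : AnalyticAt ℝ F.Qc 0 :=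
    AnalyticAt.comp (f := fun q : Coord s r => ((q.2.1, q.2.2, q.1.im) : GraphVar s r))
      F.analytic_Q (analyticAt_graphVar (0 : Coord s r))
  exact h.eventually_analyticAt

lemma analyticAt_re (q : Coord s r) : AnalyticAt ℝ (fun q : Coord s r => q.1.re) q :=
  (Complex.reCLM.analyticAt _).comp analyticAt_fst

lemma analyticAt_rho0 : ∀ᶠ q in 𝓝 (0 : Coord s r), AnalyticAt ℝ F.rho0 q := by
  filter_upwards [F.analyticAt_Pc] with q hq using (analyticAt_re q).sub hq

lemma analyticAt_rho : ∀ᶠ q in 𝓝 (0 : Coord s r), AnalyticAt ℝ F.rho q := by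
  filter_upwards [F.analyticAt_rho0, F.analyticAt_Qc] with q h1 h2 using h1.sub h2

lemma isGraphFunction_rho0 : IsGraphFunction F.rho0 := fun q c => by
  simp [rho0, Pc, eW]; ring

lemma isGraphFunction_rho : IsGraphFunction F.rho := fun q c => by
  rw [rho, F.isGraphFunction_rho0, rho]
  simp [Qc, eW]; ring

/-- The weight condition on Q, for all ζ near 0, in the form suited to limits: order 3 in t, so that
division by t² still leaves something tending to 0. -/
lemma vanishesToOrder_Qt : ∀ᶠ q in 𝓝 (0 : Coord s r), VanishesToOrder 3 F.Qt q := by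
  have ht : Tendsto (fun q : Coord s r => q.2.2) (𝓝 0) (𝓝 0) :=
    (continuous_snd.comp continuous_snd).tendsto (0 : Coord s r)
  have h1 : Tendsto (fun p : Coord s r => dil 0 p) (𝓝 0) (𝓝 0) := by
    simpa using (dil (s := s) (r := r) 0).continuous.tendsto 0
  filter_upwards [ht.eventually F.weight_Q.eventually_nhds, h1.eventually
    F.analyticAt_Qc.eventually_nhds] with q hq hQ
  refine ⟨?_, fun j hj => ?_⟩
  · have h2 := (analyticAt_dil ((0 : ℝ), q)).continuousAt.eventually hQ
    filter_upwards [h2] with p hp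
    exact (AnalyticAt.comp (f := fun p : ℝ × Coord s r => dil p.1 p.2) hp
      (analyticAt_dil p)).contDiffAt
  · have h2 : Tendsto (fun q : Coord s r => q.2.2) (𝓝 q) (𝓝 q.2.2) :=
      (continuous_snd.comp continuous_snd).tendsto q
    filter_upwards [h2.eventually hq] with x hx
    have h3 := hx x.2.1 x.1.im j (by omega)
    rw [graphWeightPart, taylorCoeff, smul_eq_zero] at h3
    have h4 := h3.resolve_left (by positivity)
    rw [← h4]
    congr 1
    funext t
    simp only [Qt, Qc, dil_apply, ← Complex.ofReal_pow, Complex.im_ofReal_mul]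

end DefiningEquation

end Equations


/-! ### The jets of P and Q along the leaf w = z = 0 -/

section Leaf

variable {s r : ℕ}

lemma hess_comp_clm {E E' : Type*} [NormedAddCommGroup E] [NormedSpace ℂ E] [NormedAddCommGroup E']
    [NormedSpace ℂ E'] {f : E' → ℝ} (L : E →L[ℝ] E') {q : E} (h : AnalyticAt ℝ f (L q)) (x y : E) :
    hess (f ∘ L) q x y = hess f (L q) (L x) (L y) := by
  have h1 : fderiv ℝ (f ∘ L) =ᶠ[𝓝 q] fun q => (fderiv ℝ f (L q)).comp L := by
    filter_upwards [L.continuous.continuousAt.eventually h.eventually_analyticAt] with q hq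
    rw [fderiv_comp q hq.differentiableAt L.differentiableAt, L.fderiv]
  have h2 : HasFDerivAt (fun q => fderiv ℝ f (L q)) ((hess f (L q)).comp L) q :=
    h.fderiv.differentiableAt.hasFDerivAt.comp q L.hasFDerivAt
  have h3 := ((ContinuousLinearMap.compL ℝ E E' ℝ).flip L).hasFDerivAt.comp q h2
  rw [hess, h1.fderiv_eq]
  have h4 : fderiv ℝ (fun q => (fderiv ℝ f (L q)).comp L) q = _ := h3.fderiv
  rw [h4]
  rfl

/-- The dilations as real linear maps. -/
noncomputable def dilR (s r : ℕ) (t : ℝ) : Coord s r →L[ℝ] Coord s r :=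
  (dil t).restrictScalars ℝ

lemma dilR_apply (t : ℝ) (q : Coord s r) : dilR s r t q = dil t q := rfl

lemma dil_inV (t : ℝ) (ζ : Fin r → ℂ) : dil t (inV s r ζ) = inV s r ζ := by
  simp [dil_apply]

lemma dX_eq_fderiv {F X : Type*} [NormedAddCommGroup F] [NormedSpace ℝ F] [NormedAddCommGroup X]
    [NormedSpace ℝ X] {G : ℝ × X → F} {t : ℝ} {x : X} (h : DifferentiableAt ℝ G (t, x)) :
    dX G (t, x) = fderiv ℝ (fun x => G (t, x)) x := (hasFDerivAt_slice h).fderiv.symm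

lemma dX_dX_eq_hess {X : Type*} [NormedAddCommGroup X]
    [NormedSpace ℂ X] {G : ℝ × X → ℝ} {t : ℝ} {x : X}
    (h : ∀ᶠ p in 𝓝 (t, x), ContDiffAt ℝ ∞ G p) :
    dX (dX G) (t, x) = hess (fun x => G (t, x)) x := by
  have h1 : ContDiffAt ℝ ∞ (dX G) (t, x) :=
    (h.self_of_nhds.fderiv_right (m := ∞) (by simp)).clm_comp contDiffAt_const
  rw [dX_eq_fderiv (h1.differentiableAt (by simp)), hess]
  refine Filter.EventuallyEq.fderiv_eq ?_
  have h2 : Tendsto (fun x => (t, x)) (𝓝 x) (𝓝 (t, x)) :=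
    (Continuous.prodMk_right t).tendsto x
  filter_upwards [h2.eventually h] with y hy
  exact dX_eq_fderiv (hy.differentiableAt (by simp))

lemma tendsto_inV : Tendsto (inV s r) (𝓝 0) (𝓝 0) := by
  have := (inV s r).continuous.tendsto 0
  rwa [map_zero] at this

/-- Used to read off that a Taylor coefficient of weight `k` ≤ 2 vanishes. -/
lemma eq_zero_of_tendsto_pow {c : ℝ} {f : ℝ → ℝ} {k : ℕ} (hk : k ≤ 2)
    (hf : ∀ t, f t = t ^ k * c)
    (h : Tendsto (fun t : ℝ => (t ^ 2)⁻¹ * f t) (𝓝[≠] 0) (𝓝 0)) : c = 0 := by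
  have h1 : Tendsto (fun t : ℝ => t ^ (2 - k) * ((t ^ 2)⁻¹ * f t)) (𝓝[≠] 0) (𝓝 0) := by
    have h2 : Tendsto (fun t : ℝ => t ^ (2 - k)) (𝓝[≠] 0) (𝓝 (0 ^ (2 - k))) :=
      ((continuous_pow (2 - k)).tendsto (0 : ℝ)).mono_left nhdsWithin_le_nhds
    simpa using h2.mul h
  have h3 : Tendsto (fun t : ℝ => t ^ (2 - k) * ((t ^ 2)⁻¹ * f t)) (𝓝[≠] 0) (𝓝 c) := by
    refine tendsto_const_nhds.congr' ?_
    filter_upwards [self_mem_nhdsWithin] with t ht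
    have ht : t ≠ 0 := ht
    have h4 : t ^ 2 = t ^ (2 - k) * t ^ k := by rw [← pow_add]; congr 1; omega
    rw [hf, h4]
    field_simp
  exact tendsto_nhds_unique h3 h1

/-- A function whose differential vanishes along the leaf has a degenerate Hessian there. -/
lemma hess_inV_eq_zero {f : Coord s r → ℝ} {ℓ : Coord s r →L[ℝ] ℝ} (hf : AnalyticAt ℝ f 0)
    (h : ∀ᶠ ζ in 𝓝 (0 : Fin r → ℂ), fderiv ℝ f (inV s r ζ) = ℓ) :
    ∀ᶠ ζ in 𝓝 (0 : Fin r → ℂ), ∀ η, hess f (inV s r ζ) (inV s r η) = 0 := by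
  filter_upwards [h.eventually_nhds, tendsto_inV.eventually hf.eventually_analyticAt]
    with ζ h1 h2 η
  have h3 : HasFDerivAt (fun ζ => fderiv ℝ f (inV s r ζ))
      ((hess f (inV s r ζ)).comp ((inV s r).restrictScalars ℝ)) ζ :=
    h2.fderiv.differentiableAt.hasFDerivAt.comp ζ ((inV s r).restrictScalars ℝ).hasFDerivAt
  have h4 : HasFDerivAt (fun ζ => fderiv ℝ f (inV s r ζ))
      (0 : (Fin r → ℂ) →L[ℝ] (Coord s r →L[ℝ] ℝ)) ζ :=
    (hasFDerivAt_const ℓ ζ).congr_of_eventuallyEq h1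
  exact DFunLike.congr_fun (h3.unique h4) η

/-- The differential of `Re w`. -/
noncomputable def reW (s r : ℕ) : Coord s r →L[ℝ] ℝ :=
  Complex.reCLM.comp (ContinuousLinearMap.fst ℝ ℂ _)

@[simp] lemma reW_apply (q : Coord s r) : reW s r q = q.1.re := rfl

lemma dC_reW (q : Coord s r) : dC (reW s r) q = q.1 := by
  apply Complex.ext <;> simp [dC_apply]

lemma coord_split (x : Coord s r) :
    x = inU s r (x.1, 0) + inU s r (0, x.2.1) + inV s r x.2.2 := by
  simp

namespace DefiningEquation

variable (F : DefiningEquation s r)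

/-- Convergence of the rescaled jets of `Q`. -/
lemma tendsto_jets_Qt : ∀ᶠ q in 𝓝 (0 : Coord s r),
    Tendsto (fun t : ℝ => (t ^ 2)⁻¹ • fderiv ℝ (F.Qc ∘ dilR s r t) q) (𝓝[≠] 0) (𝓝 0) ∧
    Tendsto (fun t : ℝ => (t ^ 2)⁻¹ • hess (F.Qc ∘ dilR s r t) q) (𝓝[≠] 0) (𝓝 0) := by
  filter_upwards [F.vanishesToOrder_Qt] with q hq
  have ht : Tendsto (fun t : ℝ => t) (𝓝[≠] 0) (𝓝 0) := nhdsWithin_le_nhds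
  have hne : ∀ᶠ t : ℝ in 𝓝[≠] 0, t ≠ 0 := self_mem_nhdsWithin
  have h1 := hq.dX.tendsto_zero (m := 2) ht hne (tendsto_const_nhds (x := q))
  have h2 := hq.dX.dX.tendsto_zero (m := 2) ht hne (tendsto_const_nhds (x := q))
  have h3 : ∀ᶠ t : ℝ in 𝓝[≠] 0, ∀ᶠ p in 𝓝 (t, q), ContDiffAt ℝ ∞ F.Qt p := by
    have h4 : Tendsto (fun t : ℝ => (t, q)) (𝓝[≠] 0) (𝓝 (0, q)) :=
      ht.prodMk_nhds tendsto_const_nhds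
    exact h4.eventually hq.1.eventually_nhds
  refine ⟨h1.congr' ?_, h2.congr' ?_⟩
  · filter_upwards [h3] with t ht
    rw [dX_eq_fderiv (ht.self_of_nhds.differentiableAt (by simp))]
    rfl
  · filter_upwards [h3] with t ht
    rw [dX_dX_eq_hess ht]
    rfl

/-- The linear terms of Q at a point of the leaf have weight 2, 1 or 0 according to the direction w,
z or ζ, and Q has no terms of such weights. -/
lemma fderiv_Qc_leaf : ∀ᶠ ζ in 𝓝 (0 : Fin r → ℂ), fderiv ℝ F.Qc (inV s r ζ) = 0 := by
  filter_upwards [tendsto_inV.eventually F.tendsto_jets_Qt, tendsto_inV.eventually F.analyticAt_Qc]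
    with ζ h1 h2
  have h3 : ∀ t x, fderiv ℝ (F.Qc ∘ dilR s r t) (inV s r ζ) x
      = fderiv ℝ F.Qc (inV s r ζ) (dil t x) := fun t x => by
    have h4 : dilR s r t (inV s r ζ) = inV s r ζ := dil_inV t ζ
    rw [fderiv_comp _ (by rw [h4]; exact h2.differentiableAt) (dilR s r t).differentiableAt,
      ContinuousLinearMap.fderiv, h4]
    rfl
  have h5 : ∀ x, Tendsto (fun t : ℝ => (t ^ 2)⁻¹ * fderiv ℝ F.Qc (inV s r ζ) (dil t x))
      (𝓝[≠] 0) (𝓝 0) := fun x => by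
    have := tendsto_clm_apply h1.1 (tendsto_const_nhds (x := x))
    simpa only [smul_apply, h3, smul_eq_mul, zero_apply] using this
  have hw : ∀ w : ℂ, fderiv ℝ F.Qc (inV s r ζ) (inU s r (w, 0)) = 0 := fun w =>
    eq_zero_of_tendsto_pow (k := 2) le_rfl (fun t => by
      have : dil t (inU s r (w, 0)) = t ^ 2 • inU s r (w, 0) := by
        simp [dil_apply]
      rw [this, map_smul, smul_eq_mul]) (h5 _)
  have hz : ∀ z : Fin s → ℂ, fderiv ℝ F.Qc (inV s r ζ) (inU s r (0, z)) = 0 := fun z =>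
    eq_zero_of_tendsto_pow (k := 1) (by norm_num) (fun t => by
      have : dil t (inU s r (0, z)) = t • inU s r (0, z) := by
        simp [dil_apply]
      rw [this, map_smul, smul_eq_mul, pow_one]) (h5 _)
  have hζ : ∀ η : Fin r → ℂ, fderiv ℝ F.Qc (inV s r ζ) (inV s r η) = 0 := fun η =>
    eq_zero_of_tendsto_pow (k := 0) (by norm_num) (fun t => by
      rw [dil_inV, pow_zero, one_mul]) (h5 _)
  refine ContinuousLinearMap.ext fun x => ?_
  rw [coord_split x, map_add, map_add, hw, hz, hζ]
  simp

/-- Terms quadratic in z have weight 2. -/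
lemma hess_Qc_leaf : ∀ᶠ ζ in 𝓝 (0 : Fin r → ℂ), ∀ z z' : Fin s → ℂ,
    hess F.Qc (inV s r ζ) (inU s r (0, z)) (inU s r (0, z')) = 0 := by
  filter_upwards [tendsto_inV.eventually F.tendsto_jets_Qt, tendsto_inV.eventually F.analyticAt_Qc]
    with ζ h1 h2 z z'
  have h3 : ∀ t, hess (F.Qc ∘ dilR s r t) (inV s r ζ) (inU s r (0, z)) (inU s r (0, z'))
      = t ^ 2 * hess F.Qc (inV s r ζ) (inU s r (0, z)) (inU s r (0, z')) := fun t => by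
    have h4 : dilR s r t (inV s r ζ) = inV s r ζ := dil_inV t ζ
    have h5 : ∀ z : Fin s → ℂ, dilR s r t (inU s r (0, z)) = t • inU s r (0, z) := fun z => by
      simp [dilR_apply, dil_apply]
    rw [hess_comp_clm _ (by rwa [h4]), h4, h5, h5]
    simp only [map_smul, smul_apply, smul_eq_mul]
    ring
  refine eq_zero_of_tendsto_pow (k := 2) le_rfl h3 ?_
  have := tendsto_clm_apply (tendsto_clm_apply h1.2 (tendsto_const_nhds (x := inU s r (0, z))))
    (tendsto_const_nhds (x := inU s r (0, z')))
  simpa only [smul_apply, smul_eq_mul, zero_apply] using this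

/-- P is multiplied by 4 under the dilation by 2, while a differential in the directions z or ζ is
multiplied by 2 or 1. In the direction w, where weights would not exclude it, P is constant. -/
lemma fderiv_Pc_leaf : ∀ᶠ ζ in 𝓝 (0 : Fin r → ℂ), fderiv ℝ F.Pc (inV s r ζ) = 0 := by
  filter_upwards [tendsto_inV.eventually F.analyticAt_Pc] with ζ h2
  have h3 : ∀ x, fderiv ℝ F.Pc (inV s r ζ) (dil 2 x) = 4 * fderiv ℝ F.Pc (inV s r ζ) x :=
    fun x => by
    have h4 : dilR s r 2 (inV s r ζ) = inV s r ζ := dil_inV 2 ζ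
    have h5 : F.Pc ∘ dilR s r 2 = fun q => (4 : ℝ) * F.Pc q := funext fun q => by
      rw [Function.comp_apply, dilR_apply, Pc_dil]; norm_num
    have h6 := fderiv_comp (inV s r ζ) (g := F.Pc) (f := dilR s r 2)
      (by rw [h4]; exact h2.differentiableAt) (dilR s r 2).differentiableAt
    rw [h5, ContinuousLinearMap.fderiv, h4, fderiv_const_mul h2.differentiableAt] at h6
    exact (DFunLike.congr_fun h6 x).symm
  have hw : ∀ w : ℂ, fderiv ℝ F.Pc (inV s r ζ) (inU s r (w, 0)) = 0 := fun w => by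
    have h4 : HasDerivAt (fun c : ℝ => F.Pc (inV s r ζ + c • ((w, 0, 0) : Coord s r)))
        (fderiv ℝ F.Pc (inV s r ζ) ((w, 0, 0) : Coord s r)) 0 := by
      have h5 : HasDerivAt (fun c : ℝ => inV s r ζ + c • ((w, 0, 0) : Coord s r))
          ((w, 0, 0) : Coord s r) 0 := by
        simpa using ((hasDerivAt_id (0 : ℝ)).smul_const ((w, 0, 0) : Coord s r)).const_add
          (inV s r ζ)
      have h7 : HasFDerivAt F.Pc (fderiv ℝ F.Pc (inV s r ζ))
          (inV s r ζ + (0 : ℝ) • ((w, 0, 0) : Coord s r)) := by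
        rw [zero_smul, add_zero]
        exact h2.differentiableAt.hasFDerivAt
      exact HasFDerivAt.comp_hasDerivAt
        (f := fun c : ℝ => inV s r ζ + c • ((w, 0, 0) : Coord s r)) 0 h7 h5
    have h6 : (fun c : ℝ => F.Pc (inV s r ζ + c • ((w, 0, 0) : Coord s r)))
        = fun _ => F.Pc (inV s r ζ) := by
      funext c; simp [Pc]
    rw [h6] at h4
    exact h4.unique (hasDerivAt_const _ _)
  have hz : ∀ z : Fin s → ℂ, fderiv ℝ F.Pc (inV s r ζ) (inU s r (0, z)) = 0 := fun z => by
    have := h3 (inU s r (0, z))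
    have h4 : dil 2 (inU s r (0, z)) = (2 : ℝ) • inU s r (0, z) := by
      rw [dil_apply, ← Complex.coe_smul]
      simp
    rw [h4, map_smul, smul_eq_mul] at this
    linarith
  have hζ : ∀ η : Fin r → ℂ, fderiv ℝ F.Pc (inV s r ζ) (inV s r η) = 0 := fun η => by
    have := h3 (inV s r η)
    rw [dil_inV] at this
    linarith
  refine ContinuousLinearMap.ext fun x => ?_
  rw [coord_split x, map_add, map_add, hw, hz, hζ]
  simp

lemma fderiv_rho0_leaf : ∀ᶠ ζ in 𝓝 (0 : Fin r → ℂ), fderiv ℝ F.rho0 (inV s r ζ) = reW s r := by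
  filter_upwards [tendsto_inV.eventually F.analyticAt_Pc, F.fderiv_Pc_leaf] with ζ h1 h2
  have := (reW s r).hasFDerivAt.sub (h1.differentiableAt.hasFDerivAt)
  rw [h2, sub_zero] at this
  exact this.fderiv

lemma fderiv_rho_leaf : ∀ᶠ ζ in 𝓝 (0 : Fin r → ℂ), fderiv ℝ F.rho (inV s r ζ) = reW s r := by
  filter_upwards [tendsto_inV.eventually F.analyticAt_rho0,
    tendsto_inV.eventually F.analyticAt_Qc, F.fderiv_rho0_leaf, F.fderiv_Qc_leaf] with ζ h1 h2 h3 h4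
  have := h1.differentiableAt.hasFDerivAt.sub (h2.differentiableAt.hasFDerivAt)
  rw [h3, h4, sub_zero] at this
  exact this.fderiv

lemma rho0_leaf (ζ : Fin r → ℂ) : F.rho0 (inV s r ζ) = 0 := by
  have := F.rho0_dil 0 (inV s r ζ)
  rw [dil_inV] at this
  simpa using this

lemma rho_leaf : ∀ᶠ ζ in 𝓝 (0 : Fin r → ℂ), F.rho (inV s r ζ) = 0 := by
  filter_upwards [F.weight_Q] with ζ h
  have h1 := h 0 0 0 (by norm_num)
  simp only [graphWeightPart, taylorCoeff, iteratedDeriv_zero] at h1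
  rw [rho, rho0_leaf, Qc]
  simpa using h1

lemma isDefiningFunctionAt_rho : IsDefiningFunctionAt F.hypersurface 0 F.rho := by
  refine ⟨F.analyticAt_rho.self_of_nhds, ?_, Eventually.of_forall fun q => F.mem_hypersurface_iff⟩
  have h := F.fderiv_rho_leaf.self_of_nhds
  rw [map_zero] at h
  rw [h]
  intro h0
  have := DFunLike.congr_fun h0 (eW s r)
  simp [eW] at this

lemma isDefiningFunctionAt_rho0 : IsDefiningFunctionAt F.model 0 F.rho0 := by
  refine ⟨F.analyticAt_rho0.self_of_nhds, ?_, Eventually.of_forall fun q => F.mem_model_iff⟩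
  have h := F.fderiv_rho0_leaf.self_of_nhds
  rw [map_zero] at h
  rw [h]
  intro h0
  have := DFunLike.congr_fun h0 (eW s r)
  simp [eW] at this

end DefiningEquation

end Leaf


/-! ### Normalized defining functions; the Levi rank of the model -/

section Normalized

variable {s r : ℕ}

/-- Euler's identity on the line through x, differentiated once more at 0. -/
lemma hess_of_homogeneous {E : Type*} [NormedAddCommGroup E] [NormedSpace ℂ E] {f : E → ℝ}
    (hf : AnalyticAt ℝ f 0) {x : E} (h : ∀ t : ℝ, f (t • x) = t ^ 2 * f x) :
    hess f 0 x x = 2 * f x := by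
  have hline : ∀ t : ℝ, HasDerivAt (fun t : ℝ => t • x) x t := fun t => by
    simpa using (hasDerivAt_id t).smul_const x
  have ht : Tendsto (fun t : ℝ => t • x) (𝓝 0) (𝓝 0) := by
    simpa using (hline 0).continuousAt.tendsto
  have h1 : ∀ᶠ t : ℝ in 𝓝 0, fderiv ℝ f (t • x) x = 2 * t * f x := by
    filter_upwards [ht.eventually hf.eventually_analyticAt] with t ht
    have h2 := HasFDerivAt.comp_hasDerivAt (f := fun t : ℝ => t • x) t
      ht.differentiableAt.hasFDerivAt (hline t)
    have h3 : HasDerivAt (fun t : ℝ => f (t • x)) (2 * t * f x) t := by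
      rw [funext h]
      simpa using (hasDerivAt_pow 2 t).mul_const (f x)
    exact h2.unique h3
  have h4 : HasDerivAt (fun t : ℝ => fderiv ℝ f (t • x) x) (hess f 0 x x) 0 := by
    have h5 : HasFDerivAt (fun q => fderiv ℝ f q x) ((hess f 0).flip x) ((0 : ℝ) • x) := by
      rw [zero_smul]
      have := hf.fderiv.differentiableAt.hasFDerivAt.clm_apply (hasFDerivAt_const x (0 : E))
      refine this.congr_fderiv ?_
      ext y; simp [hess]
    exact HasFDerivAt.comp_hasDerivAt (f := fun t : ℝ => t • x) 0 h5 (hline 0)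
  have h6 : HasDerivAt (fun t : ℝ => fderiv ℝ f (t • x) x) (2 * f x) 0 := by
    refine HasDerivAt.congr_of_eventuallyEq ?_ h1
    simpa using ((hasDerivAt_id (0 : ℝ)).const_mul 2).mul_const (f x)
  exact h4.unique h6

lemma tendsto_sub_of_tendsto_zero {G ι : Type*} [NormedAddCommGroup G] {l : Filter ι} {f : ι → G}
    (c : G) (h : Tendsto f l (𝓝 0)) : Tendsto (fun i => c - f i) l (𝓝 c) := by
  simpa using h.const_sub c

lemma inv_smul_smul_sub {G : Type*} [NormedAddCommGroup G] [NormedSpace ℝ G] {c : ℝ} (hc : c ≠ 0)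
    (x y : G) : c⁻¹ • (c • x - y) = x - c⁻¹ • y := by
  rw [smul_sub, smul_smul, inv_mul_cancel₀ hc, one_smul]

/-- The map `jetMap` of the jet of a function. -/
noncomputable def jetMapAt (ρ : Coord s r → ℝ) (q : Coord s r) : Coord s r →L[ℂ] CoordU s :=
  jetMap (fderiv ℝ ρ q) (hess ρ q)

/-- The frame of the Levi kernels of the level sets of `ρ`. -/
noncomputable def frame (ρ : Coord s r → ℝ) (q : Coord s r) : (Fin r → ℂ) →L[ℂ] CoordU s :=
  frameMap (jetMapAt ρ q)

/-- Defining functions with the leaf `{w = z = 0}` in the Levi foliation. -/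
structure IsNormalized (ρ : Coord s r → ℝ) : Prop where
  analytic : AnalyticAt ℝ ρ 0
  graph : IsGraphFunction ρ
  leaf : ∀ᶠ ζ in 𝓝 (0 : Fin r → ℂ), ρ (inV s r ζ) = 0
  fderiv_leaf : ∀ᶠ ζ in 𝓝 (0 : Fin r → ℂ), fderiv ℝ ρ (inV s r ζ) = reW s r
  invertible : ((jetMapAt ρ 0).comp (inU s r)).IsInvertible
  rank : ∀ᶠ q in 𝓝 (0 : Coord s r),
    Module.finrank ℂ (jetKernel (fderiv ℝ ρ q) (hess ρ q)) = r

variable {ρ : Coord s r → ℝ}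

lemma contDiffAt_jetMapAt {q : Coord s r} (h : AnalyticAt ℝ ρ q) :
    ContDiffAt ℝ ∞ (jetMapAt ρ) q :=
  ContDiffAt.comp (g := fun J : (Coord s r →L[ℝ] ℝ) ×
    (Coord s r →L[ℝ] Coord s r →L[ℝ] ℝ) => jetMap J.1 J.2)
    (f := fun q => (fderiv ℝ ρ q, hess ρ q)) q contDiff_jetMap.contDiffAt
    (h.fderiv.contDiffAt.prodMk h.fderiv.fderiv.contDiffAt)

lemma eventually_invertible {q : Coord s r} (h : AnalyticAt ℝ ρ q)
    (hT : ((jetMapAt ρ q).comp (inU s r)).IsInvertible) :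
    ∀ᶠ q in 𝓝 q, ((jetMapAt ρ q).comp (inU s r)).IsInvertible :=
  (contDiffAt_jetMapAt h).continuousAt.eventually (eventually_isInvertible hT)

lemma contDiffAt_frame {q : Coord s r} (h : AnalyticAt ℝ ρ q)
    (hT : ((jetMapAt ρ q).comp (inU s r)).IsInvertible) : ContDiffAt ℝ ∞ (frame ρ) q :=
  (contDiffAt_frameMap hT).comp q (contDiffAt_jetMapAt h)

namespace IsNormalized

lemma smooth_frame (h : IsNormalized ρ) : ∀ᶠ q in 𝓝 0, ContDiffAt ℝ ∞ (frame ρ) q := by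
  filter_upwards [h.analytic.eventually_analyticAt, eventually_invertible h.analytic h.invertible]
    with q h1 h2 using contDiffAt_frame h1 h2

lemma jetKernel_eq (h : IsNormalized ρ) : ∀ᶠ q in 𝓝 0, jetKernel (fderiv ℝ ρ q) (hess ρ q)
    = LinearMap.range (graphMap (frame ρ q) : (Fin r → ℂ) →ₗ[ℂ] Coord s r) := by
  filter_upwards [h.rank, eventually_invertible h.analytic h.invertible] with q h1 h2
    using jetKernel_eq_range h2 h1

/-- The differential of ρ is constant along the leaf, so the Hessian kills leaf directions: the leaf
is tangent to the Levi kernels. -/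
lemma jetMapAt_leaf (h : IsNormalized ρ) : ∀ᶠ ζ in 𝓝 (0 : Fin r → ℂ), ∀ η,
    jetMapAt ρ (inV s r ζ) (inV s r η) = 0 := by
  filter_upwards [hess_inV_eq_zero h.analytic h.fderiv_leaf, h.fderiv_leaf] with ζ h1 h2 η
  have h3 : ∀ y, lev (hess ρ (inV s r ζ)) (inV s r η) y = 0 := fun y => by
    have : Complex.I • inV s r η = inV s r (Complex.I • η) := ((inV s r).map_smul _ _).symm
    rw [lev, this, h1, h1]; simp
  refine jetMap_eq_zero_of_mem_jetKernel ⟨?_, fun y _ => h3 y⟩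
  rw [h2, dC_reW]; rfl

lemma frame_leaf (h : IsNormalized ρ) : ∀ᶠ ζ in 𝓝 (0 : Fin r → ℂ),
    frame ρ (inV s r ζ) = 0 := by
  filter_upwards [h.jetMapAt_leaf] with ζ h1
  have : (jetMapAt ρ (inV s r ζ)).comp (inV s r) = 0 := ContinuousLinearMap.ext h1
  rw [frame, frameMap, this, ContinuousLinearMap.comp_zero, neg_zero]

lemma zero (h : IsNormalized ρ) : ρ 0 = 0 := by
  simpa [-inV_apply] using h.leaf.self_of_nhds

lemma fderiv_zero (h : IsNormalized ρ) : fderiv ℝ ρ 0 = reW s r := by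
  simpa [-inV_apply] using h.fderiv_leaf.self_of_nhds

end IsNormalized

namespace DefiningEquation

variable (F : DefiningEquation s r)

-- Replacing z by iz preserves the Hermitian part of P and changes the sign of the part with S.
open Matrix in
lemma P_add_P_I (z : Fin s → ℂ) (ζ : Fin r → ℂ) :
    F.P z ζ + F.P (Complex.I • z) ζ = 2 * (z ⬝ᵥ (F.H ζ *ᵥ star z)).re := by
  have h1 : star (Complex.I • z) = -(Complex.I • star z) := by
    ext i; simp
  simp only [P, h1, Matrix.mulVec_neg, Matrix.mulVec_smul, dotProduct_neg, dotProduct_smul,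
    smul_dotProduct, neg_dotProduct, smul_eq_mul, mul_neg]
  have h2 : ∀ c : ℂ, Complex.I * (Complex.I * c) = -c := fun c => by
    rw [← mul_assoc, Complex.I_mul_I, neg_one_mul]
  simp only [h2, neg_neg, Complex.neg_re]
  ring

lemma rho0_inU (z : Fin s → ℂ) : F.rho0 (inU s r (0, z)) = -F.P z 0 := by
  simp [rho0, Pc]

-- The Hessian of −P at 0 is recovered by polarization, and its Levi form sees only H; the factor 4
-- combines 2 from the Hessian with 2 from `P_add_P_I`.
open Matrix in
lemma levC_rho0 (z z' : Fin s → ℂ) : levC (hess F.rho0 0) (inU s r (0, z')) (inU s r (0, z))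
    = -4 * (z ⬝ᵥ (F.H 0 *ᵥ star z')) := by
  have hf := F.analyticAt_rho0.self_of_nhds
  have h1 : ∀ z : Fin s → ℂ, hess F.rho0 0 (inU s r (0, z)) (inU s r (0, z)) = -2 * F.P z 0 :=
    fun z => by
    rw [hess_of_homogeneous hf (x := inU s r (0, z)), rho0_inU]
    · ring
    · intro t
      have : t • inU s r (0, z) = dil t (inU s r (0, z)) := by
        rw [dil_apply, ← Complex.coe_smul]; simp
      rw [this, rho0_dil]
  have h2 : ∀ z z' : Fin s → ℂ, hess F.rho0 0 (inU s r (0, z)) (inU s r (0, z'))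
      = -F.P (z + z') 0 + F.P z 0 + F.P z' 0 := fun z z' => by
    have h3 := h1 (z + z')
    have h4 : inU s r (0, z + z') = inU s r (0, z) + inU s r (0, z') := by simp
    rw [h4] at h3
    simp only [map_add, _root_.add_apply] at h3
    have h5 := hess_symm hf (inU s r (0, z')) (inU s r (0, z))
    have h6 := h1 z
    have h7 := h1 z'
    simp only [hess] at h3 h5 h6 h7 ⊢
    linarith
  have hI : ∀ z : Fin s → ℂ, Complex.I • inU s r (0, z) = inU s r (0, Complex.I • z) :=
    fun z => by simp
  have hH : ∀ z z' : Fin s → ℂ, (z' ⬝ᵥ (F.H 0 *ᵥ star z)).re = (z ⬝ᵥ (F.H 0 *ᵥ star z')).re :=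
    fun z z' => by
    have h3 : star (z ⬝ᵥ (F.H 0 *ᵥ star z')) = z' ⬝ᵥ (F.H 0 *ᵥ star z) := by
      rw [← star_dotProduct_star, Matrix.star_mulVec, star_star, F.hermitian_H.self_of_nhds.eq,
        ← Matrix.dotProduct_mulVec]
    rw [← h3]; simp
  have h8 : ∀ z z' : Fin s → ℂ, lev (hess F.rho0 0) (inU s r (0, z)) (inU s r (0, z'))
      = -4 * (z ⬝ᵥ (F.H 0 *ᵥ star z')).re := fun z z' => by
    rw [lev, hI, hI, h2, h2, ← smul_add]
    have e1 := F.P_add_P_I (z + z') 0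
    have e2 := F.P_add_P_I z 0
    have e3 := F.P_add_P_I z' 0
    simp only [star_add, Matrix.mulVec_add, dotProduct_add, add_dotProduct, Complex.add_re] at e1
    have e4 := hH z z'
    linarith
  rw [levC_apply, hI, h8, h8]
  have h9 : star (Complex.I • z') = -(Complex.I • star z') := by
    ext i; simp
  rw [h9, Matrix.mulVec_neg, Matrix.mulVec_smul, dotProduct_neg, dotProduct_smul]
  apply Complex.ext <;> simp

lemma levC_eq_of_lev_eq {B B' : Coord s r →L[ℝ] Coord s r →L[ℝ] ℝ}
    (h : ∀ z z' : Fin s → ℂ, B (inU s r (0, z)) (inU s r (0, z'))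
      = B' (inU s r (0, z)) (inU s r (0, z'))) (z z' : Fin s → ℂ) :
    levC B (inU s r (0, z)) (inU s r (0, z')) = levC B' (inU s r (0, z)) (inU s r (0, z')) := by
  have hI : ∀ z : Fin s → ℂ, Complex.I • inU s r (0, z) = inU s r (0, Complex.I • z) :=
    fun z => by simp
  simp only [levC_apply, lev, hI, h]

lemma jetMap_inU {B : Coord s r →L[ℝ] Coord s r →L[ℝ] ℝ} (u : CoordU s) :
    jetMap (reW s r) B (inU s r u) = (u.1, fun j => levC B (eZ s r j) (inU s r u)) := by
  refine Prod.ext ?_ (funext fun j => ?_)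
  · rw [jetMap_fst, dC_reW]; rfl
  · rw [jetMap_snd, dC_reW, dC_reW]
    simp [eW, eZ]

/-- On the (w, z)-space the map is block triangular, with 1 for w and a multiple of H(0,0) for z.
Only the Levi form in the z-directions matters, so the lemma serves both M and its model. -/
lemma isInvertible_of_levC {B : Coord s r →L[ℝ] Coord s r →L[ℝ] ℝ}
    (h : ∀ z z' : Fin s → ℂ, levC B (inU s r (0, z)) (inU s r (0, z'))
      = levC (hess F.rho0 0) (inU s r (0, z)) (inU s r (0, z'))) :
    ((jetMap (reW s r) B).comp (inU s r)).IsInvertible := by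
  have hinj : Function.Injective ((jetMap (reW s r) B).comp (inU s r) : CoordU s →ₗ[ℂ] CoordU s) := by
    rw [← LinearMap.ker_eq_bot, LinearMap.ker_eq_bot']
    intro u hu
    have h1 : jetMap (reW s r) B (inU s r u) = 0 := hu
    rw [jetMap_inU] at h1
    have hu1 : u.1 = 0 := congrArg Prod.fst h1
    obtain ⟨w, z⟩ := u
    simp only at hu1
    subst hu1
    have h2 : Matrix.vecMul z (F.H 0) = 0 := by
      funext j
      have h3 : levC B (eZ s r j) (inU s r (0, z)) = 0 := congrFun (congrArg Prod.snd h1) j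
      have h4 : eZ s r j = inU s r (0, Pi.single j 1) := by simp [eZ]
      have h5 : star (Pi.single j 1 : Fin s → ℂ) = Pi.single j 1 := by
        ext i
        by_cases hij : i = j
        · subst hij; simp
        · simp [hij]
      rw [h4, h, levC_rho0, h5] at h3
      simp only [Matrix.mulVec_single_one, mul_eq_zero, neg_eq_zero, OfNat.ofNat_ne_zero,
        false_or] at h3
      exact h3
    have h3 := Matrix.eq_zero_of_vecMul_eq_zero F.nondegenerate_H h2
    rw [h3]; rfl
  exact ⟨(LinearEquiv.ofInjectiveEndo _ hinj).toContinuousLinearEquiv, ContinuousLinearMap.ext fun _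
      => rfl⟩

lemma invertible_rho0 : ((jetMapAt F.rho0 0).comp (inU s r)).IsInvertible := by
  have h := F.fderiv_rho0_leaf.self_of_nhds
  rw [map_zero] at h
  rw [jetMapAt, h]
  exact F.isInvertible_of_levC fun _ _ => rfl

lemma hess_rho : ∀ᶠ q in 𝓝 0, hess F.rho q = hess F.rho0 q - hess F.Qc q := by
  filter_upwards [F.analyticAt_rho0.eventually_nhds, F.analyticAt_Qc.eventually_nhds] with q h1 h2
  have h3 : fderiv ℝ F.rho =ᶠ[𝓝 q] fun q => fderiv ℝ F.rho0 q - fderiv ℝ F.Qc q := by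
    filter_upwards [h1, h2] with q h1 h2
    exact fderiv_sub h1.differentiableAt h2.differentiableAt
  rw [hess, h3.fderiv_eq]
  exact fderiv_sub h1.self_of_nhds.fderiv.differentiableAt h2.self_of_nhds.fderiv.differentiableAt

lemma hess_rho_zero (z z' : Fin s → ℂ) : hess F.rho 0 (inU s r (0, z)) (inU s r (0, z'))
    = hess F.rho0 0 (inU s r (0, z)) (inU s r (0, z')) := by
  have h := F.hess_Qc_leaf.self_of_nhds z z'
  rw [map_zero] at h
  rw [F.hess_rho.self_of_nhds, sub_apply, sub_apply, h, sub_zero]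

lemma invertible_rho : ((jetMapAt F.rho 0).comp (inU s r)).IsInvertible := by
  have h := F.fderiv_rho_leaf.self_of_nhds
  rw [map_zero] at h
  rw [jetMapAt, h]
  exact F.isInvertible_of_levC (levC_eq_of_lev_eq F.hess_rho_zero)

variable {F}

lemma isNormalized_rho (hM : HasConstantLeviRankNear F.hypersurface 0 s) : IsNormalized F.rho where
  analytic := F.analyticAt_rho.self_of_nhds
  graph := F.isGraphFunction_rho
  leaf := F.rho_leaf
  fderiv_leaf := F.fderiv_rho_leaf
  invertible := F.invertible_rho
  rank := F.isGraphFunction_rho.finrank_jetKernel F.isDefiningFunctionAt_rho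
    (by have := F.rho_leaf.self_of_nhds; rwa [map_zero] at this) hM

/-- At a fixed q near 0 the 2-jets of t⁻² ρ ∘ `dil t` converge to that of ρ₀. For small t ≠ 0 the
kernel has dimension r, because `dil t` is biholomorphic and the rank condition holds near 0. Having
dimension r is closed by `finrank_jetKernel_of_tendsto`. -/
lemma finrank_jetKernel_rho0 (hM : HasConstantLeviRankNear F.hypersurface 0 s) :
    ∀ᶠ q in 𝓝 (0 : Coord s r),
      Module.finrank ℂ (jetKernel (fderiv ℝ F.rho0 q) (hess F.rho0 q)) = r := by
  have h1 : Tendsto (fun p : Coord s r => dil 0 p) (𝓝 0) (𝓝 0) := by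
    have := (dil (s := s) (r := r) 0).continuous.tendsto 0
    rwa [map_zero] at this
  filter_upwards [F.analyticAt_rho0, F.tendsto_jets_Qt, h1.eventually
    ((isNormalized_rho hM).rank.and (F.analyticAt_Qc.and F.analyticAt_rho)).eventually_nhds,
    eventually_dC_ne F.analyticAt_rho0.self_of_nhds
      (F.isGraphFunction_rho0.dC_eW F.analyticAt_rho0.self_of_nhds.differentiableAt),
    eventually_invertible F.analyticAt_rho0.self_of_nhds F.invertible_rho0]
    with q h2 h3 h4 h5 h6
  have h7 : Tendsto (fun t : ℝ => dil t q) (𝓝[≠] 0) (𝓝 (dil 0 q)) :=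
    ((contDiff_dil.continuous.comp (Continuous.prodMk_left q)).tendsto 0).mono_left
      nhdsWithin_le_nhds
  have h8 := h7.eventually h4
  have hne : ∀ᶠ t : ℝ in 𝓝[≠] 0, t ≠ 0 := self_mem_nhdsWithin
  have key : ∀ t : ℝ, F.rho ∘ dil t = fun q => t ^ 2 * F.rho0 q - (F.Qc ∘ dilR s r t) q :=
    fun t => funext fun q => by
      rw [Function.comp_apply, rho, rho0_dil]; rfl
  have hcomp : ∀ t q, AnalyticAt ℝ F.Qc (dil t q) → AnalyticAt ℝ (F.Qc ∘ dilR s r t) q :=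
    fun t q h => h.comp ((dilR s r t).analyticAt q)
  have hD : ∀ t q, AnalyticAt ℝ F.rho0 q → AnalyticAt ℝ F.Qc (dil t q) →
      fderiv ℝ (F.rho ∘ dil t) q = t ^ 2 • fderiv ℝ F.rho0 q - fderiv ℝ (F.Qc ∘ dilR s r t) q :=
    fun t q h h' => by
      rw [key]
      exact ((h.differentiableAt.hasFDerivAt.const_mul (t ^ 2)).sub
        (hcomp t q h').differentiableAt.hasFDerivAt).fderiv
  have hD2 : ∀ t, AnalyticAt ℝ F.Qc (dil t q) →
      hess (F.rho ∘ dil t) q = t ^ 2 • hess F.rho0 q - hess (F.Qc ∘ dilR s r t) q := fun t h' => by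
    have h9 : fderiv ℝ (F.rho ∘ dil t) =ᶠ[𝓝 q]
        fun q => t ^ 2 • fderiv ℝ F.rho0 q - fderiv ℝ (F.Qc ∘ dilR s r t) q := by
      filter_upwards [h2.eventually_analyticAt,
        (dil (s := s) (r := r) t).continuous.continuousAt.eventually h'.eventually_analyticAt]
        with x h h' using hD t x h h'
    rw [hess, h9.fderiv_eq]
    exact ((h2.fderiv.differentiableAt.hasFDerivAt.const_smul (t ^ 2)).sub
      (hcomp t q h').fderiv.differentiableAt.hasFDerivAt).fderiv
  refine finrank_jetKernel_of_tendsto (f := 𝓝[≠] (0 : ℝ))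
    (ℓ := fun t => (t ^ 2)⁻¹ • fderiv ℝ (F.rho ∘ dil t) q)
    (B := fun t => (t ^ 2)⁻¹ • hess (F.rho ∘ dil t) q) ?_ ?_ h5 h6 ?_
  · have := h3.1.const_sub (fderiv ℝ F.rho0 q)
    rw [sub_zero] at this
    refine this.congr' ?_
    filter_upwards [h8, hne] with t ht htne
    rw [hD t q h2 ht.2.1, smul_sub, smul_smul, inv_mul_cancel₀ (pow_ne_zero 2 htne),
      one_smul]
  · have := tendsto_sub_of_tendsto_zero (G := Coord s r →L[ℝ] Coord s r →L[ℝ] ℝ)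
      (hess F.rho0 q) h3.2
    refine this.congr' ?_
    filter_upwards [h8, hne] with t ht htne
    rw [hD2 t ht.2.1]
    exact (inv_smul_smul_sub (G := Coord s r →L[ℝ] Coord s r →L[ℝ] ℝ)
      (pow_ne_zero 2 htne) _ _).symm
  · filter_upwards [h8, hne] with t ht htne
    rw [jetKernel_smul (inv_ne_zero (pow_ne_zero 2 htne)),
      finrank_jetKernel_comp_dil htne ht.2.2]
    exact ht.1

lemma isNormalized_rho0 (hM : HasConstantLeviRankNear F.hypersurface 0 s) :
    IsNormalized F.rho0 where
  analytic := F.analyticAt_rho0.self_of_nhds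
  graph := F.isGraphFunction_rho0
  leaf := Eventually.of_forall F.rho0_leaf
  fderiv_leaf := F.fderiv_rho0_leaf
  invertible := F.invertible_rho0
  rank := finrank_jetKernel_rho0 hM

/-- The model has constant Levi rank. -/
lemma hasConstantLeviRankNear_model (hM : HasConstantLeviRankNear F.hypersurface 0 s) :
    HasConstantLeviRankNear F.model 0 s :=
  F.isGraphFunction_rho0.hasConstantLeviRankNear F.isDefiningFunctionAt_rho0
    (finrank_jetKernel_rho0 hM)

end DefiningEquation

end Normalized


/-! ### 2-nondegeneracy in terms of the frame -/

section TwoNondegenerate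

variable {s r : ℕ} {ρ : Coord s r → ℝ} {M : Set (Coord s r)}

/-- The `∂̄`-derivative of the frame. -/
noncomputable def dbarFrame (ρ : Coord s r → ℝ) (q y : Coord s r) (η : Fin r → ℂ) : CoordU s :=
  fderiv ℝ (frame ρ) q y η + Complex.I • fderiv ℝ (frame ρ) q (Complex.I • y) η

lemma hasFDerivAt_graphMap {a : Coord s r → ((Fin r → ℂ) →L[ℂ] CoordU s)} {ξ : Coord s r → Fin r →
    ℂ}
    {q : Coord s r} (ha : DifferentiableAt ℝ a q) (hξ : DifferentiableAt ℝ ξ q) (y : Coord s r) :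
    DifferentiableAt ℝ (fun q => graphMap (a q) (ξ q)) q ∧
    fderiv ℝ (fun q => graphMap (a q) (ξ q)) q y
      = graphMap (a q) (fderiv ℝ ξ q y) + inU s r (fderiv ℝ a q y (ξ q)) := by
  have h0 : HasFDerivAt (fun q => (a q).restrictScalars ℝ)
      ((ContinuousLinearMap.restrictScalarsL ℂ (Fin r → ℂ) (CoordU s) ℝ ℝ).comp (fderiv ℝ a q)) q :=
    (ContinuousLinearMap.restrictScalarsL ℂ (Fin r → ℂ) (CoordU s) ℝ ℝ).hasFDerivAt.comp q
      ha.hasFDerivAt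
  have h1 := h0.clm_apply hξ.hasFDerivAt
  have h2 := (((inU s r).restrictScalars ℝ).hasFDerivAt.comp q h1).add
    (((inV s r).restrictScalars ℝ).hasFDerivAt.comp q hξ.hasFDerivAt)
  have h3 : (fun q => graphMap (a q) (ξ q)) = ((inU s r).restrictScalars ℝ ∘
      fun q => (a q).restrictScalars ℝ (ξ q)) + ((inV s r).restrictScalars ℝ ∘ ξ) := by
    funext q; simp [graphMap]
  rw [h3]
  refine ⟨h2.differentiableAt, ?_⟩
  rw [h2.fderiv]
  simp [graphMap]

lemma eq_graphMap_of_mem_range {a : (Fin r → ℂ) →L[ℂ] CoordU s} {v : Coord s r} :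
    v ∈ LinearMap.range (graphMap a : (Fin r → ℂ) →ₗ[ℂ] Coord s r) ↔
      v = graphMap a v.2.2 := by
  constructor
  · rintro ⟨η, rfl⟩
    simp [graphMap_apply]
  · intro h
    exact ⟨v.2.2, h.symm⟩

namespace IsNormalized

lemma leviKernel_eq (h : IsNormalized ρ) (hM : IsDefiningFunctionAt M 0 ρ) :
    ∀ᶠ q in 𝓝 (0 : Coord s r), q ∈ M → leviKernel M q
      = LinearMap.range (graphMap (frame ρ q) : (Fin r → ℂ) →ₗ[ℂ] Coord s r) := by
  filter_upwards [h.jetKernel_eq, hM.eventually] with q h1 h2 hq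
  rw [h2.leviKernel_eq hq, h1]

/-- Along M a section of the Levi kernel is the frame applied to its ζ-component. By the product
rule, `dbar` of it is again in the graph up to the ∂̄-derivative of the frame; only tangential
derivatives occur, so the relation is needed only on M. -/
lemma dbar_section (h : IsNormalized ρ) (hM : IsDefiningFunctionAt M 0 ρ) :
    ∀ᶠ q in 𝓝 (0 : Coord s r), q ∈ M → ∀ x : Coord s r → Coord s r,
      IsSectionNear M (leviKernel M) q x → ∀ y ∈ complexTangent M q,
        dbar x q y = graphMap (frame ρ q) (dbar x q y).2.2
          + inU s r (dbarFrame ρ q y (x q).2.2) := by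
  filter_upwards [(h.leviKernel_eq hM).eventually_nhds, hM.eventually, h.smooth_frame]
    with q h1 h2 h3 hq x hx y hy
  have hd : DifferentiableAt ℝ x q := hx.differentiableAt
  have hξ : DifferentiableAt ℝ (fun q => (x q).2.2) q := hd.snd.snd
  have hξ' : ∀ v, fderiv ℝ (fun q => (x q).2.2) q v = (fderiv ℝ x q v).2.2 := fun v => by
    have := (((prV s r).restrictScalars ℝ).hasFDerivAt.comp q hd.hasFDerivAt).fderiv
    exact DFunLike.congr_fun this v
  have key : ∀ v, fderiv ℝ ρ q v = 0 → fderiv ℝ x q v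
      = graphMap (frame ρ q) (fderiv ℝ x q v).2.2
        + inU s r (fderiv ℝ (frame ρ) q v (x q).2.2) := fun v hv => by
    obtain ⟨h4, h5⟩ := hasFDerivAt_graphMap (h3.differentiableAt (by simp)) hξ v
    have h6 := h2.fderiv_eq_zero hq (hd.sub h4) (by
      filter_upwards [hx, h1] with q' h7 h8 hq'
      have h9 := h7.2 hq'
      rw [h8 hq', eq_graphMap_of_mem_range] at h9
      exact sub_eq_zero.2 h9) hv
    rw [fderiv_sub hd h4, sub_apply, sub_eq_zero, h5, hξ'] at h6
    exact h6
  obtain ⟨hy1, hy2⟩ := dC_eq_zero_iff.1 ((h2.mem_complexTangent hq).1 hy)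
  have k1 := key y hy1
  have k2 := key (Complex.I • y) hy2
  have k3 : dbar x q y = fderiv ℝ x q y + Complex.I • fderiv ℝ x q (Complex.I • y) := rfl
  have k4 : (dbar x q y).2.2
      = (fderiv ℝ x q y).2.2 + Complex.I • (fderiv ℝ x q (Complex.I • y)).2.2 := rfl
  rw [k4, k3, dbarFrame]
  generalize fderiv ℝ x q y = A at *
  generalize fderiv ℝ x q (Complex.I • y) = B at *
  rw [map_add, (graphMap (frame ρ q)).map_smul, map_add, (inU s r).map_smul]
  have k5 : Complex.I • B = Complex.I • graphMap (frame ρ q) B.2.2 + Complex.I •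
      inU s r (((fderiv ℝ (frame ρ) q) (Complex.I • y)) (x q).2.2) := by
    rw [← smul_add, ← k2]
  rw [k5]
  nth_rewrite 1 [k1]
  abel

/-- The deviation of `dbar x q y` from the Levi kernel is the ∂̄-derivative of the frame, which
depends only on the value of the section at q. Conversely a constant ζ-component supplies a section
through any kernel vector. -/
lemma mem_freemanThree (h : IsNormalized ρ) (hM : IsDefiningFunctionAt M 0 ρ) :
    ∀ᶠ q in 𝓝 (0 : Coord s r), q ∈ M → ∀ v, v ∈ freemanThree M q ↔
      v = graphMap (frame ρ q) v.2.2 ∧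
        ∀ y, dC (fderiv ℝ ρ q) y = 0 → dbarFrame ρ q y v.2.2 = 0 := by
  filter_upwards [(h.leviKernel_eq hM).eventually_nhds, hM.eventually, h.dbar_section hM,
    h.smooth_frame.eventually_nhds] with q h1 h2 h3 h4 hq v
  have key : ∀ x : Coord s r → Coord s r, IsSectionNear M (leviKernel M) q x →
      ∀ y, dC (fderiv ℝ ρ q) y = 0 →
        (dbar x q y ∈ leviKernel M q ↔ dbarFrame ρ q y (x q).2.2 = 0) := by
    intro x hx y hy
    have h5 := h3 hq x hx y ((h2.mem_complexTangent hq).2 hy)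
    rw [h1.self_of_nhds hq, eq_graphMap_of_mem_range]
    constructor
    · intro h6
      rw [← h6, left_eq_add] at h5
      refine Prod.ext (congrArg (fun v : Coord s r => v.1) h5) ?_
      exact congrArg (fun v : Coord s r => v.2.1) h5
    · intro h6
      rw [h6, map_zero, add_zero] at h5
      exact h5
  rw [h2.mem_freemanThree hq]
  constructor
  · rintro ⟨x, hx, rfl, hxy⟩
    refine ⟨?_, fun y hy => (key x hx y hy).1 (hxy y ((h2.mem_complexTangent hq).2 hy))⟩
    have h5 := hx.self_of_nhds.2 hq
    rwa [h1.self_of_nhds hq, eq_graphMap_of_mem_range] at h5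
  · rintro ⟨hv, hy⟩
    have hx : IsSectionNear M (leviKernel M) q (fun q => graphMap (frame ρ q) v.2.2) := by
      filter_upwards [h1, h4] with q' h5 h6
      refine ⟨?_, fun hq' => ?_⟩
      · have h7 : ContDiffAt ℝ ∞ (fun q => frame ρ q v.2.2) q' :=
          (((ContinuousLinearMap.apply ℂ (CoordU s) v.2.2).restrictScalars
              ℝ).contDiff.contDiffAt).comp
            q' h6
        have h8 := (((inU s r).restrictScalars ℝ).contDiff.contDiffAt.comp q' h7).add
          (contDiffAt_const (c := inV s r v.2.2))
        exact h8
      · rw [h5 hq']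
        exact LinearMap.mem_range_self _ _
    refine ⟨_, hx, hv.symm, fun y hyT => ?_⟩
    rw [h2.mem_complexTangent hq] at hyT
    refine (key _ hx y hyT).2 ?_
    rw [← hv]
    exact hy y hyT

/-- The Levi kernel has dimension r, hence the condition 0 < r; the rest says that the ∂̄-derivative
of the frame is injective in η. -/
lemma isTwoNondegenerateAt_iff (h : IsNormalized ρ) (hM : IsDefiningFunctionAt M 0 ρ) :
    ∀ᶠ q in 𝓝 (0 : Coord s r), q ∈ M → (IsTwoNondegenerateAt M q ↔
      0 < r ∧ ∀ η, (∀ y, dC (fderiv ℝ ρ q) y = 0 → dbarFrame ρ q y η = 0) → η = 0) := by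
  filter_upwards [h.leviKernel_eq hM, h.mem_freemanThree hM] with q h1 h2 hq
  refine and_congr ?_ ?_
  · have h3 := finrank_range_graphMap (frame ρ q)
    rw [← h1 hq] at h3
    rw [ne_eq, ← Submodule.finrank_eq_zero (S := leviKernel M q), h3, Nat.pos_iff_ne_zero]
  · constructor
    · intro h3 η hη
      have h4 : graphMap (frame ρ q) η ∈ freemanThree M q := by
        rw [h2 hq]
        simpa [graphMap_apply] using hη
      rw [h3, Set.mem_singleton_iff] at h4
      simpa [graphMap_apply] using congrArg (fun v : Coord s r => v.2.2) h4
    · intro h3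
      refine Set.eq_singleton_iff_unique_mem.2 ⟨?_, fun v hv => ?_⟩
      · rw [h2 hq]
        exact ⟨(map_zero _).symm, fun y _ => by simp [dbarFrame]⟩
      · obtain ⟨h4, h5⟩ := (h2 hq v).1 hv
        rw [h4, h3 _ h5, map_zero]

/-- The `2`-nondegeneracy condition is open. -/
lemma injective_near (h : IsNormalized ρ)
    (h0 : ∀ η, (∀ y : Coord s r, y.1 = 0 → dbarFrame ρ 0 y η = 0) → η = 0) :
    ∀ᶠ q in 𝓝 (0 : Coord s r), ∀ η,
      (∀ y, dC (fderiv ℝ ρ q) y = 0 → dbarFrame ρ q y η = 0) → η = 0 := by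
  have hw := h.graph.dC_eW h.analytic.differentiableAt
  have hne := eventually_dC_ne h.analytic hw
  have hcF : ContinuousAt (fderiv ℝ (frame ρ)) 0 :=
    (h.smooth_frame.self_of_nhds.fderiv_right (m := ∞) (by simp)).continuousAt
  have hF : ∀ {y : Coord s r → Coord s r}, ContinuousAt y 0 → ∀ η,
      ContinuousAt (fun p : Coord s r × (Fin r → ℂ) => fderiv ℝ (frame ρ) p.1 (y p.1) p.2) (0, η) := by
    intro y hy η
    have h1 : ContinuousAt (fun q => fderiv ℝ (frame ρ) q (y q)) 0 := hcF.clm_apply hy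
    have h2 : ContinuousAt (fun p : Coord s r × (Fin r → ℂ) => fderiv ℝ (frame ρ) p.1 (y p.1)) (0,
        η) :=
      ContinuousAt.comp (g := fun q => fderiv ℝ (frame ρ) q (y q)) (f := Prod.fst) h1
        continuousAt_fst
    exact h2.clm_apply continuousAt_snd
  have hlocal : ∀ η ∈ Metric.sphere (0 : Fin r → ℂ) 1, ∀ᶠ p in 𝓝 (((0 : Coord s r), η)),
      ∃ y, dC (fderiv ℝ ρ p.1) y = 0 ∧ dbarFrame ρ p.1 y p.2 ≠ 0 := by
    intro η hη
    have hη0 : η ≠ 0 := by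
      rintro rfl
      simp at hη
    have : ∃ y : Coord s r, y.1 = 0 ∧ dbarFrame ρ 0 y η ≠ 0 := by
      by_contra! hcon
      exact hη0 (h0 η hcon)
    obtain ⟨y, hy, hy0⟩ := this
    have h1 : hproj ρ (eW s r) y 0 = y := by
      rw [hproj, h.fderiv_zero, dC_reW, hy]
      simp
    have hy1 : ContinuousAt (hproj ρ (eW s r) y) 0 :=
      (contDiffAt_hproj h.analytic hw y).continuousAt
    have h2 : ContinuousAt (fun p : Coord s r × (Fin r → ℂ) =>
        dbarFrame ρ p.1 (hproj ρ (eW s r) y p.1) p.2) (0, η) :=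
      (hF hy1 η).add ((hF (hy1.const_smul Complex.I) η).const_smul Complex.I)
    have h3 : Tendsto (fun p : Coord s r × (Fin r → ℂ) => p.1) (𝓝 (0, η)) (𝓝 0) :=
      continuousAt_fst
    filter_upwards [h2.eventually_ne (by rwa [h1] : dbarFrame ρ 0 (hproj ρ (eW s r) y 0) η ≠ 0),
      h3.eventually hne] with p hp1 hp2
    exact ⟨_, dC_hproj hp2 y, hp1⟩
  -- Compactness of the unit sphere in the ζ-space makes the pointwise open condition uniform in η;
  -- homogeneity then covers all η ≠ 0.
  have hall := (isCompact_sphere (0 : Fin r → ℂ) 1).eventually_forall_of_forall_eventually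
    (P := fun (q : Coord s r) (η : Fin r → ℂ) =>
      ∃ y, dC (fderiv ℝ ρ q) y = 0 ∧ dbarFrame ρ q y η ≠ 0) (fun η hη => hlocal η hη)
  filter_upwards [hall] with q hq η hη
  by_contra hη0
  have hn : ‖η‖ ≠ 0 := norm_ne_zero_iff.2 hη0
  obtain ⟨y, hy1, hy2⟩ := hq ((‖η‖⁻¹ : ℂ) • η) (by
    rw [mem_sphere_zero_iff_norm, norm_smul]
    simp [hn])
  refine hy2 ?_
  have h1 := hη y hy1
  have h2 : dbarFrame ρ q y ((‖η‖⁻¹ : ℂ) • η) = (‖η‖⁻¹ : ℂ) • dbarFrame ρ q y η := by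
    simp only [dbarFrame, map_smul, smul_add]
    congr 1
    rw [smul_comm]
  rw [h2, h1, smul_zero]

end IsNormalized

end TwoNondegenerate


/-! ### The frames of M and of its model at the origin -/

section Compare

variable {s r : ℕ} {ρ : Coord s r → ℝ} {M : Set (Coord s r)}

/-- `ℓ ↦ dC ℓ x` as a linear map. -/
noncomputable def dCEval (x : Coord s r) : (Coord s r →L[ℝ] ℝ) →L[ℝ] ℂ :=
  ((ContinuousLinearMap.apply ℝ ℂ x).comp
    (ContinuousLinearMap.restrictScalarsL ℂ (Coord s r) ℂ ℝ ℝ)).comp (dCL (Coord s r))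

/-- The third derivative. -/
noncomputable abbrev third (ρ : Coord s r → ℝ) (p : Coord s r) :
    Coord s r →L[ℝ] Coord s r →L[ℝ] Coord s r →L[ℝ] ℝ := fderiv ℝ (hess ρ) p

lemma hasFDerivAt_hess {q : Coord s r} (h : AnalyticAt ℝ ρ q) :
    HasFDerivAt (hess ρ) (third ρ q) q := h.fderiv.fderiv.differentiableAt.hasFDerivAt

lemma hasFDerivAt_hess_apply {q : Coord s r} (h : AnalyticAt ℝ ρ q) (x y : Coord s r) :
    HasFDerivAt (fun q => hess ρ q x y) (((third ρ q).flip x).flip y) q := by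
  have := ((hasFDerivAt_hess h).clm_apply (hasFDerivAt_const x q)).clm_apply
    (hasFDerivAt_const y q)
  refine this.congr_fderiv ?_
  refine ContinuousLinearMap.ext fun v => ?_
  simp

lemma third_symm_right {q : Coord s r} (h : AnalyticAt ℝ ρ q) (x y z : Coord s r) :
    third ρ q x y z = third ρ q x z y := by
  have h1 := hasFDerivAt_hess_apply h y z
  have h2 := hasFDerivAt_hess_apply h z y
  have h3 : (fun q => hess ρ q y z) =ᶠ[𝓝 q] fun q => hess ρ q z y := by
    filter_upwards [h.eventually_analyticAt] with q hq using hess_symm hq y z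
  exact DFunLike.congr_fun (h1.unique (h2.congr_of_eventuallyEq h3)) x

lemma third_symm_left {q : Coord s r} (h : AnalyticAt ℝ ρ q) (x y z : Coord s r) :
    third ρ q x y z = third ρ q y x z := by
  have h1 : IsSymmSndFDerivAt ℝ (fderiv ℝ ρ) q :=
    (h.fderiv.contDiffAt (n := ω)).isSymmSndFDerivAt (by simp)
  exact DFunLike.congr_fun (h1 x y) z

lemma exists_hasFDerivAt_levC {q : Coord s r} (h : AnalyticAt ℝ ρ q) (y x : Coord s r) :
    ∃ L : Coord s r →L[ℝ] ℂ, HasFDerivAt (fun q => levC (hess ρ q) y x) L q ∧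
      ∀ v, L v = levC (third ρ q v) y x := by
  have h1 : ∀ x y, HasFDerivAt (fun q => ((hess ρ q x y : ℝ) : ℂ))
      (Complex.ofRealCLM.comp (((third ρ q).flip x).flip y)) q := fun x y =>
    Complex.ofRealCLM.hasFDerivAt.comp q (hasFDerivAt_hess_apply h x y)
  have h2 := ((h1 x y).add (h1 (Complex.I • x) (Complex.I • y))).add
    (((h1 x (Complex.I • y)).add (h1 (Complex.I • x) (Complex.I • Complex.I • y))).const_mul
      Complex.I)
  refine ⟨_, h2.congr_of_eventuallyEq (Eventually.of_forall fun q => ?_), fun v => ?_⟩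
  · simp [levC_apply, lev]
  · simp [levC_apply, lev, mul_add]

namespace IsNormalized

lemma hess_leaf (h : IsNormalized ρ) : ∀ᶠ ζ in 𝓝 (0 : Fin r → ℂ), ∀ η,
    hess ρ (inV s r ζ) (inV s r η) = 0 := hess_inV_eq_zero h.analytic h.fderiv_leaf

lemma hess_zero_inV (h : IsNormalized ρ) (η : Fin r → ℂ) : hess ρ 0 (inV s r η) = 0 := by
  have := h.hess_leaf.self_of_nhds η
  rwa [map_zero] at this

lemma levC_zero_inV (h : IsNormalized ρ) (y : Coord s r) (η : Fin r → ℂ) :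
    levC (hess ρ 0) y (inV s r η) = 0 := by
  have : Complex.I • inV s r η = inV s r (Complex.I • η) := ((inV s r).map_smul _ _).symm
  simp only [levC_apply, lev, this, h.hess_zero_inV]
  simp

lemma hess_zero_apply_inV (h : IsNormalized ρ) (y : Coord s r) (η : Fin r → ℂ) :
    hess ρ 0 y (inV s r η) = 0 := by
  rw [hess_symm h.analytic, h.hess_zero_inV]; rfl

/-- The Hessian at 0 kills leaf directions, so in the product rule only the terms differentiating
the Hessian survive; the coefficients are 1 for w and 0 for z because the differential at 0 is that
of Re w. -/
lemma fderiv_jetMapAt (h : IsNormalized ρ) (y : Coord s r) (η : Fin r → ℂ) :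
    fderiv ℝ (jetMapAt ρ) 0 y (inV s r η)
      = (0, fun j => levC (third ρ 0 y) (eZ s r j) (inV s r η)) := by
  have hT : HasFDerivAt (jetMapAt ρ) (fderiv ℝ (jetMapAt ρ) 0) 0 :=
    ((contDiffAt_jetMapAt h.analytic).differentiableAt (by simp)).hasFDerivAt
  have hTη : HasFDerivAt (fun q => jetMapAt ρ q (inV s r η))
      (((ContinuousLinearMap.apply ℝ (CoordU s) (inV s r η)).comp
        (ContinuousLinearMap.restrictScalarsL ℂ (Coord s r) (CoordU s) ℝ ℝ)).comp
        (fderiv ℝ (jetMapAt ρ) 0)) 0 :=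
    ((ContinuousLinearMap.apply ℝ (CoordU s) (inV s r η)).comp
      (ContinuousLinearMap.restrictScalarsL ℂ (Coord s r) (CoordU s) ℝ ℝ)).hasFDerivAt.comp 0 hT
  have hdc : ∀ x, HasFDerivAt (fun q => dC (fderiv ℝ ρ q) x) ((dCEval x).comp (hess ρ 0)) 0 :=
    fun x => (dCEval x).hasFDerivAt.comp (0 : Coord s r)
      h.analytic.fderiv.differentiableAt.hasFDerivAt
  have hdcc : ∀ x, HasFDerivAt (fun q => starRingEnd ℂ (dC (fderiv ℝ ρ q) x))
      (Complex.conjCLE.toContinuousLinearMap.comp ((dCEval x).comp (hess ρ 0))) 0 :=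
    fun x => Complex.conjCLE.toContinuousLinearMap.hasFDerivAt.comp (0 : Coord s r) (hdc x)
  choose L hL hL' using fun x => exists_hasFDerivAt_levC h.analytic x (inV s r η)
  refine Prod.ext ?_ (funext fun j => ?_)
  · have h1 := (ContinuousLinearMap.fst ℝ ℂ (Fin s → ℂ)).hasFDerivAt.comp (0 : Coord s r) hTη
    have h2 : (ContinuousLinearMap.fst ℝ ℂ (Fin s → ℂ)) ∘ (fun q => jetMapAt ρ q (inV s r η))
        = fun q => dC (fderiv ℝ ρ q) (inV s r η) := funext fun q => jetMap_fst _ _ _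
    rw [h2] at h1
    have h3 := DFunLike.congr_fun (h1.unique (hdc _)) y
    have h4 : Complex.I • inV s r η = inV s r (Complex.I • η) := ((inV s r).map_smul _ _).symm
    have h5 : dC (hess ρ 0 y) (inV s r η) = 0 := by
      rw [dC_eq_zero_iff, h4, h.hess_zero_apply_inV, h.hess_zero_apply_inV]
      exact ⟨rfl, rfl⟩
    exact h3.trans h5
  · have h1 := ((ContinuousLinearMap.proj (R := ℝ) (φ := fun _ : Fin s => ℂ) j).comp
      (ContinuousLinearMap.snd ℝ ℂ (Fin s → ℂ))).hasFDerivAt.comp (0 : Coord s r) hTη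
    have h2 : ((ContinuousLinearMap.proj (R := ℝ) (φ := fun _ : Fin s => ℂ) j).comp
      (ContinuousLinearMap.snd ℝ ℂ (Fin s → ℂ))) ∘ (fun q => jetMapAt ρ q (inV s r η))
        = fun q => starRingEnd ℂ (dC (fderiv ℝ ρ q) (eW s r)) * levC (hess ρ q) (eZ s r j) (inV s r
            η)
        - starRingEnd ℂ (dC (fderiv ℝ ρ q) (eZ s r j)) * levC (hess ρ q) (eW s r) (inV s r η) :=
      funext fun q => jetMap_snd _ _ _ _
    rw [h2] at h1
    have h3 := ((hdcc (eW s r)).mul (hL (eZ s r j))).sub ((hdcc (eZ s r j)).mul (hL (eW s r)))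
    have h4 := DFunLike.congr_fun (h1.unique h3) y
    refine h4.trans ?_
    simp only [h.levC_zero_inV, h.fderiv_zero, dC_reW]
    simp [eW, eZ, hL', -inV_apply]

/-- The derivative of the frame at the origin. -/
lemma jetMapAt_fderiv_frame (h : IsNormalized ρ) (y : Coord s r) (η : Fin r → ℂ) :
    jetMapAt ρ 0 (inU s r (fderiv ℝ (frame ρ) 0 y η))
      = -fderiv ℝ (jetMapAt ρ) 0 y (inV s r η) := by
  have hT : HasFDerivAt (jetMapAt ρ) (fderiv ℝ (jetMapAt ρ) 0) 0 :=
    ((contDiffAt_jetMapAt h.analytic).differentiableAt (by simp)).hasFDerivAt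
  have hT' : HasFDerivAt (fun q => (jetMapAt ρ q).restrictScalars ℝ)
      ((ContinuousLinearMap.restrictScalarsL ℂ (Coord s r) (CoordU s) ℝ ℝ).comp
        (fderiv ℝ (jetMapAt ρ) 0)) 0 :=
    (ContinuousLinearMap.restrictScalarsL ℂ (Coord s r) (CoordU s) ℝ ℝ).hasFDerivAt.comp 0 hT
  obtain ⟨h1, h2⟩ := hasFDerivAt_graphMap (h.smooth_frame.self_of_nhds.differentiableAt (by simp))
    (differentiableAt_const η) y
  have h3 := hT'.clm_apply h1.hasFDerivAt
  have h4 : (fun q => (jetMapAt ρ q).restrictScalars ℝ (graphMap (frame ρ q) η)) =ᶠ[𝓝 0]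
      fun _ => 0 := by
    filter_upwards [eventually_invertible h.analytic h.invertible] with q hq
    exact (jetMap_eq_zero_iff hq).2 (LinearMap.mem_range_self _ η)
  have h5 := DFunLike.congr_fun (h3.unique ((hasFDerivAt_const (0 : CoordU s) (0 : Coord s
      r)).congr_of_eventuallyEq h4)) y
  have h6 : frame ρ 0 = 0 := by
    have := h.frame_leaf.self_of_nhds
    rwa [map_zero] at this
  simp only [add_apply, ContinuousLinearMap.comp_apply, ContinuousLinearMap.flip_apply, h2,
    ContinuousLinearMap.coe_restrictScalars', zero_apply] at h5
  rw [fderiv_fun_const] at h5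
  simp only [Pi.zero_apply, zero_apply, map_zero, zero_add] at h5
  rw [eq_neg_iff_add_eq_zero]
  have h7 : graphMap (frame ρ 0) η = inV s r η := by
    rw [h6]; simp [graphMap]
  rw [h7] at h5
  exact h5

end IsNormalized

namespace DefiningEquation

variable (F : DefiningEquation s r)

/-- The Taylor terms concerned are of type zζz′ or ζζz′, of weight 2 or 1. They are treated as
derivatives along the leaf of second derivatives that vanish identically there. -/
lemma third_Qc (z z' : Fin s → ℂ) (η ξ : Fin r → ℂ) :
    third F.Qc 0 (inU s r (0, z) + inV s r ξ) (inV s r η) (inU s r (0, z')) = 0 := by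
  have hQ := F.analyticAt_Qc.self_of_nhds
  have hleaf : ∀ x y, (∀ᶠ ζ in 𝓝 (0 : Fin r → ℂ), hess F.Qc (inV s r ζ) x y = 0) → ∀ η,
      third F.Qc 0 (inV s r η) x y = 0 := fun x y hxy η => by
    have h1 : HasFDerivAt (fun q => hess F.Qc q x y) (((third F.Qc 0).flip x).flip y)
        ((inV s r).restrictScalars ℝ 0) := by
      rw [map_zero]; exact hasFDerivAt_hess_apply hQ x y
    have h2 := h1.comp (0 : Fin r → ℂ) ((inV s r).restrictScalars ℝ).hasFDerivAt
    have h3 := h2.unique ((hasFDerivAt_const (0 : ℝ) (0 : Fin r → ℂ)).congr_of_eventuallyEq hxy)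
    exact DFunLike.congr_fun h3 η
  have h1 : third F.Qc 0 (inV s r ξ) (inV s r η) (inU s r (0, z')) = 0 := by
    refine hleaf _ _ ?_ ξ
    filter_upwards [hess_inV_eq_zero hQ F.fderiv_Qc_leaf] with ζ hζ
    rw [hζ]; rfl
  have h2 : third F.Qc 0 (inV s r η) (inU s r (0, z)) (inU s r (0, z')) = 0 := by
    refine hleaf _ _ ?_ η
    filter_upwards [F.hess_Qc_leaf] with ζ hζ using hζ z z'
  rw [map_add, add_apply, add_apply, h1, third_symm_left hQ, h2, add_zero]

lemma third_rho (x y z : Coord s r) :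
    third F.rho 0 x y z = third F.rho0 0 x y z - third F.Qc 0 x y z := by
  have h1 : (fun q => hess F.rho q y z) =ᶠ[𝓝 0] fun q => hess F.rho0 q y z - hess F.Qc q y z := by
    filter_upwards [F.hess_rho] with q hq
    rw [hq, sub_apply, sub_apply]
  have h2 := (hasFDerivAt_hess_apply F.analyticAt_rho.self_of_nhds y z).congr_of_eventuallyEq
    h1.symm
  exact DFunLike.congr_fun (h2.unique ((hasFDerivAt_hess_apply F.analyticAt_rho0.self_of_nhds y
      z).sub
    (hasFDerivAt_hess_apply F.analyticAt_Qc.self_of_nhds y z))) x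

variable {F}

/-- By `jetMapAt_fderiv_frame` the derivative of the frame solves a linear system built from the
2-jet and the third derivatives at 0. For `y` without w-component Q contributes neither to the right
side nor to the relevant block of the matrix. -/
lemma fderiv_frame_eq (hM : HasConstantLeviRankNear F.hypersurface 0 s) {y : Coord s r}
    (hy : y.1 = 0) (η : Fin r → ℂ) :
    fderiv ℝ (frame F.rho) 0 y η = fderiv ℝ (frame F.rho0) 0 y η := by
  have hn := isNormalized_rho hM
  have hn0 := isNormalized_rho0 hM
  have hy' : y = inU s r (0, y.2.1) + inV s r y.2.2 := by
    refine Prod.ext ?_ ?_ <;> simp [hy]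
  have hI : Complex.I • inV s r η = inV s r (Complex.I • η) := ((inV s r).map_smul _ _).symm
  have hIz : ∀ z : Fin s → ℂ, Complex.I • inU s r (0, z) = inU s r (0, Complex.I • z) :=
    fun z => by simp
  have heZ : ∀ j, eZ s r j = inU s r (0, Pi.single j 1) := fun j => by simp [eZ]
  have h1 : fderiv ℝ (jetMapAt F.rho) 0 y (inV s r η)
      = fderiv ℝ (jetMapAt F.rho0) 0 y (inV s r η) := by
    rw [hn.fderiv_jetMapAt, hn0.fderiv_jetMapAt]
    refine Prod.ext rfl (funext fun j => ?_)
    have hB : ∀ η z', third F.rho 0 y (inV s r η) (inU s r (0, z'))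
        = third F.rho0 0 y (inV s r η) (inU s r (0, z')) := fun η z' => by
      have h2 := F.third_Qc y.2.1 z' η y.2.2
      rw [← hy'] at h2
      rw [third_rho, h2, sub_zero]
    simp only [heZ, levC_apply, lev, hI, hIz, hB]
  have e1 := hn.jetMapAt_fderiv_frame y η
  have e0 := hn0.jetMapAt_fderiv_frame y η
  rw [h1] at e1
  have hfst : (fderiv ℝ (jetMapAt F.rho0) 0 y (inV s r η)).1 = 0 := by
    rw [hn0.fderiv_jetMapAt]
  set u := fderiv ℝ (frame F.rho) 0 y η
  set u0 := fderiv ℝ (frame F.rho0) 0 y η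
  rw [jetMapAt, hn.fderiv_zero] at e1
  rw [jetMapAt, hn0.fderiv_zero] at e0
  -- The w-component vanishes, so only the Hessian in the z-directions enters, where ρ and ρ₀ agree;
  -- the mixed second derivatives of Q in w and z need not vanish.
  have hu : u.1 = 0 := by
    have := congrArg Prod.fst e1
    rw [jetMap_inU, Prod.fst_neg, hfst] at this
    simpa using this
  have huz : inU s r u = inU s r (0, u.2) := by
    rw [← hu]
  have h3 : jetMap (reW s r) (hess F.rho 0) (inU s r u)
      = jetMap (reW s r) (hess F.rho0 0) (inU s r u) := by
    rw [jetMap_inU, jetMap_inU]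
    refine Prod.ext rfl (funext fun j => ?_)
    simp only [heZ, huz]
    exact levC_eq_of_lev_eq F.hess_rho_zero _ _
  rw [h3, ← e0] at e1
  obtain ⟨e, he⟩ := hn0.invertible
  rw [jetMapAt, hn0.fderiv_zero] at he
  have h4 : e u = e u0 := by
    have h5 : ∀ u, e u = jetMap (reW s r) (hess F.rho0 0) (inU s r u) := fun u =>
      DFunLike.congr_fun he u
    rw [h5, h5, e1]
  exact e.injective h4

/-- The model of an everywhere `2`-nondegenerate hypersurface is `2`-nondegenerate. -/
lemma isTwoNondegenerateNear_model (hM : HasConstantLeviRankNear F.hypersurface 0 s)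
    (h2 : IsTwoNondegenerateAt F.hypersurface 0) : IsTwoNondegenerateNear F.model 0 := by
  have hn := isNormalized_rho hM
  have hn0 := isNormalized_rho0 hM
  have h0 : (0 : Coord s r) ∈ F.hypersurface := F.mem_hypersurface_iff.2 hn.zero
  obtain ⟨hr, hinj⟩ := ((hn.isTwoNondegenerateAt_iff F.isDefiningFunctionAt_rho).self_of_nhds h0).1
      h2
  have hinj0 : ∀ η, (∀ y : Coord s r, y.1 = 0 → dbarFrame F.rho0 0 y η = 0) → η = 0 := by
    intro η hη
    refine hinj η fun y hy => ?_
    rw [hn.fderiv_zero, dC_reW] at hy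
    have hy' : (Complex.I • y).1 = 0 := by simp [hy]
    have := hη y hy
    rw [dbarFrame] at this ⊢
    rw [fderiv_frame_eq hM hy, fderiv_frame_eq hM hy', this]
  filter_upwards [hn0.isTwoNondegenerateAt_iff F.isDefiningFunctionAt_rho0,
    hn0.injective_near hinj0] with q h3 h4 hq
  exact (h3 hq).2 ⟨hr, h4⟩

end DefiningEquation

end Compare


/-! ### Maps sending the leaf into the leaf -/

section LeafMap

variable {s r : ℕ}

/-- Uniqueness for the Levi foliation: the image of the leaf is tangent to the kernel graphs of the
frame `a`, and the flat leaf is itself an integral manifold because `a` vanishes on it. -/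
lemma prU_eq_zero_on_leaf {a : Coord s r → ((Fin r → ℂ) →L[ℂ] CoordU s)}
    (ha : ContDiffAt ℝ ∞ a 0) (ha0 : ∀ᶠ ζ in 𝓝 (0 : Fin r → ℂ), a (inV s r ζ) = 0)
    {φ : Coord s r → Coord s r} (hφ : AnalyticAt ℂ φ 0) (h0 : φ 0 = 0)
    (h : ∀ᶠ ζ in 𝓝 (0 : Fin r → ℂ), ∀ η, prU s r (fderiv ℂ φ (inV s r ζ) (inV s r η))
      = a (φ (inV s r ζ)) (prV s r (fderiv ℂ φ (inV s r ζ) (inV s r η)))) :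
    ∀ᶠ ζ in 𝓝 (0 : Fin r → ℂ), prU s r (φ (inV s r ζ)) = 0 := by
  obtain ⟨K, T, hT, hK⟩ := (ha.of_le (WithTop.coe_le_coe.2 (le_top : (1 : ℕ∞) ≤ ⊤))
    : ContDiffAt ℝ 1 a 0).exists_lipschitzOnWith
  have hφt : Tendsto (fun ζ => φ (inV s r ζ)) (𝓝 0) (𝓝 0) := by
    have h1 : Tendsto φ (𝓝 0) (𝓝 0) := by simpa [ContinuousAt, h0] using hφ.continuousAt
    exact h1.comp tendsto_inV
  have hφV : Tendsto (fun ζ => prV s r (φ (inV s r ζ))) (𝓝 0) (𝓝 0) := by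
    have h1 := (prV s r).continuous.tendsto 0
    rw [map_zero] at h1
    exact h1.comp hφt
  have hC : ∀ᶠ ζ in 𝓝 (0 : Fin r → ℂ), ‖fderiv ℂ φ (inV s r ζ)‖ < ‖fderiv ℂ φ 0‖ + 1 :=
    (hφ.fderiv.continuousAt.tendsto.comp tendsto_inV).norm.eventually_lt_const (by simp)
  have hall := h.and (hC.and ((tendsto_inV.eventually hφ.eventually_analyticAt).and
    ((hφt.eventually hT).and (((tendsto_inV.comp hφV).eventually hT).and (hφV.eventually ha0)))))
  rw [Metric.eventually_nhds_iff_ball] at hall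
  obtain ⟨ε, hε, hall⟩ := hall
  filter_upwards [Metric.ball_mem_nhds (0 : Fin r → ℂ) hε] with ζ hζ
  have hmem : ∀ τ ∈ Set.Icc (0 : ℝ) 1, τ • ζ ∈ Metric.ball (0 : Fin r → ℂ) ε := fun τ hτ => by
    rw [mem_ball_zero_iff] at hζ ⊢
    rw [norm_smul, Real.norm_of_nonneg hτ.1]
    nlinarith [norm_nonneg ζ, hτ.2]
  set f : ℝ → CoordU s := fun τ => prU s r (φ (inV s r (τ • ζ))) with hf
  have hder : ∀ τ ∈ Set.Icc (0 : ℝ) 1, HasDerivAt f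
      (prU s r (fderiv ℂ φ (inV s r (τ • ζ)) (inV s r ζ))) τ := fun τ hτ => by
    have h1 : HasDerivAt (fun τ : ℝ => τ • ζ) ζ τ := by
      simpa using (hasDerivAt_id τ).smul_const ζ
    have h2 := HasFDerivAt.comp_hasDerivAt (f := fun τ : ℝ => τ • ζ) τ
      ((inV s r).restrictScalars ℝ).hasFDerivAt h1
    have h3 := hasFDerivAt_real_of_complex (hall _ (hmem τ hτ)).2.2.1
    have h4 := HasFDerivAt.comp_hasDerivAt (f := fun τ : ℝ => inV s r (τ • ζ)) τ h3 h2
    exact HasFDerivAt.comp_hasDerivAt (f := fun τ : ℝ => φ (inV s r (τ • ζ))) τ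
      ((prU s r).restrictScalars ℝ).hasFDerivAt h4
  -- `a` is Lipschitz and vanishes on the leaf, so ‖a‖ is at most a multiple of the distance ‖f‖ to
  -- the leaf, and Grönwall's inequality applies along each ray.
  have key := eq_zero_of_abs_deriv_le_mul_abs_self_of_eq_zero_right (f := f)
    (f' := fun τ => prU s r (fderiv ℂ φ (inV s r (τ • ζ)) (inV s r ζ)))
    (K := K * ‖inU s r‖ * (‖prV s r‖ * ((‖fderiv ℂ φ 0‖ + 1) * ‖inV s r ζ‖))) (a := 0) (b := 1)
    (fun τ hτ => (hder τ hτ).continuousAt.continuousWithinAt)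
    (fun τ hτ => (hder τ ⟨hτ.1, hτ.2.le⟩).hasDerivWithinAt) (by simp [hf, h0, -inV_apply])
    (fun τ hτ => ?_)
  · have := key 1 (by simp)
    simpa [hf, -inV_apply, -prU_apply] using this
  · obtain ⟨k1, k2, -, k4, k5, k6⟩ := hall _ (hmem τ ⟨hτ.1, hτ.2.le⟩)
    rw [k1]
    set p := φ (inV s r (τ • ζ)) with hp
    have e1 : ‖a p‖ ≤ K * (‖inU s r‖ * ‖f τ‖) := by
      have e2 := hK.dist_le_mul _ k4 _ k5
      simp only [Function.comp_apply] at e2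
      rw [k6, dist_zero_right, dist_eq_norm] at e2
      have e3 : p - inV s r (prV s r p) = inU s r (f τ) := by
        rw [sub_eq_iff_eq_add]
        exact (inU_add_inV p).symm
      rw [e3] at e2
      exact e2.trans (mul_le_mul_of_nonneg_left ((inU s r).le_opNorm _) K.2)
    calc ‖a p (prV s r (fderiv ℂ φ (inV s r (τ • ζ)) (inV s r ζ)))‖
        ≤ ‖a p‖ * (‖prV s r‖ * (‖fderiv ℂ φ (inV s r (τ • ζ))‖ * ‖inV s r ζ‖)) :=
          (a p).le_opNorm_of_le (((prV s r).le_opNorm_of_le ((fderiv ℂ φ _).le_opNorm _)))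
      _ ≤ (K * (‖inU s r‖ * ‖f τ‖)) * (‖prV s r‖ * ((‖fderiv ℂ φ 0‖ + 1) * ‖inV s r ζ‖)) := by
          gcongr
      _ = _ := by ring

end LeafMap

/-! ### Holomorphic dependence of Taylor coefficients -/

section Slices

variable {X V : Type*} [NormedAddCommGroup X] [NormedSpace ℂ X] [NormedAddCommGroup V]
  [NormedSpace ℂ V] [CompleteSpace V]

/-- Derivatives in the real parameter of a jointly holomorphic function are complex derivatives
restricted to real t, hence holomorphic in x. -/
lemma analyticAt_iteratedDeriv_slice (k : ℕ) : ∀ {G : ℂ × X → V} {x₀ : X},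
    AnalyticAt ℂ G (0, x₀) →
      AnalyticAt ℂ (fun x => iteratedDeriv k (fun t : ℝ => G ((t : ℂ), x)) 0) x₀ := by
  induction k with
  | zero =>
    intro G x₀ hG
    simp only [iteratedDeriv_zero, Complex.ofReal_zero]
    exact AnalyticAt.comp (g := G) (f := fun x => ((0 : ℂ), x)) hG
      (analyticAt_const.prod analyticAt_id)
  | succ k ih =>
    intro G x₀ hG
    have h1 : AnalyticAt ℂ (fun p => fderiv ℂ G p (1, 0)) (0, x₀) :=
      ((ContinuousLinearMap.apply ℂ V ((1, 0) : ℂ × X)).analyticAt _).comp hG.fderiv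
    refine (ih h1).congr ?_
    have h2 := hG.eventually_analyticAt
    rw [nhds_prod_eq] at h2
    filter_upwards [(Filter.eventually_swap_iff.1 h2).curry] with x hx
    rw [iteratedDeriv_succ']
    refine Filter.EventuallyEq.iteratedDeriv_eq k ?_
    have h3 : Tendsto (fun t : ℝ => (t : ℂ)) (𝓝 0) (𝓝 0) := by
      simpa using Complex.continuous_ofReal.tendsto 0
    filter_upwards [h3.eventually hx] with t ht
    have h4 : HasDerivAt (fun t : ℝ => ((t : ℂ), x)) ((1 : ℂ), (0 : X)) t :=
      (Complex.ofRealCLM.hasDerivAt (x := t)).prodMk (hasDerivAt_const t x)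
    have ht' : AnalyticAt ℂ G ((t : ℂ), x) := ht
    exact (HasFDerivAt.comp_hasDerivAt (f := fun t : ℝ => ((t : ℂ), x)) t
      (ht'.differentiableAt.hasFDerivAt.restrictScalars ℝ) h4).deriv.symm

end Slices

/-! ### Weighted components of holomorphic maps -/

section WeightParts

variable {s r : ℕ} {V : Type*} [NormedAddCommGroup V] [NormedSpace ℂ V] [CompleteSpace V]

lemma weightPart_eq (k : ℕ) (f : Coord s r → V) (q : Coord s r) :
    weightPart k f q = taylorCoeff k fun t : ℝ => f (dil t q) := by
  simp only [weightPart, dil_apply]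

lemma eventually_dil_zero {p : Coord s r → Prop} (h : ∀ᶠ q in 𝓝 0, p q) :
    ∀ᶠ q in 𝓝 (0 : Coord s r), ∀ᶠ q' in 𝓝 (dil 0 q), p q' := by
  have h1 : Tendsto (fun p : Coord s r => dil 0 p) (𝓝 0) (𝓝 0) := by
    have := (dil (s := s) (r := r) 0).continuous.tendsto 0
    rwa [map_zero] at this
  exact h1.eventually h.eventually_nhds

lemma dil_zero_apply (q : Coord s r) : dil 0 q = inV s r (prV s r q) := by
  simp [dil_apply]

lemma analyticAt_comp_dil {f : Coord s r → V} (hf : AnalyticAt ℂ f 0) :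
    ∀ᶠ q in 𝓝 (0 : Coord s r), ∀ᶠ p in 𝓝 ((0 : ℝ), q),
      AnalyticAt ℝ (fun p : ℝ × Coord s r => f (dil p.1 p.2)) p := by
  filter_upwards [eventually_dil_zero hf.eventually_analyticAt] with q hq
  filter_upwards [(analyticAt_dil ((0 : ℝ), q)).continuousAt.eventually hq] with p hp
  exact AnalyticAt.comp (g := f) (f := fun p : ℝ × Coord s r => dil p.1 p.2)
    hp.restrictScalars (analyticAt_dil p)

/-- The dilation parameter is allowed to be complex, which makes f(t²w, tz, ζ) jointly holomorphic.
-/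
lemma analyticAt_weightPart (k : ℕ) {f : Coord s r → V} (hf : AnalyticAt ℂ f 0) :
    AnalyticAt ℂ (weightPart k f) 0 := by
  have h1 : AnalyticAt ℂ (fun p : ℂ × Coord s r =>
      ((p.1 ^ 2 * p.2.1, p.1 • p.2.2.1, p.2.2.2) : Coord s r)) (0, 0) := by
    have hw : AnalyticAt ℂ (fun p : ℂ × Coord s r => p.2.1) (0, 0) :=
      analyticAt_fst.comp analyticAt_snd
    have hz : AnalyticAt ℂ (fun p : ℂ × Coord s r => p.2.2.1) (0, 0) :=
      analyticAt_fst.comp (analyticAt_snd.comp analyticAt_snd)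
    have hζ : AnalyticAt ℂ (fun p : ℂ × Coord s r => p.2.2.2) (0, 0) :=
      analyticAt_snd.comp (analyticAt_snd.comp analyticAt_snd)
    exact ((analyticAt_fst.pow 2).mul hw).prod ((analyticAt_fst.smul hz).prod hζ)
  have h2 : AnalyticAt ℂ (fun p : ℂ × Coord s r => f (p.1 ^ 2 * p.2.1, p.1 • p.2.2.1, p.2.2.2))
      (0, 0) := by
    refine AnalyticAt.comp (g := f) ?_ h1
    have h4 : (((0 : ℂ) ^ 2 * (0 : Coord s r).1, (0 : ℂ) • (0 : Coord s r).2.1,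
        (0 : Coord s r).2.2) : Coord s r) = 0 := by simp
    exact h4.symm ▸ hf
  have h3 := (analyticAt_iteratedDeriv_slice k h2).const_smul (c := ((k.factorial : ℂ))⁻¹)
  refine h3.congr (Eventually.of_forall fun q => ?_)
  simp only [weightPart, taylorCoeff, Pi.smul_apply]
  rw [← Complex.coe_smul]
  push_cast
  rfl

end WeightParts


/-! ### Equivalences and their weighted degree preserving parts -/

section LeafPreserving

variable {s r : ℕ}

/-- Germs of holomorphic maps that preserve the leaf `{w = z = 0}` and whose first component has
no terms of weight one. -/
structure PreservesLeaf (φ : Coord s r → Coord s r) : Prop where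
  analytic : AnalyticAt ℂ φ 0
  zero : φ 0 = 0
  leaf : ∀ᶠ ζ in 𝓝 (0 : Fin r → ℂ), prU s r (φ (inV s r ζ)) = 0
  fderiv_leaf : ∀ᶠ ζ in 𝓝 (0 : Fin r → ℂ), ∀ z : Fin s → ℂ,
    (fderiv ℂ φ (inV s r ζ) (inU s r (0, z))).1 = 0

namespace PreservesLeaf

variable {φ : Coord s r → Coord s r}

/-- The first t-derivative of the w-component at t = 0 is its derivative at a leaf point in a
z-direction, since t²w does not contribute; it vanishes by `fderiv_leaf`. -/
lemma vanishes (h : PreservesLeaf φ) : ∀ᶠ q in 𝓝 (0 : Coord s r),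
    VanishesToOrder 2 (fun p : ℝ × Coord s r => (φ (dil p.1 p.2)).1) q ∧
    VanishesToOrder 1 (fun p : ℝ × Coord s r => (φ (dil p.1 p.2)).2.1) q ∧
    VanishesToOrder 0 (fun p : ℝ × Coord s r => (φ (dil p.1 p.2)).2.2) q := by
  have hV : Tendsto (prV s r) (𝓝 0) (𝓝 0) := by
    have h1 := (prV s r).continuous.tendsto 0
    rwa [map_zero] at h1
  have hP : ∀ᶠ ζ in 𝓝 (0 : Fin r → ℂ), AnalyticAt ℂ φ (inV s r ζ) :=
    tendsto_inV.eventually h.analytic.eventually_analyticAt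
  filter_upwards [analyticAt_comp_dil h.analytic, hV.eventually h.leaf.eventually_nhds,
    hV.eventually (h.fderiv_leaf.and hP).eventually_nhds] with q h1 h2 h3
  have hq : Tendsto (prV s r) (𝓝 q) (𝓝 (prV s r q)) := (prV s r).continuous.tendsto q
  have h0 : ∀ᶠ x in 𝓝 q, prU s r (φ (dil 0 x)) = 0 := by
    filter_upwards [hq.eventually h2] with x hx
    rwa [dil_zero_apply]
  refine ⟨⟨?_, ?_⟩, ⟨?_, ?_⟩, ⟨?_, ?_⟩⟩
  · filter_upwards [h1] with p hp using (analyticAt_fst.comp hp).contDiffAt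
  · intro j hj
    interval_cases j
    · filter_upwards [h0] with x hx
      rw [iteratedDeriv_zero]
      exact congrArg Prod.fst hx
    · filter_upwards [hq.eventually h3] with x hx
      rw [iteratedDeriv_one]
      have h4 : HasDerivAt (fun t : ℝ => dil t x) (inU s r (0, x.2.1)) 0 := by
        have h5 : HasDerivAt (fun t : ℝ => (t : ℂ)) 1 0 := Complex.ofRealCLM.hasDerivAt
        have h6 : HasDerivAt (fun t : ℝ => (t : ℂ) ^ 2 * x.1) 0 0 := by
          simpa using (h5.pow 2).mul_const x.1
        have h7 : HasDerivAt (fun t : ℝ => (t : ℂ) • x.2.1) x.2.1 0 := by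
          simpa using h5.smul_const x.2.1
        simp only [dil_apply]
        exact h6.prodMk (h7.prodMk (hasDerivAt_const _ _))
      have h8 : HasFDerivAt φ ((fderiv ℂ φ (inV s r (prV s r x))).restrictScalars ℝ)
          (dil 0 x) := by
        rw [dil_zero_apply]
        exact hasFDerivAt_real_of_complex hx.2
      have h9 := HasFDerivAt.comp_hasDerivAt (f := fun t : ℝ => dil t x) 0 h8 h4
      have h10 := HasFDerivAt.comp_hasDerivAt (f := φ ∘ fun t : ℝ => dil t x) (0 : ℝ)
        (ContinuousLinearMap.fst ℝ ℂ ((Fin s → ℂ) × (Fin r → ℂ))).hasFDerivAt h9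
      exact h10.deriv.trans (hx.1 _)
  · filter_upwards [h1] with p hp using
      (analyticAt_fst.comp (analyticAt_snd.comp hp)).contDiffAt
  · intro j hj
    interval_cases j
    filter_upwards [h0] with x hx
    rw [iteratedDeriv_zero]
    exact congrArg Prod.snd hx
  · filter_upwards [h1] with p hp using
      (analyticAt_snd.comp (analyticAt_snd.comp hp)).contDiffAt
  · intro j hj
    omega

lemma analyticAt_degreePreservingPart (h : PreservesLeaf φ) :
    AnalyticAt ℂ (degreePreservingPart φ) 0 := by
  have h1 : AnalyticAt ℂ (fun q => (φ q).1) 0 := analyticAt_fst.comp h.analytic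
  have h2 : AnalyticAt ℂ (fun q => (φ q).2.1) 0 :=
    analyticAt_fst.comp (analyticAt_snd.comp h.analytic)
  have h3 : AnalyticAt ℂ (fun q => (φ q).2.2) 0 :=
    analyticAt_snd.comp (analyticAt_snd.comp h.analytic)
  exact (analyticAt_weightPart 2 h1).prod
    ((analyticAt_weightPart 1 h2).prod (analyticAt_weightPart 0 h3))

lemma degreePreservingPart_zero (h : PreservesLeaf φ) : degreePreservingPart φ 0 = 0 := by
  have h1 : ∀ t : ℝ, φ (dil t 0) = 0 := fun t => by rw [map_zero, h.zero]
  simp only [degreePreservingPart, weightPart_eq, h1, taylorCoeff]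
  have h2 : ∀ (V : Type) [NormedAddCommGroup V] [NormedSpace ℝ V] (k : ℕ),
      iteratedDeriv k (fun _ : ℝ => (0 : V)) 0 = 0 := fun V _ _ k => by
    rw [iteratedDeriv_const]; simp
  refine Prod.ext ?_ (Prod.ext ?_ ?_)
  · exact (congrArg _ (h2 ℂ 2)).trans (smul_zero _)
  · exact (congrArg _ (h2 (Fin s → ℂ) 1)).trans (smul_zero _)
  · exact (congrArg _ (h2 (Fin r → ℂ) 0)).trans (smul_zero _)

/-- The rescaled maps converge to the weighted degree preserving part. -/
lemma tendsto_rescaled (h : PreservesLeaf φ) : ∀ᶠ q in 𝓝 (0 : Coord s r), ∀ x : ℝ → Coord s r,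
    Tendsto x (𝓝[≠] 0) (𝓝 q) →
      Tendsto (fun t => dil t⁻¹ (φ (dil t (x t)))) (𝓝[≠] 0) (𝓝 (degreePreservingPart φ q)) := by
  filter_upwards [h.vanishes] with q hq x hx
  have ht : Tendsto (fun t : ℝ => t) (𝓝[≠] 0) (𝓝 0) := nhdsWithin_le_nhds
  have hne : ∀ᶠ t : ℝ in 𝓝[≠] 0, t ≠ 0 := self_mem_nhdsWithin
  have h1 := hq.1.tendsto ht hne hx
  have h2 := hq.2.1.tendsto ht hne hx
  have h3 := hq.2.2.tendsto ht hne hx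
  simp only [degreePreservingPart, weightPart_eq]
  refine (h1.prodMk_nhds (h2.prodMk_nhds h3)).congr fun t => ?_
  simp only
  generalize φ (dil t (x t)) = y
  rw [dil_apply]
  refine Prod.ext ?_ (Prod.ext ?_ ?_)
  · simp
  · simp only [pow_one]
    exact (Complex.coe_smul t⁻¹ y.2.1).symm
  · simp

end PreservesLeaf

lemma dil_dil_inv {t : ℝ} (ht : t ≠ 0) (q : Coord s r) : dil t (dil t⁻¹ q) = q :=
  (dilEquiv s r ht).apply_symm_apply q

lemma dil_inv_dil {t : ℝ} (ht : t ≠ 0) (q : Coord s r) : dil t⁻¹ (dil t q) = q :=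
  (dilEquiv s r ht).symm_apply_apply q

lemma tendsto_dil_zero {x : ℝ → Coord s r} {q : Coord s r} (hx : Tendsto x (𝓝[≠] 0) (𝓝 q)) :
    Tendsto (fun t => dil t (x t)) (𝓝[≠] 0) (𝓝 (dil 0 q)) := by
  have h1 : Tendsto (fun t : ℝ => (t, x t)) (𝓝[≠] 0) (𝓝 (0, q)) :=
    Tendsto.prodMk_nhds nhdsWithin_le_nhds hx
  have h2 : Tendsto (fun p : ℝ × Coord s r => dil p.1 p.2) (𝓝 ((0 : ℝ), q)) (𝓝 (dil 0 q)) :=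
    contDiff_dil.continuous.tendsto ((0 : ℝ), q)
  exact Tendsto.comp (f := fun t : ℝ => (t, x t)) (g := fun p : ℝ × Coord s r => dil p.1 p.2) h2 h1

/-- The rescaled maps compose to the identity for every t ≠ 0, and `tendsto_rescaled` with moving
base points lets both converge at once. -/
lemma degreePreservingPart_comp {φ ψ : Coord s r → Coord s r} (hφ : PreservesLeaf φ)
    (hψ : PreservesLeaf ψ) (h : ∀ᶠ q in 𝓝 0, ψ (φ q) = q) :
    ∀ᶠ q in 𝓝 0, degreePreservingPart ψ (degreePreservingPart φ q) = q := by
  have hc : Tendsto (degreePreservingPart φ) (𝓝 0) (𝓝 0) := by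
    have := hφ.analyticAt_degreePreservingPart.continuousAt.tendsto
    rwa [hφ.degreePreservingPart_zero] at this
  filter_upwards [hφ.tendsto_rescaled, hc.eventually hψ.tendsto_rescaled,
    eventually_dil_zero h] with q h1 h2 h3
  have h4 := h2 _ (h1 (fun _ => q) tendsto_const_nhds)
  have hne : ∀ᶠ t : ℝ in 𝓝[≠] 0, t ≠ 0 := self_mem_nhdsWithin
  refine tendsto_nhds_unique h4 (tendsto_const_nhds.congr' ?_)
  filter_upwards [hne, (tendsto_dil_zero (tendsto_const_nhds (x := q))).eventually h3]
    with t ht ht3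
  rw [dil_dil_inv ht, ht3, dil_inv_dil ht]

namespace DefiningEquation

variable {F F' : DefiningEquation s r}

/-- Points of the rescaled hypersurfaces approximating a point of the model. -/
lemma exists_approximation (F : DefiningEquation s r) : ∀ᶠ q in 𝓝 (0 : Coord s r), q ∈ F.model →
    ∃ x : ℝ → Coord s r, Tendsto x (𝓝[≠] 0) (𝓝 q) ∧ ∀ t ≠ 0, dil t (x t) ∈ F.hypersurface := by
  filter_upwards [F.vanishesToOrder_Qt] with q hq hqM
  have ht : Tendsto (fun t : ℝ => t) (𝓝[≠] 0) (𝓝 0) := nhdsWithin_le_nhds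
  have hne : ∀ᶠ t : ℝ in 𝓝[≠] 0, t ≠ 0 := self_mem_nhdsWithin
  have h1 := hq.tendsto_zero (m := 2) ht hne (tendsto_const_nhds (x := q))
  -- Q does not depend on Re w, so moving q by t⁻² Q(`dil t q`) in that direction solves the
  -- rescaled equation exactly; the shift tends to 0.
  refine ⟨fun t => q + ((t ^ 2)⁻¹ • F.Qt (t, q)) • eW s r, ?_, fun t ht => ?_⟩
  · have h2 := (h1.smul_const (eW s r)).const_add q
    rwa [zero_smul, add_zero] at h2
  · rw [mem_hypersurface_iff, rho, rho0_dil, F.isGraphFunction_rho0, F.mem_model_iff.1 hqM]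
    have h3 : F.Qc (dil t (q + ((t ^ 2)⁻¹ • F.Qt (t, q)) • eW s r)) = F.Qt (t, q) := by
      have h4 : dil t (q + ((t ^ 2)⁻¹ • F.Qt (t, q)) • eW s r)
          = dil t q + F.Qt (t, q) • eW s r := by
        rw [map_add]
        congr 1
        have : (t : ℂ) ≠ 0 := by exact_mod_cast ht
        rw [dil_apply]
        refine Prod.ext ?_ (Prod.ext ?_ ?_) <;> simp [eW]
        field_simp
      rw [h4, Qt]
      simp [Qc, eW]
    rw [h3]
    have := pow_ne_zero 2 ht
    simp only [smul_eq_mul]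
    field_simp
    ring

/-- Points of the rescaled hypersurfaces converge to the given model point. Their images satisfy ρ₀
= t⁻² Q ∘ `dil t`, and the right side tends to 0. -/
lemma mapsTo_model {φ : Coord s r → Coord s r} (hφ : PreservesLeaf φ)
    (h : ∀ᶠ q in 𝓝 0, q ∈ F.hypersurface → φ q ∈ F'.hypersurface) :
    ∀ᶠ q in 𝓝 0, q ∈ F.model → degreePreservingPart φ q ∈ F'.model := by
  have hc : Tendsto (degreePreservingPart φ) (𝓝 0) (𝓝 0) := by
    have := hφ.analyticAt_degreePreservingPart.continuousAt.tendsto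
    rwa [hφ.degreePreservingPart_zero] at this
  filter_upwards [F.exists_approximation, hφ.tendsto_rescaled, hc.eventually F'.vanishesToOrder_Qt,
    hc.eventually F'.analyticAt_rho0, eventually_dil_zero h] with q h1 h2 h3 h4 h5 hq
  obtain ⟨x, hx, hxM⟩ := h1 hq
  have ht : Tendsto (fun t : ℝ => t) (𝓝[≠] 0) (𝓝 0) := nhdsWithin_le_nhds
  have hne : ∀ᶠ t : ℝ in 𝓝[≠] 0, t ≠ 0 := self_mem_nhdsWithin
  have h6 := h2 x hx
  have h7 := h3.tendsto_zero (m := 2) ht hne h6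
  have h8 := h4.continuousAt.tendsto.comp h6
  rw [mem_model_iff]
  refine tendsto_nhds_unique h8 (h7.congr' ?_)
  filter_upwards [hne, (tendsto_dil_zero hx).eventually h5] with t ht ht5
  have h9 := F'.mem_hypersurface_iff.1 (ht5 (hxM t ht))
  have h10 : φ (dil t (x t)) = dil t (dil t⁻¹ (φ (dil t (x t)))) := (dil_dil_inv ht _).symm
  rw [h10, rho, rho0_dil] at h9
  rw [Function.comp_apply, Qt, smul_eq_mul]
  have := pow_ne_zero 2 ht
  clear h10
  simp only
  generalize dil t⁻¹ (φ (dil t (x t))) = p at *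
  field_simp
  linarith

/-- Levi kernels are invariant, so the leaf goes to the leaf by `prU_eq_zero_on_leaf`. At leaf
points the complex tangent space is {w = 0} for both hypersurfaces, so z-directions acquire no
w-component. -/
lemma preservesLeaf_of_isLocalEquivalence (hM : HasConstantLeviRankNear F.hypersurface 0 s)
    (hM' : HasConstantLeviRankNear F'.hypersurface 0 s) {φ : Coord s r → Coord s r} (h0 : φ 0 = 0)
    (h : IsLocalEquivalence φ 0 F.hypersurface F'.hypersurface) : PreservesLeaf φ := by
  have hn := isNormalized_rho hM
  have hn' := isNormalized_rho hM'
  have hφ : Tendsto φ (𝓝 0) (𝓝 0) := by simpa [ContinuousAt, h0] using h.1.continuousAt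
  have hmem : ∀ᶠ ζ in 𝓝 (0 : Fin r → ℂ), inV s r ζ ∈ F.hypersurface := by
    filter_upwards [hn.leaf] with ζ hζ using F.mem_hypersurface_iff.2 hζ
  have hframe0 : frame F'.rho 0 = 0 := by
    have := hn'.frame_leaf.self_of_nhds
    rwa [map_zero] at this
  have hleaf : ∀ᶠ ζ in 𝓝 (0 : Fin r → ℂ), prU s r (φ (inV s r ζ)) = 0 := by
    refine prU_eq_zero_on_leaf hn'.smooth_frame.self_of_nhds hn'.frame_leaf h.1 h0 ?_
    filter_upwards [hmem, tendsto_inV.eventually h.eventually, hn.frame_leaf,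
      tendsto_inV.eventually (hn.leviKernel_eq F.isDefiningFunctionAt_rho),
      tendsto_inV.eventually (hφ.eventually (hn'.leviKernel_eq F'.isDefiningFunctionAt_rho)),
      tendsto_inV.eventually (hφ.eventually F'.isDefiningFunctionAt_rho.eventually)]
      with ζ h1 h2 h3 h4 h5 h6 η
    have h7 : inV s r η ∈ leviKernel F.hypersurface (inV s r ζ) := by
      rw [h4 h1, h3]
      exact ⟨η, by simp [graphMap]⟩
    rw [h2.mem_leviKernel_iff ⟨_, h6⟩ h1, h5 (h2.2.2.self_of_nhds.2 h1),
      eq_graphMap_of_mem_range] at h7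
    rw [h7]
    simp [graphMap_apply]
  refine ⟨h.1, h0, hleaf, ?_⟩
  have hV : Tendsto (fun ζ => prV s r (φ (inV s r ζ))) (𝓝 0) (𝓝 0) := by
    have h1 := (prV s r).continuous.tendsto 0
    rw [map_zero] at h1
    exact h1.comp (hφ.comp tendsto_inV)
  filter_upwards [hmem, tendsto_inV.eventually h.eventually, hleaf, hn.fderiv_leaf,
    tendsto_inV.eventually F.isDefiningFunctionAt_rho.eventually,
    tendsto_inV.eventually (hφ.eventually F'.isDefiningFunctionAt_rho.eventually),
    hV.eventually hn'.fderiv_leaf] with ζ h1 h2 h3 h4 h5 h6 h7 z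
  have h8 : inU s r (0, z) ∈ complexTangent F.hypersurface (inV s r ζ) := by
    rw [h5.mem_complexTangent h1, h4, dC_reW]; rfl
  rw [h2.mem_complexTangent_iff ⟨_, h6⟩ h1, h6.mem_complexTangent (h2.2.2.self_of_nhds.2 h1)] at h8
  have h9 : φ (inV s r ζ) = inV s r (prV s r (φ (inV s r ζ))) := by
    conv_lhs => rw [← inU_add_inV (φ (inV s r ζ)), h3, map_zero, zero_add]
  rw [h9, h7, dC_reW] at h8
  exact h8

/-- The weighted degree preserving part maps the model to the model. -/
lemma isLocalEquivalence_degreePreservingPart (hM : HasConstantLeviRankNear F.hypersurface 0 s)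
    (hM' : HasConstantLeviRankNear F'.hypersurface 0 s) {φ : Coord s r → Coord s r} (h0 : φ 0 = 0)
    (h : IsLocalEquivalence φ 0 F.hypersurface F'.hypersurface) :
    degreePreservingPart φ 0 = 0 ∧
      IsLocalEquivalence (degreePreservingPart φ) 0 F.model F'.model := by
  have hφ := preservesLeaf_of_isLocalEquivalence hM hM' h0 h
  obtain ⟨ψ, hψ0, hψe, hψφ, hφψ⟩ := h.exists_symm
  rw [h0] at hψ0 hψe hφψ
  have hψ := preservesLeaf_of_isLocalEquivalence hM' hM hψ0 hψe
  have h1 := degreePreservingPart_comp hφ hψ hψφ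
  have h2 := degreePreservingPart_comp hψ hφ hφψ
  have hφ0 := hφ.degreePreservingPart_zero
  have hψ0' := hψ.degreePreservingPart_zero
  have hA := hφ.analyticAt_degreePreservingPart
  have hB := hψ.analyticAt_degreePreservingPart
  refine ⟨hφ0, hA, ?_, ?_⟩
  · have dA := hA.differentiableAt.hasFDerivAt
    have dB := hB.differentiableAt.hasFDerivAt
    have dBA := HasFDerivAt.comp (g := degreePreservingPart ψ) 0
      (by rw [hφ0]; exact dB) dA
    have dAB := HasFDerivAt.comp (g := degreePreservingPart φ) 0
      (by rw [hψ0']; exact dA) dB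
    have e1 := dBA.unique ((hasFDerivAt_id (0 : Coord s r)).congr_of_eventuallyEq h1)
    have e2 := dAB.unique ((hasFDerivAt_id (0 : Coord s r)).congr_of_eventuallyEq h2)
    exact ⟨ContinuousLinearEquiv.equivOfInverse (fderiv ℂ (degreePreservingPart φ) 0)
      (fderiv ℂ (degreePreservingPart ψ) 0) (fun x => DFunLike.congr_fun e1 x)
      (fun x => DFunLike.congr_fun e2 x), dA⟩
  · have m1 := mapsTo_model (F := F) (F' := F') hφ (by
      filter_upwards [h.2.2] with q hq using hq.2)
    have m2 := mapsTo_model (F := F') (F' := F) hψ (by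
      filter_upwards [hψe.2.2] with q hq using hq.2)
    have hc : Tendsto (degreePreservingPart φ) (𝓝 0) (𝓝 0) := by
      have := hA.continuousAt.tendsto
      rwa [hφ0] at this
    filter_upwards [m1, hc.eventually m2, h1] with q h3 h4 h5
    refine ⟨fun h6 => ?_, h3⟩
    have := h4 h6
    rwa [h5] at this

end DefiningEquation

end LeafPreserving


/-! ### Dimension comparison through leading terms -/

section Filtration

variable {K A : Type*} [Field K] [AddCommGroup A] [Module K A]

/-- The elements of `W` killed by `τ 0, …, τ (m - 1)`. -/
def orderGE (τ : ℕ → A →ₗ[K] A) (W : Submodule K A) (m : ℕ) : Submodule K A :=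
  W ⊓ ⨅ j : Fin m, LinearMap.ker (τ j)

lemma mem_orderGE {τ : ℕ → A →ₗ[K] A} {W : Submodule K A} {m : ℕ} {x : A} :
    x ∈ orderGE τ W m ↔ x ∈ W ∧ ∀ j < m, τ j x = 0 := by
  simp only [orderGE, Submodule.mem_inf, Submodule.mem_iInf, LinearMap.mem_ker]
  exact and_congr_right fun _ => ⟨fun h j hj => h ⟨j, hj⟩, fun h j => h j j.2⟩

/-- Comparison of dimensions through leading terms. -/
lemma finrank_le_of_leading_terms (τ : ℕ → A →ₗ[K] A) (V W : Submodule K A)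
    [FiniteDimensional K V] [FiniteDimensional K W]
    (hsep : ∀ x, (∀ m, τ m x = 0) → x = 0)
    (hproj : ∀ m x, τ m (τ m x) = τ m x) (horth : ∀ j m x, j ≠ m → τ j (τ m x) = 0)
    (hlead : ∀ m, ∀ x ∈ orderGE τ V m, τ m x ∈ W) :
    Module.finrank K V ≤ Module.finrank K W := by
  have hVle : ∀ m, orderGE τ V m ≤ V := fun m x hx => (mem_orderGE.1 hx).1
  have hWle : ∀ m, orderGE τ W m ≤ W := fun m x hx => (mem_orderGE.1 hx).1
  have hVfin : ∀ m, FiniteDimensional K (orderGE τ V m) := fun m =>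
    Submodule.finiteDimensional_of_le (hVle m)
  have hWfin : ∀ m, FiniteDimensional K (orderGE τ W m) := fun m =>
    Submodule.finiteDimensional_of_le (hWle m)
  -- By rank and nullity the dimension drops from order m to m + 1 in V by the rank of `τ m`. Its
  -- image lies in W at order m and meets order m + 1 only in 0, since `τ m` is idempotent; so the
  -- drop in W is at least as large.
  have step : ∀ m, Module.finrank K (orderGE τ V (m + 1)) ≤ Module.finrank K (orderGE τ W (m + 1)) →
      Module.finrank K (orderGE τ V m) ≤ Module.finrank K (orderGE τ W m) := by
    intro m hm
    set f := (τ m).domRestrict (orderGE τ V m) with hf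
    have h1 := LinearMap.finrank_range_add_finrank_ker f
    have h2 : Module.finrank K (LinearMap.ker f) = Module.finrank K (orderGE τ V (m + 1)) := by
      have : (LinearMap.ker f).map (orderGE τ V m).subtype = orderGE τ V (m + 1) := by
        ext x
        simp only [Submodule.mem_map, LinearMap.mem_ker, Submodule.subtype_apply, Subtype.exists,
          exists_and_right, exists_eq_right, hf, LinearMap.domRestrict_apply, mem_orderGE]
        constructor
        · rintro ⟨hx, hx0⟩
          refine ⟨hx.1, fun j hj => ?_⟩
          rcases Nat.lt_succ_iff_lt_or_eq.1 hj with h | rfl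
          · exact hx.2 j h
          · exact hx0
        · rintro ⟨hx, hx0⟩
          exact ⟨⟨hx, fun j hj => hx0 j (by omega)⟩, hx0 m (by omega)⟩
      rw [← this]
      exact (LinearEquiv.finrank_eq (Submodule.equivMapOfInjective _
        (Submodule.injective_subtype _) _))
    have hle : LinearMap.range f ≤ orderGE τ W m := by
      rintro _ ⟨x, rfl⟩
      refine mem_orderGE.2 ⟨hlead m x x.2, fun j hj => ?_⟩
      exact horth j m x hj.ne
    have hle' : orderGE τ W (m + 1) ≤ orderGE τ W m := fun x hx =>
      mem_orderGE.2 ⟨(mem_orderGE.1 hx).1, fun j hj => (mem_orderGE.1 hx).2 j (by omega)⟩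
    have hdis : LinearMap.range f ⊓ orderGE τ W (m + 1) = ⊥ := by
      rw [eq_bot_iff]
      rintro _ ⟨⟨x, rfl⟩, hx⟩
      have h3 : τ m (τ m x) = 0 := (mem_orderGE.1 hx).2 m (by omega)
      rw [hproj] at h3
      exact h3
    have h3 := Submodule.finrank_sup_add_finrank_inf_eq (LinearMap.range f) (orderGE τ W (m + 1))
    rw [hdis, finrank_bot, add_zero] at h3
    have h4 : Module.finrank K ↥(LinearMap.range f ⊔ orderGE τ W (m + 1))
        ≤ Module.finrank K (orderGE τ W m) := Submodule.finrank_mono (sup_le hle hle')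
    omega
  -- A decreasing sequence of finite-dimensional spaces is eventually constant, and an element of
  -- its last term is killed by every `τ m`.
  have hbot : ∃ N, orderGE τ V N = ⊥ := by
    have hanti : ∀ m n, m ≤ n → orderGE τ V n ≤ orderGE τ V m := fun m n hmn x hx =>
      mem_orderGE.2 ⟨(mem_orderGE.1 hx).1, fun j hj => (mem_orderGE.1 hx).2 j (by omega)⟩
    obtain ⟨N, hN⟩ : ∃ N, ∀ n, Module.finrank K (orderGE τ V N) ≤ Module.finrank K (orderGE τ V n)
        :=
      ⟨_, fun n => Function.argmin_le (fun n => Module.finrank K (orderGE τ V n)) n⟩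
    refine ⟨N, eq_bot_iff.2 fun x hx => hsep x fun m => ?_⟩
    have h1 : orderGE τ V (max N (m + 1)) = orderGE τ V N :=
      Submodule.eq_of_le_of_finrank_le (hanti _ _ (le_max_left _ _)) (hN _)
    rw [← h1] at hx
    exact (mem_orderGE.1 hx).2 m (lt_of_lt_of_le (Nat.lt_succ_self m) (le_max_right _ _))
  obtain ⟨N, hN⟩ := hbot
  have hall : ∀ k, k ≤ N → Module.finrank K (orderGE τ V (N - k))
      ≤ Module.finrank K (orderGE τ W (N - k)) := by
    intro k
    induction k with
    | zero => intro _; rw [Nat.sub_zero, hN, finrank_bot]; exact Nat.zero_le _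
    | succ k ih =>
      intro hk
      refine step _ ?_
      have : N - (k + 1) + 1 = N - k := by omega
      rw [this]
      exact ih (by omega)
  have h0 := hall N le_rfl
  have hz : ∀ W : Submodule K A, orderGE τ W 0 = W := fun W => by
    ext x; simp [mem_orderGE]
  rwa [Nat.sub_self, hz, hz] at h0

/-- When W is finite-dimensional, it suffices to bound finite independent families in V. The
condition on leading terms passes to their spans, which need not be stable under the `τ m`. -/
lemma realDim_le_of_leading_terms {A : Type*} [AddCommGroup A] [Module ℝ A]
    (τ : ℕ → A →ₗ[ℝ] A) (V W : Submodule ℝ A)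
    (hsep : ∀ x, (∀ m, τ m x = 0) → x = 0)
    (hproj : ∀ m x, τ m (τ m x) = τ m x) (horth : ∀ j m x, j ≠ m → τ j (τ m x) = 0)
    (hlead : ∀ m, ∀ x ∈ V, (∀ j < m, τ j x = 0) → τ m x ∈ W) :
    realDim V ≤ realDim W := by
  by_cases hW : FiniteDimensional ℝ W
  · have h1 : Module.rank ℝ V ≤ (Module.finrank ℝ W : ℕ) := by
      refine rank_le fun t ht => ?_
      set V' : Submodule ℝ A := (Submodule.span ℝ (t : Set V)).map V.subtype with hV'
      have hfin : FiniteDimensional ℝ (Submodule.span ℝ (t : Set V)) :=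
        FiniteDimensional.span_finset ℝ t
      have hfin' : FiniteDimensional ℝ V' := inferInstance
      have h2 : Module.finrank ℝ V' = t.card := by
        rw [← LinearEquiv.finrank_eq (Submodule.equivMapOfInjective V.subtype
          (Submodule.injective_subtype _) (Submodule.span ℝ (t : Set V)))]
        exact finrank_span_finset_eq_card ht
      rw [← h2]
      refine finrank_le_of_leading_terms τ V' W hsep hproj horth fun m x hx => ?_
      obtain ⟨hx1, hx2⟩ := mem_orderGE.1 hx
      refine hlead m x ?_ hx2
      obtain ⟨y, -, rfl⟩ := hx1
      exact y.2
    have h2 := Cardinal.toENat.monotone' h1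
    rw [Module.finrank_eq_rank ℝ W] at h2
    exact h2
  · have : realDim W = ⊤ := by
      rw [realDim, Cardinal.toENat_eq_top]
      by_contra! hcon
      exact hW (Module.rank_lt_aleph0_iff.1 hcon)
    rw [this]
    exact le_top

end Filtration

/-! ### Infinite order of vanishing and derivatives in one variable -/

section Vanishing

variable {E F : Type*} [NormedAddCommGroup E] [NormedSpace ℝ E] [NormedAddCommGroup F]
  [NormedSpace ℝ F]

/-- An analytic function vanishing to infinite order at a point vanishes near it. -/
lemma eventually_eq_zero_of_isBigO {f : E → F} {x : E} (hf : AnalyticAt ℝ f x)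
    (h : ∀ n : ℕ, (fun y => f (x + y)) =O[𝓝 0] fun y => ‖y‖ ^ n) : ∀ᶠ y in 𝓝 x, f y = 0 := by
  obtain ⟨p, hp⟩ := hf
  have hzero : ∀ n, ∀ y, (p n fun _ => y) = 0 := by
    intro n
    induction n using Nat.strong_induction_on with
    | _ n ih =>
      refine Asymptotics.IsBigO.continuousMultilinearMap_apply_eq_zero ?_
      have h1 := hp.isBigO_sub_partialSum_pow (n + 1)
      have h2 : ∀ y, p.partialSum (n + 1) y = p n fun _ => y := fun y => by
        rw [FormalMultilinearSeries.partialSum, Finset.sum_range_succ,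
          Finset.sum_eq_zero fun k hk => ih k (Finset.mem_range.1 hk) y, zero_add]
      simp only [h2] at h1
      refine ((h (n + 1)).sub h1).congr_left fun y => ?_
      abel
  filter_upwards [hp.eventually_hasSum_sub] with y hy
  simp only [hzero] at hy
  exact hy.unique hasSum_zero

variable {V W : Type*} [NormedAddCommGroup V] [NormedSpace ℝ V] [NormedAddCommGroup W]
  [NormedSpace ℝ W]

lemma iteratedDeriv_clm_comp (L : V →L[ℝ] W) (m : ℕ) : ∀ {f : ℝ → V} {t₀ : ℝ},
    (∀ᶠ t in 𝓝 t₀, ContDiffAt ℝ ∞ f t) →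
      iteratedDeriv m (fun t => L (f t)) t₀ = L (iteratedDeriv m f t₀) := by
  induction m with
  | zero => intro f t₀ _; simp
  | succ m ih =>
    intro f t₀ hf
    rw [iteratedDeriv_succ', iteratedDeriv_succ', ← ih]
    · refine Filter.EventuallyEq.iteratedDeriv_eq m ?_
      filter_upwards [hf] with t ht
      exact (L.hasFDerivAt.comp_hasDerivAt t (ht.differentiableAt (by simp)).hasDerivAt).deriv
    · filter_upwards [hf] with t ht
      exact (ht.fderiv_right (m := ∞) (by simp)).clm_apply contDiffAt_const

lemma iteratedDeriv_comp_mul (c : ℝ) (m : ℕ) : ∀ {f : ℝ → V},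
    (∀ᶠ t in 𝓝 0, ContDiffAt ℝ ∞ f t) →
      iteratedDeriv m (fun t => f (c * t)) 0 = c ^ m • iteratedDeriv m f 0 := by
  induction m with
  | zero => intro f _; simp
  | succ m ih =>
    intro f hf
    have hf' : ∀ᶠ t in 𝓝 0, ContDiffAt ℝ ∞ (deriv f) t := by
      filter_upwards [hf] with t ht
      exact (ht.fderiv_right (m := ∞) (by simp)).clm_apply contDiffAt_const
    have hc : Tendsto (fun t : ℝ => c * t) (𝓝 0) (𝓝 0) := by
      have : Tendsto (fun t : ℝ => c * t) (𝓝 0) (𝓝 (c * 0)) := (continuous_const_mul c).tendsto 0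
      rwa [mul_zero] at this
    have h1 : deriv (fun t => f (c * t)) =ᶠ[𝓝 0]
        fun t => (c • ContinuousLinearMap.id ℝ V) (deriv f (c * t)) := by
      filter_upwards [hc.eventually hf] with t ht
      have h2 : HasDerivAt (fun t : ℝ => c * t) c t := by
        simpa using (hasDerivAt_id t).const_mul c
      exact (HasDerivAt.scomp (h := fun t : ℝ => c * t) t
        (ht.differentiableAt (by simp)).hasDerivAt h2).deriv
    rw [iteratedDeriv_succ', h1.iteratedDeriv_eq, iteratedDeriv_clm_comp, ih hf',
      iteratedDeriv_succ']
    · rw [pow_succ', mul_smul]; rfl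
    · filter_upwards [hc.eventually hf'] with t ht
      exact ContDiffAt.comp (g := deriv f) (f := fun t : ℝ => c * t) t ht
        (contDiff_const.mul contDiff_id).contDiffAt

lemma taylorCoeff_pow_smul (j m : ℕ) (v : V) :
    taylorCoeff j (fun t : ℝ => t ^ m • v) = if j = m then v else 0 := by
  have h1 : iteratedDeriv j (fun t : ℝ => t ^ m • v) 0
      = iteratedDeriv j (fun t : ℝ => t ^ m) 0 • v := by
    have h2 := iteratedDeriv_clm_comp ((ContinuousLinearMap.id ℝ ℝ).smulRight v) j
      (f := fun t : ℝ => t ^ m) (t₀ := 0)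
      (Eventually.of_forall fun t => (contDiff_id.pow m).contDiffAt)
    simpa using h2
  rw [taylorCoeff, h1, iteratedDeriv_fun_pow_zero]
  split_ifs with h
  · rw [h, smul_smul, inv_mul_cancel₀ (by positivity), one_smul]
  · simp

end Vanishing


/-! ### Weighted components of holomorphic vector fields -/

section WeightComponents

variable {s r : ℕ}

/-- The dilation with a complex parameter. -/
noncomputable def cdil (τ : ℂ) (q : Coord s r) : Coord s r := (τ ^ 2 * q.1, τ • q.2.1, q.2.2)

lemma cdil_ofReal (t : ℝ) (q : Coord s r) : cdil (t : ℂ) q = dil t q := (dil_apply t q).symm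

lemma cdil_cdil (τ σ : ℂ) (q : Coord s r) : cdil τ (cdil σ q) = cdil (σ * τ) q := by
  refine Prod.ext ?_ (Prod.ext ?_ rfl)
  · simp only [cdil]; ring
  · simp only [cdil, smul_smul, mul_comm]

/-- `(X, Y, Z) ↦ (X, τ Y, τ² Z)`. -/
noncomputable def wdil (τ : ℂ) : Coord s r →L[ℂ] Coord s r :=
  (ContinuousLinearMap.fst ℂ ℂ ((Fin s → ℂ) × (Fin r → ℂ))).prod
    ((τ • (ContinuousLinearMap.fst ℂ (Fin s → ℂ) (Fin r → ℂ)).comp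
      (ContinuousLinearMap.snd ℂ ℂ ((Fin s → ℂ) × (Fin r → ℂ)))).prod
      (τ ^ 2 • (ContinuousLinearMap.snd ℂ (Fin s → ℂ) (Fin r → ℂ)).comp
        (ContinuousLinearMap.snd ℂ ℂ ((Fin s → ℂ) × (Fin r → ℂ)))))

lemma wdil_apply (τ : ℂ) (x : Coord s r) : wdil τ x = (x.1, τ • x.2.1, τ ^ 2 • x.2.2) := rfl

lemma wdil_wdil (τ σ : ℂ) (x : Coord s r) : wdil τ (wdil σ x) = wdil (τ * σ) x := by
  simp only [wdil_apply, smul_smul, mul_pow]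

/-- Pulling back a field divides its components by t², t and 1. Multiplying by t² removes the poles,
which is why `tau m` extracts the component of weight m − 2. -/
lemma dil_wdil (t : ℝ) (x : Coord s r) : dil t (wdil (t : ℂ) x) = t ^ 2 • x := by
  rw [dil_apply, wdil_apply]
  refine Prod.ext ?_ (Prod.ext ?_ ?_)
  · simp
  · simp only [smul_smul, ← sq, Prod.smul_fst, Prod.smul_snd]
    rw [← Complex.ofReal_pow, Complex.coe_smul]
  · simp only [Prod.smul_snd]
    rw [← Complex.ofReal_pow, Complex.coe_smul]

/-- The rescaled vector field, `τ ^ 2` times the pullback of `X` under the dilation. -/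
noncomputable def resc (X : Coord s r → Coord s r) (p : ℂ × Coord s r) : Coord s r :=
  wdil p.1 (X (cdil p.1 p.2))

/-- The component of weight `m - 2` of a vector field. -/
noncomputable def tau (m : ℕ) (X : Coord s r → Coord s r) (q : Coord s r) : Coord s r :=
  taylorCoeff m fun t : ℝ => resc X ((t : ℂ), q)

variable {X X' : Coord s r → Coord s r}

lemma analyticAt_resc (hX : AnalyticAt ℂ X 0) : AnalyticAt ℂ (resc X) (0, 0) := by
  have h1 : AnalyticAt ℂ (fun p : ℂ × Coord s r => cdil p.1 p.2) (0, 0) := by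
    have hw : AnalyticAt ℂ (fun p : ℂ × Coord s r => p.2.1) (0, 0) :=
      analyticAt_fst.comp analyticAt_snd
    have hz : AnalyticAt ℂ (fun p : ℂ × Coord s r => p.2.2.1) (0, 0) :=
      analyticAt_fst.comp (analyticAt_snd.comp analyticAt_snd)
    have hζ : AnalyticAt ℂ (fun p : ℂ × Coord s r => p.2.2.2) (0, 0) :=
      analyticAt_snd.comp (analyticAt_snd.comp analyticAt_snd)
    exact ((analyticAt_fst.pow 2).mul hw).prod ((analyticAt_fst.smul hz).prod hζ)
  have h2 : AnalyticAt ℂ (fun p : ℂ × Coord s r => X (cdil p.1 p.2)) (0, 0) := by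
    have h3 : cdil (0 : ℂ) (0 : Coord s r) = 0 := by simp [cdil]
    exact AnalyticAt.comp (g := X) (f := fun p : ℂ × Coord s r => cdil p.1 p.2)
      (by rw [h3]; exact hX) h1
  exact (analyticAt_fst.comp h2).prod ((analyticAt_fst.smul (analyticAt_fst.comp
    (analyticAt_snd.comp h2))).prod ((analyticAt_fst.pow 2).smul (analyticAt_snd.comp
    (analyticAt_snd.comp h2))))

lemma analyticAt_tau (m : ℕ) (hX : AnalyticAt ℂ X 0) : AnalyticAt ℂ (tau m X) 0 := by
  have h3 := (analyticAt_iteratedDeriv_slice m (analyticAt_resc hX)).const_smul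
    (c := ((m.factorial : ℂ))⁻¹)
  refine h3.congr (Eventually.of_forall fun q => ?_)
  simp only [tau, taylorCoeff, Pi.smul_apply]
  rw [← Complex.coe_smul]
  push_cast
  rfl

lemma analyticAt_resc_real (hX : AnalyticAt ℂ X 0) : ∀ᶠ p in 𝓝 ((0 : ℝ), (0 : Coord s r)),
    AnalyticAt ℝ (fun p : ℝ × Coord s r => resc X ((p.1 : ℂ), p.2)) p := by
  have h1 : ∀ p : ℝ × Coord s r, AnalyticAt ℝ (fun p : ℝ × Coord s r => ((p.1 : ℂ), p.2)) p :=
    fun p => ((Complex.ofRealCLM.comp (ContinuousLinearMap.fst ℝ ℝ (Coord s r))).analyticAt p).prod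
      analyticAt_snd
  have h2 : Tendsto (fun p : ℝ × Coord s r => ((p.1 : ℂ), p.2)) (𝓝 (0, 0)) (𝓝 (0, 0)) := by
    have := (h1 (0, 0)).continuousAt.tendsto
    simpa only [Complex.ofReal_zero] using this
  filter_upwards [h2.eventually (analyticAt_resc hX).eventually_analyticAt] with p hp
  exact AnalyticAt.comp (g := resc X) (f := fun p : ℝ × Coord s r => ((p.1 : ℂ), p.2))
    hp.restrictScalars (h1 p)

lemma eventually_at_zero {p : ℝ × Coord s r → Prop} (h : ∀ᶠ x in 𝓝 ((0 : ℝ), (0 : Coord s r)), p x)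
    :
    ∀ᶠ q in 𝓝 (0 : Coord s r), ∀ᶠ x in 𝓝 ((0 : ℝ), q), p x :=
  ((Continuous.prodMk_right (0 : ℝ)).tendsto (0 : Coord s r)).eventually h.eventually_nhds

lemma smooth_resc (hX : AnalyticAt ℂ X 0) : ∀ᶠ q in 𝓝 (0 : Coord s r),
    ∀ᶠ t in 𝓝 (0 : ℝ), ContDiffAt ℝ ∞ (fun t : ℝ => resc X ((t : ℂ), q)) t := by
  filter_upwards [eventually_slice (analyticAt_resc_real hX)] with q hq
  filter_upwards [hq] with t ht
  exact ContDiffAt.comp (g := fun p : ℝ × Coord s r => resc X ((p.1 : ℂ), p.2))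
    (f := fun t : ℝ => (t, q)) t ht.contDiffAt (contDiffAt_id.prodMk contDiffAt_const)

lemma tendsto_dil_left (q : Coord s r) : Tendsto (fun t : ℝ => dil t q) (𝓝 0) (𝓝 (dil 0 q)) :=
  (contDiff_dil.continuous.comp (Continuous.prodMk_left q)).tendsto 0

lemma tau_congr (m : ℕ) (h : X =ᶠ[𝓝 0] X') : tau m X =ᶠ[𝓝 0] tau m X' := by
  filter_upwards [eventually_dil_zero h] with q hq
  refine congrArg _ (Filter.EventuallyEq.iteratedDeriv_eq m ?_)
  filter_upwards [(tendsto_dil_left q).eventually hq] with t ht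
  rw [resc, resc, cdil_ofReal, ht]

lemma tau_add (m : ℕ) (hX : AnalyticAt ℂ X 0) (hX' : AnalyticAt ℂ X' 0) :
    tau m (X + X') =ᶠ[𝓝 0] tau m X + tau m X' := by
  filter_upwards [smooth_resc hX, smooth_resc hX'] with q h1 h2
  have h3 : (fun t : ℝ => resc (X + X') ((t : ℂ), q))
      = (fun t : ℝ => resc X ((t : ℂ), q)) + fun t : ℝ => resc X' ((t : ℂ), q) := by
    funext t
    simp [resc]
  have hm : ((m : ℕ) : WithTop ℕ∞) ≤ ∞ := WithTop.coe_le_coe.2 le_top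
  rw [tau, taylorCoeff, h3, iteratedDeriv_add (h1.self_of_nhds.of_le hm) (h2.self_of_nhds.of_le hm),
    smul_add]
  rfl

lemma tau_smul (m : ℕ) (c : ℝ) (hX : AnalyticAt ℂ X 0) :
    tau m (c • X) =ᶠ[𝓝 0] c • tau m X := by
  filter_upwards [smooth_resc hX] with q h1
  have h3 : (fun t : ℝ => resc (c • X) ((t : ℂ), q))
      = fun t : ℝ => (c • ContinuousLinearMap.id ℝ (Coord s r)) (resc X ((t : ℂ), q)) := by
    funext t
    have : (c • X) (cdil (t : ℂ) q) = (c : ℂ) • X (cdil (t : ℂ) q) := (Complex.coe_smul _ _).symm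
    rw [resc, this, map_smul, Complex.coe_smul]
    rfl
  rw [tau, taylorCoeff, h3, iteratedDeriv_clm_comp _ _ h1]
  simp only [Pi.smul_apply, tau, taylorCoeff, smul_apply,
    ContinuousLinearMap.id_apply]
  rw [smul_comm]

/-- The component is homogeneous: rescaling by t and then by u is rescaling by tu, and the m-th
derivative in u at 0 produces t ^ m. -/
lemma resc_tau (m : ℕ) (hX : AnalyticAt ℂ X 0) : ∀ᶠ q in 𝓝 (0 : Coord s r),
    ∀ᶠ t : ℝ in 𝓝 0, resc (tau m X) ((t : ℂ), q) = t ^ m • tau m X q := by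
  filter_upwards [smooth_resc hX, eventually_dil_zero (smooth_resc hX)] with q h1 h2
  filter_upwards [(tendsto_dil_left q).eventually h2] with t ht
  have h3 : ∀ u : ℝ, ((wdil (t : ℂ)).restrictScalars ℝ) (resc X ((u : ℂ), dil t q))
      = resc X (((t * u : ℝ) : ℂ), q) := fun u => by
    rw [← cdil_ofReal, resc, resc, cdil_cdil, ContinuousLinearMap.coe_restrictScalars', wdil_wdil]
    push_cast
    rfl
  have h4 := iteratedDeriv_clm_comp ((wdil (s := s) (r := r) (t : ℂ)).restrictScalars ℝ) m ht
  simp only [h3] at h4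
  rw [iteratedDeriv_comp_mul t m (f := fun u : ℝ => resc X ((u : ℂ), q)) h1] at h4
  rw [resc, cdil_ofReal, tau, tau, taylorCoeff, taylorCoeff, smul_comm, h4]
  exact ((wdil (s := s) (r := r) (t : ℂ)).restrictScalars ℝ).map_smul _ _

lemma tau_tau (j m : ℕ) (hX : AnalyticAt ℂ X 0) :
    tau j (tau m X) =ᶠ[𝓝 0] if j = m then tau m X else 0 := by
  filter_upwards [resc_tau m hX] with q hq
  have h1 : taylorCoeff j (fun t : ℝ => resc (tau m X) ((t : ℂ), q))
      = taylorCoeff j fun t : ℝ => t ^ m • tau m X q := by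
    rw [taylorCoeff, taylorCoeff, Filter.EventuallyEq.iteratedDeriv_eq j hq]
  rw [tau, h1, taylorCoeff_pow_smul]
  split_ifs <;> rfl

lemma vanishesToOrder_resc {m : ℕ} (hX : AnalyticAt ℂ X 0) (h : ∀ j < m, tau j X =ᶠ[𝓝 0] 0) :
    ∀ᶠ q in 𝓝 (0 : Coord s r),
      VanishesToOrder m (fun p : ℝ × Coord s r => resc X ((p.1 : ℂ), p.2)) q := by
  have h1 : ∀ᶠ q in 𝓝 (0 : Coord s r), ∀ j : Fin m, ∀ᶠ x in 𝓝 q, tau j X x = 0 :=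
    eventually_all.2 fun j => (h j j.2).eventually_nhds
  filter_upwards [h1, eventually_at_zero (analyticAt_resc_real hX)] with q h2 h3
  refine ⟨?_, fun j hj => ?_⟩
  · filter_upwards [h3] with p hp using hp.contDiffAt
  · filter_upwards [h2 ⟨j, hj⟩] with x hx
    rw [tau, taylorCoeff, smul_eq_zero] at hx
    exact hx.resolve_left (by positivity)

/-- The rescaled field vanishes to infinite order in t, hence in (t, q) jointly at the origin, since
|t| ≤ ‖(t, q)‖. Being analytic it vanishes near (0, 0), and one fixed t ≠ 0 recovers X. -/
lemma eq_zero_of_tau (hX : AnalyticAt ℂ X 0) (h : ∀ m, tau m X =ᶠ[𝓝 0] 0) : X =ᶠ[𝓝 0] 0 := by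
  have h1 : ∀ᶠ p in 𝓝 ((0 : ℝ), (0 : Coord s r)), resc X ((p.1 : ℂ), p.2) = 0 := by
    refine eventually_eq_zero_of_isBigO (analyticAt_resc_real hX).self_of_nhds fun n => ?_
    have h2 := (vanishesToOrder_resc (m := n) hX fun j _ => h j).self_of_nhds.norm_sub_le 1 one_pos
    have h3 : taylorCoeff n (fun t : ℝ => resc X ((t : ℂ), (0 : Coord s r))) = 0 :=
      (h n).self_of_nhds
    refine Asymptotics.IsBigO.of_bound 1 ?_
    filter_upwards [h2] with p hp
    rw [h3, smul_zero, sub_zero] at hp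
    have h4 : ((0 : ℝ), (0 : Coord s r)) + p = p := zero_add p
    rw [h4]
    refine hp.trans ?_
    rw [one_mul, one_mul, norm_pow, norm_norm]
    exact pow_le_pow_left₀ (abs_nonneg _) (norm_fst_le p) n
  rw [nhds_prod_eq] at h1
  have h2 : ∀ᶠ t : ℝ in 𝓝[≠] 0, ∀ᶠ q in 𝓝 (0 : Coord s r), resc X ((t : ℂ), q) = 0 :=
    h1.curry.filter_mono nhdsWithin_le_nhds
  obtain ⟨t, ht, ht0⟩ := (h2.and self_mem_nhdsWithin).exists
  have ht0 : t ≠ 0 := ht0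
  have h3 : Tendsto (fun q : Coord s r => dil t⁻¹ q) (𝓝 0) (𝓝 0) := by
    have := (dil (s := s) (r := r) t⁻¹).continuous.tendsto 0
    rwa [map_zero] at this
  filter_upwards [h3.eventually ht] with q hq
  rw [resc, cdil_ofReal, dil_dil_inv ht0] at hq
  have h4 := dil_wdil t (X q)
  simp only at hq
  rw [hq, map_zero, eq_comm, smul_eq_zero] at h4
  exact h4.resolve_left (pow_ne_zero 2 ht0)

end WeightComponents


/-! ### Infinitesimal symmetries and their leading components -/

section Symmetries

variable {s r : ℕ} {X : Coord s r → Coord s r}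

namespace DefiningEquation

variable (F : DefiningEquation s r)

/-- The differential of ρ ∘ `dil t` = t² ρ₀ − Q ∘ `dil t` in the space variables, with the chain
rule on the left. -/
lemma fderiv_rho_dil : ∀ᶠ q in 𝓝 (0 : Coord s r), ∀ᶠ p in 𝓝 ((0 : ℝ), q), ∀ v,
    fderiv ℝ F.rho (dil p.1 p.2) (dil p.1 v)
      = p.1 ^ 2 * fderiv ℝ F.rho0 p.2 v - dX F.Qt p v := by
  filter_upwards [F.vanishesToOrder_Qt, F.analyticAt_rho0.eventually_nhds,
    eventually_dil_zero F.analyticAt_rho] with q h1 h2 h3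
  have h4 := (analyticAt_dil ((0 : ℝ), q)).continuousAt.eventually h3
  filter_upwards [h1.1, h4, (continuous_snd.tendsto ((0 : ℝ), q)).eventually h2]
    with ⟨t, x⟩ hQ hρ hρ0 v
  have h5 : HasFDerivAt (fun x => F.rho (dil t x)) ((fderiv ℝ F.rho (dil t x)).comp
      ((dil t).restrictScalars ℝ)) x :=
    HasFDerivAt.comp (g := F.rho) (f := fun x => dil t x) x
      hρ.differentiableAt.hasFDerivAt ((dil t).restrictScalars ℝ).hasFDerivAt
  have h6 := (hρ0.differentiableAt.hasFDerivAt.const_mul (t ^ 2)).sub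
    (hasFDerivAt_slice (hQ.differentiableAt (by simp)))
  have h7 : (fun x => F.rho (dil t x)) = (fun x => t ^ 2 * F.rho0 x) - fun x => F.Qt (t, x) := by
    funext x
    rw [rho, rho0_dil]
    rfl
  rw [h7] at h5
  exact DFunLike.congr_fun (h5.unique h6) v

/-- The leading component of an infinitesimal symmetry is an infinitesimal symmetry of the
model. -/
lemma tau_mem_realTangent {m : ℕ} (hX : AnalyticAt ℂ X 0)
    (hT : ∀ᶠ q in 𝓝 0, q ∈ F.hypersurface → X q ∈ realTangent F.hypersurface q)
    (hlow : ∀ j < m, tau j X =ᶠ[𝓝 0] 0) :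
    ∀ᶠ q in 𝓝 0, q ∈ F.model → tau m X q ∈ realTangent F.model q := by
  filter_upwards [F.exists_approximation, vanishesToOrder_resc hX hlow, F.vanishesToOrder_Qt,
    F.fderiv_rho_dil, F.analyticAt_rho0, F.isDefiningFunctionAt_rho0.eventually,
    eventually_dil_zero hT, eventually_dil_zero F.isDefiningFunctionAt_rho.eventually]
    with q h1 h2 h3 h4 h5 h6 h7 h8 hq
  obtain ⟨x, hx, hxM⟩ := h1 hq
  have ht : Tendsto (fun t : ℝ => t) (𝓝[≠] 0) (𝓝 0) := nhdsWithin_le_nhds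
  have hne : ∀ᶠ t : ℝ in 𝓝[≠] 0, t ≠ 0 := self_mem_nhdsWithin
  have hv := h2.tendsto ht hne hx
  have hQ := h3.dX.tendsto_zero (m := 2) ht hne hx
  have hL := tendsto_clm_apply (h5.fderiv.continuousAt.tendsto.comp hx) hv
  have hR := tendsto_clm_apply hQ hv
  rw [zero_apply] at hR
  rw [h6.mem_realTangent hq]
  refine tendsto_nhds_unique hL (hR.congr' ?_)
  filter_upwards [hne, (tendsto_dil_zero hx).eventually h7, (tendsto_dil_zero hx).eventually h8,
    (ht.prodMk_nhds hx).eventually h4] with t ht0 h9 h10 h11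
  -- Tangency of X at the approximating point says that t² dρ₀ and d(Q ∘ `dil t`) agree on the
  -- rescaled field. After division by t^(2+m) the field tends to its leading component and the side
  -- of Q tends to 0.
  have h12 := (h10.mem_realTangent (hxM t ht0)).1 (h9 (hxM t ht0))
  have h13 := h11 (resc X ((t : ℂ), x t))
  have h14 : dil t (resc X ((t : ℂ), x t)) = t ^ 2 • X (dil t (x t)) := by
    rw [resc, dil_wdil, cdil_ofReal]
  rw [h14, (fderiv ℝ F.rho (dil t (x t))).map_smul, h12, smul_zero] at h13
  rw [Function.comp_apply, smul_apply, (dX F.Qt (t, x t)).map_smul, (fderiv ℝ F.rho0 (x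
      t)).map_smul, smul_comm]
  congr 1
  have := pow_ne_zero 2 ht0
  rw [smul_eq_mul, inv_mul_eq_iff_eq_mul₀ this]
  linarith

end DefiningEquation

/-- Germs at `0` of holomorphic vector fields. -/
def holomorphicGerms (s r : ℕ) : Submodule ℝ (Germ (𝓝 (0 : Coord s r)) (Coord s r)) where
  carrier := {ξ | ∃ X : Coord s r → Coord s r, ξ = (X : Germ _ _) ∧ AnalyticAt ℂ X 0}
  zero_mem' := ⟨0, rfl, analyticAt_const⟩
  add_mem' := by
    rintro a b ⟨X, rfl, hX⟩ ⟨X', rfl, hX'⟩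
    exact ⟨X + X', rfl, hX.add hX'⟩
  smul_mem' := by
    rintro c a ⟨X, rfl, hX⟩
    have : AnalyticAt ℂ ((c : ℂ) • X) 0 := hX.const_smul
    exact ⟨c • X, rfl, this.congr (Eventually.of_forall fun q => Complex.coe_smul c (X q))⟩

/-- The components of given weight of a germ of a holomorphic vector field. -/
noncomputable def tauGerm (m : ℕ) : holomorphicGerms s r →ₗ[ℝ] holomorphicGerms s r where
  toFun ξ := ⟨Germ.map' (tau m) (fun _ _ h => tau_congr m h) ξ.1, by
    obtain ⟨ξ, X, rfl, hX⟩ := ξ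
    exact ⟨tau m X, rfl, analyticAt_tau m hX⟩⟩
  map_add' := by
    rintro ⟨_, X, rfl, hX⟩ ⟨_, X', rfl, hX'⟩
    exact Subtype.ext (Germ.coe_eq.2 (tau_add m hX hX'))
  map_smul' := by
    rintro c ⟨_, X, rfl, hX⟩
    exact Subtype.ext (Germ.coe_eq.2 (tau_smul m c hX))

lemma hol_le_holomorphicGerms (M : Set (Coord s r)) : hol M 0 ≤ holomorphicGerms s r := by
  rintro _ ⟨X, rfl, hX, -⟩
  exact ⟨X, rfl, hX⟩

lemma realDim_comap_hol (M : Set (Coord s r)) :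
    realDim ((hol M 0).comap (holomorphicGerms s r).subtype) = realDim (hol M 0) := by
  rw [realDim, realDim, (Submodule.comapSubtypeEquivOfLe (hol_le_holomorphicGerms M)).rank_eq]

lemma tauGerm_eq_zero_iff {m : ℕ} (hX : AnalyticAt ℂ X 0) :
    tauGerm m ⟨Germ.ofFun X, ⟨X, rfl, hX⟩⟩ = 0 ↔ tau m X =ᶠ[𝓝 0] 0 := by
  rw [Subtype.ext_iff]
  exact Germ.coe_eq

/-- The components `tau m` act on germs as mutually orthogonal projections with trivial common
kernel, and leading components of symmetries are symmetries of the model. -/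
lemma DefiningEquation.realDim_hol_le (F : DefiningEquation s r) :
    realDim (hol F.hypersurface 0) ≤ realDim (hol F.model 0) := by
  rw [← realDim_comap_hol, ← realDim_comap_hol]
  refine realDim_le_of_leading_terms tauGerm _ _ ?_ ?_ ?_ ?_
  · rintro ⟨_, X, rfl, hX⟩ h
    exact Subtype.ext (Germ.coe_eq.2
      (eq_zero_of_tau hX fun m => (tauGerm_eq_zero_iff hX).1 (h m)))
  · rintro m ⟨_, X, rfl, hX⟩
    have := tau_tau m m hX
    rw [if_pos rfl] at this
    exact Subtype.ext (Germ.coe_eq.2 this)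
  · rintro j m ⟨_, X, rfl, hX⟩ hj
    have := tau_tau j m hX
    rw [if_neg hj] at this
    exact Subtype.ext (Germ.coe_eq.2 this)
  · rintro m ⟨_, X, rfl, hX⟩ hV hlow
    obtain ⟨X', h1, h2, h3⟩ := hV
    have h1 : X =ᶠ[𝓝 0] X' := Germ.coe_eq.1 h1
    refine ⟨tau m X, rfl, analyticAt_tau m hX, F.tau_mem_realTangent hX ?_ fun j hj =>
      (tauGerm_eq_zero_iff hX).1 (hlow j hj)⟩
    filter_upwards [h1, h3] with q hq h
    rwa [hq]

end Symmetries


/-! ### Involutivity of the Levi kernels -/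

section Involutive

variable {s r : ℕ} {ρ : Coord s r → ℝ} {q : Coord s r} {X Y : Coord s r → Coord s r}

lemma hess_add_fderiv_eq_zero (hρ : AnalyticAt ℝ ρ q) (hX : DifferentiableAt ℝ X q)
    (h0 : ∀ᶠ x in 𝓝 q, fderiv ℝ ρ x (X x) = 0) (v : Coord s r) :
    hess ρ q v (X q) + fderiv ℝ ρ q (fderiv ℝ X q v) = 0 := by
  have h1 := hρ.fderiv.differentiableAt.hasFDerivAt.clm_apply hX.hasFDerivAt
  have h2 := h1.unique ((hasFDerivAt_const (0 : ℝ) q).congr_of_eventuallyEq h0)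
  have h3 := DFunLike.congr_fun h2 v
  simpa [add_comm] using h3

lemma dC_hess_add_fderiv_eq_zero (hρ : AnalyticAt ℝ ρ q) (hX : DifferentiableAt ℝ X q)
    (h0 : ∀ᶠ x in 𝓝 q, dC (fderiv ℝ ρ x) (X x) = 0) (v : Coord s r) :
    (hess ρ q v (X q) + fderiv ℝ ρ q (fderiv ℝ X q v) = 0) ∧
      hess ρ q v (Complex.I • X q) + fderiv ℝ ρ q (Complex.I • fderiv ℝ X q v) = 0 := by
  refine ⟨hess_add_fderiv_eq_zero hρ hX (h0.mono fun x hx => (dC_eq_zero_iff.1 hx).1) v, ?_⟩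
  have := hess_add_fderiv_eq_zero hρ (hX.const_smul Complex.I)
    (h0.mono fun x hx => (dC_eq_zero_iff.1 hx).2) v
  rwa [fderiv_const_smul hX] at this

lemma lev_fderiv_eq_zero (hρ : AnalyticAt ℝ ρ q) (hX : DifferentiableAt ℝ X q)
    (hY : DifferentiableAt ℝ Y q) (h0 : ∀ᶠ x in 𝓝 q, lev (hess ρ x) (X x) (Y x) = 0)
    (v : Coord s r) :
    lev (third ρ q v) (X q) (Y q) + lev (hess ρ q) (fderiv ℝ X q v) (Y q)
      + lev (hess ρ q) (X q) (fderiv ℝ Y q v) = 0 := by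
  have h1 : ∀ {X Y : Coord s r → Coord s r}, DifferentiableAt ℝ X q → DifferentiableAt ℝ Y q →
      ∃ L : Coord s r →L[ℝ] ℝ, HasFDerivAt (fun x => hess ρ x (X x) (Y x)) L q ∧
        L v = third ρ q v (X q) (Y q) + hess ρ q (fderiv ℝ X q v) (Y q)
          + hess ρ q (X q) (fderiv ℝ Y q v) := by
    intro X Y hX hY
    refine ⟨_, ((hasFDerivAt_hess hρ).clm_apply hX.hasFDerivAt).clm_apply hY.hasFDerivAt, ?_⟩
    simp
    ring
  obtain ⟨L, hL, hLv⟩ := h1 hX hY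
  obtain ⟨L', hL', hLv'⟩ := h1 (hX.const_smul Complex.I) (hY.const_smul Complex.I)
  have h2 := (hL.add hL').unique ((hasFDerivAt_const (0 : ℝ) q).congr_of_eventuallyEq h0)
  have h3 := DFunLike.congr_fun h2 v
  rw [add_apply, hLv, hLv', fderiv_const_smul hX, fderiv_const_smul hY] at h3
  simp only [Pi.smul_apply, smul_apply, zero_apply] at h3
  simp only [lev]
  linarith

/-- The Levi kernels of the level sets of a function form an involutive distribution. -/
lemma bracket_mem_jetKernel {X X' : Coord s r → Coord s r} (hρ : AnalyticAt ℝ ρ q)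
    (hw : dC (fderiv ℝ ρ q) (eW s r) ≠ 0)
    (hX : DifferentiableAt ℝ X q) (hX' : DifferentiableAt ℝ X' q)
    (h : ∀ᶠ x in 𝓝 q, X x ∈ jetKernel (fderiv ℝ ρ x) (hess ρ x))
    (h' : ∀ᶠ x in 𝓝 q, X' x ∈ jetKernel (fderiv ℝ ρ x) (hess ρ x)) :
    fderiv ℝ X' q (X q) - fderiv ℝ X q (X' q) ∈ jetKernel (fderiv ℝ ρ q) (hess ρ q) := by
  have hs := hess_symm hρ
  have hI : ∀ {x : Coord s r} {v : Coord s r}, dC (fderiv ℝ ρ x) v = 0 →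
      dC (fderiv ℝ ρ x) (Complex.I • v) = 0 := fun hv => by
    rw [(dC _).map_smul, hv, smul_zero]
  have a1 := dC_hess_add_fderiv_eq_zero hρ hX (h.mono fun x hx => hx.1)
  have a2 := dC_hess_add_fderiv_eq_zero hρ hX' (h'.mono fun x hx => hx.1)
  refine ⟨dC_eq_zero_iff.2 ⟨?_, ?_⟩, fun y hy => ?_⟩
  · have := (a1 (X' q)).1
    have := (a2 (X q)).1
    have := hs (X q) (X' q)
    rw [map_sub]
    linarith
  · have e1 := (a1 (X' q)).2
    have e2 := (a2 (X q)).2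
    have e3 := h.self_of_nhds.2 _ (hI h'.self_of_nhds.1)
    have e4 := hs (X' q) (Complex.I • X q)
    rw [lev, I_smul_I_smul, map_neg] at e3
    rw [smul_sub, map_sub]
    linarith
  · set Y := hproj ρ (eW s r) y with hYdef
    have hYq : Y q = y := by rw [hYdef, hproj, hy, zero_div, zero_smul, sub_zero]
    have hYd : DifferentiableAt ℝ Y q := (contDiffAt_hproj hρ hw y).differentiableAt (by simp)
    have hYh : ∀ᶠ x in 𝓝 q, dC (fderiv ℝ ρ x) (Y x) = 0 := by
      filter_upwards [eventually_dC_ne hρ hw] with x hx using dC_hproj hx y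
    have a3 := dC_hess_add_fderiv_eq_zero hρ hYd hYh
    -- The combination is again annihilated by ∂ρ: the Hessian terms that arise add up to Levi
    -- pairings of X with Y, which vanish. It may therefore be paired with kernel vectors.
    have hZ : ∀ {X : Coord s r → Coord s r}, X q ∈ jetKernel (fderiv ℝ ρ q) (hess ρ q) →
        (∀ v, (hess ρ q v (X q) + fderiv ℝ ρ q (fderiv ℝ X q v) = 0) ∧
          hess ρ q v (Complex.I • X q) + fderiv ℝ ρ q (Complex.I • fderiv ℝ X q v) = 0) →
        dC (fderiv ℝ ρ q) (fderiv ℝ Y q (X q)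
          + Complex.I • fderiv ℝ X q (Complex.I • Y q)) = 0 := by
      intro X hk a
      obtain ⟨b1, b2⟩ := a3 (X q)
      obtain ⟨c1, c2⟩ := a (Complex.I • Y q)
      have d1 := hk.2 (Y q) hYh.self_of_nhds
      have d2 := hk.2 _ (hI hYh.self_of_nhds)
      have e1 := hs (Complex.I • Y q) (X q)
      have e2 := hs (Complex.I • Y q) (Complex.I • X q)
      rw [lev] at d1 d2
      rw [I_smul_I_smul, map_neg] at d2
      refine dC_eq_zero_iff.2 ⟨?_, ?_⟩
      · rw [map_add]
        linarith
      · rw [smul_add, I_smul_I_smul, map_add, map_neg]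
        linarith
    have z1 := h'.self_of_nhds.2 _ (hZ h.self_of_nhds a1)
    have z2 := h.self_of_nhds.2 _ (hZ h'.self_of_nhds a2)
    -- Three vanishing Levi pairings are differentiated: (X′, Y) along X, (X, Y) along X′, and (X′,
    -- iX) along iY. In E1 − E2 + E3 the third derivatives cancel by symmetry, and the remaining
    -- terms are `z1`, `z2` and the pairing of the bracket with Y.
    have E1 := lev_fderiv_eq_zero hρ hX' hYd
      (by filter_upwards [h', hYh] with x hx hy using hx.2 _ hy) (X q)
    have E2 := lev_fderiv_eq_zero hρ hX hYd
      (by filter_upwards [h, hYh] with x hx hy using hx.2 _ hy) (X' q)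
    have E3 := lev_fderiv_eq_zero hρ hX' (hX.const_smul Complex.I)
      (by filter_upwards [h', h] with x hx hy using hx.2 _ (hI hy.1)) (Complex.I • Y q)
    rw [fderiv_const_smul hX] at E3
    simp only [Pi.smul_apply, smul_apply] at E3
    rw [← hYq]
    have t1 := third_symm_left hρ (X q) (X' q) (Y q)
    have t2 : third ρ q (X q) (Complex.I • X' q) (Complex.I • Y q)
        = third ρ q (Complex.I • Y q) (Complex.I • X' q) (X q) := by
      rw [third_symm_right hρ, third_symm_left hρ, third_symm_right hρ]
    have t3 : third ρ q (X' q) (Complex.I • X q) (Complex.I • Y q)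
        = third ρ q (Complex.I • Y q) (X' q) (Complex.I • X q) := by
      rw [third_symm_right hρ, third_symm_left hρ]
    have u1 := hs (fderiv ℝ X' q (Complex.I • Y q)) (Complex.I • X q)
    have u2 := hs (Complex.I • fderiv ℝ X' q (Complex.I • Y q)) (X q)
    simp only [lev, smul_add, smul_sub, I_smul_I_smul, map_add, map_sub, map_neg,
      sub_apply] at E1 E2 E3 z1 z2 ⊢
    linarith

/-- The integrability condition for the frame of the Levi kernels. -/
lemma fderiv_frame_symm (hρ : AnalyticAt ℝ ρ 0) (hg : IsGraphFunction ρ)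
    (hi : ((jetMapAt ρ 0).comp (inU s r)).IsInvertible)
    (hr : ∀ᶠ q in 𝓝 (0 : Coord s r),
      Module.finrank ℂ (jetKernel (fderiv ℝ ρ q) (hess ρ q)) = r) :
    ∀ᶠ q in 𝓝 (0 : Coord s r), ∀ η ξ,
      fderiv ℝ (frame ρ) q (graphMap (frame ρ q) η) ξ
        = fderiv ℝ (frame ρ) q (graphMap (frame ρ q) ξ) η := by
  have hk : ∀ᶠ q in 𝓝 (0 : Coord s r), jetKernel (fderiv ℝ ρ q) (hess ρ q)
      = LinearMap.range (graphMap (frame ρ q) : (Fin r → ℂ) →ₗ[ℂ] Coord s r) := by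
    filter_upwards [hr, eventually_invertible hρ hi] with q h1 h2 using jetKernel_eq_range h2 h1
  filter_upwards [hk.eventually_nhds, hρ.eventually_analyticAt, eventually_invertible hρ hi]
    with q h1 h2 h3 η ξ
  have h4 : DifferentiableAt ℝ (frame ρ) q := (contDiffAt_frame h2 h3).differentiableAt (by simp)
  have h5 : ∀ η, ∀ᶠ x in 𝓝 q, graphMap (frame ρ x) η ∈ jetKernel (fderiv ℝ ρ x) (hess ρ x) :=
    fun η => by filter_upwards [h1] with x hx; rw [hx]; exact ⟨η, rfl⟩
  have h6 : ∀ η, DifferentiableAt ℝ (fun x => graphMap (frame ρ x) η) q ∧ ∀ y,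
      fderiv ℝ (fun x => graphMap (frame ρ x) η) q y = inU s r (fderiv ℝ (frame ρ) q y η) :=
    fun η => by
    have h7 := hasFDerivAt_graphMap h4 (differentiableAt_const η)
    refine ⟨(h7 0).1, fun y => ?_⟩
    have h8 := (h7 y).2
    rw [fderiv_fun_const] at h8
    rw [h8]
    simp
  have h7 := bracket_mem_jetKernel h2 (hg.dC_eW h2.differentiableAt) (h6 η).1 (h6 ξ).1 (h5 η) (h5 ξ)
  rw [(h6 η).2, (h6 ξ).2, ← map_sub, h1.self_of_nhds, eq_graphMap_of_mem_range] at h7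
  have h8 : (inU s r (fderiv ℝ (frame ρ) q (graphMap (frame ρ q) η) ξ
      - fderiv ℝ (frame ρ) q (graphMap (frame ρ q) ξ) η)).2.2 = 0 := rfl
  rw [h8, map_zero] at h7
  rw [← sub_eq_zero]
  exact congrArg (prU s r) h7

end Involutive


/-! ### Integrable systems together with their linearization -/

section Linearized

variable {U V : Type*} [NormedAddCommGroup U] [NormedSpace ℝ U] [NormedAddCommGroup V]
  [NormedSpace ℝ V]

/-- Solutions of an integrable total differential equation together with a solution of the
linearized equation. -/
lemma exists_linearized_solution [CompleteSpace U] {a : U × V → (V →L[ℝ] U)} {u₀ : U}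
    (ha : ∀ᶠ q in 𝓝 (u₀, (0 : V)), ContDiffAt ℝ ∞ a q)
    (hint : ∀ᶠ q in 𝓝 (u₀, (0 : V)), ∀ η ξ : V,
      fderiv ℝ a q (a q η, η) ξ = fderiv ℝ a q (a q ξ, ξ) η) (γ₀ : U) :
    ∃ g γ : V → U, g 0 = u₀ ∧ γ 0 = γ₀ ∧
      (∀ᶠ ζ in 𝓝 (0 : V), ContDiffAt ℝ ∞ g ζ ∧ ContDiffAt ℝ ∞ γ ζ ∧
        HasFDerivAt g (a (g ζ, ζ)) ζ ∧ HasFDerivAt γ (fderiv ℝ a (g ζ, ζ) (γ ζ, 0)) ζ) := by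
  let pr : (U × U) × V →L[ℝ] U × V :=
    ((ContinuousLinearMap.fst ℝ U U).comp (ContinuousLinearMap.fst ℝ (U × U) V)).prod
      (ContinuousLinearMap.snd ℝ (U × U) V)
  let vr : (U × U) × V →L[ℝ] U × V :=
    (((ContinuousLinearMap.snd ℝ U U).comp (ContinuousLinearMap.fst ℝ (U × U) V))).prod 0
  -- The system for the pair (g, γ): the original equation and its derivative in the direction γ.
  -- One application of the Frobenius theorem solves both.
  let b : (U × U) × V → (V →L[ℝ] U × U) := fun q => (a (pr q)).prod (fderiv ℝ a (pr q) (vr q))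
  let pl : (V →L[ℝ] U) × (V →L[ℝ] U) →L[ℝ] (V →L[ℝ] U × U) :=
    ((ContinuousLinearMap.prodₗᵢ ℝ : (V →L[ℝ] U) × (V →L[ℝ] U) ≃ₗᵢ[ℝ] (V →L[ℝ] U × U)) :
      (V →L[ℝ] U) × (V →L[ℝ] U) →L[ℝ] (V →L[ℝ] U × U))
  have hpr : Tendsto pr (𝓝 ((u₀, γ₀), 0)) (𝓝 (u₀, 0)) := pr.continuous.tendsto ((u₀, γ₀), 0)
  have hb : ∀ᶠ q in 𝓝 ((u₀, γ₀), (0 : V)), ContDiffAt ℝ ∞ b q := by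
    filter_upwards [hpr.eventually ha] with q hq
    have h1 : ContDiffAt ℝ ∞ (fun q => a (pr q)) q :=
      ContDiffAt.comp (g := a) q hq pr.contDiff.contDiffAt
    have h2 : ContDiffAt ℝ ∞ (fun q => fderiv ℝ a (pr q)) q :=
      ContDiffAt.comp (g := fderiv ℝ a) q (hq.fderiv_right (m := ∞) (by simp))
        pr.contDiff.contDiffAt
    have h3 : ContDiffAt ℝ ∞ (fun q => fderiv ℝ a (pr q) (vr q)) q :=
      h2.clm_apply vr.contDiff.contDiffAt
    exact pl.contDiff.contDiffAt.comp q (h1.prodMk h3)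
  have hbint : ∀ᶠ q in 𝓝 ((u₀, γ₀), (0 : V)), ∀ η ξ : V,
      fderiv ℝ b q (b q η, η) ξ = fderiv ℝ b q (b q ξ, ξ) η := by
    filter_upwards [hpr.eventually (ha.and hint).eventually_nhds] with q hq η ξ
    have hd : DifferentiableAt ℝ a (pr q) := hq.self_of_nhds.1.differentiableAt (by simp)
    have hd2 : DifferentiableAt ℝ (fderiv ℝ a) (pr q) :=
      (hq.self_of_nhds.1.fderiv_right (m := ∞) (by simp)).differentiableAt (by simp)
    have hsym : IsSymmSndFDerivAt ℝ a (pr q) :=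
      hq.self_of_nhds.1.isSymmSndFDerivAt minSmoothness_two_le
    have h1 : HasFDerivAt (fun q => a (pr q)) ((fderiv ℝ a (pr q)).comp pr) q :=
      HasFDerivAt.comp (g := a) q hd.hasFDerivAt pr.hasFDerivAt
    have h2 : HasFDerivAt (fun q => fderiv ℝ a (pr q))
        ((fderiv ℝ (fderiv ℝ a) (pr q)).comp pr) q :=
      HasFDerivAt.comp (g := fderiv ℝ a) q hd2.hasFDerivAt pr.hasFDerivAt
    have h3 := h2.clm_apply vr.hasFDerivAt
    have hbd : ∀ y ξ, fderiv ℝ b q y ξ = (fderiv ℝ a (pr q) (pr y) ξ,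
        fderiv ℝ (fderiv ℝ a) (pr q) (pr y) (vr q) ξ + fderiv ℝ a (pr q) (vr y) ξ) := by
      intro y ξ
      have h4 : HasFDerivAt b _ q :=
        pl.hasFDerivAt.comp q (h1.prodMk h3)
      rw [h4.fderiv]
      simp [pl, add_comm]
      rfl
    have hX : ∀ η : V, HasFDerivAt (fun x : U × V => (a x η, η))
        (((fderiv ℝ a (pr q)).flip η).prod 0) (pr q) := fun η => by
      have := (hd.hasFDerivAt.clm_apply (hasFDerivAt_const η (pr q))).prodMk
        (hasFDerivAt_const η (pr q))
      refine this.congr_fderiv ?_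
      refine ContinuousLinearMap.ext fun y => ?_
      simp
    have hY : ∀ η ξ : V, HasFDerivAt (fun x : U × V => fderiv ℝ a x (a x η, η) ξ) _ (pr q) :=
      fun η ξ => (hd2.hasFDerivAt.clm_apply (hX η)).clm_apply (hasFDerivAt_const ξ (pr q))
    have h5 : (fun x : U × V => fderiv ℝ a x (a x η, η) ξ) =ᶠ[𝓝 (pr q)]
        fun x => fderiv ℝ a x (a x ξ, ξ) η := by
      filter_upwards [hq] with x hx using hx.2 η ξ
    -- The second half of the new integrability condition is the old condition differentiated in the
    -- direction γ, up to symmetry of the second derivative of `a`.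
    have h6 := DFunLike.congr_fun ((hY η ξ).unique ((hY ξ η).congr_of_eventuallyEq h5)) (vr q)
    simp at h6
    have e1 : ∀ η, pr (b q η, η) = (a (pr q) η, η) := fun η => rfl
    have e2 : ∀ η, vr (b q η, η) = (fderiv ℝ a (pr q) (vr q) η, 0) := fun η => rfl
    rw [hbd, hbd, e1, e1, e2, e2]
    refine Prod.ext (hq.self_of_nhds.2 η ξ) ?_
    have s1 := hsym (vr q) (a (pr q) η, η)
    have s2 := hsym (vr q) (a (pr q) ξ, ξ)
    simp only
    rw [← s1, ← s2, add_comm, add_comm (fderiv ℝ (fderiv ℝ a) (pr q) (vr q) (a (pr q) ξ, ξ) η)]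
    exact h6
  obtain ⟨G, hG0, hG⟩ := exists_hasFDerivAt_eq hb hbint
  have hGs := contDiffAt_of_hasFDerivAt_eq (by rwa [hG0]) hG
  refine ⟨fun ζ => (G ζ).1, fun ζ => (G ζ).2, congrArg Prod.fst hG0, congrArg Prod.snd hG0, ?_⟩
  filter_upwards [hG, hGs] with ζ h1 h2
  exact ⟨h2.fst, h2.snd, h1.fst, h1.snd⟩

end Linearized


/-! ### Linear normalization and graph form -/

section GraphForm

variable {s r : ℕ}

/-- Linear coordinates adapted to a hyperplane and a subspace of it. -/
lemma exists_adapted_linear_equiv {E : Type*} [NormedAddCommGroup E] [NormedSpace ℂ E]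
    [FiniteDimensional ℂ E] {ℓ : E →L[ℂ] ℂ} (hℓ : ℓ ≠ 0) {W : Submodule ℂ E}
    (hW : ∀ v ∈ W, ℓ v = 0) (hr : Module.finrank ℂ W = r) (hdim : Module.finrank ℂ E = 1 + s + r) :
    ∃ T : E ≃L[ℂ] Coord s r, (∀ v, (T v).1 = ℓ v) ∧
      ∀ v, v ∈ W ↔ (T v).1 = 0 ∧ (T v).2.1 = 0 := by
  let ℓ' : E ⧸ W →ₗ[ℂ] ℂ := W.liftQ (ℓ : E →ₗ[ℂ] ℂ) hW
  have hℓ' : ∀ v, ℓ' (W.mkQ v) = ℓ v := fun v => rfl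
  have hsurj : LinearMap.range ℓ' = ⊤ := by
    refine LinearMap.range_eq_top.2 (LinearMap.surjective fun h0 => hℓ ?_)
    refine ContinuousLinearMap.ext fun v => ?_
    rw [← hℓ', h0]; rfl
  have hK : Module.finrank ℂ (LinearMap.ker ℓ') = s := by
    have h1 := LinearMap.finrank_range_add_finrank_ker ℓ'
    have h2 := W.finrank_quotient_add_finrank
    rw [hsurj, finrank_top, Module.finrank_self] at h1
    omega
  obtain ⟨πK, hπK⟩ := (LinearMap.ker ℓ').subtype.exists_leftInverse_of_injective
    (Submodule.ker_subtype _)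
  obtain ⟨πW, hπW⟩ := W.subtype.exists_leftInverse_of_injective (Submodule.ker_subtype _)
  have eK : LinearMap.ker ℓ' ≃ₗ[ℂ] (Fin s → ℂ) := LinearEquiv.ofFinrankEq _ _ (by simp [hK])
  have eW : W ≃ₗ[ℂ] (Fin r → ℂ) := LinearEquiv.ofFinrankEq _ _ (by simp [hr])
  let T : E →ₗ[ℂ] Coord s r := (ℓ : E →ₗ[ℂ] ℂ).prod
    ((eK.toLinearMap ∘ₗ πK ∘ₗ W.mkQ).prod (eW.toLinearMap ∘ₗ πW))
  have hmem : ∀ v, v ∈ W ↔ (T v).1 = 0 ∧ (T v).2.1 = 0 := by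
    intro v
    constructor
    · intro hv
      refine ⟨hW v hv, ?_⟩
      change eK (πK (W.mkQ v)) = 0
      rw [(Submodule.Quotient.mk_eq_zero W).2 hv |> (fun h => (h : W.mkQ v = 0)), map_zero,
          map_zero]
    · rintro ⟨h1, h2⟩
      have h3 : πK (W.mkQ v) = 0 := eK.map_eq_zero_iff.1 h2
      have h4 := LinearMap.congr_fun hπK ⟨W.mkQ v, h1⟩
      have h5 : (⟨W.mkQ v, h1⟩ : LinearMap.ker ℓ') = 0 := h4.symm.trans h3
      exact (Submodule.Quotient.mk_eq_zero W).1 (congrArg Subtype.val h5)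
  have hinj : LinearMap.ker T = ⊥ := by
    refine LinearMap.ker_eq_bot'.2 fun v hv => ?_
    have h1 : v ∈ W := (hmem v).2 (by rw [hv]; exact ⟨rfl, rfl⟩)
    have h2 : πW v = 0 := eW.map_eq_zero_iff.1 (congrArg (fun q : Coord s r => q.2.2) hv)
    have h3 := LinearMap.congr_fun hπW ⟨v, h1⟩
    exact congrArg Subtype.val (h3.symm.trans h2)
  have hfin : Module.finrank ℂ E = Module.finrank ℂ (Coord s r) := by
    rw [hdim]
    simp [add_assoc]
  refine ⟨(LinearEquiv.ofInjectiveOfFinrankEq T (LinearMap.ker_eq_bot.1 hinj)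
    hfin).toContinuousLinearEquiv, fun v => rfl, hmem⟩

/-- The function `Re w - F(z, ζ, Im w)`. -/
def graphDef (F : GraphVar s r → ℝ) (q : Coord s r) : ℝ := q.1.re - F (q.2.1, q.2.2, q.1.im)

lemma isGraphFunction_graphDef (F : GraphVar s r → ℝ) : IsGraphFunction (graphDef F) := fun q c =>
    by
  simp [graphDef, eW]; ring

lemma analyticAt_graphDef {F : GraphVar s r → ℝ} (hF : AnalyticAt ℝ F 0) :
    AnalyticAt ℝ (graphDef F) 0 :=
  (DefiningEquation.analyticAt_re 0).sub (AnalyticAt.comp (g := F)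
    (f := fun q : Coord s r => ((q.2.1, q.2.2, q.1.im) : GraphVar s r)) hF
    (DefiningEquation.analyticAt_graphVar 0))

/-- The implicit function theorem. -/
lemma exists_graphDef_eq_zero_iff {ρ : Coord s r → ℝ} (hρ : AnalyticAt ℝ ρ 0) (h0 : ρ 0 = 0)
    (hw : fderiv ℝ ρ 0 (eW s r) ≠ 0) :
    ∃ F : GraphVar s r → ℝ, AnalyticAt ℝ F 0 ∧ F 0 = 0 ∧
      ∀ᶠ q in 𝓝 (0 : Coord s r), (ρ q = 0 ↔ graphDef F q = 0) := by
  -- The map replaces Re w by ρ and keeps the other real coordinates. F is Re w of its inverse on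
  -- the slice where the replaced coordinate is 0.
  let f : Coord s r → Coord s r := fun q => q + (ρ q - q.1.re) • eW s r
  have hf : AnalyticAt ℝ f 0 := analyticAt_id.add ((hρ.sub (DefiningEquation.analyticAt_re 0)).smul
    analyticAt_const)
  have hf0 : f 0 = 0 := by simp [f, h0]
  let re : Coord s r →L[ℝ] ℝ := Complex.reCLM.comp (ContinuousLinearMap.fst ℝ ℂ _)
  let L : Coord s r →L[ℝ] Coord s r :=
    ContinuousLinearMap.id ℝ _ + (fderiv ℝ ρ 0 - re).smulRight (eW s r)
  have hL : HasFDerivAt f L 0 := (hasFDerivAt_id 0).add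
    ((hρ.differentiableAt.hasFDerivAt.sub re.hasFDerivAt).smul_const (eW s r))
  have hinj : Function.Injective (L : Coord s r →ₗ[ℝ] Coord s r) := by
    rw [← LinearMap.ker_eq_bot, LinearMap.ker_eq_bot']
    intro v hv
    have h1 : v + (fderiv ℝ ρ 0 v - v.1.re) • eW s r = 0 := hv
    have h2 : v = (v.1.re - fderiv ℝ ρ 0 v) • eW s r := by
      have h3 := eq_neg_of_add_eq_zero_left h1
      rw [← neg_smul, neg_sub] at h3
      exact h3
    set c := v.1.re - fderiv ℝ ρ 0 v with hc
    have h3 : v.1.re = c := by rw [h2]; simp [eW]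
    have h4 : fderiv ℝ ρ 0 v = c * fderiv ℝ ρ 0 (eW s r) := by
      conv_lhs => rw [h2, map_smul, smul_eq_mul]
    have h5 : c * fderiv ℝ ρ 0 (eW s r) = 0 := by linarith
    rw [h2, (mul_eq_zero.1 h5).resolve_right hw, zero_smul]
  let e : Coord s r ≃L[ℝ] Coord s r :=
    (LinearEquiv.ofInjectiveEndo (L : Coord s r →ₗ[ℝ] Coord s r) hinj).toContinuousLinearEquiv
  have he : HasFDerivAt f (e : Coord s r →L[ℝ] Coord s r) 0 :=
    hL.congr_fderiv (ContinuousLinearMap.ext fun v => rfl)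
  obtain ⟨ψ, hψ0, hψ, -, hψf, hfψ⟩ := exists_analytic_inverse hf e he
  rw [hf0] at hψ0 hψ hfψ
  let ι : GraphVar s r → Coord s r := fun x => (x.2.2 * Complex.I, x.1, x.2.1)
  have hι : AnalyticAt ℝ ι 0 := by
    have h1 : AnalyticAt ℝ (fun x : GraphVar s r => (x.2.2 : ℂ)) 0 :=
      (Complex.ofRealCLM.analyticAt _).comp (analyticAt_snd.comp analyticAt_snd)
    exact (h1.mul analyticAt_const).prod (analyticAt_fst.prod (analyticAt_fst.comp analyticAt_snd))
  have hι0 : ι 0 = 0 := by simp [ι]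
  refine ⟨fun x => (ψ (ι x)).1.re, ?_, by simp [hι0, hψ0], ?_⟩
  · have h1 : AnalyticAt ℝ (fun x => ψ (ι x)) 0 :=
      AnalyticAt.comp (g := ψ) (f := ι) (by rwa [hι0]) hι
    exact (Complex.reCLM.analyticAt _).comp (analyticAt_fst.comp h1)
  · let pr : Coord s r → Coord s r := fun q => ι (q.2.1, q.2.2, q.1.im)
    have hpr : Tendsto pr (𝓝 0) (𝓝 0) := by
      have h1 : ContinuousAt pr 0 := ContinuousAt.comp (g := ι) hι.continuousAt
        (DefiningEquation.analyticAt_graphVar (0 : Coord s r)).continuousAt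
      have h2 : pr 0 = 0 := by simp [pr, ι]
      rwa [ContinuousAt, h2] at h1
    have hψpr : Tendsto (fun q => ψ (pr q)) (𝓝 0) (𝓝 0) := by
      have h1 : Tendsto ψ (𝓝 0) (𝓝 0) := by
        have := hψ.continuousAt.tendsto
        rwa [hψ0] at this
      exact h1.comp hpr
    filter_upwards [hψf, hpr.eventually hfψ, hψpr.eventually hψf] with q h1 h2 h3
    have hfq : ρ q = 0 → f q = pr q := fun h => by
      refine Prod.ext ?_ (by simp [f, pr, ι, eW])
      refine Complex.ext ?_ ?_ <;> simp [f, pr, ι, eW, h]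
    rw [graphDef, sub_eq_zero]
    constructor
    · intro h
      rw [hfq h] at h1
      change q.1.re = (ψ (pr q)).1.re
      rw [h1]
    · intro h
      change q.1.re = (ψ (pr q)).1.re at h
      have h4 : (ψ (pr q)).2 = q.2 := by
        have h5 := congrArg Prod.snd h2
        have h6 : (f (ψ (pr q))).2 = (ψ (pr q)).2 + (0 : (Fin s → ℂ) × (Fin r → ℂ)) := by
          simp only [f, Prod.snd_add, Prod.smul_snd, eW]
          congr 1
          exact smul_zero _
        rw [h6, add_zero] at h5
        exact h5
      have h5 : (ψ (pr q)).1.im = q.1.im := by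
        have := congrArg (fun q : Coord s r => q.1.im) h2
        simpa [f, pr, ι, eW] using this
      have h6 : ψ (pr q) = q := Prod.ext (Complex.ext h.symm h5) h4
      rw [h6] at h2
      have := congrArg (fun q : Coord s r => q.1.re) h2
      simpa [f, pr, ι, eW] using this

end GraphForm


/-! ### Second-order normalization at a point -/

section Prepared

variable {s r : ℕ}

lemma inU_eq_sum (z : Fin s → ℂ) : inU s r (0, z) = ∑ j, z j • eZ s r j := by
  refine Prod.ext ?_ (Prod.ext ?_ ?_)
  · simp [eZ, Prod.fst_sum]
  · simp only [inU_apply, eZ, Prod.snd_sum, Prod.smul_snd, Prod.fst_sum, Prod.smul_fst]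
    exact (pi_eq_sum_univ' z).trans (Finset.sum_congr rfl fun j _ => by congr 1)
  · simp [eZ, Prod.snd_sum]

lemma levC_inU (B : Coord s r →L[ℝ] Coord s r →L[ℝ] ℝ) (z : Fin s → ℂ) (x : Coord s r) :
    levC B (inU s r (0, z)) x = ∑ j, starRingEnd ℂ (z j) * levC B (eZ s r j) x := by
  have h (t : Finset (Fin s)) : levC B (∑ j ∈ t, z j • eZ s r j) x
      = ∑ j ∈ t, starRingEnd ℂ (z j) * levC B (eZ s r j) x := by
    induction t using Finset.cons_induction with
    | empty => simp [levC_apply, lev]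
    | cons j t hj ih => rw [Finset.sum_cons, Finset.sum_cons, levC_add, ih, levC_smul]
  rw [inU_eq_sum, h]

/-- A vector of the (w, z)-space killed by `jetMap` is orthogonal to the z-directions by
construction and to the ζ-directions because these lie in the kernel. So it lies in the Levi kernel,
that is in {w = z = 0}. -/
lemma isInvertible_jetMap_of_jetKernel {B : Coord s r →L[ℝ] Coord s r →L[ℝ] ℝ}
    (hB : ∀ x y, B x y = B y x)
    (hk : ∀ v : Coord s r, v ∈ jetKernel (reW s r) B ↔ v.1 = 0 ∧ v.2.1 = 0) :
    ((jetMap (reW s r) B).comp (inU s r)).IsInvertible := by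
  have hinj : Function.Injective
      ((jetMap (reW s r) B).comp (inU s r) : CoordU s →ₗ[ℂ] CoordU s) := by
    rw [← LinearMap.ker_eq_bot, LinearMap.ker_eq_bot']
    intro u hu
    have hu' : jetMap (reW s r) B (inU s r u) = 0 := hu
    rw [DefiningEquation.jetMap_inU, Prod.mk_eq_zero] at hu'
    obtain ⟨h1, h2⟩ := hu'
    have hsymm : ∀ x y, lev B x y = lev B y x := fun x y => by
      rw [lev, lev, hB x y, hB (Complex.I • x)]
    have h3 : ∀ z : Fin s → ℂ, levC B (inU s r (0, z)) (inU s r u) = 0 := fun z => by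
      rw [levC_inU]
      exact Finset.sum_eq_zero fun j _ => by rw [congrFun h2 j]; exact mul_zero _
    have h6 : inU s r u ∈ jetKernel (reW s r) B := by
      refine ⟨by rw [dC_reW]; exact h1, fun y hy => ?_⟩
      rw [dC_reW] at hy
      have h7 : y = inU s r (0, y.2.1) + inV s r y.2.2 := by
        refine Prod.ext ?_ (Prod.ext ?_ ?_) <;> simp [hy]
      have h8 := (hk (inV s r y.2.2)).2 ⟨rfl, rfl⟩
      rw [h7, lev_add_right, ← levC_re, h3, hsymm, h8.2 _ (by rw [dC_reW]; exact h1)]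
      simp
    exact Prod.ext h1 ((hk _).1 h6).2
  exact ⟨(LinearEquiv.ofInjectiveEndo _ hinj).toContinuousLinearEquiv,
    ContinuousLinearMap.ext fun _ => rfl⟩

/-- Defining functions in graph form, normalized to second order at the origin. -/
structure IsPrepared (ρ : Coord s r → ℝ) : Prop where
  analytic : AnalyticAt ℝ ρ 0
  graph : IsGraphFunction ρ
  zero : ρ 0 = 0
  fderiv_zero : fderiv ℝ ρ 0 = reW s r
  invertible : ((jetMapAt ρ 0).comp (inU s r)).IsInvertible
  rank : ∀ᶠ q in 𝓝 (0 : Coord s r),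
    Module.finrank ℂ (jetKernel (fderiv ℝ ρ q) (hess ρ q)) = r

lemma eq_smul_reW {ℓ : Coord s r →L[ℝ] ℝ} (h : ∀ v : Coord s r, v.1.re = 0 → ℓ v = 0) :
    ℓ = ℓ (eW s r) • reW s r := by
  refine ContinuousLinearMap.ext fun v => ?_
  have h1 := h (v - v.1.re • eW s r) (by simp [eW])
  rw [map_sub, map_smul, sub_eq_zero] at h1
  rw [h1, smul_apply, smul_eq_mul, smul_eq_mul, mul_comm]
  rfl

lemma isDefiningFunctionAt_graphDef {F : GraphVar s r → ℝ} (hF : AnalyticAt ℝ F 0) :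
    IsDefiningFunctionAt {q | graphDef F q = 0} 0 (graphDef F) := by
  refine ⟨analyticAt_graphDef hF, fun h0 => ?_, Eventually.of_forall fun q => Iff.rfl⟩
  have h1 := (isGraphFunction_graphDef F).fderiv_eW (analyticAt_graphDef hF).differentiableAt
  rw [h0] at h1
  simp at h1

/-- A linear change of coordinates turns ∂ρ at p into dw and the Levi kernel at p into the ζ-space;
the implicit function theorem then gives graph form. -/
lemma exists_prepared {E : Type*} [NormedAddCommGroup E] [NormedSpace ℂ E]
    [FiniteDimensional ℂ E] {M : Set E} {p : E} (hdim : Module.finrank ℂ E = 1 + s + r)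
    (hp : p ∈ M) (hM : HasConstantLeviRankNear M p s) :
    ∃ (φ : E → Coord s r) (F : GraphVar s r → ℝ), φ p = 0 ∧ AnalyticAt ℝ F 0 ∧
      IsLocalEquivalence φ p M {q | graphDef F q = 0} ∧ IsPrepared (graphDef F) := by
  have : CompleteSpace E := FiniteDimensional.complete ℂ E
  obtain ⟨⟨ρ, hρ⟩, hrank⟩ := hM.self_of_nhds hp
  have hℓ : dC (fderiv ℝ ρ p) ≠ 0 := fun h0 => by
    obtain ⟨e, he⟩ := hρ.exists_transversal
    rw [h0] at he
    exact he rfl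
  have hCT : complexTangent M p = LinearMap.ker (dC (fderiv ℝ ρ p) : E →ₗ[ℂ] ℂ) := by
    ext v
    rw [hρ.mem_complexTangent hp, LinearMap.mem_ker, ContinuousLinearMap.coe_coe]
  have hW : Module.finrank ℂ (leviKernel M p) = r := by
    have h1 := LinearMap.finrank_range_add_finrank_ker (dC (fderiv ℝ ρ p) : E →ₗ[ℂ] ℂ)
    have h2 : LinearMap.range (dC (fderiv ℝ ρ p) : E →ₗ[ℂ] ℂ) = ⊤ :=
      LinearMap.range_eq_top.2 (LinearMap.surjective fun h0 => hℓ
        (ContinuousLinearMap.coe_injective h0))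
    rw [h2, finrank_top, Module.finrank_self] at h1
    rw [HasLeviRankAt, hCT] at hrank
    omega
  obtain ⟨T, hT1, hT2⟩ := exists_adapted_linear_equiv (s := s) hℓ
    (fun v hv => (hρ.mem_complexTangent hp).1 (leviKernel_le_complexTangent hv)) hW hdim
  let φ : E → Coord s r := fun q => T (q - p)
  let ψ : Coord s r → E := fun x => T.symm x + p
  have hφp : φ p = 0 := by simp [φ]
  have hψφ : ∀ q, ψ (φ q) = q := fun q => by simp [φ, ψ]
  have hψ0 : ψ 0 = p := by simp [ψ]
  have hφ : HasFDerivAt (𝕜 := ℂ) φ (T : E →L[ℂ] Coord s r) p := by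
    have := (T : E →L[ℂ] Coord s r).hasFDerivAt.comp p ((hasFDerivAt_id p).sub_const p)
    exact this
  have hφa : AnalyticAt ℂ φ p :=
    ((T : E →L[ℂ] Coord s r).analyticAt _).comp (analyticAt_id.sub analyticAt_const)
  have hψa : AnalyticAt ℝ ψ 0 :=
    (((T.symm : Coord s r →L[ℂ] E).restrictScalars ℝ).analyticAt _).add analyticAt_const
  have hψd : HasFDerivAt ψ ((T.symm : Coord s r →L[ℂ] E).restrictScalars ℝ) 0 :=
    ((T.symm : Coord s r →L[ℂ] E).restrictScalars ℝ).hasFDerivAt.add_const p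
  have hρ1a : AnalyticAt ℝ (fun x => ρ (ψ x)) 0 :=
    AnalyticAt.comp (g := ρ) (f := ψ) (by rw [hψ0]; exact hρ.1) hψa
  have hρ1d : fderiv ℝ (fun x => ρ (ψ x)) 0 = reW s r := by
    have h1 : HasFDerivAt (fun x => ρ (ψ x)) _ 0 := HasFDerivAt.comp (g := ρ) (f := ψ) 0
      (by rw [hψ0]; exact hρ.1.differentiableAt.hasFDerivAt) hψd
    rw [h1.fderiv]
    refine ContinuousLinearMap.ext fun x => ?_
    change fderiv ℝ ρ p (T.symm x) = x.1.re
    rw [← dC_re, ← hT1, T.apply_symm_apply]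
  obtain ⟨F, hF, hF0, hFρ⟩ := exists_graphDef_eq_zero_iff hρ1a
    (by simp only [hψ0]; exact hρ.2.2.self_of_nhds.1 hp) (by
      rw [hρ1d]
      have : reW s r (eW s r) = 1 := by simp [reW, eW]
      rw [this]; exact one_ne_zero)
  have hφt : Tendsto φ (𝓝 p) (𝓝 0) := by
    have := hφa.continuousAt.tendsto
    rwa [hφp] at this
  have he : IsLocalEquivalence φ p M {q | graphDef F q = 0} := by
    refine ⟨hφa, ⟨T, hφ⟩, ?_⟩
    filter_upwards [hφt.eventually hFρ, hρ.2.2] with q h1 h2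
    rw [hψφ] at h1
    exact h1.symm.trans h2.symm
  have hM1 := he.hasConstantLeviRankNear hM
  rw [hφp] at hM1
  have hdef := isDefiningFunctionAt_graphDef hF
  have h0 : graphDef F 0 = 0 := by
    have : graphDef F (0 : Coord s r) = (0 : ℂ).re - F 0 := rfl
    rw [this, hF0]; simp
  have hmem0 : (0 : Coord s r) ∈ {q | graphDef F q = 0} := h0
  have hfd : fderiv ℝ (graphDef F) 0 = reW s r := by
    have h1 : IsDefiningFunctionAt {q | graphDef F q = 0} 0 fun x => ρ (ψ x) := by
      refine ⟨hρ1a, fun h2 => ?_, hFρ.mono fun q hq => hq.symm⟩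
      have := DFunLike.congr_fun (hρ1d.symm.trans h2) (eW s r)
      simp [reW, eW] at this
    -- Two defining functions of the same set have proportional differentials, and graph form fixes
    -- the factor to be 1.
    have h2 := eq_smul_reW (ℓ := fderiv ℝ (graphDef F) 0) fun v hv =>
      h1.fderiv_eq_zero hmem0 hdef.1.differentiableAt (Eventually.of_forall fun q hq => hq)
        (by rw [hρ1d]; exact hv)
    rw [h2, (isGraphFunction_graphDef F).fderiv_eW hdef.1.differentiableAt, one_smul]
  refine ⟨φ, F, hφp, hF, he, hdef.1, isGraphFunction_graphDef F, h0, hfd, ?_,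
    (isGraphFunction_graphDef F).finrank_jetKernel hdef h0 hM1⟩
  rw [jetMapAt, hfd]
  refine isInvertible_jetMap_of_jetKernel (hess_symm hdef.1) fun v => ?_
  rw [← hfd, ← hdef.leviKernel_eq hmem0]
  have h1 := he.mem_leviKernel_iff (by rw [hφp]; exact ⟨_, hdef⟩) hp (v := T.symm v)
  rw [hφp, hφ.fderiv, ContinuousLinearEquiv.coe_coe, T.apply_symm_apply] at h1
  rw [← h1, hT2, T.apply_symm_apply]

end Prepared


/-! ### The leaf of the Levi foliation and its deformation -/

section Leaf

variable {s r : ℕ} {ρ : Coord s r → ℝ}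

lemma eventually_eq_zero_of_hasFDerivAt {V : Type*} [NormedAddCommGroup V] [NormedSpace ℝ V]
    {f : V → ℝ} {x : V} (hf : ∀ᶠ y in 𝓝 x, HasFDerivAt f (0 : V →L[ℝ] ℝ) y) (h0 : f x = 0) :
    ∀ᶠ y in 𝓝 x, f y = 0 := by
  obtain ⟨ε, hε, h⟩ := Metric.eventually_nhds_iff_ball.1 hf
  filter_upwards [Metric.ball_mem_nhds x hε] with y hy
  rw [← h0]
  exact Metric.isOpen_ball.is_const_of_fderiv_eq_zero (convex_ball x ε).isPreconnected
    (fun z hz => (h z hz).differentiableAt.differentiableWithinAt)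
    (fun z hz => (h z hz).fderiv) hy (Metric.mem_ball_self hε)

/-- The point of the leaf `u = g(ζ)`. -/
noncomputable def leafPoint (g : (Fin r → ℂ) → CoordU s) (ζ : Fin r → ℂ) : Coord s r :=
  inU s r (g ζ) + inV s r ζ

namespace IsPrepared

lemma smooth_frame (h : IsPrepared ρ) : ∀ᶠ q in 𝓝 (0 : Coord s r), ContDiffAt ℝ ∞ (frame ρ) q := by
  filter_upwards [h.analytic.eventually_analyticAt, eventually_invertible h.analytic h.invertible]
    with q h1 h2 using contDiffAt_frame h1 h2

lemma graphMap_mem_jetKernel (h : IsPrepared ρ) : ∀ᶠ q in 𝓝 (0 : Coord s r), ∀ η,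
    graphMap (frame ρ q) η ∈ jetKernel (fderiv ℝ ρ q) (hess ρ q) := by
  filter_upwards [h.rank, eventually_invertible h.analytic h.invertible] with q h1 h2 η
  rw [jetKernel_eq_range h2 h1]
  exact ⟨η, rfl⟩

lemma dC_graphMap (h : IsPrepared ρ) : ∀ᶠ q in 𝓝 (0 : Coord s r), ∀ η,
    dC (fderiv ℝ ρ q) (graphMap (frame ρ q) η) = 0 :=
  h.graphMap_mem_jetKernel.mono fun _ hq η => (hq η).1

end IsPrepared

/-- `g` parametrizes the leaf through the origin of the Levi foliation, and `γ` is an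
infinitesimal deformation of it. -/
structure IsLeaf (ρ : Coord s r → ℝ) (g γ : (Fin r → ℂ) → CoordU s) : Prop where
  zero : g 0 = 0
  deform_zero : γ 0 = (Complex.I, 0)
  smooth : ∀ᶠ ζ in 𝓝 (0 : Fin r → ℂ), ContDiffAt ℝ ∞ g ζ
  deform_smooth : ∀ᶠ ζ in 𝓝 (0 : Fin r → ℂ), ContDiffAt ℝ ∞ γ ζ
  deriv : ∀ᶠ ζ in 𝓝 (0 : Fin r → ℂ),
    HasFDerivAt g ((frame ρ (leafPoint g ζ)).restrictScalars ℝ) ζ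
  deform_deriv : ∀ᶠ ζ in 𝓝 (0 : Fin r → ℂ), HasFDerivAt γ
    ((fderiv ℝ (frame ρ) (leafPoint g ζ) (inU s r (γ ζ))).restrictScalars ℝ) ζ

/-- The equation Dg = frame(g, ζ) is integrable by `fderiv_frame_symm`. The deformation γ starts at
(i, 0), which is tangent to M but not complex tangent; it is used to normalize the conormal. -/
lemma IsPrepared.exists_isLeaf (h : IsPrepared ρ) : ∃ g γ, IsLeaf ρ g γ := by
  let pair : CoordU s × (Fin r → ℂ) →L[ℝ] Coord s r :=
    ((inU s r).restrictScalars ℝ).comp (ContinuousLinearMap.fst ℝ _ _) +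
      ((inV s r).restrictScalars ℝ).comp (ContinuousLinearMap.snd ℝ _ _)
  let R : ((Fin r → ℂ) →L[ℂ] CoordU s) →L[ℝ] ((Fin r → ℂ) →L[ℝ] CoordU s) :=
    ContinuousLinearMap.restrictScalarsL ℂ (Fin r → ℂ) (CoordU s) ℝ ℝ
  let a : CoordU s × (Fin r → ℂ) → ((Fin r → ℂ) →L[ℝ] CoordU s) := fun q => R (frame ρ (pair q))
  have hpair : Tendsto pair (𝓝 (0, 0)) (𝓝 0) := by
    have := pair.continuous.tendsto (0, 0)
    have h0 : pair (0, 0) = 0 := pair.map_zero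
    rwa [h0] at this
  have hfs := h.smooth_frame
  have ha : ∀ᶠ q in 𝓝 ((0 : CoordU s), (0 : Fin r → ℂ)), ContDiffAt ℝ ∞ a q := by
    filter_upwards [hpair.eventually hfs] with q hq
    exact R.contDiff.contDiffAt.comp q
      (ContDiffAt.comp (g := frame ρ) q hq pair.contDiff.contDiffAt)
  have had : ∀ {q}, ContDiffAt ℝ ∞ (frame ρ) (pair q) → ∀ y ξ,
      fderiv ℝ a q y ξ = fderiv ℝ (frame ρ) (pair q) (pair y) ξ := fun {q} hq y ξ => by
    have h1 : HasFDerivAt a _ q := R.hasFDerivAt.comp q (HasFDerivAt.comp (g := frame ρ) q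
      (hq.differentiableAt (by simp)).hasFDerivAt pair.hasFDerivAt)
    rw [h1.fderiv]
    rfl
  have hgm : ∀ q η, pair (a q η, η) = graphMap (frame ρ (pair q)) η := fun q η => rfl
  have hint : ∀ᶠ q in 𝓝 ((0 : CoordU s), (0 : Fin r → ℂ)), ∀ η ξ : Fin r → ℂ,
      fderiv ℝ a q (a q η, η) ξ = fderiv ℝ a q (a q ξ, ξ) η := by
    filter_upwards [hpair.eventually hfs, hpair.eventually
      (fderiv_frame_symm h.analytic h.graph h.invertible h.rank)] with q h1 h2 η ξ
    rw [had h1, had h1, hgm, hgm]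
    exact h2 η ξ
  obtain ⟨g, γ, hg0, hγ0, hsol⟩ := exists_linearized_solution ha hint (Complex.I, 0)
  have hleaf : ∀ ζ, leafPoint g ζ = pair (g ζ, ζ) := fun ζ => rfl
  have hlp : Tendsto (fun ζ => pair (g ζ, ζ)) (𝓝 0) (𝓝 0) := by
    have h1 : Tendsto (fun ζ => (g ζ, ζ)) (𝓝 0) (𝓝 (0, 0)) := by
      have := hsol.self_of_nhds.1.continuousAt.tendsto.prodMk_nhds
        (tendsto_id (x := 𝓝 (0 : Fin r → ℂ)))
      rwa [hg0] at this
    exact hpair.comp h1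
  refine ⟨g, γ, hg0, hγ0, hsol.mono fun ζ hζ => hζ.1, hsol.mono fun ζ hζ => hζ.2.1,
    hsol.mono fun ζ hζ => hζ.2.2.1, ?_⟩
  filter_upwards [hsol, hlp.eventually hfs] with ζ h1 h2
  refine h1.2.2.2.congr_fderiv (ContinuousLinearMap.ext fun η => ?_)
  have h3 : pair (γ ζ, 0) = inU s r (γ ζ) := by simp [pair, -inU_apply]
  rw [had h2, h3]
  rfl

namespace IsLeaf

variable {g γ : (Fin r → ℂ) → CoordU s}

lemma leafPoint_zero (hL : IsLeaf ρ g γ) : leafPoint g 0 = (0 : Coord s r) := by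
  rw [leafPoint, hL.zero, map_zero, map_zero, add_zero]

lemma hasFDerivAt_leafPoint (hL : IsLeaf ρ g γ) : ∀ᶠ ζ in 𝓝 (0 : Fin r → ℂ),
    HasFDerivAt (leafPoint g) ((graphMap (frame ρ (leafPoint g ζ))).restrictScalars ℝ) ζ := by
  filter_upwards [hL.deriv] with ζ hζ
  exact (((inU s r).restrictScalars ℝ).hasFDerivAt.comp ζ hζ).add
    ((inV s r).restrictScalars ℝ).hasFDerivAt

lemma tendsto_leafPoint (hL : IsLeaf ρ g γ) :
    Tendsto (leafPoint g) (𝓝 0) (𝓝 (0 : Coord s r)) := by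
  have := hL.hasFDerivAt_leafPoint.self_of_nhds.continuousAt.tendsto
  rwa [hL.leafPoint_zero] at this

/-- The tangent vectors of the leaf are annihilated by dρ, so ρ is constant on it. -/
lemma apply_leafPoint (hL : IsLeaf ρ g γ) (h : IsPrepared ρ) :
    ∀ᶠ ζ in 𝓝 (0 : Fin r → ℂ), ρ (leafPoint g ζ) = 0 := by
  refine eventually_eq_zero_of_hasFDerivAt ?_ (by rw [hL.leafPoint_zero, h.zero])
  filter_upwards [hL.hasFDerivAt_leafPoint, hL.tendsto_leafPoint.eventually h.dC_graphMap,
    hL.tendsto_leafPoint.eventually h.analytic.eventually_analyticAt] with ζ h1 h2 h3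
  refine (h3.differentiableAt.hasFDerivAt.comp ζ h1).congr_fderiv ?_
  exact ContinuousLinearMap.ext fun η => (dC_eq_zero_iff.1 (h2 η)).1

/-- The identity dρ(frame η) = 0, differentiated in the direction γ, is the vanishing of the
derivative of dρ(γ) along the leaf, by symmetry of the Hessian. At 0 the value is Re i = 0. -/
lemma fderiv_deform (hL : IsLeaf ρ g γ) (h : IsPrepared ρ) :
    ∀ᶠ ζ in 𝓝 (0 : Fin r → ℂ), fderiv ℝ ρ (leafPoint g ζ) (inU s r (γ ζ)) = 0 := by
  refine eventually_eq_zero_of_hasFDerivAt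
    (f := fun ζ => fderiv ℝ ρ (leafPoint g ζ) (inU s r (γ ζ))) ?_ ?_
  · filter_upwards [hL.hasFDerivAt_leafPoint, hL.deform_deriv,
      hL.tendsto_leafPoint.eventually h.dC_graphMap.eventually_nhds,
      hL.tendsto_leafPoint.eventually h.analytic.eventually_analyticAt,
      hL.tendsto_leafPoint.eventually h.smooth_frame] with ζ h0 h1 h2 h3 h4
    have h5 := (h3.fderiv.differentiableAt.hasFDerivAt.comp ζ h0).clm_apply
      (((inU s r).restrictScalars ℝ).hasFDerivAt.comp ζ h1)
    refine h5.congr_fderiv (ContinuousLinearMap.ext fun η => ?_)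
    have h6 := hasFDerivAt_graphMap (h4.differentiableAt (by simp)) (differentiableAt_const η)
      (inU s r (γ ζ))
    rw [fderiv_fun_const] at h6
    have h7 := hess_add_fderiv_eq_zero h3 h6.1 (h2.mono fun x hx => (dC_eq_zero_iff.1 (hx η)).1)
      (inU s r (γ ζ))
    rw [h6.2, hess_symm h3, add_comm] at h7
    simp only [Pi.zero_apply, zero_apply, map_zero, zero_add] at h7
    exact h7
  · simp only [hL.leafPoint_zero, hL.deform_zero, h.fderiv_zero]
    simp [reW]

end IsLeaf

end Leaf


/-! ### Holomorphy of the leaf and of its conormal -/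

section Holomorphic

variable {s r : ℕ} {ρ : Coord s r → ℝ} {V : Type*} [NormedAddCommGroup V] [NormedSpace ℂ V]

lemma dC_levC_apply {B : Coord s r →L[ℝ] Coord s r →L[ℝ] ℝ} (hB : ∀ x y, B x y = B y x)
    (x y : Coord s r) :
    dC (B x) y + Complex.I * dC (B (Complex.I • x)) y = levC B x y := by
  simp only [dC_apply, levC_apply, lev, I_smul_I_smul, map_neg]
  rw [hB y x, hB (Complex.I • y) (Complex.I • x), hB y (Complex.I • x), hB (Complex.I • y) x]
  push_cast
  linear_combination (-((B (Complex.I • x) (Complex.I • y) : ℝ) : ℂ)) * Complex.I_mul_I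

/-- Along a holomorphic curve or surface, the ∂̄-derivative of ∂ρ applied to a holomorphic vector is
the Levi form. -/
lemma exists_hasFDerivAt_dC {c y : V → Coord s r} {c' y' : V →L[ℂ] Coord s r} {ζ : V}
    (hρ : AnalyticAt ℝ ρ (c ζ)) (hc : HasFDerivAt c (c'.restrictScalars ℝ) ζ)
    (hy : HasFDerivAt y (y'.restrictScalars ℝ) ζ) :
    ∃ L : V →L[ℝ] ℂ, HasFDerivAt (fun ζ => dC (fderiv ℝ ρ (c ζ)) (y ζ)) L ζ ∧
      ∀ η, L η + Complex.I * L (Complex.I • η) = levC (hess ρ (c ζ)) (c' η) (y ζ) := by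
  have h1 : HasFDerivAt (fun ζ => fderiv ℝ ρ (c ζ)) ((hess ρ (c ζ)).comp
      (c'.restrictScalars ℝ)) ζ := hρ.fderiv.differentiableAt.hasFDerivAt.comp ζ hc
  have h2 := (Complex.ofRealCLM.hasFDerivAt.comp ζ (h1.clm_apply hy)).sub
    ((Complex.ofRealCLM.hasFDerivAt.comp ζ
      (h1.clm_apply (hy.const_smul Complex.I))).const_mul Complex.I)
  have h3 : (fun ζ => dC (fderiv ℝ ρ (c ζ)) (y ζ)) = (fun ζ => ((fderiv ℝ ρ (c ζ) (y ζ) : ℝ) : ℂ))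
      - fun ζ => Complex.I * ((fderiv ℝ ρ (c ζ) (Complex.I • y ζ) : ℝ) : ℂ) :=
    funext fun ζ => dC_apply _ _
  rw [h3]
  refine ⟨_, h2, fun η => ?_⟩
  rw [← dC_levC_apply (hess_symm hρ)]
  simp [dC_apply, I_smul_I_smul]
  linear_combination ((fderiv ℝ ρ (c ζ) (y' η) : ℝ) : ℂ) * Complex.I_sq

/-- A kernel vector is Levi orthogonal to the hyperplane ∂ρ = 0, so its Levi form, linear in y, is a
multiple of ∂ρ. -/
lemma levC_of_mem_jetKernel {ℓ : Coord s r →L[ℝ] ℝ} {B : Coord s r →L[ℝ] Coord s r →L[ℝ] ℝ}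
    (hB : ∀ x y, B x y = B y x) {x e : Coord s r} (hx : x ∈ jetKernel ℓ B) (he : dC ℓ e ≠ 0)
    (y : Coord s r) : levC B x y = levC B x e / dC ℓ e * dC ℓ y := by
  have h1 : ∀ y, dC ℓ y = 0 → levC B x y = 0 := fun y hy => by
    have hs : ∀ x y, lev B x y = lev B y x := fun x y => by
      rw [lev, lev, hB x y, hB (Complex.I • x)]
    have hy' : dC ℓ (Complex.I • y) = 0 := by rw [map_smul, hy, smul_zero]
    have h2 := lev_I_left B y x
    rw [hs, hx.2 _ hy'] at h2
    rw [levC_apply, hs, hx.2 y hy]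
    simp [← neg_eq_zero (a := lev B y (Complex.I • x)), ← h2]
  have h2 := h1 (y - (dC ℓ y / dC ℓ e) • e)
    (by rw [map_sub, map_smul, smul_eq_mul, div_mul_cancel₀ _ he, sub_self])
  rw [map_sub, map_smul, sub_eq_zero, smul_eq_mul] at h2
  rw [h2]
  ring

/-- Numerator and denominator satisfy the same equation ∂̄f = κf, so κ cancels in the quotient. -/
lemma differentiableAt_div {f₁ f₂ : V → ℂ} {ζ : V} {L₁ L₂ : V →L[ℝ] ℂ} {κ : V → ℂ}
    (h₁ : HasFDerivAt f₁ L₁ ζ) (h₂ : HasFDerivAt f₂ L₂ ζ) (h0 : f₂ ζ ≠ 0)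
    (hd : DifferentiableAt ℝ (fun ζ => f₁ ζ / f₂ ζ) ζ)
    (e₁ : ∀ η, L₁ η + Complex.I * L₁ (Complex.I • η) = κ η * f₁ ζ)
    (e₂ : ∀ η, L₂ η + Complex.I * L₂ (Complex.I • η) = κ η * f₂ ζ) :
    DifferentiableAt ℂ (fun ζ => f₁ ζ / f₂ ζ) ζ := by
  refine differentiableAt_complex_of_real hd fun v => ?_
  have h3 : (fun ζ => f₁ ζ / f₂ ζ * f₂ ζ) =ᶠ[𝓝 ζ] f₁ := by
    filter_upwards [h₂.continuousAt.eventually_ne h0] with x hx using div_mul_cancel₀ _ hx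
  have h4 := (hd.hasFDerivAt.mul h₂).unique (h₁.congr_of_eventuallyEq h3)
  have h5 := DFunLike.congr_fun h4 v
  have h6 := DFunLike.congr_fun h4 (Complex.I • v)
  have a₁ := e₁ v
  have a₂ := e₂ v
  simp only [add_apply, smul_apply, smul_eq_mul] at h5 h6
  set D := fderiv ℝ (fun ζ => f₁ ζ / f₂ ζ) ζ
  rw [smul_eq_mul]
  have h7 : f₁ ζ / f₂ ζ * f₂ ζ = f₁ ζ := div_mul_cancel₀ _ h0
  refine mul_left_cancel₀ h0 ?_
  linear_combination h6 - Complex.I * h5 - Complex.I * a₁ + Complex.I * (f₁ ζ / f₂ ζ) * a₂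
    + Complex.I * κ v * h7 + (L₁ (Complex.I • v) - f₁ ζ / f₂ ζ * L₂ (Complex.I • v)) * Complex.I_sq

end Holomorphic

namespace IsLeaf

variable {s r : ℕ} {ρ : Coord s r → ℝ} {g γ : (Fin r → ℂ) → CoordU s}

/-- The frame takes values in complex linear maps, so the derivative of g is complex linear. -/
lemma analyticAt (hL : IsLeaf ρ g γ) : AnalyticAt ℂ g 0 := by
  refine analyticAt_complex_of_smooth hL.smooth ?_
  filter_upwards [hL.deriv] with ζ hζ
  refine differentiableAt_complex_of_real hζ.differentiableAt fun v => ?_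
  rw [hζ.fderiv]
  exact (frame ρ (leafPoint g ζ)).map_smul _ _

lemma analyticAt_leafPoint (hL : IsLeaf ρ g γ) : AnalyticAt ℂ (leafPoint (s := s) g) 0 :=
  (((inU s r).analyticAt _).comp hL.analyticAt).add ((inV s r).analyticAt 0)

/-- The normalized conormal form of the leaf. -/
noncomputable def _root_.CRModel.conormal (ρ : Coord s r → ℝ) (g γ : (Fin r → ℂ) → CoordU s)
    (ζ : Fin r → ℂ) : CoordU s →L[ℂ] ℂ :=
  (Complex.I / dC (fderiv ℝ ρ (leafPoint g ζ)) (inU s r (γ ζ))) •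
    (dC (fderiv ℝ ρ (leafPoint g ζ))).comp (inU s r)

lemma dC_deform_ne_zero (hL : IsLeaf ρ g γ) (h : IsPrepared ρ) : ∀ᶠ ζ in 𝓝 (0 : Fin r → ℂ),
    dC (fderiv ℝ ρ (leafPoint g ζ)) (inU s r (γ ζ)) ≠ 0 := by
  have h1 : ContinuousAt (fun ζ => dC (fderiv ℝ ρ (leafPoint g ζ)) (inU s r (γ ζ))) 0 := by
    refine ContinuousAt.clm_apply ?_
      ((inU s r).continuous.continuousAt.comp hL.deform_smooth.self_of_nhds.continuousAt)
    refine ContinuousAt.comp (g := fun q => dC (fderiv ℝ ρ q)) ?_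
      hL.analyticAt_leafPoint.continuousAt
    rw [hL.leafPoint_zero]
    exact (fderiv_dC h.analytic).continuousAt
  refine h1.eventually_ne ?_
  rw [hL.leafPoint_zero, hL.deform_zero, h.fderiv_zero, dC_reW]
  exact Complex.I_ne_zero

/-- The tangent directions of the leaf lie in the Levi kernel, so ∂ρ(u) and ∂ρ(γ) satisfy ∂̄f = κf
with the same κ: u is constant and γ has complex linear derivative. Their quotient is holomorphic
although ∂ρ itself need not be. -/
lemma analyticAt_conormal_apply (hL : IsLeaf ρ g γ) (h : IsPrepared ρ) (u : CoordU s) :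
    AnalyticAt ℂ (fun ζ => conormal ρ g γ ζ u) 0 := by
  have hsm : ∀ᶠ ζ in 𝓝 (0 : Fin r → ℂ), ContDiffAt ℝ ∞ (fun ζ =>
      dC (fderiv ℝ ρ (leafPoint g ζ)) (inU s r u) /
        dC (fderiv ℝ ρ (leafPoint g ζ)) (inU s r (γ ζ))) ζ := by
    filter_upwards [hL.tendsto_leafPoint.eventually h.analytic.eventually_analyticAt,
      hL.analyticAt_leafPoint.eventually_analyticAt, hL.deform_smooth, hL.dC_deform_ne_zero h]
      with ζ h1 h2 h3 h4
    have h5 : ContDiffAt ℝ ∞ (fun ζ => (dC (fderiv ℝ ρ (leafPoint g ζ))).restrictScalars ℝ) ζ := by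
      have h6 : ContDiffAt ℝ ∞ (fun ζ => fderiv ℝ ρ (leafPoint g ζ)) ζ :=
        ContDiffAt.comp (g := fderiv ℝ ρ) ζ h1.fderiv.contDiffAt h2.restrictScalars.contDiffAt
      exact ((ContinuousLinearMap.restrictScalarsL ℂ (Coord s r) ℂ ℝ ℝ).comp
        (dCL (Coord s r))).contDiff.contDiffAt.comp ζ h6
    have h7 : ∀ y : (Fin r → ℂ) → CoordU s, ContDiffAt ℝ ∞ y ζ → ContDiffAt ℝ ∞
        (fun ζ => dC (fderiv ℝ ρ (leafPoint g ζ)) (inU s r (y ζ))) ζ := fun y hy =>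
      h5.clm_apply (((inU s r).restrictScalars ℝ).contDiff.contDiffAt.comp ζ hy)
    simp only [div_eq_mul_inv]
    exact (h7 _ contDiffAt_const).mul ((h7 _ h3).inv h4)
  have hq : AnalyticAt ℂ (fun ζ => dC (fderiv ℝ ρ (leafPoint g ζ)) (inU s r u) /
        dC (fderiv ℝ ρ (leafPoint g ζ)) (inU s r (γ ζ))) 0 := by
    refine analyticAt_complex_of_smooth hsm ?_
    filter_upwards [hsm, hL.tendsto_leafPoint.eventually h.analytic.eventually_analyticAt,
      hL.hasFDerivAt_leafPoint, hL.deform_deriv, hL.dC_deform_ne_zero h,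
      hL.tendsto_leafPoint.eventually h.graphMap_mem_jetKernel] with ζ h1 h2 h3 h4 h5 h6
    obtain ⟨L₁, hL₁, e₁⟩ := exists_hasFDerivAt_dC (y' := 0) h2 h3
      (hasFDerivAt_const (inU s r u) ζ)
    obtain ⟨L₂, hL₂, e₂⟩ := exists_hasFDerivAt_dC h2 h3
      (y := fun ζ => inU s r (γ ζ)) (y' := (inU s r).comp _)
      (((inU s r).restrictScalars ℝ).hasFDerivAt.comp ζ h4)
    refine differentiableAt_div hL₁ hL₂ h5 (h1.differentiableAt (by simp))
      (κ := fun η => levC (hess ρ (leafPoint g ζ)) (graphMap (frame ρ (leafPoint g ζ)) η)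
        (inU s r (γ ζ)) / dC (fderiv ℝ ρ (leafPoint g ζ)) (inU s r (γ ζ))) ?_ ?_
    · intro η
      rw [e₁, levC_of_mem_jetKernel (hess_symm h2) (h6 η) h5]
    · intro η
      rw [e₂, div_mul_cancel₀ _ h5]
  refine (analyticAt_const (v := Complex.I)).mul hq |>.congr (Eventually.of_forall fun ζ => ?_)
  simp only [conormal, smul_apply, ContinuousLinearMap.comp_apply, smul_eq_mul, Pi.mul_apply]
  ring

lemma analyticAt_conormal (hL : IsLeaf ρ g γ) (h : IsPrepared ρ) :
    AnalyticAt ℂ (conormal ρ g γ) 0 := by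
  have h1 : ∀ ζ, conormal ρ g γ ζ = conormal ρ g γ ζ (1, 0) • ContinuousLinearMap.fst ℂ ℂ _
      + ∑ j, conormal ρ g γ ζ (0, Pi.single j 1) •
        (ContinuousLinearMap.proj (R := ℂ) (φ := fun _ : Fin s => ℂ) j).comp
          (ContinuousLinearMap.snd ℂ ℂ (Fin s → ℂ)) := fun ζ => by
    refine ContinuousLinearMap.ext fun u => ?_
    have h2 : u = u.1 • ((1 : ℂ), (0 : Fin s → ℂ))
        + ∑ j, u.2 j • ((0 : ℂ), (Pi.single j 1 : Fin s → ℂ)) := by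
      refine Prod.ext (by simp [Prod.fst_sum]) ?_
      rw [Prod.snd_add, Prod.snd_sum]
      simp only [Prod.smul_snd, smul_zero, zero_add]
      exact (pi_eq_sum_univ' u.2).trans (Finset.sum_congr rfl fun j _ => by congr 1)
    conv_lhs => rw [h2]
    simp only [map_add, map_sum, ContinuousLinearMap.map_smul]
    simp [mul_comm]
  rw [funext h1]
  exact ((hL.analyticAt_conormal_apply h _).smul analyticAt_const).add
    (Finset.analyticAt_fun_sum _ fun j _ =>
      (hL.analyticAt_conormal_apply h _).smul analyticAt_const)

lemma conormal_zero (hL : IsLeaf ρ g γ) (h : IsPrepared ρ) (u : CoordU s) :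
    conormal ρ g γ 0 u = u.1 := by
  rw [conormal, hL.leafPoint_zero, hL.deform_zero, h.fderiv_zero, dC_reW]
  simp [dC_reW, Complex.I_ne_zero]

/-- Along the leaf, the differential of the defining function is a real multiple of the
normalized conormal form. -/
lemma fderiv_eq_conormal (hL : IsLeaf ρ g γ) (h : IsPrepared ρ) : ∀ᶠ ζ in 𝓝 (0 : Fin r → ℂ),
    ∃ κ : ℝ, ∀ v : Coord s r, fderiv ℝ ρ (leafPoint g ζ) v
      = κ * (conormal ρ g γ ζ (prU s r v - frame ρ (leafPoint g ζ) (prV s r v))).re := by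
  filter_upwards [hL.dC_deform_ne_zero h, hL.fderiv_deform h,
    hL.tendsto_leafPoint.eventually h.dC_graphMap] with ζ h1 h2 h3
  refine ⟨(dC (fderiv ℝ ρ (leafPoint g ζ)) (inU s r (γ ζ))).im, fun v => ?_⟩
  set ℓ := fderiv ℝ ρ (leafPoint g ζ)
  -- ∂ρ(γ) is purely imaginary because γ is tangent to M, so the normalizing factor i / ∂ρ(γ) is
  -- real. This is why the real tangent space, and not just the complex one, is straightened.
  have h4 : dC ℓ (inU s r (γ ζ)) = (dC ℓ (inU s r (γ ζ))).im * Complex.I := by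
    refine Complex.ext ?_ ?_
    · rw [dC_re, h2]; simp
    · simp
  set κ := (dC ℓ (inU s r (γ ζ))).im
  have hκ : (κ : ℂ) ≠ 0 := fun h0 => h1 (by rw [h4, h0, zero_mul])
  have h5 : v = inU s r (prU s r v - frame ρ (leafPoint g ζ) (prV s r v))
      + graphMap (frame ρ (leafPoint g ζ)) (prV s r v) := by
    rw [map_sub, graphMap, add_apply, ContinuousLinearMap.comp_apply]
    conv_lhs => rw [← inU_add_inV v]
    abel
  have h6 : (κ : ℂ) * conormal ρ g γ ζ (prU s r v - frame ρ (leafPoint g ζ) (prV s r v))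
      = dC ℓ v := by
    conv_rhs => rw [h5, map_add, h3, add_zero]
    rw [conormal, h4, smul_apply, ContinuousLinearMap.comp_apply, smul_eq_mul, ← mul_assoc]
    have : (κ : ℂ) * (Complex.I / (κ * Complex.I)) = 1 := by
      field_simp
    rw [this, one_mul]
  rw [← dC_re, ← h6, Complex.re_ofReal_mul]

end IsLeaf


/-! ### Straightening the leaf and its conormal -/

section Straighten

variable {s r : ℕ} {ρ : Coord s r → ℝ} {g γ : (Fin r → ℂ) → CoordU s}

/-- The map that straightens the leaf and its conormal form. -/
noncomputable def straighten (ρ : Coord s r → ℝ) (g γ : (Fin r → ℂ) → CoordU s) (q : Coord s r) :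
    Coord s r :=
  (conormal ρ g γ q.2.2 (prU s r q - g q.2.2), q.2.1 - (g q.2.2).2, q.2.2)

namespace IsLeaf

lemma straighten_leafPoint (ζ : Fin r → ℂ) :
    straighten ρ g γ (leafPoint g ζ) = inV s r ζ := by
  simp [straighten, leafPoint]

/-- On the leaf the argument of the conormal vanishes, so the derivative of the conormal itself
drops out. -/
lemma hasFDerivAt_straighten_fst (hL : IsLeaf ρ g γ) (h : IsPrepared ρ) :
    ∀ᶠ ζ in 𝓝 (0 : Fin r → ℂ), HasFDerivAt (𝕜 := ℂ) (fun q => (straighten ρ g γ q).1)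
      ((conormal ρ g γ ζ).comp (prU s r - (frame ρ (leafPoint g ζ)).comp (prV s r)))
      (leafPoint g ζ) := by
  filter_upwards [(hL.analyticAt_conormal h).eventually_analyticAt,
    hL.analyticAt.eventually_analyticAt, hL.deriv] with ζ h1 h2 h3
  have h4 : HasFDerivAt (𝕜 := ℂ) g (frame ρ (leafPoint g ζ)) ζ := by
    have h5 := h2.differentiableAt.hasFDerivAt
    have h6 := (h5.restrictScalars ℝ).unique h3
    exact h5.congr_fderiv (ContinuousLinearMap.ext fun v => DFunLike.congr_fun h6 v)
  have hζ : (leafPoint (s := s) g ζ).2.2 = ζ := by simp [leafPoint]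
  have h5 : HasFDerivAt (𝕜 := ℂ) (fun q : Coord s r => conormal ρ g γ q.2.2) _ (leafPoint g ζ) :=
    HasFDerivAt.comp (g := conormal ρ g γ) (f := fun q : Coord s r => q.2.2) (leafPoint g ζ)
      (by rw [hζ]; exact h1.differentiableAt.hasFDerivAt) (prV s r).hasFDerivAt
  have h6 : HasFDerivAt (𝕜 := ℂ) (fun q : Coord s r => g q.2.2)
      ((frame ρ (leafPoint g ζ)).comp (prV s r)) (leafPoint g ζ) :=
    HasFDerivAt.comp (g := g) (f := fun q : Coord s r => q.2.2) (leafPoint g ζ)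
      (by rw [hζ]; exact h4) (prV s r).hasFDerivAt
  have h7 := h5.clm_apply ((prU s r).hasFDerivAt.fun_sub h6)
  refine h7.congr_fderiv (ContinuousLinearMap.ext fun v => ?_)
  have h8 : prU s r (leafPoint g ζ) - g ζ = 0 := by simp [leafPoint]
  simp only [hζ, h8]
  simp

lemma analyticAt_straighten (hL : IsLeaf ρ g γ) (h : IsPrepared ρ) :
    AnalyticAt ℂ (straighten ρ g γ) 0 := by
  have hV : AnalyticAt ℂ (fun q : Coord s r => q.2.2) 0 := (prV s r).analyticAt 0
  have h1 : AnalyticAt ℂ (fun q : Coord s r => conormal ρ g γ q.2.2) 0 :=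
    AnalyticAt.comp (g := conormal ρ g γ) (f := fun q : Coord s r => q.2.2)
      (hL.analyticAt_conormal h) hV
  have h2 : AnalyticAt ℂ (fun q : Coord s r => g q.2.2) 0 :=
    AnalyticAt.comp (g := g) (f := fun q : Coord s r => q.2.2) hL.analyticAt hV
  have h3 : AnalyticAt ℂ (fun q : Coord s r => prU s r q - g q.2.2) 0 :=
    ((prU s r).analyticAt 0).sub h2
  have h4 : AnalyticAt ℂ (fun q : Coord s r => conormal ρ g γ q.2.2 (prU s r q - g q.2.2)) 0 :=
    AnalyticAt.comp (g := fun p : (CoordU s →L[ℂ] ℂ) × CoordU s => p.1 p.2)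
      (f := fun q : Coord s r => (conormal ρ g γ q.2.2, prU s r q - g q.2.2))
      ((isBoundedBilinearMap_apply (𝕜 := ℂ) (E := CoordU s) (F := ℂ)).toContinuousLinearMap
        |>.analyticAt_bilinear _) (h1.prod h3)
  exact h4.prod (((analyticAt_fst.comp analyticAt_snd).sub (analyticAt_snd.comp h2)).prod hV)

lemma straighten_zero (hL : IsLeaf ρ g γ) : straighten ρ g γ (0 : Coord s r) = 0 := by
  have := straighten_leafPoint (ρ := ρ) (g := g) (γ := γ) 0
  rwa [hL.leafPoint_zero, map_zero] at this

lemma exists_equiv_straighten (hL : IsLeaf ρ g γ) (h : IsPrepared ρ) :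
    ∃ e : Coord s r ≃L[ℂ] Coord s r,
      HasFDerivAt (straighten ρ g γ) (e : Coord s r →L[ℂ] Coord s r) 0 ∧
        e (eW s r) = eW s r := by
  have h1 := (hL.hasFDerivAt_straighten_fst h).self_of_nhds
  rw [hL.leafPoint_zero] at h1
  have h2 : HasFDerivAt (𝕜 := ℂ) (fun q : Coord s r => g q.2.2)
      ((fderiv ℂ g 0).comp (prV s r)) 0 :=
    HasFDerivAt.comp (g := g) (f := fun q : Coord s r => q.2.2) 0
      hL.analyticAt.differentiableAt.hasFDerivAt (prV s r).hasFDerivAt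
  have h3 := h1.prodMk ((((ContinuousLinearMap.snd ℂ ℂ (Fin s → ℂ)).comp
    (prU s r)).hasFDerivAt (x := (0 : Coord s r)).fun_sub h2.snd).prodMk
      ((prV s r).hasFDerivAt (x := (0 : Coord s r))))
  set L := ((conormal ρ g γ 0).comp (prU s r - (frame ρ 0).comp (prV s r))).prod
    (((ContinuousLinearMap.snd ℂ ℂ (Fin s → ℂ)).comp (prU s r) -
      (ContinuousLinearMap.snd ℂ ℂ (Fin s → ℂ)).comp ((fderiv ℂ g 0).comp (prV s r))).prod
        (prV s r)) with hLdef
  have hL1 : ∀ v, L v = ((v.1 - (frame ρ 0 v.2.2).1), v.2.1 - (fderiv ℂ g 0 v.2.2).2, v.2.2) :=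
    fun v => by
      refine Prod.ext ?_ rfl
      change conormal ρ g γ 0 (prU s r v - frame ρ 0 (prV s r v)) = _
      rw [hL.conormal_zero h]
      rfl
  have hinj : Function.Injective (L : Coord s r →ₗ[ℂ] Coord s r) := by
    rw [← LinearMap.ker_eq_bot, LinearMap.ker_eq_bot']
    intro v hv
    have hv' : L v = 0 := hv
    rw [hL1, Prod.mk_eq_zero, Prod.mk_eq_zero] at hv'
    obtain ⟨e1, e2, e3⟩ := hv'
    rw [e3, map_zero] at e1 e2
    refine Prod.ext ?_ (Prod.ext ?_ e3)
    · simpa using e1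
    · simpa using e2
  refine ⟨(LinearEquiv.ofInjectiveEndo _ hinj).toContinuousLinearEquiv,
    h3.congr_fderiv (ContinuousLinearMap.ext fun v => rfl), ?_⟩
  change L (eW s r) = _
  rw [hL1]
  simp [eW]

end IsLeaf

/-- Coordinates in which the leaf is flat and the differential is constant along it. -/
lemma IsPrepared.exists_flat (h : IsPrepared ρ) :
    ∃ (Ψ : Coord s r → Coord s r) (F : GraphVar s r → ℝ), Ψ 0 = 0 ∧ AnalyticAt ℝ F 0 ∧
      IsLocalEquivalence Ψ 0 {q | ρ q = 0} {q | graphDef F q = 0} ∧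
      ∀ᶠ ζ in 𝓝 (0 : Fin r → ℂ), graphDef F (inV s r ζ) = 0 ∧
        fderiv ℝ (graphDef F) (inV s r ζ) = reW s r := by
  obtain ⟨g, γ, hL⟩ := h.exists_isLeaf
  have hΨ0 := hL.straighten_zero
  have hΨa := hL.analyticAt_straighten h
  obtain ⟨e, he, heW⟩ := hL.exists_equiv_straighten h
  set Ψ := straighten ρ g γ with hΨ
  obtain ⟨ψ, hψ0, hψa, hψd, hψΨ, hΨψ⟩ := exists_analytic_inverse hΨa e he
  rw [hΨ0] at hψ0 hψa hψd hΨψ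
  have hρψ : AnalyticAt ℝ (fun x => ρ (ψ x)) 0 :=
    AnalyticAt.comp (g := ρ) (f := ψ) (by rw [hψ0]; exact h.analytic) hψa.restrictScalars
  obtain ⟨F, hF, hF0, hFρ⟩ := exists_graphDef_eq_zero_iff hρψ (by rw [hψ0]; exact h.zero) (by
    have h1 : HasFDerivAt (fun x => ρ (ψ x)) _ 0 := HasFDerivAt.comp (g := ρ) (f := ψ) 0
      (by rw [hψ0]; exact h.analytic.differentiableAt.hasFDerivAt) (hψd.restrictScalars ℝ)
    rw [h1.fderiv, h.fderiv_zero]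
    change reW s r (e.symm (eW s r)) ≠ 0
    rw [← heW, e.symm_apply_apply]
    simp [reW, eW])
  have hΨt : Tendsto Ψ (𝓝 0) (𝓝 0) := by
    have := hΨa.continuousAt.tendsto
    rwa [hΨ0] at this
  have hEq : IsLocalEquivalence Ψ 0 {q | ρ q = 0} {q | graphDef F q = 0} := by
    refine ⟨hΨa, ⟨e, he⟩, ?_⟩
    filter_upwards [hΨt.eventually hFρ, hψΨ] with q h1 h2
    rw [h2] at h1
    exact h1.symm
  refine ⟨Ψ, F, hΨ0, hF, hEq, ?_⟩
  have hρdef : IsDefiningFunctionAt {q | ρ q = 0} 0 ρ := by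
    refine ⟨h.analytic, fun h0 => ?_, Eventually.of_forall fun q => Iff.rfl⟩
    have := DFunLike.congr_fun (h.fderiv_zero.symm.trans h0) (eW s r)
    simp [reW, eW] at this
  filter_upwards [hL.apply_leafPoint h, hL.tendsto_leafPoint.eventually hEq.eventually,
    hL.tendsto_leafPoint.eventually hρdef.eventually, hL.fderiv_eq_conormal h,
    hL.hasFDerivAt_straighten_fst h,
    tendsto_inV.eventually (isDefiningFunctionAt_graphDef hF).eventually] with ζ h1 h2 h3 h4 h5 h6
  have hp : Ψ (leafPoint g ζ) = inV s r ζ := IsLeaf.straighten_leafPoint ζ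
  have hmem : leafPoint g ζ ∈ {q | ρ q = 0} := h1
  have hmem' := h2.2.2.self_of_nhds.2 hmem
  rw [hp] at hmem'
  refine ⟨hmem', ?_⟩
  obtain ⟨κ, hκ⟩ := h4
  obtain ⟨e', he'⟩ := h2.2.1
  -- A vector with Re w = 0 pulls back to one annihilated by dρ, since dρ is a real multiple of the
  -- real part of the first component of the derivative. So the new differential is a multiple of
  -- that of Re w, and graph form makes the factor 1.
  have h7 := eq_smul_reW (ℓ := fderiv ℝ (graphDef F) (inV s r ζ)) fun w hw => by
    have h8 : (e' (e'.symm w)).1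
        = conormal ρ g γ ζ (prU s r (e'.symm w) - frame ρ (leafPoint g ζ) (prV s r (e'.symm w))) :=
      DFunLike.congr_fun (he'.fst.unique h5) (e'.symm w)
    rw [e'.apply_symm_apply] at h8
    have h9 : fderiv ℝ ρ (leafPoint g ζ) (e'.symm w) = 0 := by
      rw [hκ, ← h8, hw, mul_zero]
    have h10 : HasFDerivAt (fun q => graphDef F (Ψ q))
        ((fderiv ℝ (graphDef F) (inV s r ζ)).comp
          ((e' : Coord s r →L[ℂ] Coord s r).restrictScalars ℝ)) (leafPoint g ζ) :=
      HasFDerivAt.comp (g := graphDef F) (f := Ψ) (leafPoint g ζ)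
        (by rw [hp]; exact h6.1.differentiableAt.hasFDerivAt) (he'.restrictScalars ℝ)
    have h11 := h3.fderiv_eq_zero hmem h10.differentiableAt
      (h2.2.2.mono fun q hq hqM => hq.2 hqM) h9
    rw [h10.fderiv] at h11
    have h12 : fderiv ℝ (graphDef F) (inV s r ζ) (e' (e'.symm w)) = 0 := h11
    rwa [e'.apply_symm_apply] at h12
  rw [h7, (isGraphFunction_graphDef F).fderiv_eW h6.1.differentiableAt, one_smul]

end Straighten


/-! ### Hermitian and complex parts of the Hessian in the z-directions -/

section QuadraticPart

variable {s r : ℕ} {B : Coord s r →L[ℝ] Coord s r →L[ℝ] ℝ}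

/-- The complex bilinear part of a real bilinear form. -/
noncomputable def symC (B : Coord s r →L[ℝ] Coord s r →L[ℝ] ℝ) (y : Coord s r) :
    Coord s r →L[ℂ] ℂ := dC ((2 : ℝ) • B y - levL y B)

lemma symC_apply (hB : ∀ x y, B x y = B y x) (x y : Coord s r) :
    symC B y x = ((B x y - B (Complex.I • x) (Complex.I • y) : ℝ) : ℂ)
      - Complex.I * ((B (Complex.I • x) y + B x (Complex.I • y) : ℝ) : ℂ) := by
  rw [symC, dC_apply]
  simp only [sub_apply, smul_apply, levL_apply, lev, smul_eq_mul, I_smul_I_smul, map_neg,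
    neg_apply, hB y]
  push_cast
  ring

lemma symC_symm (hB : ∀ x y, B x y = B y x) (x y : Coord s r) : symC B y x = symC B x y := by
  rw [symC_apply hB, symC_apply hB, hB y x, hB (Complex.I • y) (Complex.I • x),
    hB (Complex.I • y) x, hB y (Complex.I • x), add_comm (B x (Complex.I • y))]

/-- The matrix of the Hermitian part of `-B / 2` in the directions `z`. -/
noncomputable def levMatrix (B : Coord s r →L[ℝ] Coord s r →L[ℝ] ℝ) : Matrix (Fin s) (Fin s) ℂ :=
  Matrix.of fun j k => -(1 / 4) * levC B (eZ s r k) (eZ s r j)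

/-- The matrix of the complex bilinear part of `-B / 2` in the directions `z`. -/
noncomputable def symMatrix (B : Coord s r →L[ℝ] Coord s r →L[ℝ] ℝ) : Matrix (Fin s) (Fin s) ℂ :=
  Matrix.of fun j k => -(1 / 4) * starRingEnd ℂ (symC B (eZ s r k) (eZ s r j))

lemma isHermitian_levMatrix (hB : ∀ x y, B x y = B y x) : (levMatrix B).IsHermitian := by
  refine Matrix.IsHermitian.ext fun j k => ?_
  have hs : ∀ x y, lev B x y = lev B y x := fun x y => by
    rw [lev, lev, hB x y, hB (Complex.I • x)]
  have h1 := lev_I_left B (eZ s r j) (eZ s r k)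
  rw [hs] at h1
  simp only [levMatrix, Matrix.of_apply, levC_apply, hs (eZ s r k) (eZ s r j), h1]
  simp

lemma isSymm_symMatrix (hB : ∀ x y, B x y = B y x) : (symMatrix B).IsSymm := by
  refine Matrix.IsSymm.ext fun j k => ?_
  simp only [symMatrix, Matrix.of_apply, symC_symm hB (eZ s r k) (eZ s r j)]

open Matrix in
lemma dotProduct_levMatrix (z z' : Fin s → ℂ) : z ⬝ᵥ (levMatrix B *ᵥ star z')
    = -(1 / 4) * levC B (inU s r (0, z')) (inU s r (0, z)) := by
  rw [levC_inU, Finset.mul_sum]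
  simp only [inU_eq_sum z, map_sum, ContinuousLinearMap.map_smul, dotProduct, mulVec,
    Finset.mul_sum, levMatrix, of_apply, smul_eq_mul]
  rw [Finset.sum_comm]
  refine Finset.sum_congr rfl fun k _ => Finset.sum_congr rfl fun j _ => ?_
  simp only [Pi.star_apply, RCLike.star_def]
  ring

open Matrix in
lemma dotProduct_symMatrix (hB : ∀ x y, B x y = B y x) (z : Fin s → ℂ) :
    star z ⬝ᵥ (symMatrix B *ᵥ star z)
      = -(1 / 4) * starRingEnd ℂ (symC B (inU s r (0, z)) (inU s r (0, z))) := by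
  have h : ∀ x, symC B (inU s r (0, z)) x = ∑ j, z j * symC B (eZ s r j) x := fun x => by
    rw [← symC_symm hB, inU_eq_sum, map_sum]
    refine Finset.sum_congr rfl fun j _ => ?_
    rw [(symC B x).map_smul, symC_symm hB, smul_eq_mul]
  rw [h, map_sum, Finset.mul_sum]
  simp only [inU_eq_sum z, map_sum, ContinuousLinearMap.map_smul, dotProduct, mulVec,
    Finset.mul_sum, symMatrix, of_apply, smul_eq_mul, map_mul]
  rw [Finset.sum_comm]
  refine Finset.sum_congr rfl fun k _ => Finset.sum_congr rfl fun j _ => ?_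
  simp only [Pi.star_apply, RCLike.star_def]
  ring

-- The Levi form and `symC` have real parts B(z,z) ± B(iz,iz), which add up to 2B(z,z); with the
-- factors −1/4 this gives −B/2, the second-order term of P when ρ = Re w − P.
open Matrix in
lemma quadratic_eq (hB : ∀ x y, B x y = B y x) (z : Fin s → ℂ) :
    (z ⬝ᵥ (levMatrix B *ᵥ star z)).re + (star z ⬝ᵥ (symMatrix B *ᵥ star z)).re
      = -(1 / 2) * B (inU s r (0, z)) (inU s r (0, z)) := by
  rw [dotProduct_levMatrix, dotProduct_symMatrix hB, levC_apply, symC_apply hB, lev]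
  have h : (-(1 / 4) : ℂ) = ((-(1 / 4) : ℝ) : ℂ) := by push_cast; rfl
  rw [h, Complex.re_ofReal_mul, Complex.re_ofReal_mul]
  simp
  ring

lemma AnalyticAt.clm_apply_const {X G H : Type*} [NormedAddCommGroup X] [NormedSpace ℝ X]
    [NormedAddCommGroup G] [NormedSpace ℝ G] [NormedAddCommGroup H] [NormedSpace ℝ H]
    {f : X → G →L[ℝ] H} {x : X} (hf : AnalyticAt ℝ f x) (y : G) :
    AnalyticAt ℝ (fun x => f x y) x :=
  ((ContinuousLinearMap.apply ℝ H y).analyticAt _).comp hf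

variable {ρ : Coord s r → ℝ}

lemma analyticAt_hess_leaf (hρ : AnalyticAt ℝ ρ 0) (x y : Coord s r) :
    AnalyticAt ℝ (fun ζ => hess ρ (inV s r ζ) x y) 0 := by
  have h1 : AnalyticAt ℝ (fun q => hess ρ q x y) 0 :=
    AnalyticAt.clm_apply_const (G := Coord s r)
      (AnalyticAt.clm_apply_const (G := Coord s r) (H := Coord s r →L[ℝ] ℝ) hρ.fderiv.fderiv x) y
  exact AnalyticAt.comp (g := fun q => hess ρ q x y) (f := fun ζ => inV s r ζ)
    (by rw [map_zero]; exact h1) (((inV s r).restrictScalars ℝ).analyticAt 0)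

lemma analyticAt_levMatrix (hρ : AnalyticAt ℝ ρ 0) (j k : Fin s) :
    AnalyticAt ℝ (fun ζ => levMatrix (hess ρ (inV s r ζ)) j k) 0 := by
  have h1 : ∀ x y, AnalyticAt ℝ (fun ζ => ((hess ρ (inV s r ζ) x y : ℝ) : ℂ)) 0 := fun x y =>
    (Complex.ofRealCLM.analyticAt _).comp (analyticAt_hess_leaf hρ x y)
  simp only [levMatrix, Matrix.of_apply, levC_apply, lev, Complex.ofReal_add]
  exact analyticAt_const.mul (((h1 _ _).add (h1 _ _)).add
    (analyticAt_const.mul ((h1 _ _).add (h1 _ _))))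

lemma analyticAt_symMatrix (hρ : AnalyticAt ℝ ρ 0) (j k : Fin s) :
    AnalyticAt ℝ (fun ζ => symMatrix (hess ρ (inV s r ζ)) j k) 0 := by
  have h1 : ∀ x y, AnalyticAt ℝ (fun ζ => ((hess ρ (inV s r ζ) x y : ℝ) : ℂ)) 0 := fun x y =>
    (Complex.ofRealCLM.analyticAt _).comp (analyticAt_hess_leaf hρ x y)
  have h2 : AnalyticAt ℝ (fun ζ => -(1 / 4) * starRingEnd ℂ
      ((((hess ρ (inV s r ζ) (eZ s r j) (eZ s r k) : ℝ) : ℂ)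
        - ((hess ρ (inV s r ζ) (Complex.I • eZ s r j) (Complex.I • eZ s r k) : ℝ) : ℂ))
      - Complex.I * (((hess ρ (inV s r ζ) (Complex.I • eZ s r j) (eZ s r k) : ℝ) : ℂ)
        + ((hess ρ (inV s r ζ) (eZ s r j) (Complex.I • eZ s r k) : ℝ) : ℂ)))) 0 :=
    analyticAt_const.mul ((Complex.conjCLE.toContinuousLinearMap.analyticAt _).comp
      (((h1 _ _).sub (h1 _ _)).sub (analyticAt_const.mul ((h1 _ _).add (h1 _ _)))))
  refine h2.congr ?_
  filter_upwards [tendsto_inV.eventually hρ.eventually_analyticAt] with ζ hζ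
  simp only [symMatrix, Matrix.of_apply, symC_apply (hess_symm hζ), Complex.ofReal_add,
    Complex.ofReal_sub]

/-- A null vector z would put (0, z, 0) into the Levi kernel, which has dimension r and is already
exhausted by the ζ-directions. -/
lemma det_levMatrix_ne_zero (hB : ∀ x y, B x y = B y x)
    (hV : ∀ η, inV s r η ∈ jetKernel (reW s r) B)
    (hr : Module.finrank ℂ (jetKernel (reW s r) B) = r) : (levMatrix B).det ≠ 0 := by
  intro h0
  obtain ⟨z, hz0, hz⟩ := Matrix.exists_vecMul_eq_zero_iff.2 h0
  have hs : ∀ x y, lev B x y = lev B y x := fun x y => by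
    rw [lev, lev, hB x y, hB (Complex.I • x)]
  have h1 : ∀ z', levC B (inU s r (0, z')) (inU s r (0, z)) = 0 := fun z' => by
    have h2 := dotProduct_levMatrix (B := B) z z'
    rw [Matrix.dotProduct_mulVec, hz, zero_dotProduct] at h2
    simpa using h2.symm
  have h2 : inU s r (0, z) ∈ jetKernel (reW s r) B := by
    refine ⟨by rw [dC_reW]; rfl, fun y hy => ?_⟩
    rw [dC_reW] at hy
    have h7 : y = inU s r (0, y.2.1) + inV s r y.2.2 := by
      refine Prod.ext ?_ (Prod.ext ?_ ?_) <;> simp [hy]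
    rw [h7, lev_add_right, ← levC_re, h1, hs, (hV _).2 _ (by rw [dC_reW]; rfl)]
    simp
  have h3 : LinearMap.range (inV s r : (Fin r → ℂ) →ₗ[ℂ] Coord s r) = jetKernel (reW s r) B := by
    refine Submodule.eq_of_le_of_finrank_eq ?_ ?_
    · rintro _ ⟨η, rfl⟩
      exact hV η
    · rw [hr, LinearMap.finrank_range_of_inj]
      · simp
      · intro η ξ h
        simpa using h
  rw [← h3] at h2
  obtain ⟨η, hη⟩ := h2
  exact hz0 (congrArg (fun q : Coord s r => q.2.1) hη).symm

end QuadraticPart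


/-! ### From flat equations to adapted form -/

section FlatEquation

variable {s r : ℕ}

lemma iteratedDeriv_one_two_of_hasDerivAt {f g : ℝ → ℝ} {b : ℝ}
    (hf : ∀ᶠ t in 𝓝 (0 : ℝ), HasDerivAt f (g t) t) (hg : HasDerivAt g b 0) :
    iteratedDeriv 1 f 0 = g 0 ∧ iteratedDeriv 2 f 0 = b := by
  refine ⟨by rw [iteratedDeriv_one, hf.self_of_nhds.deriv], ?_⟩
  rw [iteratedDeriv_succ', iteratedDeriv_one]
  exact (hg.congr_of_eventuallyEq (hf.mono fun t ht => ht.deriv)).deriv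

/-- The derivatives of a function along a parametrized parabola. -/
lemma hasDerivAt_parabola {E : Type*} [NormedAddCommGroup E] [NormedSpace ℂ E] {ρ : E → ℝ}
    {p a b : E} (hρ : AnalyticAt ℝ ρ p) :
    (∀ᶠ t in 𝓝 (0 : ℝ), HasDerivAt (fun t : ℝ => ρ (p + t • a + t ^ 2 • b))
      (fderiv ℝ ρ (p + t • a + t ^ 2 • b) (a + (2 * t) • b)) t) ∧
    HasDerivAt (fun t : ℝ => fderiv ℝ ρ (p + t • a + t ^ 2 • b) (a + (2 * t) • b))
      (hess ρ p a a + 2 * fderiv ℝ ρ p b) 0 := by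
  have hc : ∀ t : ℝ, HasDerivAt (fun t : ℝ => p + t • a + t ^ 2 • b) (a + (2 * t) • b) t := by
    intro t
    have h1 := (((hasDerivAt_id t).smul_const a).const_add p).add
      (((hasDerivAt_id t).pow 2).smul_const b)
    refine h1.congr_deriv ?_
    simp
  have hc0 : p + (0 : ℝ) • a + (0 : ℝ) ^ 2 • b = p := by simp
  constructor
  · have ht : Tendsto (fun t : ℝ => p + t • a + t ^ 2 • b) (𝓝 0) (𝓝 p) := by
      have := (hc 0).continuousAt.tendsto
      rwa [hc0] at this
    filter_upwards [ht.eventually hρ.eventually_analyticAt] with t h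
    exact h.differentiableAt.hasFDerivAt.comp_hasDerivAt t (hc t)
  · have h1 : HasDerivAt (fun t : ℝ => fderiv ℝ ρ (p + t • a + t ^ 2 • b))
        (hess ρ p (a + (2 * (0 : ℝ)) • b)) 0 :=
      HasFDerivAt.comp_hasDerivAt (l := fderiv ℝ ρ) (0 : ℝ)
        (by rw [hc0]; exact hρ.fderiv.differentiableAt.hasFDerivAt) (hc 0)
    have h2 : HasDerivAt (fun t : ℝ => a + (2 * t) • b) ((2 : ℝ) • b) 0 := by
      have := (((hasDerivAt_id (0 : ℝ)).const_mul 2).smul_const b).const_add a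
      simpa using this
    refine (h1.clm_apply h2).congr_deriv ?_
    simp

section Quadratic

variable {H S : (Fin r → ℂ) → Matrix (Fin s) (Fin s) ℂ}

open Matrix in
/-- The real quadratic function of `z` with Hermitian part `H ζ` and complex part `S ζ`. -/
noncomputable def quadratic (H S : (Fin r → ℂ) → Matrix (Fin s) (Fin s) ℂ) (z : Fin s → ℂ)
    (ζ : Fin r → ℂ) : ℝ :=
  (z ⬝ᵥ (H ζ *ᵥ star z)).re + (star z ⬝ᵥ (S ζ *ᵥ star z)).re

lemma analyticAt_quadratic (hH : ∀ i j, AnalyticAt ℝ (fun ζ => H ζ i j) 0)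
    (hS : ∀ i j, AnalyticAt ℝ (fun ζ => S ζ i j) 0) :
    AnalyticAt ℝ (fun x : GraphVar s r => quadratic H S x.1 x.2.1) 0 := by
  have hζ : AnalyticAt ℝ (fun q : GraphVar s r => q.2.1) 0 := analyticAt_fst.comp analyticAt_snd
  have hz : ∀ i, AnalyticAt ℝ (fun q : GraphVar s r => q.1 i) 0 := fun i =>
    ((ContinuousLinearMap.proj (R := ℝ) (φ := fun _ : Fin s => ℂ) i).analyticAt _).comp
      (analyticAt_fst : AnalyticAt ℝ (fun q : GraphVar s r => q.1) 0)
  have hzc : ∀ i, AnalyticAt ℝ (fun q : GraphVar s r => star (q.1 i)) 0 := fun i =>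
    (Complex.conjCLE.toContinuousLinearMap.analyticAt _).comp (hz i)
  have hre : ∀ f : GraphVar s r → ℂ, AnalyticAt ℝ f 0 → AnalyticAt ℝ (fun q => (f q).re) 0 :=
    fun f hf => (Complex.reCLM.analyticAt _).comp hf
  change AnalyticAt ℝ (fun q : GraphVar s r => (∑ i, q.1 i * ∑ j, H q.2.1 i j * star (q.1 j)).re
    + (∑ i, star (q.1 i) * ∑ j, S q.2.1 i j * star (q.1 j)).re) 0
  refine (hre _ ?_).add (hre _ ?_)
  · refine Finset.analyticAt_fun_sum _ fun i _ => (hz i).mul ?_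
    refine Finset.analyticAt_fun_sum _ fun j _ => AnalyticAt.mul ?_ (hzc j)
    exact AnalyticAt.comp (g := fun ζ => H ζ i j) (f := fun q : GraphVar s r => q.2.1) (hH i j) hζ
  · refine Finset.analyticAt_fun_sum _ fun i _ => (hzc i).mul ?_
    refine Finset.analyticAt_fun_sum _ fun j _ => AnalyticAt.mul ?_ (hzc j)
    exact AnalyticAt.comp (g := fun ζ => S ζ i j) (f := fun q : GraphVar s r => q.2.1) (hS i j) hζ

end Quadratic

/-- Along the leaf, the terms of weight at most two of a flat equation are its quadratic part. -/
lemma graphWeightPart_sub_quadratic {F : GraphVar s r → ℝ} {ζ : Fin r → ℂ} {P : ℝ → ℝ}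
    (hρ : AnalyticAt ℝ (graphDef F) (inV s r ζ)) (h0 : graphDef F (inV s r ζ) = 0)
    (hd : fderiv ℝ (graphDef F) (inV s r ζ) = reW s r) {z : Fin s → ℂ} {v : ℝ}
    (hP : ∀ t : ℝ, P t = t ^ 2 *
      (-(1 / 2) * hess (graphDef F) (inV s r ζ) (inU s r (0, z)) (inU s r (0, z)))) :
    ∀ k ≤ 2, taylorCoeff k (fun t : ℝ => F ((t : ℂ) • z, ζ, t ^ 2 * v) - P t) = 0 := by
  set a : Coord s r := inU s r (0, z) with ha
  set b : Coord s r := ((v : ℂ) * Complex.I, 0, 0) with hb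
  set p : Coord s r := inV s r ζ with hp
  obtain ⟨h1, h2⟩ := hasDerivAt_parabola (a := a) (b := b) hρ
  set B := hess (graphDef F) p a a with hB
  -- Weighted expansion at a leaf point is expansion along the parabola p + ta + t²b with b = (iv,
  -- 0, 0). The points there have Re w = 0, so F is minus the defining function.
  have hf : (fun t : ℝ => F ((t : ℂ) • z, ζ, t ^ 2 * v) - P t)
      = fun t : ℝ => -graphDef F (p + t • a + t ^ 2 • b) - t ^ 2 * (-(1 / 2) * B) := by
    funext t
    have e : p + t • a + t ^ 2 • b
        = (((t ^ 2 * v : ℝ) : ℂ) * Complex.I, (t : ℂ) • z, ζ) := by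
      refine Prod.ext ?_ (Prod.ext ?_ ?_)
      · simp [hp, ha, hb, mul_assoc]
      · simp [hp, ha, hb]
      · simp [hp, ha, hb]
    rw [hP, e, graphDef]
    simp only [Complex.re_ofReal_mul, Complex.im_ofReal_mul, Complex.I_re, Complex.I_im]
    ring_nf
  -- The only possible terms of weight 2 linear in Im w vanish, since the differential is that of Re
  -- w.
  have hb0 : reW s r b = 0 := by simp [hb]
  have ha0 : reW s r a = 0 := by simp [ha]
  have h3 : ∀ t : ℝ, HasDerivAt (fun t : ℝ => t ^ 2 * (-(1 / 2) * B)) (2 * t * (-(1 / 2) * B)) t :=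
    fun t => by simpa using ((hasDerivAt_id t).pow 2).mul_const (-(1 / 2) * B)
  have h4 : HasDerivAt (fun t : ℝ => 2 * t * (-(1 / 2) * B)) (2 * (-(1 / 2) * B)) 0 := by
    simpa using ((hasDerivAt_id (0 : ℝ)).const_mul 2).mul_const (-(1 / 2) * B)
  obtain ⟨h5, h6⟩ := iteratedDeriv_one_two_of_hasDerivAt
    (h1.mono fun t ht => ht.neg.sub (h3 t)) (h2.neg.sub h4)
  have hk : ∀ k ≤ 2, iteratedDeriv k
      (fun t : ℝ => -graphDef F (p + t • a + t ^ 2 • b) - t ^ 2 * (-(1 / 2) * B)) 0 = 0 := by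
    intro k hk
    interval_cases k
    · simp [h0]
    · refine h5.trans ?_
      simp [hd, ha]
    · refine h6.trans ?_
      rw [hd, hb0]
      ring
  intro k hk2
  rw [hf, taylorCoeff, hk k hk2, smul_zero]

lemma inV_mem_jetKernel {B : Coord s r →L[ℝ] Coord s r →L[ℝ] ℝ}
    (h : ∀ η, B (inV s r η) = 0) (η : Fin r → ℂ) : inV s r η ∈ jetKernel (reW s r) B := by
  refine ⟨by rw [dC_reW]; rfl, fun y _ => ?_⟩
  rw [lev, ← (inV s r).map_smul, h, h]
  simp

/-- A flat equation is in adapted form. -/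
lemma exists_definingEquation_of_flat {F : GraphVar s r → ℝ} (hF : AnalyticAt ℝ F 0)
    (h : ∀ᶠ ζ in 𝓝 (0 : Fin r → ℂ), graphDef F (inV s r ζ) = 0 ∧
      fderiv ℝ (graphDef F) (inV s r ζ) = reW s r)
    (hM : HasConstantLeviRankNear {q | graphDef F q = 0} 0 s) :
    ∃ D : DefiningEquation s r, D.hypersurface = {q | graphDef F q = 0} := by
  have hρ := analyticAt_graphDef hF
  have hρe := tendsto_inV.eventually hρ.eventually_analyticAt
  have h0 := h.self_of_nhds
  rw [map_zero] at h0
  have hH := analyticAt_levMatrix hρ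
  have hS := analyticAt_symMatrix hρ
  have hV := (hess_inV_eq_zero hρ (h.mono fun ζ hζ => hζ.2)).self_of_nhds
  have hr := ((isGraphFunction_graphDef F).finrank_jetKernel (isDefiningFunctionAt_graphDef hF)
    h0.1 hM).self_of_nhds
  rw [h0.2] at hr
  refine ⟨{
    H := fun ζ => levMatrix (hess (graphDef F) (inV s r ζ))
    S := fun ζ => symMatrix (hess (graphDef F) (inV s r ζ))
    Q := fun x => F x - quadratic (fun ζ => levMatrix (hess (graphDef F) (inV s r ζ)))
      (fun ζ => symMatrix (hess (graphDef F) (inV s r ζ))) x.1 x.2.1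
    analytic_H := hH
    analytic_S := hS
    hermitian_H := hρe.mono fun ζ hζ => isHermitian_levMatrix (hess_symm hζ)
    symmetric_S := hρe.mono fun ζ hζ => isSymm_symMatrix (hess_symm hζ)
    nondegenerate_H := ?_
    analytic_Q := hF.sub (analyticAt_quadratic hH hS)
    weight_Q := ?_ }, ?_⟩
  · refine det_levMatrix_ne_zero (hess_symm ?_) (inV_mem_jetKernel hV) ?_
    · rw [map_zero]; exact hρ
    · rw [map_zero]; exact hr
  · filter_upwards [h, hρe] with ζ h1 h2 z v
    refine graphWeightPart_sub_quadratic h2 h1.1 h1.2 fun t => ?_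
    have e : inU s r (0, (t : ℂ) • z) = t • inU s r (0, z) := by
      refine Prod.ext ?_ (Prod.ext ?_ ?_) <;> simp
    change quadratic _ _ _ _ = _
    rw [quadratic, quadratic_eq (hess_symm h2), e]
    simp only [map_smul, smul_apply, smul_eq_mul]
    ring
  · ext q
    simp only [DefiningEquation.hypersurface, DefiningEquation.P, Set.mem_ofPred_eq, graphDef,
      quadratic]
    constructor <;> intro h <;> linarith

lemma IsLocalEquivalence.trans {E E' E'' : Type*} [NormedAddCommGroup E] [NormedSpace ℂ E]
    [NormedAddCommGroup E'] [NormedSpace ℂ E'] [NormedAddCommGroup E''] [NormedSpace ℂ E'']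
    {φ : E → E'} {ψ : E' → E''} {p : E} {M : Set E} {M' : Set E'} {M'' : Set E''}
    (h : IsLocalEquivalence φ p M M') (h' : IsLocalEquivalence ψ (φ p) M' M'') :
    IsLocalEquivalence (fun q => ψ (φ q)) p M M'' := by
  obtain ⟨h1, ⟨e, he⟩, h2⟩ := h
  obtain ⟨h1', ⟨e', he'⟩, h2'⟩ := h'
  refine ⟨AnalyticAt.comp (g := ψ) (f := φ) h1' h1, ⟨e.trans e', he'.comp p he⟩, ?_⟩
  filter_upwards [h2, h1.continuousAt.eventually h2'] with q a b using b.trans a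

/-- Adapted coordinates exist near every point. -/
lemma exists_adapted_coordinates {E : Type} [NormedAddCommGroup E] [NormedSpace ℂ E]
    [FiniteDimensional ℂ E] {M : Set E} {p : E} (hdim : Module.finrank ℂ E = 1 + s + r)
    (hp : p ∈ M) (hM : HasConstantLeviRankNear M p s) :
    ∃ (Φ : E → Coord s r) (F : DefiningEquation s r),
      Φ p = 0 ∧ IsLocalEquivalence Φ p M F.hypersurface := by
  obtain ⟨φ, F, hφ0, hF, hφ, hprep⟩ := exists_prepared hdim hp hM
  obtain ⟨Ψ, F', hΨ0, hF', hΨ, hflat⟩ := hprep.exists_flat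
  rw [← hφ0] at hΨ
  have hΦ := hφ.trans hΨ
  have hM' := hΦ.hasConstantLeviRankNear hM
  simp only [hφ0, hΨ0] at hM'
  obtain ⟨D, hD⟩ := exists_definingEquation_of_flat hF' hflat hM'
  exact ⟨fun q => Ψ (φ q), D, by simp only [hφ0, hΨ0], by rw [hD]; exact hΦ⟩

end FlatEquation


/-! ### Transport of 2-nondegeneracy -/

section Transport

lemma IsLocalEquivalence.isTwoNondegenerateAt {E E' : Type*} [NormedAddCommGroup E]
    [NormedSpace ℂ E] [CompleteSpace E] [NormedAddCommGroup E'] [NormedSpace ℂ E']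
    [CompleteSpace E'] {φ : E → E'} {p : E} {M : Set E} {M' : Set E'}
    (h : IsLocalEquivalence φ p M M')
    (hM' : ∀ᶠ q in 𝓝 (φ p), q ∈ M' → IsHypersurfaceAt M' q) (hp : p ∈ M)
    (h2 : IsTwoNondegenerateAt M p) : IsTwoNondegenerateAt M' (φ p) := by
  refine ⟨fun h0 => h2.1 ?_, h.freemanThree_eq_zero hM' hp h2.2⟩
  obtain ⟨e, he⟩ := h.2.1
  refine (Submodule.eq_bot_iff _).2 fun v hv => e.injective ?_
  rw [h.mem_leviKernel_iff (hM'.self_of_nhds (h.2.2.self_of_nhds.2 hp)) hp, h0, Submodule.mem_bot,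
    he.fderiv] at hv
  rw [map_zero]
  exact hv

end Transport

end CRModel

/-! ### Assembly of the three assertions -/

theorem theorem1p1 (n s : ℕ) (hs : s ≤ n) :
    -- First part
    (∀ M : Set (Fin (n + 1) → ℂ), CRModel.IsRealAnalyticHypersurface M →
      (∀ q ∈ M, CRModel.HasLeviRankAt M q s) →
      ∀ p ∈ M,
        (∃ (Φ : (Fin (n + 1) → ℂ) → CRModel.Coord s (n - s))
          (F : CRModel.DefiningEquation s (n - s)),
          Φ p = 0 ∧ CRModel.IsLocalEquivalence Φ p M F.hypersurface) ∧
        (∀ (Φ : (Fin (n + 1) → ℂ) → CRModel.Coord s (n - s))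
          (F : CRModel.DefiningEquation s (n - s)),
          Φ p = 0 → CRModel.IsLocalEquivalence Φ p M F.hypersurface →
          CRModel.HasConstantLeviRankNear F.model 0 s ∧
          ((∀ q ∈ M, CRModel.IsTwoNondegenerateAt M q) →
            CRModel.IsTwoNondegenerateNear F.model 0))) ∧
    -- Second part
    (∀ F F' : CRModel.DefiningEquation s (n - s),
      CRModel.HasConstantLeviRankNear F.hypersurface 0 s →
      CRModel.HasConstantLeviRankNear F'.hypersurface 0 s →
      ∀ φ : CRModel.Coord s (n - s) → CRModel.Coord s (n - s),
        φ 0 = 0 → CRModel.IsLocalEquivalence φ 0 F.hypersurface F'.hypersurface →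
        CRModel.degreePreservingPart φ 0 = 0 ∧
        CRModel.IsLocalEquivalence (CRModel.degreePreservingPart φ) 0 F.model F'.model) ∧
    -- Third part
    (∀ F : CRModel.DefiningEquation s (n - s),
      CRModel.HasConstantLeviRankNear F.hypersurface 0 s →
      CRModel.realDim (CRModel.hol F.hypersurface 0) ≤
        CRModel.realDim (CRModel.hol F.model 0)) := by
  refine ⟨fun M hM hs' p hp => ?_, fun F F' hF hF' φ h0 h =>
    CRModel.DefiningEquation.isLocalEquivalence_degreePreservingPart hF hF' h0 h,
    fun F _ => F.realDim_hol_le⟩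
  have hc : CRModel.HasConstantLeviRankNear M p s :=
    Eventually.of_forall fun q hq => ⟨hM q hq, hs' q hq⟩
  refine ⟨CRModel.exists_adapted_coordinates ?_ hp hc, fun Φ F h0 h => ?_⟩
  -- The dimension count n + 1 = 1 + s + (n − s) uses s ≤ n, as the subtraction is truncated.
  · rw [Module.finrank_fin_fun]
    omega
  · have hF := h.hasConstantLeviRankNear hc
    have hF' : ∀ᶠ q in 𝓝 (Φ p), q ∈ F.hypersurface →
        CRModel.IsHypersurfaceAt F.hypersurface q := by
      filter_upwards [hF] with q hq hqM using (hq hqM).1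
    -- 2-nondegeneracy of M is used only at p: it passes to 0 on the adapted hypersurface, and
    -- openness on the model does the rest.
    have h2 := fun h' => h.isTwoNondegenerateAt hF' hp h'
    rw [h0] at hF h2
    exact ⟨CRModel.DefiningEquation.hasConstantLeviRankNear_model hF,
      fun h' => CRModel.DefiningEquation.isTwoNondegenerateNear_model hF (h2 (h' p hp))⟩
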